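/- Let $N\ge 1$ be an integer (in the applications $N$ is even), let $X$ be a smooth manifold with nonempty boundary $\partial X$ and interior $\mathring X$, let $i_\partial : X\hookrightarrow \mathbb R^{N-1}$ be a smooth embedding and $\rho : X\to[0,\infty)$ a smooth defining function of the boundary ($\rho^{-1}(0)=\partial X$ and $d\rho\neq 0$ on $\partial X$). Put $i=(i_\partial,\rho):X\hookrightarrow\mathbb R^{N-1}\times[0,\infty)$, with normal bundle $N(X)=\bigsqcup_x \mathbb R^N/d_xi(T_xX)$. Let $\Gamma(X)=\{(x,y,\alpha)\in X\times X\times\mathbb R:\rho(x)=e^{\alpha}\rho(y)\}$ be the $b$-groupoid (target $x$, source $y$), with the homomorphism $h:\Gamma(X)\to\mathbb R^N$, $h(x,y,\alpha)=(i_\partial(x)-i_\partial(y),\alpha)$, and let $A(\Gamma(X))$ be its Lie algebroid, with fibres $A(\Gamma(X))_x=\{(v,\alpha)\in T_xX\times\mathbb R: d_x\rho(v)=\rho(x)\alpha\}$, and $A(h)(v,\alpha)=(d_xi_\partial(v),\alpha)$. Let $X_{\mathscr F}=X\times[0,1]\setminus(\partial X\times\{1\})$, and let $\Gamma(X)_{\mathscr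 F}\rightrightarrows X_{\mathscr F}$ be the restriction to $X_{\mathscr F}$ of the tangent groupoid $A(\Gamma(X))\times\{0\}\sqcup\Gamma(X)\times(0,1]$, with the homomorphism $h_{\mathscr F}$ to $\mathbb R^N$ equal to $A(h)$ at $t=0$ and to $h/t$ at $t>0$. Let $\mathscr B_h$ be the orbit space of the semi-direct groupoid $\Gamma(X)_{\mathscr F}\rtimes_{h_{\mathscr F}}\mathbb R^N$, i.e. the quotient of $X_{\mathscr F}\times\mathbb R^N$, with the quotient topology, by the relation $(r(\gamma),V)\sim(s(\gamma),V+h_{\mathscr F}(\gamma))$, $\gamma\in\Gamma(X)_{\mathscr F}$, where $r$ and $s$ are the target and source maps. Let $\mathscr N_{sing}(X)=N(X)\times\{0\}\sqcup(0,1)\times\mathbb R^{N-1}$ and $\mathscr B_{\mathscr F}=\mathscr N_{sing}(X)\sqcup(0,1]\times\mathbb R^N$ as sets. Write $V=(V',V_N)\in\mathbb R^{N-1}\times\mathbb R$ and define $q_{\mathscr F}:X_{\mathscr F}\times\mathbb R^N\to\mathscr B_{\mathscr F}$ by $$q_{\mathscr F}(x,t,V)=\begin{cases}[(V',\rho(x)V_N)]_x\in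 N_x(X)& t=0,\\ (t,\,i_\partial(x)+tV')\in(0,1)\times\mathbb R^{N-1}& t>0,\ x\in\partial X,\\ (t,\,tV+(i_\partial(x),\log\rho(x)))\in(0,1]\times\mathbb R^N& t>0,\ x\in\mathring X.\end{cases}$$ Give $\mathscr B_{\mathscr F}$ the quotient topology of $q_{\mathscr F}$, and $\mathscr N_{sing}(X)$ the quotient topology of the restriction of $q_{\mathscr F}$ over $X_\partial=X\times\{0\}\cup\partial X\times[0,1)$. **Proposition.** The map $q_{\mathscr F}$ induces a homeomorphism $\mathscr B_h\cong\mathscr B_{\mathscr F}$, and $\mathscr B_{\mathscr F}$ is locally compact. There are smooth structures on $\mathscr N_{sing}(X)$ and $\mathscr B_{\mathscr F}$, given by atlases whose changes of coordinates have positive Jacobian determinant, such that: 1. $\mathscr N_{sing}(X)$ is a smooth oriented $N$-manifold obtained by gluing $N(X)$ and the deformation to the normal cone $D_\partial=N(\partial X)\times\{0\}\sqcup(0,1)\times\mathbb R^{N-1}$ of $i_\partial:\partial X\hookrightarrow\mathbb R^{N-1}$ along their common boundary $N(X)|_{\partial X}\cong N(\partial X)$ (the inclusions of these two manifolds with boundary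 are smooth immersions of codimension $0$); 2. $\mathscr B_{\mathscr F}$ is a (Hausdorff, second countable) smooth oriented manifold with boundary of dimension $N+1$, and $(0,1]\times\mathbb R^N$ with its standard smooth structure is an open submanifold of it; 3. $\mathscr N_{sing}(X)$ and $\{1\}\times\mathbb R^N$ are disjoint closed smoothly embedded submanifolds of $\mathscr B_{\mathscr F}$ and, for the boundary orientation with the outward normal first and the standard orientation of $\mathbb R^N$, $$\partial\mathscr B_{\mathscr F}=-\mathscr N_{sing}(X)\ \sqcup\ \{1\}\times\mathbb R^N .$$ Thus $\mathscr B_{\mathscr F}$ is an oriented cobordism from $\mathscr N_{sing}(X)$ to $\mathbb R^N$. -/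

import Mathlib

open scoped Manifold ContDiff
open Set

noncomputable section

namespace APS

/-- The Euclidean space `ℝ^d`. -/
abbrev E (d : ℕ) : Type := EuclideanSpace ℝ (Fin d)

/-- The point `(a, s)` of `ℝ^m × ℝ = ℝ^(m+1)`. -/
def join {m : ℕ} (a : E m) (s : ℝ) : E (m + 1) :=
  WithLp.toLp 2 (Fin.snoc (α := fun _ => ℝ) (fun i => a i) s)

/-- The first `m` coordinates of a vector of `ℝ^(m+1)`. -/
def front {m : ℕ} (V : E (m + 1)) : E m := WithLp.toLp 2 (fun i => V i.castSucc)

/-- The last coordinate of a vector of `ℝ^(m+1)`. -/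
def height {m : ℕ} (V : E (m + 1)) : ℝ := V (Fin.last m)

theorem join_add {m : ℕ} (a b : E m) (s t : ℝ) :
    join (a + b) (s + t) = join a s + join b t := by
  ext i
  refine Fin.lastCases ?_ (fun j => ?_) i <;> simp [join]

theorem join_zero {m : ℕ} : join (0 : E m) 0 = 0 := by
  ext i
  refine Fin.lastCases ?_ (fun j => ?_) i <;> simp [join]

theorem join_neg {m : ℕ} (a : E m) (s : ℝ) : join (-a) (-s) = -join a s := by
  ext i
  refine Fin.lastCases ?_ (fun j => ?_) i <;> simp [join]

/-! ### Oriented manifolds and oriented cobordisms -/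

/-- The atlas is oriented: all changes of coordinates have positive Jacobian determinant. -/
def IsOrientedAtlas {F H : Type*} [NormedAddCommGroup F] [NormedSpace ℝ F] [TopologicalSpace H]
    (I : ModelWithCorners ℝ F H) (M : Type*) [TopologicalSpace M] [ChartedSpace H M] : Prop :=
  ∀ e ∈ atlas H M, ∀ e' ∈ atlas H M, ∀ x ∈ e.source ∩ e'.source,
    0 < (fderivWithin ℝ (e'.extend I ∘ (e.extend I).symm) (range I) (e.extend I x)).det

/-- For `j : M → W` with values in the boundary of the `(d+1)`-dimensional manifold `W`, the frame
"outward normal first" of `T_{j p} W`: first the outward pointing vector `-∂₀` of the half space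
`{x₀ ≥ 0}`, then the images under the differential of `j` of the coordinate vectors at `p`.
All vectors are expressed in the preferred charts at `p` and at `j p`, which belong to the given
atlases. -/
def boundaryFrame {d : ℕ} {M W : Type*} [TopologicalSpace M] [ChartedSpace (E d) M]
    [TopologicalSpace W] [ChartedSpace (EuclideanHalfSpace (d + 1)) W] (j : M → W) (p : M) :
    Fin (d + 1) → E (d + 1) :=
  Fin.cons (α := fun _ => E (d + 1)) (-EuclideanSpace.single 0 (1 : ℝ))
    (fun i => (mfderiv (𝓡 d) (𝓡∂ (d + 1)) j p : E d →L[ℝ] E (d + 1)) (EuclideanSpace.single i 1))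

/-- The determinant of `boundaryFrame j p`. If the atlases of `M` and `W` are oriented, it is
positive (negative) exactly if `j` preserves (reverses) orientation at `p`, the boundary of `W`
being oriented by the rule "outward normal first". -/
def boundarySign {d : ℕ} {M W : Type*} [TopologicalSpace M] [ChartedSpace (E d) M]
    [TopologicalSpace W] [ChartedSpace (EuclideanHalfSpace (d + 1)) W] (j : M → W) (p : M) : ℝ :=
  (EuclideanSpace.basisFun (Fin (d + 1)) ℝ).toBasis.det (boundaryFrame (d := d) j p)

/-- `W` is a smooth oriented manifold with boundary of dimension `d + 1`, with
`∂W = -j₀(M₀) ⊔ j₁(M₁)` as oriented manifolds: an oriented cobordism from the oriented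
`d`-manifold `M₀` to the oriented `d`-manifold `M₁` (compactness is not required). -/
structure IsOrientedCobordism {d : ℕ} {M₀ M₁ W : Type*}
    [TopologicalSpace M₀] [ChartedSpace (E d) M₀] [TopologicalSpace M₁] [ChartedSpace (E d) M₁]
    [TopologicalSpace W] [ChartedSpace (EuclideanHalfSpace (d + 1)) W]
    (j₀ : M₀ → W) (j₁ : M₁ → W) : Prop where
  t2 : T2Space W
  secondCountable : SecondCountableTopology W
  smooth : IsManifold (𝓡∂ (d + 1)) ∞ W
  smooth₀ : IsManifold (𝓡 d) ∞ M₀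
  smooth₁ : IsManifold (𝓡 d) ∞ M₁
  oriented : IsOrientedAtlas (𝓡∂ (d + 1)) W
  oriented₀ : IsOrientedAtlas (𝓡 d) M₀
  oriented₁ : IsOrientedAtlas (𝓡 d) M₁
  embedding₀ : Manifold.IsSmoothEmbedding (𝓡 d) (𝓡∂ (d + 1)) ∞ j₀
  embedding₁ : Manifold.IsSmoothEmbedding (𝓡 d) (𝓡∂ (d + 1)) ∞ j₁
  isClosed₀ : IsClosed (range j₀)
  isClosed₁ : IsClosed (range j₁)
  disjoint : Disjoint (range j₀) (range j₁)
  boundary_eq : (𝓡∂ (d + 1)).boundary W = range j₀ ∪ range j₁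
  reverses : ∀ p, boundarySign (d := d) j₀ p < 0
  preserves : ∀ p, 0 < boundarySign (d := d) j₁ p

/-! ### The embedding, the b-groupoid and the Fredholm tangent groupoid -/

/-- A smooth embedding `emb` of the manifold with boundary `X` in `ℝ^m`, together with a smooth
defining function `rho` of the boundary. Here `m = N - 1`. -/
structure BoundaryEmbedding (n m : ℕ) [NeZero n] (X : Type*) [TopologicalSpace X]
    [ChartedSpace (EuclideanHalfSpace n) X] where
  emb : X → E m
  rho : X → ℝ
  isSmoothEmbedding : Manifold.IsSmoothEmbedding (𝓡∂ n) (𝓡 m) ∞ emb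
  contMDiff_rho : ContMDiff (𝓡∂ n) 𝓘(ℝ, ℝ) ∞ rho
  rho_nonneg : ∀ x, 0 ≤ rho x
  rho_eq_zero_iff : ∀ x, rho x = 0 ↔ x ∈ (𝓡∂ n).boundary X
  mfderiv_rho_ne_zero : ∀ x ∈ (𝓡∂ n).boundary X, mfderiv (𝓡∂ n) 𝓘(ℝ, ℝ) rho x ≠ 0

variable {n m : ℕ} [NeZero n] {X : Type*} [TopologicalSpace X]
  [ChartedSpace (EuclideanHalfSpace n) X] (D : BoundaryEmbedding n m X)

namespace BoundaryEmbedding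

/-- The embedding `i = (emb, rho)` of `X` in `ℝ^m × [0, ∞) ⊆ ℝ^(m+1)`. -/
def incl (x : X) : E (m + 1) := join (D.emb x) (D.rho x)

/-- The differential of `emb` at `x`. -/
def dEmb (x : X) : E n →L[ℝ] E m := mfderiv (𝓡∂ n) (𝓡 m) D.emb x

/-- The differential of `rho` at `x`. -/
def dRho (x : X) : E n →L[ℝ] ℝ := mfderiv (𝓡∂ n) 𝓘(ℝ, ℝ) D.rho x

/-- The b-groupoid `Γ(X)` of triples `(x, y, α)` with `ρ(x) = e^α ρ(y)`. Its target is `x`, its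
source is `y` and its product is `(x, y, α)(y, z, β) = (x, z, α + β)`. -/
structure BGroupoid where
  tgt : X
  src : X
  ang : ℝ
  rel : D.rho tgt = Real.exp ang * D.rho src

/-- The homomorphism `h : Γ(X) → ℝ^(m+1)`, `h(x, y, α) = (emb x - emb y, α)`; over the interior
`α = log (ρ(x) / ρ(y))`. -/
def BGroupoid.hom (γ : D.BGroupoid) : E (m + 1) := join (D.emb γ.tgt - D.emb γ.src) γ.ang

/-- The fibre at `x` of the Lie algebroid `A(Γ(X))`, i.e. the vectors `(v, α)` which satisfy the
linearization of `ρ(x) = e^α ρ(y)` along the fibre of the source map at the unit `(x, x, 0)`.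
At an interior point `v ∈ T_x X` is arbitrary and `α = dρ(v) / ρ(x)`; at a boundary point
`v ∈ T_x ∂X` and `α ∈ ℝ` is arbitrary. -/
def algebroid (x : X) : Submodule ℝ (E n × ℝ) where
  carrier := {p | D.dRho x p.1 = D.rho x * p.2}
  add_mem' := by
    intro a b ha hb
    simp only [mem_ofPred_eq, Prod.fst_add, Prod.snd_add, map_add] at *
    rw [ha, hb]; ring
  zero_mem' := by simp
  smul_mem' := by
    intro c a ha
    simp only [mem_ofPred_eq, Prod.smul_fst, Prod.smul_snd, map_smul, smul_eq_mul] at *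
    rw [ha]; ring

/-- The induced map `A(h) : A(Γ(X)) → ℝ^(m+1)`. -/
def algebroidHom (x : X) (ξ : D.algebroid x) : E (m + 1) := join (D.dEmb x ξ.1.1) ξ.1.2

/-- `X_F = X × [0,1] \ (∂X × {1})`. -/
def XF (_ : BoundaryEmbedding n m X) : Type _ :=
  {p : X × ℝ // p.2 ∈ Icc (0 : ℝ) 1 ∧ ¬(p.1 ∈ (𝓡∂ n).boundary X ∧ p.2 = 1)}

instance : TopologicalSpace D.XF := inferInstanceAs (TopologicalSpace {_p : X × ℝ // _})

/-- The arrows of the Fredholm tangent groupoid: the restriction to `X_F` of the tangent groupoid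
`A(Γ(X)) ⊔ Γ(X) × (0,1]`. -/
inductive FredholmArrow
  | alg (x : X) (ξ : D.algebroid x)
  | pos (γ : D.BGroupoid) (t : ℝ) (ht : t ∈ Ioc (0 : ℝ) 1)
      (htgt : ¬(γ.tgt ∈ (𝓡∂ n).boundary X ∧ t = 1))
      (hsrc : ¬(γ.src ∈ (𝓡∂ n).boundary X ∧ t = 1))

/-- Target (range) of an arrow. -/
def FredholmArrow.rng : D.FredholmArrow → D.XF
  | .alg x _ => ⟨(x, 0), by simp⟩
  | .pos γ t ht htgt _ => ⟨(γ.tgt, t), ⟨ht.1.le, ht.2⟩, htgt⟩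

/-- Source of an arrow. -/
def FredholmArrow.src : D.FredholmArrow → D.XF
  | .alg x _ => ⟨(x, 0), by simp⟩
  | .pos γ t ht _ hsrc => ⟨(γ.src, t), ⟨ht.1.le, ht.2⟩, hsrc⟩

/-- The homomorphism `h_F` on the Fredholm tangent groupoid: `A(h)` at `t = 0` and `h / t` for
`t > 0`. -/
def FredholmArrow.hom : D.FredholmArrow → E (m + 1)
  | .alg x ξ => D.algebroidHom x ξ
  | .pos γ t _ _ _ => t⁻¹ • γ.hom

/-- The orbit equivalence relation on `X_F × ℝ^(m+1)` of the semi-direct groupoid, whose arrows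
`(γ, V)` have target `(r(γ), V)` and source `(s(γ), V + h_F(γ))`. -/
def orbitSetoid : Setoid (D.XF × E (m + 1)) where
  r a b := ∃ γ : D.FredholmArrow, γ.rng = a.1 ∧ γ.src = b.1 ∧ b.2 = a.2 + γ.hom
  iseqv := by
    refine ⟨?_, ?_, ?_⟩
    · rintro ⟨⟨⟨x, t⟩, ht, hx⟩, V⟩
      rcases ht.1.eq_or_lt with h0 | h0
      · obtain rfl : (0 : ℝ) = t := h0
        refine ⟨.alg x 0, rfl, rfl, ?_⟩
        simp [FredholmArrow.hom, algebroidHom, join_zero]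
      · refine ⟨.pos ⟨x, x, 0, by simp⟩ t ⟨h0, ht.2⟩ hx hx, rfl, rfl, ?_⟩
        simp [FredholmArrow.hom, BGroupoid.hom, join_zero]
    · rintro ⟨a, V⟩ ⟨b, W⟩ ⟨γ, h1, h2, h3⟩
      cases γ with
      | alg x ξ =>
        refine ⟨.alg x (-ξ), h2, h1, ?_⟩
        simp only [FredholmArrow.hom, algebroidHom] at h3 ⊢
        rw [h3]
        simp [join_neg]
      | pos γ t ht h4 h5 =>
        refine ⟨.pos ⟨γ.src, γ.tgt, -γ.ang, ?_⟩ t ht h5 h4, h2, h1, ?_⟩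
        · rw [γ.rel, ← mul_assoc, ← Real.exp_add]; simp
        · simp only [FredholmArrow.hom, BGroupoid.hom] at h3 ⊢
          rw [h3, ← neg_sub (D.emb γ.tgt), join_neg, smul_neg, add_neg_cancel_right]
    · rintro ⟨a, V⟩ ⟨b, W⟩ ⟨c, Z⟩ ⟨γ, h1, h2, h3⟩ ⟨δ, k1, k2, k3⟩
      simp only at h1 h2 h3 k1 k2 k3
      subst h1 k2 h3 k3
      cases γ with
      | alg x ξ =>
        cases δ with
        | alg y η =>
          have e := congrArg (fun p : D.XF => p.1.1) (h2.trans k1.symm)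
          obtain rfl : x = y := e
          refine ⟨.alg x (ξ + η), rfl, rfl, ?_⟩
          simp only [FredholmArrow.hom, algebroidHom, add_assoc, ← join_add]
          simp
        | pos δ t ht h4 h5 =>
          have e : (0 : ℝ) = t := congrArg (fun p : D.XF => p.1.2) (h2.trans k1.symm)
          exact absurd ht.1 (by rw [← e]; exact lt_irrefl _)
      | pos γ s hs h4 h5 =>
        cases δ with
        | alg y η =>
          have e : s = 0 := congrArg (fun p : D.XF => p.1.2) (h2.trans k1.symm)
          exact absurd hs.1 (by rw [e]; exact lt_irrefl _)
        | pos δ t ht h6 h7 =>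
          have e : s = t := congrArg (fun p : D.XF => p.1.2) (h2.trans k1.symm)
          have e' : γ.src = δ.tgt := congrArg (fun p : D.XF => p.1.1) (h2.trans k1.symm)
          subst e
          refine ⟨.pos ⟨γ.tgt, δ.src, γ.ang + δ.ang, ?_⟩ s hs h4 h7, rfl, rfl, ?_⟩
          · rw [γ.rel, e', δ.rel, Real.exp_add, mul_assoc]
          · simp only [FredholmArrow.hom, BGroupoid.hom, add_assoc, ← smul_add, ← join_add]
            rw [e', sub_add_sub_cancel]

/-- The orbit space of the semi-direct groupoid, with the quotient topology. -/
def OrbitSpace : Type _ := Quotient D.orbitSetoid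

instance : TopologicalSpace D.OrbitSpace :=
  inferInstanceAs (TopologicalSpace (Quotient D.orbitSetoid))

/-- The quotient map to the orbit space. -/
def toOrbit (a : D.XF × E (m + 1)) : D.OrbitSpace := Quotient.mk D.orbitSetoid a

/-! ### The singular normal bundle -/

/-- The image of `T_x X` under the differential of `i = (emb, rho)`. -/
def tangentImage (x : X) : Submodule ℝ (E (m + 1)) :=
  LinearMap.range
    (mfderiv (𝓡∂ n) (𝓡 (m + 1)) D.incl x : E n →L[ℝ] E (m + 1)).toLinearMap

/-- The fibre at `x` of the normal bundle `N(X)` of the embedding `i`. -/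
abbrev NormalSpace (x : X) : Type := E (m + 1) ⧸ D.tangentImage x

/-- The set `N_sing(X) = N(X) ⊔ (0,1) × ℝ^m`. -/
inductive Nsing
  | normal (x : X) (v : D.NormalSpace x)
  | cyl (t : Ioo (0 : ℝ) 1) (P : E m)

/-- `X_∂ = X × {0} ∪ ∂X × [0,1)`. -/
def XBd : Type _ := {p : D.XF // p.1.2 = 0 ∨ p.1.1 ∈ (𝓡∂ n).boundary X}

instance : TopologicalSpace D.XBd := inferInstanceAs (TopologicalSpace {_p : D.XF // _})

open Classical in
/-- The map `q_∂ : X_∂ × ℝ^(m+1) → N_sing(X)`. For `t > 0` it is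
`(x, t, V) ↦ (t, emb x + t V')`, where `V'` is formed by the first `m` coordinates of `V`. At
`t = 0` it sends `V` to the class of `(V', ρ(x) V_last)` in `N_x(X)`: the factor `ρ(x)` is the
differential of `(P, u) ↦ (P, e^u)`, which carries the embedding `(emb, log ρ)` of the
interior, with respect to which `h` is formed, to `i = (emb, ρ)`. -/
def qSing (a : D.XBd × E (m + 1)) : D.Nsing :=
  if h : a.1.1.1.2 = 0 then
    .normal a.1.1.1.1 (Submodule.Quotient.mk
      (join (front a.2) (D.rho a.1.1.1.1 * height a.2)))
  else
    .cyl ⟨a.1.1.1.2, lt_of_le_of_ne a.1.1.2.1.1 (Ne.symm h),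
      lt_of_le_of_ne a.1.1.2.1.2 (fun h1 => a.1.1.2.2 ⟨a.1.2.resolve_left h, h1⟩)⟩
      (D.emb a.1.1.1.1 + a.1.1.1.2 • front a.2)

/-- `N_sing(X)` has the quotient topology of `q_∂`. -/
instance : TopologicalSpace D.Nsing := TopologicalSpace.coinduced D.qSing inferInstance

/-- The map `(x, V) ↦ [V]_x` from the trivial bundle onto the normal bundle `N(X)`. -/
def normalMap (p : X × E (m + 1)) : D.Nsing := .normal p.1 (Submodule.Quotient.mk p.2)

open Classical in
/-- For `x ∈ ∂X` and `t ∈ [0,1)`: the map `(x, t, V) ↦ (t, emb x + t V)` for `t > 0`,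
`(x, 0, V) ↦ [V]_x`, onto the deformation to the normal cone
`D_∂ = N(∂X) ⊔ (0,1) × ℝ^m` of `emb : ∂X → ℝ^m`. The fibre of `N(∂X)` at `x`, which is
`ℝ^m / d emb (T_x ∂X)`, is identified with `N_x(X)` through `V ↦ (V, 0)`. -/
def coneMap (x : X) (t : ℝ) (V : E m) : D.Nsing :=
  if h : t ∈ Ioo (0 : ℝ) 1 then .cyl ⟨t, h⟩ (D.emb x + t • V)
  else .normal x (Submodule.Quotient.mk (join V 0))

/-- The smooth structure on `N_sing(X)` is obtained by gluing the manifolds with boundary `N(X)`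
and `D_∂` along their common boundary `N(∂X) = N(X)|_∂X`: both inclusions into the
manifold `N_sing(X)` are smooth immersions of codimension `0`. The smooth structures of `N(X)`
and of `D_∂` are those for which the surjections from `X × ℝ^(m+1)` and from
`∂X × [0,1) × ℝ^m` are submersions, so this is stated through these surjections; the smooth
structure of `∂X` enters through its smooth parametrizations `c`. -/
structure IsGlued [ChartedSpace (E (m + 1)) D.Nsing] : Prop where
  smooth_normal : ContMDiff ((𝓡∂ n).prod (𝓡 (m + 1))) (𝓡 (m + 1)) ∞ D.normalMap
  submersion_normal : ∀ p, Function.Surjective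
    (mfderiv ((𝓡∂ n).prod (𝓡 (m + 1))) (𝓡 (m + 1)) D.normalMap p)
  smooth_cone : ∀ (O : Set (E (n - 1))) (c : E (n - 1) → X), IsOpen O →
    ContMDiffOn (𝓡 (n - 1)) (𝓡∂ n) ∞ c O → (∀ y ∈ O, c y ∈ (𝓡∂ n).boundary X) →
    ContMDiffOn 𝓘(ℝ, E (n - 1) × ℝ × E m) (𝓡 (m + 1)) ∞
      (fun p : E (n - 1) × ℝ × E m => D.coneMap (c p.1) p.2.1 p.2.2)
      (O ×ˢ Ico (0 : ℝ) 1 ×ˢ univ)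
  submersion_cone : ∀ (O : Set (E (n - 1))) (c : E (n - 1) → X), IsOpen O →
    ContMDiffOn (𝓡 (n - 1)) (𝓡∂ n) ∞ c O → (∀ y ∈ O, c y ∈ (𝓡∂ n).boundary X) →
    (∀ y ∈ O, Function.Injective (mfderiv (𝓡 (n - 1)) (𝓡∂ n) c y)) →
    ∀ p ∈ O ×ˢ Ico (0 : ℝ) 1 ×ˢ (univ : Set (E m)), Function.Surjective
      (mfderivWithin 𝓘(ℝ, E (n - 1) × ℝ × E m) (𝓡 (m + 1))
        (fun p : E (n - 1) × ℝ × E m => D.coneMap (c p.1) p.2.1 p.2.2)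
        (O ×ˢ Ico (0 : ℝ) 1 ×ˢ univ) p)

/-! ### The space `B_F` -/

/-- The set `B_F = N_sing(X) ⊔ (0,1] × ℝ^(m+1)`. -/
inductive BF
  | sing (z : D.Nsing)
  | pos (t : Ioc (0 : ℝ) 1) (P : E (m + 1))

open Classical in
/-- The map `q_F : X_F × ℝ^(m+1) → B_F`, equal to `q_∂` over `X_∂` and to
`(x, t, V) ↦ (t, t V + (emb x, log ρ(x)))` if `t > 0` and `x` is an interior point. -/
def qF (a : D.XF × E (m + 1)) : D.BF :=
  if h : a.1.1.2 = 0 ∨ a.1.1.1 ∈ (𝓡∂ n).boundary X then .sing (D.qSing (⟨a.1, h⟩, a.2))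
  else .pos ⟨a.1.1.2, lt_of_le_of_ne a.1.2.1.1 (fun h0 => h (Or.inl h0.symm)), a.1.2.1.2⟩
    (a.1.1.2 • a.2 + join (D.emb a.1.1.1) (Real.log (D.rho a.1.1.1)))

/-- `B_F` has the quotient topology of `q_F`, i.e. the topology of the orbit space. -/
instance : TopologicalSpace D.BF := TopologicalSpace.coinduced D.qF inferInstance

/-- The end `{1} × ℝ^(m+1)` of `B_F`. -/
def topEnd (P : E (m + 1)) : D.BF := .pos ⟨1, by simp⟩ P

/-- The coordinates `(t, P)` on the subset `(0,1] × ℝ^(m+1)` of `B_F` (and `0` elsewhere). -/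
def coord : D.BF → ℝ × E (m + 1)
  | .sing _ => 0
  | .pos t P => (t, P)

/-- `(0,1] × ℝ^(m+1)`, with its standard smooth structure, is an open submanifold of `B_F`. -/
structure IsStandardOnCylinder [ChartedSpace (EuclideanHalfSpace (m + 2)) D.BF] : Prop where
  isOpenEmbedding :
    Topology.IsOpenEmbedding (fun p : Ioc (0 : ℝ) 1 × E (m + 1) => BF.pos (D := D) p.1 p.2)
  smooth : ContMDiffOn (𝓡∂ (m + 2)) 𝓘(ℝ, ℝ × E (m + 1)) ∞ D.coord
    (range (fun p : Ioc (0 : ℝ) 1 × E (m + 1) => BF.pos (D := D) p.1 p.2))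
  bijective : ∀ (t : Ioc (0 : ℝ) 1) (P : E (m + 1)), Function.Bijective
    (mfderiv (𝓡∂ (m + 2)) 𝓘(ℝ, ℝ × E (m + 1)) D.coord (.pos t P))

end BoundaryEmbedding

end APS

end

/-!
The homeomorphism between the orbit space and `B_F` is formal: the fibres of `qF` are exactly the
classes of the orbit relation (`qF_eq_iff`) and `qF` is onto. All the content is in the smooth
structure of `B_F` near `N_sing(X)`, and it comes from a tubular neighbourhood of `X` in
`ℝ^m × [0, ∞)` which is adapted to the b-groupoid.

*The tube.* A vector `v = (v', s)` at `x` is *normal* (`IsNrm`) when it is orthogonal to the image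
of the Lie algebroid `A(Γ(X))_x`. Every class in `N_x(X)` is `[(v', ρ(x) s)]_x` for exactly one
normal `v` (`nrm`), also over `∂X`, and `v` depends smoothly on the class. The b-exponential map
`expo x v = (i_∂ x + v', ρ(x) e^s)` is the Euclidean exponential map in the coordinates
`(P, log u)` of the half space, so `(x, v)` can be recovered from `expo x v` as a nearest point:
the groupoid has quadratic contact with its algebroid, uniformly up to the boundary
(`exists_inner_le`). Hence `expo` is a homeomorphism from a neighbourhood `tube` of the zero
section onto a relatively open set of the half space, and the inverse `vec` is smooth in the
coordinates `(P, log u)` and on the boundary `u = 0` (`contDiffAt_vec_logc`,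
`contDiffAt_vec_slice`). These two kinds of smoothness are all that is used; joint smoothness at
`u = 0` is not needed, because near a point of `N_sing(X)` the space `B_F` is charted by a single
chart.

*Global coordinates.* Let `b` be a cutoff function of the tube, a function of the foot point `x`
and decreasing in `|v|²` (`Cutoff`). The map `Θ t`, which multiplies the normal vector `v` by
`t / (b + t)`, is for `t > 0` a bijection of the half space with inverse `G t`, and as `t → 0` it
degenerates to the collapse of the tube onto `X`. Hence `(t, P) ↦ (t, G t P)` on the cylinder and
`(x, v) ↦ (0, expo x (τ v))` with `τ = β(x, |τ v|²)` on the normal bundle are the two parts of one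
map `model` from `B_F` to `[0,1] × ℝ^m × [0, ∞)`. It is a homeomorphism onto the set `region`,
which is open in `[0,1] × ℝ^m × [0, ∞)` minus the face `u = 0` of `t = 1` (`isEmbedding_model`,
`range_model`): continuity at `t = 0` is the quadratic contact again, and openness follows from
explicit local sections of `qF` over the tube. In these coordinates `N_sing(X)` is the set
`t u = 0`, with `N(X)` the face `t = 0` and `D_∂` the face `u = 0`.

*Charts.* The corner `t = u = 0` is unfolded by `(t, P, u) ↦ (t u, P, t - u)`, a homeomorphism of
the quadrant onto the half space which is a diffeomorphism over the interior. This gives a chart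
of `B_F` around `N_sing(X)`, a chart of `N_sing(X)`, and, with the standard chart of
`(0,1] × ℝ^(m+1)`, an atlas of `B_F`. The only change of coordinates takes place over the
connected manifold `(0,1) × ℝ^(m+1)`, so the sign of its Jacobian is constant and can be made
positive by a reflection (`exists_sign`). The boundary signs of the two ends are then read off in
the charts. That `N(X)` and `D_∂` are immersed is a computation of kernels: a curve whose image in
the model has velocity zero moves neither the foot point nor the normal part of its vector, so the
kernel of the differential of `(x, V) ↦ [V]_x` is `T_x X`, and a dimension count makes the
differential onto; similarly for `D_∂`.
-/

noncomputable section

namespace APS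

open Filter Topology
open scoped RealInnerProductSpace

/-! ### Smoothness of series and of difference quotients -/

/-- Any sequence of smooth functions can be rescaled so that its series, and every series with
smaller nonnegative coefficients, is smooth: the `i`-th coefficient makes all derivatives of order
at most `i` smaller than `2⁻ⁱ` on the ball of radius `i`. -/
theorem exists_coeff_contDiff_tsum {V W : Type*} [NormedAddCommGroup V] [NormedSpace ℝ V]
    [FiniteDimensional ℝ V] [NormedAddCommGroup W] [NormedSpace ℝ W] [CompleteSpace W]
    (f : ℕ → V → W) (hf : ∀ i, ContDiff ℝ ∞ (f i)) :
    ∃ c : ℕ → ℝ, (∀ i, 0 < c i) ∧ ∀ c' : ℕ → ℝ, (∀ i, 0 ≤ c' i ∧ c' i ≤ c i) →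
      ContDiff ℝ ∞ (fun x => ∑' i, c' i • f i x) := by
  have hM : ∀ i : ℕ, ∃ M : ℝ, 0 ≤ M ∧ ∀ k ≤ i, ∀ x ∈ Metric.closedBall (0 : V) i,
      ‖iteratedFDeriv ℝ k (f i) x‖ ≤ M := by
    intro i
    have h1 : ∀ k : ℕ, ∃ C, ∀ x ∈ Metric.closedBall (0 : V) i, ‖iteratedFDeriv ℝ k (f i) x‖ ≤ C :=
      fun k => (isCompact_closedBall (0 : V) (i : ℝ)).exists_bound_of_continuousOn
        (((hf i).continuous_iteratedFDeriv (m := k) (by exact_mod_cast le_top)).continuousOn)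
    choose C hC using h1
    refine ⟨∑ k ∈ Finset.range (i + 1), |C k|, by positivity, fun k hk x hx => ?_⟩
    exact ((hC k x hx).trans (le_abs_self _)).trans
      (Finset.single_le_sum (f := fun k => |C k|) (fun _ _ => abs_nonneg _)
        (Finset.mem_range.2 (by omega)))
  choose M hM0 hM using hM
  refine ⟨fun i => (1 / 2) ^ i / (1 + M i), fun i => by have := hM0 i; positivity, ?_⟩
  intro c' hc'
  have hsmall : ∀ i : ℕ, ∀ k ≤ i, ∀ x ∈ Metric.closedBall (0 : V) i,
      ‖iteratedFDeriv ℝ k (fun y => c' i • f i y) x‖ ≤ (1 / 2 : ℝ) ^ i := by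
    intro i k hk x hx
    have e : iteratedFDeriv ℝ k (fun y => c' i • f i y) x = c' i • iteratedFDeriv ℝ k (f i) x :=
      iteratedFDeriv_const_smul_apply
        ((hf i).contDiffAt.of_le (by exact_mod_cast le_top))
    rw [e, norm_smul, Real.norm_of_nonneg (hc' i).1]
    have := hM0 i
    calc c' i * ‖iteratedFDeriv ℝ k (f i) x‖ ≤ ((1 / 2) ^ i / (1 + M i)) * (1 + M i) :=
          mul_le_mul (hc' i).2 ((hM i k hk x hx).trans (by linarith)) (norm_nonneg _)
            (by positivity)
      _ = (1 / 2 : ℝ) ^ i := by field_simp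
  rw [contDiff_iff_contDiffAt]
  intro x₀
  let ψ : ContDiffBump x₀ := default
  have hψs : ContDiff ℝ ∞ (ψ : V → ℝ) := ψ.contDiff
  have hB : ∀ j : ℕ, ∃ B, ∀ x, ‖iteratedFDeriv ℝ j (ψ : V → ℝ) x‖ ≤ B := fun j =>
    (ψ.hasCompactSupport.iteratedFDeriv j).exists_bound_of_continuous
      (hψs.continuous_iteratedFDeriv (m := j) (by exact_mod_cast le_top))
  choose B hB using hB
  have hglob : ContDiff ℝ ∞ (fun x => ∑' i, ψ x • (c' i • f i x)) := by
    refine contDiff_tsum_of_eventually (v := fun k i =>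
      (∑ j ∈ Finset.range (k + 1), (k.choose j : ℝ) * B j) * (1 / 2) ^ i)
      (fun i => hψs.smul (contDiff_const.smul (hf i))) ?_ ?_
    · exact fun k _ => summable_geometric_two.mul_left _
    · intro k _
      rw [Nat.cofinite_eq_atTop]
      obtain ⟨N, hN⟩ := exists_nat_ge (‖x₀‖ + ψ.rOut)
      filter_upwards [eventually_ge_atTop (max k N)] with i hi x
      have hki : k ≤ i := (le_max_left _ _).trans hi
      have hNi : (N : ℝ) ≤ i := by exact_mod_cast (le_max_right _ _).trans hi
      refine (norm_iteratedFDeriv_smul_le (N := ∞) hψs (contDiff_const.smul (hf i)) x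
        (by exact_mod_cast le_top)).trans ?_
      rw [Finset.sum_mul]
      refine Finset.sum_le_sum fun j hj => ?_
      by_cases hx : x ∈ tsupport (ψ : V → ℝ)
      · have hx' : x ∈ Metric.closedBall (0 : V) i := by
          rw [ψ.tsupport_eq, Metric.mem_closedBall, dist_eq_norm] at hx
          rw [mem_closedBall_zero_iff]
          have : ‖x‖ ≤ ‖x - x₀‖ + ‖x₀‖ := by simpa using norm_add_le (x - x₀) x₀
          linarith
        have h0 : 0 ≤ B j := (norm_nonneg _).trans (hB j x)
        exact mul_le_mul (mul_le_mul_of_nonneg_left (hB j x) (by positivity))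
          (hsmall i (k - j) (by omega) x hx') (norm_nonneg _) (by positivity)
      · have h0 : iteratedFDeriv ℝ j (ψ : V → ℝ) x = 0 := by
          by_contra h
          exact hx (support_iteratedFDeriv_subset j h)
        have h1 : 0 ≤ B j := (norm_nonneg _).trans (hB j x)
        rw [h0, norm_zero, mul_zero, zero_mul]
        positivity
  refine hglob.contDiffAt.congr_of_eventuallyEq ?_
  filter_upwards [ψ.eventuallyEq_one] with x hx
  simp [hx]

/-- A parametric integral over `[0,1]` of a smooth function is smooth. -/
theorem contDiff_intervalIntegral {V : Type} [NormedAddCommGroup V] [NormedSpace ℝ V]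
    [FiniteDimensional ℝ V] {W : Type} [NormedAddCommGroup W] [NormedSpace ℝ W] [CompleteSpace W]
    {f : V × ℝ → W} (hf : ContDiff ℝ ∞ f) :
    ContDiff ℝ ∞ (fun x => ∫ s in (0 : ℝ)..1, f (x, s)) := by
  rw [contDiff_infty]
  intro k
  induction k generalizing W with
  | zero =>
    rw [Nat.cast_zero, contDiff_zero]
    have hc : Continuous (Function.uncurry fun x s => f (x, s)) := hf.continuous
    exact intervalIntegral.continuous_parametric_intervalIntegral_of_continuous' hc 0 1
  | succ k ih =>
    let f' : V × ℝ → V →L[ℝ] W := fun p => (fderiv ℝ f p).comp (.inl ℝ V ℝ)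
    have hf' : ContDiff ℝ ∞ f' :=
      (hf.fderiv_right (m := ∞) (by simp)).clm_comp contDiff_const
    have hd : ∀ x s, HasFDerivAt (fun y => f (y, s)) (f' (x, s)) x := fun x s =>
      (hf.differentiable (by simp) (x, s)).hasFDerivAt.comp x (hasFDerivAt_prodMk_left x s)
    have hder : ∀ x, HasFDerivAt (fun x => ∫ s in (0 : ℝ)..1, f (x, s))
        (∫ s in (0 : ℝ)..1, f' (x, s)) x := by
      intro x
      obtain ⟨C, hC⟩ := ((isCompact_closedBall x 1).prod (isCompact_Icc (a := (0 : ℝ)) (b := 1)))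
        |>.exists_bound_of_continuousOn hf'.continuous.continuousOn
      refine intervalIntegral.hasFDerivAt_integral_of_dominated_of_fderiv_le
        (F' := fun x s => f' (x, s)) (bound := fun _ => C)
        (Metric.closedBall_mem_nhds x one_pos) ?_ ?_ ?_ ?_ ?_ ?_
      · exact Eventually.of_forall fun y =>
          (hf.continuous.comp (Continuous.prodMk_right y)).aestronglyMeasurable
      · exact (hf.continuous.comp (Continuous.prodMk_right x)).intervalIntegrable _ _
      · exact (hf'.continuous.comp (Continuous.prodMk_right x)).aestronglyMeasurable
      · refine Eventually.of_forall fun s hs y hy => hC (y, s) ⟨hy, ?_⟩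
        rw [uIoc_of_le zero_le_one] at hs
        exact Ioc_subset_Icc_self hs
      · simp
      · exact Eventually.of_forall fun s _ y _ => hd y s
    rw [Nat.cast_succ, contDiff_succ_iff_hasFDerivAt]
    exact ⟨_, ih hf', hder⟩

/-- Hadamard's lemma: a smooth function vanishing for `t = 0` is `t` times a smooth function. -/
theorem exists_contDiffAt_eq_smul {Z : Type} [NormedAddCommGroup Z] [NormedSpace ℝ Z]
    [FiniteDimensional ℝ Z] {W : Type} [NormedAddCommGroup W] [NormedSpace ℝ W] [CompleteSpace W]
    {H : Z × ℝ → W} {z₀ : Z} (hH : ∀ᶠ p in 𝓝 (z₀, (0 : ℝ)), ContDiffAt ℝ ∞ H p)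
    (h0 : ∀ᶠ z in 𝓝 z₀, H (z, 0) = 0) :
    ∃ K : Z × ℝ → W, ContDiffAt ℝ ∞ K (z₀, 0) ∧
      ∀ᶠ p in 𝓝 (z₀, (0 : ℝ)), H p = p.2 • K p := by
  have h0' : ∀ᶠ p in 𝓝 (z₀, (0 : ℝ)), H (p.1, 0) = 0 :=
    (continuous_fst.tendsto (z₀, (0 : ℝ))).eventually h0
  obtain ⟨ε, hε, hball⟩ := Metric.eventually_nhds_iff_ball.1 (hH.and h0')
  let ψ : ContDiffBump ((z₀, (0 : ℝ)) : Z × ℝ) := ⟨ε / 4, ε / 2, by positivity, by linarith⟩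
  let G : Z × ℝ → W := fun p => ψ p • H p
  have hG : ContDiff ℝ ∞ G := by
    rw [contDiff_iff_contDiffAt]
    intro p
    by_cases hp : p ∈ Metric.ball (z₀, (0 : ℝ)) ε
    · exact ψ.contDiffAt.smul (hball p hp).1
    · have : p ∉ tsupport ψ := by
        rw [ψ.tsupport_eq]
        exact fun h => hp (Metric.closedBall_subset_ball (show ε / 2 < ε by linarith) h)
      refine (contDiffAt_const (c := (0 : W))).congr_of_eventuallyEq ?_
      filter_upwards [(isClosed_tsupport ψ).isOpen_compl.mem_nhds this] with q hq
      have : ψ q = 0 := image_eq_zero_of_notMem_tsupport hq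
      simp [G, this]
  have hG0 : ∀ z, G (z, 0) = 0 := by
    intro z
    by_cases hp : (z, (0 : ℝ)) ∈ Metric.ball (z₀, (0 : ℝ)) ε
    · have := (hball _ hp).2
      simp only [G]
      rw [this, smul_zero]
    · have : ψ (z, (0 : ℝ)) = 0 := ψ.zero_of_le_dist (by
        rw [Metric.mem_ball, not_lt] at hp
        exact le_trans (show ε / 2 ≤ ε by linarith) hp)
      simp [G, this]
  let g : (Z × ℝ) × ℝ → W := fun q => fderiv ℝ G (q.1.1, q.2 * q.1.2) (0, 1)
  have hg : ContDiff ℝ ∞ g := by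
    have h1 : ContDiff ℝ ∞ (fderiv ℝ G) := hG.fderiv_right (by simp)
    have h2 : ContDiff ℝ ∞ (fun q : (Z × ℝ) × ℝ => (q.1.1, q.2 * q.1.2)) := by fun_prop
    exact (h1.comp h2).clm_apply contDiff_const
  refine ⟨fun p => ∫ s in (0 : ℝ)..1, g (p, s), (contDiff_intervalIntegral hg).contDiffAt, ?_⟩
  have hval : ∀ p : Z × ℝ, G p = p.2 • ∫ s in (0 : ℝ)..1, g (p, s) := by
    rintro ⟨z, t⟩
    have hd : ∀ s : ℝ, HasDerivAt (fun s : ℝ => G (z, s * t)) (t • g ((z, t), s)) s := by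
      intro s
      have h1 : HasDerivAt (fun s : ℝ => ((z, s * t) : Z × ℝ)) (0, t) s :=
        (hasDerivAt_const s z).prodMk (by simpa using (hasDerivAt_id s).mul_const t)
      have h2 := (hG.differentiable (by simp) (z, s * t)).hasFDerivAt.comp_hasDerivAt s h1
      have e : ((0 : Z), t) = t • ((0 : Z), (1 : ℝ)) := by simp
      rw [e, map_smul] at h2
      exact h2
    have hi : IntervalIntegrable (fun s => t • g ((z, t), s)) MeasureTheory.volume 0 1 :=
      ((hg.continuous.comp (Continuous.prodMk_right (z, t))).const_smul t).intervalIntegrable _ _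
    have := intervalIntegral.integral_eq_sub_of_hasDerivAt (fun s _ => hd s) hi
    simp only [one_mul, zero_mul, hG0, sub_zero] at this
    rw [← this, intervalIntegral.integral_smul]
  filter_upwards [ψ.eventuallyEq_one] with p hp
  rw [← hval p]
  simp [G, hp]

section ImplicitFunctions

/-! ### Implicit functions: nearest points and radial rescaling -/

/-- Let `φ` be a parametrization such that the squared distance of `P₀` to `φ a` grows at least
quadratically at `a₀`. If `α P` depends continuously on `P` and `φ (α P)` is a critical point of
the distance to `P`, then `α` is smooth at `P₀`: the quadratic growth makes the Hessian of the
squared distance nondegenerate, so the implicit function theorem applies to the critical point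
equation. -/
theorem contDiffAt_of_critical {V E : Type*} [NormedAddCommGroup V] [NormedSpace ℝ V]
    [FiniteDimensional ℝ V] [NormedAddCommGroup E] [InnerProductSpace ℝ E] [FiniteDimensional ℝ E]
    {φ : V → E} {a₀ : V} {P₀ : E} {κ : ℝ} {α : E → V} (hφ : ContDiffAt ℝ ∞ φ a₀) (hκ : 0 < κ)
    (hmin : ∀ᶠ a in 𝓝 a₀, ‖P₀ - φ a₀‖ ^ 2 + κ * ‖a - a₀‖ ^ 2 ≤ ‖P₀ - φ a‖ ^ 2)
    (hα : ContinuousAt α P₀) (hα0 : α P₀ = a₀)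
    (hcrit : ∀ᶠ P in 𝓝 P₀, ∀ ξ, ⟪P - φ (α P), fderiv ℝ φ (α P) ξ⟫ = 0) :
    ContDiffAt ℝ ∞ α P₀ := by
  let F : E × V → V →L[ℝ] ℝ := fun p => (innerSL ℝ (p.1 - φ p.2)).comp (fderiv ℝ φ p.2)
  have hFv : ∀ p ξ, F p ξ = ⟪p.1 - φ p.2, fderiv ℝ φ p.2 ξ⟫ := fun p ξ => rfl
  have hφ2 : ContDiffAt ℝ ∞ (fun p : E × V => φ p.2) (P₀, a₀) :=
    ContDiffAt.comp (g := φ) (P₀, a₀) hφ contDiffAt_snd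
  have hdφ : ContDiffAt ℝ ∞ (fun p : E × V => fderiv ℝ φ p.2) (P₀, a₀) :=
    ContDiffAt.comp (g := fderiv ℝ φ) (P₀, a₀) (hφ.fderiv_right (m := ∞) (by simp)) contDiffAt_snd
  have hF : ContDiffAt ℝ ∞ F (P₀, a₀) :=
    ((innerSL ℝ (E := E)).contDiff.contDiffAt.comp (P₀, a₀)
      (contDiffAt_fst.sub hφ2)).clm_comp hdφ
  have hF0 : F (P₀, a₀) = 0 := by
    ext ξ
    rw [hFv]
    simpa [hα0] using hcrit.self_of_nhds ξ
  let L : V →L[ℝ] V →L[ℝ] ℝ := (fderiv ℝ F (P₀, a₀)).comp (.inr ℝ E V)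
  have hLinj : Function.Injective L := by
    rw [injective_iff_map_eq_zero]
    intro ξ hξ
    by_contra hne
    have hξ0 : 0 < ‖ξ‖ := norm_pos_iff.2 hne
    have hline : HasDerivAt (fun s : ℝ => ((P₀, a₀ + s • ξ) : E × V)) (0, ξ) 0 := by
      have h1 : HasDerivAt (fun s : ℝ => a₀ + s • ξ) ξ 0 := by
        simpa using ((hasDerivAt_id (0 : ℝ)).smul_const ξ).const_add a₀
      exact (hasDerivAt_const (0 : ℝ) P₀).prodMk h1
    have hFd : HasDerivAt (fun s : ℝ => F (P₀, a₀ + s • ξ) ξ) 0 0 := by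
      have h1 : HasFDerivAt F (fderiv ℝ F (P₀, a₀)) (P₀, a₀ + (0 : ℝ) • ξ) := by
        simpa using (hF.differentiableAt (by simp)).hasFDerivAt
      have h2 := h1.comp_hasDerivAt (0 : ℝ) hline
      have h3 : fderiv ℝ F (P₀, a₀) (0, ξ) = 0 := hξ
      rw [h3] at h2
      simpa using h2.clm_apply (hasDerivAt_const (0 : ℝ) ξ)
    have hlin : Tendsto (fun s : ℝ => a₀ + s • ξ) (𝓝 0) (𝓝 a₀) := by
      have : Continuous fun s : ℝ => a₀ + s • ξ := by fun_prop
      simpa using this.tendsto 0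
    have hd : ∀ᶠ s in 𝓝 (0 : ℝ), HasDerivAt (fun s : ℝ => ‖P₀ - φ (a₀ + s • ξ)‖ ^ 2)
        (-2 * F (P₀, a₀ + s • ξ) ξ) s := by
      have h1 : ∀ᶠ a in 𝓝 a₀, DifferentiableAt ℝ φ a := by
        filter_upwards [(hφ.of_le (m := 1) (by simp)).eventually (by simp)] with a ha
        exact ha.differentiableAt (by simp)
      filter_upwards [hlin.eventually h1] with s hs
      have h2 : HasDerivAt (fun s : ℝ => a₀ + s • ξ) ξ s := by
        simpa using ((hasDerivAt_id s).smul_const ξ).const_add a₀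
      have h3 := (hs.hasFDerivAt.comp_hasDerivAt s h2).const_sub P₀
      have h4 := h3.norm_sq
      simp only [Function.comp_def, inner_neg_right] at h4
      rw [hFv]
      convert h4 using 1
      ring
    have hsm : ∀ᶠ s in 𝓝 (0 : ℝ), |F (P₀, a₀ + s • ξ) ξ| ≤ κ * ‖ξ‖ ^ 2 / 4 * |s| := by
      have := hFd.isLittleO.def (c := κ * ‖ξ‖ ^ 2 / 4) (by positivity)
      filter_upwards [this] with s hs
      simpa [hF0] using hs
    have hmin' := hlin.eventually hmin
    obtain ⟨ε, hε, hb⟩ := Metric.eventually_nhds_iff_ball.1 (hd.and (hsm.and hmin'))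
    have hs0 : (0 : ℝ) < ε / 2 := by positivity
    have hmem : ∀ s ∈ Icc 0 (ε / 2), s ∈ Metric.ball (0 : ℝ) ε := by
      intro s hs
      rw [Metric.mem_ball, dist_zero_right, Real.norm_eq_abs, abs_of_nonneg hs.1]
      linarith [hs.2]
    obtain ⟨s, hs, hse⟩ := exists_hasDerivAt_eq_slope (fun s : ℝ => ‖P₀ - φ (a₀ + s • ξ)‖ ^ 2)
      (fun s => -2 * F (P₀, a₀ + s • ξ) ξ) hs0
      (fun s hs => (hb s (hmem s hs)).1.continuousAt.continuousWithinAt)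
      (fun s hs => (hb s (hmem s (Ioo_subset_Icc_self hs))).1)
    have h5 := (hb s (hmem s (Ioo_subset_Icc_self hs))).2.1
    have h6 := (hb (ε / 2) (hmem _ (right_mem_Icc.2 hs0.le))).2.2
    simp only [add_sub_cancel_left, norm_smul, Real.norm_eq_abs, abs_of_pos hs0] at h6
    rw [sub_zero, eq_div_iff hs0.ne'] at hse
    simp only [zero_smul, add_zero] at hse
    rw [abs_of_pos hs.1] at h5
    have h7 : -2 * F (P₀, a₀ + s • ξ) ξ ≤ κ * ‖ξ‖ ^ 2 / 2 * (ε / 2) := by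
      have := neg_abs_le (F (P₀, a₀ + s • ξ) ξ)
      have h8 : κ * ‖ξ‖ ^ 2 / 4 * s ≤ κ * ‖ξ‖ ^ 2 / 4 * (ε / 2) :=
        mul_le_mul_of_nonneg_left hs.2.le (by positivity)
      linarith
    have h9 := mul_le_mul_of_nonneg_right h7 hs0.le
    have h10 : 0 < κ * (ε / 2 * ‖ξ‖) ^ 2 := by positivity
    nlinarith
  have hLinv : ((fderiv ℝ F (P₀, a₀)).comp (.inr ℝ E V)).IsInvertible := by
    have hdim : Module.finrank ℝ V = Module.finrank ℝ (V →L[ℝ] ℝ) := by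
      rw [← (LinearMap.toContinuousLinearMap (𝕜 := ℝ) (E := V) (F' := ℝ)).finrank_eq]
      exact (Subspace.dual_finrank_eq (K := ℝ) (V := V)).symm
    have hinj : Function.Injective (L : V →ₗ[ℝ] V →L[ℝ] ℝ) := hLinj
    let e := LinearEquiv.ofInjectiveOfFinrankEq (L : V →ₗ[ℝ] V →L[ℝ] ℝ) hinj hdim
    refine ⟨e.toContinuousLinearEquiv, ?_⟩
    ext1 ξ
    rfl
  have himp := hF.contDiffAt_implicitFunction (by simp) hLinv
  refine himp.congr_of_eventuallyEq ?_
  have h1 := hF.eventually_apply_eq_iff_implicitFunction (by simp) hLinv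
  have h2 : Tendsto (fun P => (P, α P)) (𝓝 P₀) (𝓝 (P₀, a₀)) := by
    rw [← hα0]
    exact (continuousAt_id.prodMk hα)
  filter_upwards [h2.eventually h1, hcrit] with P hP hc
  refine (hP.1 ?_).symm
  rw [hF0]
  ext ξ
  rw [hFv]
  exact hc ξ

/-- The inverse of `(t, P) ↦ (t, P - (b P + t)⁻¹ • F P)` is smooth at the zeros of `b`: there the
derivative of this map is the identity. -/
theorem contDiffAt_inverse_of_eq_zero {E : Type*} [NormedAddCommGroup E] [NormedSpace ℝ E]
    [FiniteDimensional ℝ E] {b : E → ℝ} {F : E → E} {g : ℝ → E → E} (hb : ContDiff ℝ ∞ b)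
    (hF : ContDiff ℝ ∞ F) (hb0 : ∀ P, 0 ≤ b P) (hFb : ∀ P, ‖F P‖ ≤ b P)
    (hg : ∀ t > 0, ∀ P, g t (P - (b P + t)⁻¹ • F P) = P) {Q : E} (hQ : b Q = 0) {t : ℝ}
    (ht : 0 < t) : ContDiffAt ℝ ∞ (fun p : ℝ × E => g p.1 p.2) (t, Q) := by
  have hFQ : F Q = 0 := norm_le_zero_iff.1 ((hFb Q).trans hQ.le)
  have hdb : HasFDerivAt b (0 : E →L[ℝ] ℝ) Q := by
    have h1 := (hb.differentiable (by simp) Q).hasFDerivAt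
    have h2 : IsLocalMin b Q := Eventually.of_forall fun P => by rw [hQ]; exact hb0 P
    rwa [h2.fderiv_eq_zero] at h1
  have hdF : HasFDerivAt F (0 : E →L[ℝ] E) Q := by
    rw [hasFDerivAt_iff_isLittleO] at hdb ⊢
    refine (Asymptotics.IsBigO.of_bound 1 (Eventually.of_forall fun P => ?_)).trans_isLittleO hdb
    simpa [hFQ, hQ, abs_of_nonneg (hb0 P)] using hFb P
  let Θ : ℝ × E → ℝ × E := fun p => (p.1, p.2 - (b p.2 + p.1)⁻¹ • F p.2)
  have hne : b (t, Q).2 + (t, Q).1 ≠ 0 := by simp [hQ, ht.ne']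
  have hcoef : ContDiffAt ℝ ∞ (fun p : ℝ × E => (b p.2 + p.1)⁻¹) (t, Q) :=
    ((hb.comp contDiff_snd).contDiffAt.add contDiffAt_fst).inv hne
  have hΘ : ContDiffAt ℝ ∞ Θ (t, Q) :=
    contDiffAt_fst.prodMk (contDiffAt_snd.sub (hcoef.smul (hF.comp contDiff_snd).contDiffAt))
  have hdΘ : HasFDerivAt Θ ((ContinuousLinearEquiv.refl ℝ (ℝ × E) : _ →L[ℝ] _)) (t, Q) := by
    have h1 : HasFDerivAt (fun p : ℝ × E => F p.2) (0 : ℝ × E →L[ℝ] E) (t, Q) := by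
      have h0 := HasFDerivAt.comp (g := F) (t, Q) hdF (hasFDerivAt_snd (𝕜 := ℝ) (p := (t, Q)))
      rwa [ContinuousLinearMap.zero_comp] at h0
    have h2 := (hcoef.differentiableAt (by simp)).hasFDerivAt.smul h1
    have h3 := (hasFDerivAt_fst (𝕜 := ℝ) (p := (t, Q))).prodMk
      ((hasFDerivAt_snd (𝕜 := ℝ) (p := (t, Q))).sub h2)
    refine h3.congr_fderiv ?_
    ext <;> simp [hFQ]
  have hΘQ : Θ (t, Q) = (t, Q) := by simp [Θ, hFQ]
  have hloc := hΘ.to_localInverse hdΘ (by simp)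
  rw [hΘQ] at hloc
  have hst := hΘ.hasStrictFDerivAt' hdΘ (by simp)
  have hri := hst.eventually_right_inverse
  rw [hΘQ] at hri
  have hpos : ∀ᶠ p : ℝ × E in 𝓝 (t, Q), 0 < p.1 :=
    continuousAt_fst.eventually_const_lt (by exact ht)
  refine (contDiffAt_snd.comp (t, Q) hloc).congr_of_eventuallyEq ?_
  filter_upwards [hri, hpos] with p hp hp0
  generalize hq : ContDiffAt.localInverse hΘ hdΘ (by simp) p = q
  have hp' : Θ q = p := by rw [← hq]; exact hp
  have e1 : (Θ q).1 = p.1 := congrArg Prod.fst hp'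
  change q.1 = p.1 at e1
  have e2 : (Θ q).2 = p.2 := congrArg Prod.snd hp'
  change q.2 - (b q.2 + q.1)⁻¹ • F q.2 = p.2 at e2
  simp only [Function.comp_def, hq]
  rw [← e2, ← e1]
  exact hg q.1 (by rw [e1]; exact hp0) q.2

section Tau

variable {W : Type*} [NormedAddCommGroup W] [NormedSpace ℝ W]

open Classical in
/-- The nonnegative solution `τ` of `τ = t + β (p, τ² q)`. -/
def tau (β : W × ℝ → ℝ) (p : W) (t q : ℝ) : ℝ :=
  if h : ∃ τ, 0 ≤ τ ∧ τ = t + β (p, τ ^ 2 * q) then h.choose else 0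

variable {β : W × ℝ → ℝ} (hβ : ContDiff ℝ ∞ β) (hβ0 : ∀ z, 0 ≤ β z)
  (hanti : ∀ p, Antitone fun r => β (p, r))

include hanti in
omit [NormedAddCommGroup W] [NormedSpace ℝ W] in
theorem tau_unique {p : W} {t q τ τ' : ℝ} (hq : 0 ≤ q) (h0 : 0 ≤ τ) (h0' : 0 ≤ τ')
    (h : τ = t + β (p, τ ^ 2 * q)) (h' : τ' = t + β (p, τ' ^ 2 * q)) : τ = τ' := by
  wlog hle : τ ≤ τ' generalizing τ τ'
  · exact (this h0' h0 h' h (le_of_not_ge hle)).symm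
  have h1 : β (p, τ' ^ 2 * q) ≤ β (p, τ ^ 2 * q) :=
    hanti p (mul_le_mul_of_nonneg_right (pow_le_pow_left₀ h0 hle 2) hq)
  linarith

include hβ hβ0 hanti in
theorem tau_spec {p : W} {t q : ℝ} (ht : 0 ≤ t) (hq : 0 ≤ q) :
    0 ≤ tau β p t q ∧ tau β p t q = t + β (p, tau β p t q ^ 2 * q) := by
  have hex : ∃ τ, 0 ≤ τ ∧ τ = t + β (p, τ ^ 2 * q) := by
    have hc : Continuous fun τ : ℝ => τ - (t + β (p, τ ^ 2 * q)) := by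
      have := hβ.continuous
      fun_prop
    have hT : 0 ≤ t + β (p, 0) := add_nonneg ht (hβ0 _)
    obtain ⟨τ, hτ, h⟩ := intermediate_value_Icc hT hc.continuousOn (show (0 : ℝ) ∈ _ from
      ⟨by simp only [sub_nonpos]; exact add_nonneg ht (hβ0 _), by
        have : β (p, (t + β (p, 0)) ^ 2 * q) ≤ β (p, 0) := hanti p (by positivity)
        simp only [sub_nonneg]
        linarith⟩)
    exact ⟨τ, hτ.1, by simp only at h; linarith⟩
  rw [tau, dif_pos hex]
  exact hex.choose_spec

include hβ hβ0 hanti in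
theorem tau_eq {p : W} {t q τ : ℝ} (ht : 0 ≤ t) (hq : 0 ≤ q) (h0 : 0 ≤ τ)
    (h : τ = t + β (p, τ ^ 2 * q)) : tau β p t q = τ :=
  tau_unique hanti hq (tau_spec hβ hβ0 hanti ht hq).1 h0 (tau_spec hβ hβ0 hanti ht hq).2 h

include hβ hβ0 hanti in
/-- Near a point where it is positive, `tau` is the restriction of a smooth function. -/
theorem exists_contDiffAt_tau [CompleteSpace W] {p : W} {t q : ℝ} (ht : 0 ≤ t) (hq : 0 ≤ q)
    (hpos : 0 < tau β p t q) :
    ∃ σ : W × ℝ × ℝ → ℝ, ContDiffAt ℝ ∞ σ (p, t, q) ∧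
      ∀ᶠ z : W × ℝ × ℝ in 𝓝 (p, t, q), 0 ≤ z.2.1 → 0 ≤ z.2.2 →
        tau β z.1 z.2.1 z.2.2 = σ z := by
  set τ := tau β p t q with hτ
  have hspec := (tau_spec hβ hβ0 hanti (p := p) ht hq).2
  rw [← hτ] at hspec
  let f : (W × ℝ × ℝ) × ℝ → ℝ := fun u => u.2 - (u.1.2.1 + β (u.1.1, u.2 ^ 2 * u.1.2.2))
  have hf : ContDiff ℝ ∞ f := by
    have h1 : ContDiff ℝ ∞ fun u : (W × ℝ × ℝ) × ℝ => (u.1.1, u.2 ^ 2 * u.1.2.2) := by fun_prop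
    have h2 := hβ.comp h1
    exact contDiff_snd.sub ((contDiff_fst.comp (contDiff_snd.comp contDiff_fst)).add h2)
  set u₀ : (W × ℝ × ℝ) × ℝ := ((p, t, q), τ) with hu₀
  have hf0 : f u₀ = 0 := by simp only [f, u₀]; linarith
  have hder : ∃ d : ℝ, 1 ≤ d ∧ HasDerivAt (fun x => f ((p, t, q), x)) d τ := by
    have hr : HasDerivAt (fun r => β (p, r)) (deriv (fun r => β (p, r)) (τ ^ 2 * q)) (τ ^ 2 * q) :=
      (((hβ.comp (contDiff_prodMk_right p)).differentiable (by simp)) _).hasDerivAt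
    have h1 : HasDerivAt (fun x : ℝ => x ^ 2 * q) (2 * τ * q) τ := by
      simpa using (hasDerivAt_pow 2 τ).mul_const q
    have h2 := (hasDerivAt_id τ).sub ((hr.comp τ h1).const_add t)
    refine ⟨_, ?_, h2⟩
    have h3 : deriv (fun r => β (p, r)) (τ ^ 2 * q) ≤ 0 := (hanti p).deriv_nonpos
    have h4 : 0 ≤ 2 * τ * q := by positivity
    nlinarith [mul_nonneg (neg_nonneg.2 h3) h4]
  obtain ⟨d, hd1, hd⟩ := hder
  have hinv : ((fderiv ℝ f u₀).comp (.inr ℝ (W × ℝ × ℝ) ℝ)).IsInvertible := by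
    have h1 : HasDerivAt (fun x => f ((p, t, q), x)) (fderiv ℝ f u₀ (0, 1)) τ := by
      have := (hf.differentiable (by simp) u₀).hasFDerivAt.comp_hasDerivAt τ
        ((hasDerivAt_const τ (p, t, q)).prodMk (hasDerivAt_id τ))
      exact this
    have h2 := h1.unique hd
    refine ⟨ContinuousLinearEquiv.unitsEquivAut ℝ (Units.mk0 d (by linarith)), ?_⟩
    ext
    simp [h2]
  have hfa : ContDiffAt ℝ ∞ f u₀ := hf.contDiffAt
  have hσ := hfa.contDiffAt_implicitFunction (by simp) hinv
  refine ⟨_, hσ, ?_⟩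
  have h1 := hfa.eventually_apply_implicitFunction (by simp) hinv
  have h2 : ∀ᶠ z in 𝓝 u₀.1, 0 < hfa.implicitFunction (by simp) hinv z :=
    hσ.continuousAt.eventually_const_lt (by
      rw [hfa.implicitFunction_apply_self]
      exact hpos)
  filter_upwards [h1, h2] with z hz hz0 h3 h4
  refine tau_eq hβ hβ0 hanti h3 h4 hz0.le ?_
  rw [hf0] at hz
  simp only [f] at hz
  linarith

end Tau

/-- A linear map whose kernel is not larger than the rank formula allows is onto. -/
theorem surjective_of_finrank_ker_le {V W : Type*} [AddCommGroup V] [Module ℝ V]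
    [FiniteDimensional ℝ V] [AddCommGroup W] [Module ℝ W] [FiniteDimensional ℝ W] (L : V →ₗ[ℝ] W)
    {k : ℕ} (hk : Module.finrank ℝ (LinearMap.ker L) ≤ k)
    (hdim : Module.finrank ℝ V = k + Module.finrank ℝ W) : Function.Surjective L := by
  rw [← LinearMap.range_eq_top]
  apply Submodule.eq_top_of_finrank_eq
  have := L.finrank_range_add_finrank_ker
  have := Submodule.finrank_le (LinearMap.range L)
  omega

end ImplicitFunctions

/-! ### Coordinates on `ℝ^(m+1)` -/

section Join

variable {m : ℕ}

@[simp] theorem front_join (a : E m) (s : ℝ) : front (join a s) = a := by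
  ext i; simp [front, join]

@[simp] theorem height_join (a : E m) (s : ℝ) : height (join a s) = s := by
  simp [height, join]

@[simp] theorem join_front_height (V : E (m + 1)) : join (front V) (height V) = V := by
  ext i
  refine Fin.lastCases ?_ (fun j => ?_) i <;> simp [join, front, height]

theorem join_smul (c : ℝ) (a : E m) (s : ℝ) : join (c • a) (c * s) = c • join a s := by
  ext i
  refine Fin.lastCases ?_ (fun j => ?_) i <;> simp [join]

/-- `join` as a continuous linear equivalence. -/
def joinL (m : ℕ) : (E m × ℝ) ≃L[ℝ] E (m + 1) :=
  LinearEquiv.toContinuousLinearEquiv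
    { toFun := fun p => join p.1 p.2
      invFun := fun V => (front V, height V)
      map_add' := fun p q => join_add _ _ _ _
      map_smul' := fun c p => join_smul c p.1 p.2
      left_inv := fun p => by simp
      right_inv := fun V => by simp }

@[simp] theorem joinL_apply (p : E m × ℝ) : joinL m p = join p.1 p.2 := rfl

/-- `front` as a continuous linear map. -/
def frontL (m : ℕ) : E (m + 1) →L[ℝ] E m :=
  (ContinuousLinearMap.fst ℝ (E m) ℝ).comp (joinL m).symm.toContinuousLinearMap

/-- `height` as a continuous linear map. -/
def heightL (m : ℕ) : E (m + 1) →L[ℝ] ℝ :=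
  (ContinuousLinearMap.snd ℝ (E m) ℝ).comp (joinL m).symm.toContinuousLinearMap

theorem frontL_apply (V : E (m + 1)) : frontL m V = front V := rfl

theorem heightL_apply (V : E (m + 1)) : heightL m V = height V := rfl

@[simp] theorem front_add (V W : E (m + 1)) : front (V + W) = front V + front W := rfl
@[simp] theorem front_sub (V W : E (m + 1)) : front (V - W) = front V - front W := rfl
@[simp] theorem front_smul (c : ℝ) (V : E (m + 1)) : front (c • V) = c • front V := rfl
@[simp] theorem front_zero : front (0 : E (m + 1)) = 0 := rfl
@[simp] theorem height_add (V W : E (m + 1)) : height (V + W) = height V + height W := rfl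
@[simp] theorem height_sub (V W : E (m + 1)) : height (V - W) = height V - height W := rfl
@[simp] theorem height_smul (c : ℝ) (V : E (m + 1)) : height (c • V) = c * height V := rfl
@[simp] theorem height_zero : height (0 : E (m + 1)) = 0 := rfl

@[fun_prop] theorem contDiff_front {k : WithTop ℕ∞} : ContDiff ℝ k (front (m := m)) :=
  (frontL m).contDiff

@[fun_prop] theorem contDiff_height {k : WithTop ℕ∞} : ContDiff ℝ k (height (m := m)) :=
  (heightL m).contDiff

theorem contDiff_join {k : WithTop ℕ∞} : ContDiff ℝ k (fun p : E m × ℝ => join p.1 p.2) :=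
  (joinL m).contDiff

@[fun_prop] theorem continuous_front : Continuous (front (m := m)) := (frontL m).continuous
@[fun_prop] theorem continuous_height : Continuous (height (m := m)) := (heightL m).continuous

@[fun_prop] theorem continuous_join {Y : Type*} [TopologicalSpace Y] {f : Y → E m} {g : Y → ℝ}
    (hf : Continuous f) (hg : Continuous g) : Continuous fun y => join (f y) (g y) :=
  (joinL m).continuous.comp (hf.prodMk hg)

theorem inner_eq_front_height (V W : E (m + 1)) :
    ⟪V, W⟫ = ⟪front V, front W⟫ + height V * height W := by
  simp only [PiLp.inner_apply, Fin.sum_univ_castSucc, front, height]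
  simp [mul_comm]

theorem norm_sq_eq_front_height (V : E (m + 1)) : ‖V‖ ^ 2 = ‖front V‖ ^ 2 + height V ^ 2 := by
  rw [← real_inner_self_eq_norm_sq, inner_eq_front_height, real_inner_self_eq_norm_sq,
    sq (height V)]

theorem norm_join_le (a : E m) (s : ℝ) : ‖join a s‖ ≤ ‖a‖ + |s| := by
  have h : ‖join a s‖ ^ 2 ≤ (‖a‖ + |s|) ^ 2 := by
    rw [norm_sq_eq_front_height, front_join, height_join, ← sq_abs s]
    nlinarith [norm_nonneg a, abs_nonneg s]
  exact (abs_le_of_sq_le_sq' h (by positivity)).2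

theorem norm_front_le (V : E (m + 1)) : ‖front V‖ ≤ ‖V‖ := by
  have h : ‖front V‖ ^ 2 ≤ ‖V‖ ^ 2 := by
    rw [norm_sq_eq_front_height V]; nlinarith [sq_nonneg (height V)]
  exact (abs_le_of_sq_le_sq' h (norm_nonneg _)).2

theorem abs_height_le (V : E (m + 1)) : |height V| ≤ ‖V‖ := by
  have h : |height V| ^ 2 ≤ ‖V‖ ^ 2 := by
    rw [norm_sq_eq_front_height V, sq_abs]; nlinarith [sq_nonneg ‖front V‖]
  exact (abs_le_of_sq_le_sq' h (norm_nonneg _)).2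

theorem norm_le_norm_join (a : E m) (s : ℝ) : ‖a‖ ≤ ‖join a s‖ := by
  simpa using norm_front_le (join a s)

theorem abs_le_norm_join (a : E m) (s : ℝ) : |s| ≤ ‖join a s‖ := by
  simpa using abs_height_le (join a s)

end Join

/-- Second order Taylor estimate on a convex set. -/
theorem exists_taylor_bound {V W : Type*} [NormedAddCommGroup V] [NormedSpace ℝ V]
    [NormedAddCommGroup W] [NormedSpace ℝ W] {f : V → W} {S : Set V} {a₀ : V} (hS : Convex ℝ S)
    (hSu : UniqueDiffOn ℝ S) (ha₀ : a₀ ∈ S) (hf : ContDiffWithinAt ℝ ∞ f S a₀) :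
    ∃ C δ : ℝ, 0 ≤ C ∧ 0 < δ ∧ ∀ a ∈ S ∩ Metric.ball a₀ δ, ∀ a' ∈ S ∩ Metric.ball a₀ δ,
      ‖f a' - f a - fderivWithin ℝ f S a (a' - a)‖ ≤ C * ‖a' - a‖ ^ 2 := by
  have hf2 : ContDiffWithinAt ℝ 2 f S a₀ :=
    hf.of_le (by norm_cast)
  have hd : ContDiffWithinAt ℝ 1 (fderivWithin ℝ f S) S a₀ :=
    hf2.fderivWithin_right (m := 1) hSu (by norm_num) ha₀
  obtain ⟨K, t, ht, hK⟩ := hd.exists_lipschitzOnWith hS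
  have hdiff : ∀ᶠ a in 𝓝[S] a₀, DifferentiableWithinAt ℝ f S a := by
    have h1 := (hf.of_le (m := 1) (by exact_mod_cast le_top)).eventually (by simp)
    rw [insert_eq_of_mem ha₀] at h1
    filter_upwards [h1] with a ha
    exact ha.differentiableWithinAt (by simp)
  obtain ⟨δ, hδ, hb⟩ := Metric.mem_nhdsWithin_iff.1 (inter_mem ht hdiff)
  refine ⟨K, δ, K.2, hδ, ?_⟩
  rintro a ⟨haS, haB⟩ a' ⟨haS', haB'⟩
  have hsub : segment ℝ a a' ⊆ S ∩ Metric.ball a₀ δ :=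
    (hS.inter (convex_ball a₀ δ)).segment_subset ⟨haS, haB⟩ ⟨haS', haB'⟩
  have hmem : ∀ z ∈ segment ℝ a a', z ∈ t ∧ DifferentiableWithinAt ℝ f S z := fun z hz =>
    hb ⟨(hsub hz).2, (hsub hz).1⟩
  have h := (convex_segment a a').norm_image_sub_le_of_norm_hasFDerivWithin_le'
    (f := f) (f' := fderivWithin ℝ f S) (φ := fderivWithin ℝ f S a) (C := K * ‖a' - a‖)
    (fun z hz => (hmem z hz).2.hasFDerivWithinAt.mono (hsub.trans inter_subset_left))
    (fun z hz => by
      refine ((hK.norm_sub_le (hmem z hz).1 (hmem a (left_mem_segment ℝ a a')).1)).trans ?_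
      exact mul_le_mul_of_nonneg_left (norm_sub_le_of_mem_segment hz) K.2)
    (left_mem_segment ℝ a a') (right_mem_segment ℝ a a')
  calc _ ≤ K * ‖a' - a‖ * ‖a' - a‖ := h
    _ = K * ‖a' - a‖ ^ 2 := by ring

namespace BoundaryEmbedding

variable {n m : ℕ} [NeZero n] {X : Type*} [TopologicalSpace X]
  [ChartedSpace (EuclideanHalfSpace n) X] (D : BoundaryEmbedding n m X)

/-! ### The embedding in a chart -/

/-- `emb` in the preferred chart at `x₀`. -/
def embC (x₀ : X) : E n → E m := D.emb ∘ (extChartAt (𝓡∂ n) x₀).symm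

/-- `rho` in the preferred chart at `x₀`. -/
def rhoC (x₀ : X) : E n → ℝ := D.rho ∘ (extChartAt (𝓡∂ n) x₀).symm

theorem contMDiff_emb : ContMDiff (𝓡∂ n) (𝓡 m) ∞ D.emb := D.isSmoothEmbedding.isImmersion.contMDiff

theorem continuous_emb : Continuous D.emb := D.contMDiff_emb.continuous

theorem continuous_rho : Continuous D.rho := D.contMDiff_rho.continuous

theorem injective_emb : Function.Injective D.emb := D.isSmoothEmbedding.isEmbedding.injective

theorem mdiff_emb (x : X) : MDifferentiableAt (𝓡∂ n) (𝓡 m) D.emb x :=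
  D.contMDiff_emb.mdifferentiable (by simp) x

theorem mdiff_rho (x : X) : MDifferentiableAt (𝓡∂ n) 𝓘(ℝ, ℝ) D.rho x :=
  D.contMDiff_rho.mdifferentiable (by simp) x

variable {D} in
theorem mem_boundary {x : X} (h : D.rho x = 0) : x ∈ (𝓡∂ n).boundary X :=
  (D.rho_eq_zero_iff x).1 h

theorem rho_pos_iff {x : X} : 0 < D.rho x ↔ x ∉ (𝓡∂ n).boundary X := by
  rw [← D.rho_eq_zero_iff, (D.rho_nonneg x).lt_iff_ne, ne_comm]

theorem mfderiv_incl (x : X) (ξ : E n) :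
    (mfderiv (𝓡∂ n) (𝓡 (m + 1)) D.incl x : E n →L[ℝ] E (m + 1)) ξ
      = join (D.dEmb x ξ) (D.dRho x ξ) := by
  have h1 : HasMFDerivAt (𝓡∂ n) 𝓘(ℝ, E m × ℝ) (fun x => (D.emb x, D.rho x)) x
      ((D.dEmb x).prod (D.dRho x)) :=
    ⟨(D.mdiff_emb x).continuousAt.prodMk (D.mdiff_rho x).continuousAt,
      (D.mdiff_emb x).hasMFDerivAt.2.prodMk (D.mdiff_rho x).hasMFDerivAt.2⟩
  have h2 : HasMFDerivAt 𝓘(ℝ, E m × ℝ) (𝓡 (m + 1)) (joinL m) (D.emb x, D.rho x)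
      (joinL m : E m × ℝ →L[ℝ] E (m + 1)) := (joinL m).hasMFDerivAt
  have h3 := (h2.comp x h1).mfderiv
  have h4 := congrArg (fun L : E n →L[ℝ] E (m + 1) => L ξ) h3
  exact h4

variable [IsManifold (𝓡∂ n) ∞ X]

omit [IsManifold (𝓡∂ n) ∞ X] in
/-- In suitable charts an immersion is an injective linear map. -/
theorem exists_linear_in_charts (x : X) :
    ∃ (e : OpenPartialHomeomorph X (EuclideanHalfSpace n)) (e' : OpenPartialHomeomorph (E m) (E m))
      (L : E n →L[ℝ] E m), x ∈ e.source ∧ D.emb x ∈ e'.source ∧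
      e ∈ IsManifold.maximalAtlas (𝓡∂ n) 1 X ∧ e' ∈ IsManifold.maximalAtlas (𝓡 m) 1 (E m) ∧
      Function.Injective L ∧ ∀ y ∈ e.source, e' (D.emb y) = L ((𝓡∂ n) (e y)) := by
  obtain ⟨F, _, _, h⟩ := D.isSmoothEmbedding.isImmersion.isImmersionAt x
  have h1 : (1 : WithTop ℕ∞) ≤ ∞ := by simp
  refine ⟨h.domChart, h.codChart, (h.equiv : E n × F →L[ℝ] E m).comp (.inl ℝ (E n) F),
    h.mem_domChart_source, h.mem_codChart_source,
    IsManifold.maximalAtlas_subset_of_le h1 h.domChart_mem_maximalAtlas,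
    IsManifold.maximalAtlas_subset_of_le h1 h.codChart_mem_maximalAtlas, ?_, ?_⟩
  · intro a b hab
    exact congrArg Prod.fst (h.equiv.injective hab)
  · intro y hy
    have hy' : y ∈ (h.domChart.extend (𝓡∂ n)).source := by
      rw [OpenPartialHomeomorph.extend_source]
      exact hy
    have h1 := h.writtenInCharts ((h.domChart.extend (𝓡∂ n)).map_source hy')
    simp only [Function.comp_apply] at h1
    rw [h.domChart.extend_left_inv hy] at h1
    simp only [OpenPartialHomeomorph.extend_coe, Function.comp_apply, modelWithCornersSelf_coe,
      id_eq] at h1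
    rw [h1]
    rfl

omit [IsManifold (𝓡∂ n) ∞ X] in
theorem injective_dEmb (x : X) : Function.Injective (D.dEmb x) := by
  obtain ⟨e, e', L, hx, hx', he, he', hL, heq⟩ := D.exists_linear_in_charts x
  have hmd : e.MDifferentiable (𝓡∂ n) (𝓡∂ n) :=
    ⟨fun y hy => (mdifferentiableAt_of_mem_maximalAtlas he hy).mdifferentiableWithinAt,
      fun y hy => (mdifferentiableAt_symm_of_mem_maximalAtlas he hy).mdifferentiableWithinAt⟩
  have hdom : HasMFDerivAt (𝓡∂ n) (𝓡∂ n) e x _ := (hmd.mdifferentiableAt hx).hasMFDerivAt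
  have hI : HasMFDerivAt (𝓡∂ n) 𝓘(ℝ, E n) (𝓡∂ n) (e x) _ := (𝓡∂ n).hasMFDerivAt
  have hR := (L.hasMFDerivAt (x := (𝓡∂ n) (e x))).comp x (hI.comp x hdom)
  have hcod : MDifferentiableAt (𝓡 m) (𝓡 m) e' (D.emb x) :=
    mdifferentiableAt_of_mem_maximalAtlas he' hx'
  have hLft := hcod.hasMFDerivAt.comp x (D.mdiff_emb x).hasMFDerivAt
  have heq' : (e' ∘ D.emb) =ᶠ[𝓝 x] (L ∘ ((𝓡∂ n) ∘ e)) := by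
    filter_upwards [e.open_source.mem_nhds hx] with y hy
    exact heq y hy
  have huniq := hasMFDerivAt_unique hLft (hR.congr_of_eventuallyEq heq')
  intro ξ η hξ
  apply hmd.mfderiv_injective hx
  apply hL
  have e1 := congrArg (fun L : E n →L[ℝ] E m => L ξ) huniq
  have e2 := congrArg (fun L : E n →L[ℝ] E m => L η) huniq
  refine e1.symm.trans (Eq.trans ?_ e2)
  exact congrArg (mfderiv (𝓡 m) (𝓡 m) e' (D.emb x) : E m →L[ℝ] E m) hξ

theorem contDiffOn_embC (x₀ : X) : ContDiffOn ℝ ∞ (D.embC x₀) (extChartAt (𝓡∂ n) x₀).target :=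
  contMDiffOn_iff_contDiffOn.1
    (D.contMDiff_emb.comp_contMDiffOn (contMDiffOn_extChartAt_symm x₀))

theorem contDiffOn_rhoC (x₀ : X) : ContDiffOn ℝ ∞ (D.rhoC x₀) (extChartAt (𝓡∂ n) x₀).target :=
  contMDiffOn_iff_contDiffOn.1
    (D.contMDiff_rho.comp_contMDiffOn (contMDiffOn_extChartAt_symm x₀))

theorem contDiffWithinAt_embC {x₀ : X} {a : E n} (ha : a ∈ (extChartAt (𝓡∂ n) x₀).target) :
    ContDiffWithinAt ℝ ∞ (D.embC x₀) (range (𝓡∂ n)) a :=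
  (D.contDiffOn_embC x₀ a ha).mono_of_mem_nhdsWithin (extChartAt_target_mem_nhdsWithin_of_mem ha)

theorem contDiffWithinAt_rhoC {x₀ : X} {a : E n} (ha : a ∈ (extChartAt (𝓡∂ n) x₀).target) :
    ContDiffWithinAt ℝ ∞ (D.rhoC x₀) (range (𝓡∂ n)) a :=
  (D.contDiffOn_rhoC x₀ a ha).mono_of_mem_nhdsWithin (extChartAt_target_mem_nhdsWithin_of_mem ha)

/-- The differential of `emb` in the preferred chart at `x₀`. -/
def dEmbC (x₀ : X) (a : E n) : E n →L[ℝ] E m := fderivWithin ℝ (D.embC x₀) (range (𝓡∂ n)) a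

/-- The differential of `rho` in the preferred chart at `x₀`. -/
def dRhoC (x₀ : X) (a : E n) : E n →L[ℝ] ℝ := fderivWithin ℝ (D.rhoC x₀) (range (𝓡∂ n)) a

/-- The differentials in the chart at `x₀` and in the preferred chart at a nearby point differ by
the change of coordinates. -/
theorem exists_coordChange {x₀ y : X} (hy : y ∈ (extChartAt (𝓡∂ n) x₀).source) :
    ∃ A : E n ≃L[ℝ] E n,
      (∀ ξ, D.dEmb y (A ξ) = D.dEmbC x₀ (extChartAt (𝓡∂ n) x₀ y) ξ) ∧
      ∀ ξ, D.dRho y (A ξ) = D.dRhoC x₀ (extChartAt (𝓡∂ n) x₀ y) ξ := by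
  set φ := extChartAt (𝓡∂ n) x₀ with hφ
  have hty : φ y ∈ φ.target := φ.map_source hy
  have hr : φ y ∈ range (𝓡∂ n) := extChartAt_target_subset_range x₀ hty
  have hyy : φ.symm (φ y) = y := φ.left_inv hy
  have hinv := isInvertible_mfderivWithin_extChartAt_symm (I := 𝓡∂ n) (x := x₀) hty
  have hmd : MDifferentiableWithinAt 𝓘(ℝ, E n) (𝓡∂ n) φ.symm (range (𝓡∂ n)) (φ y) :=
    mdifferentiableWithinAt_extChartAt_symm hty
  have hu : UniqueMDiffWithinAt 𝓘(ℝ, E n) (range (𝓡∂ n)) (φ y) :=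
    (𝓡∂ n).uniqueMDiffOn _ hr
  rw [hyy] at hinv
  obtain ⟨A, hA⟩ := hinv
  refine ⟨A, fun ξ => ?_, fun ξ => ?_⟩
  · have h1 := mfderiv_comp_mfderivWithin_of_eq (g := D.emb) (D.mdiff_emb y) hmd hu hyy
    rw [mfderivWithin_eq_fderivWithin] at h1
    have h2 := congrArg (fun L : E n →L[ℝ] E m => L ξ) h1
    have h3 := congrArg (fun L : E n →L[ℝ] E n => D.dEmb y (L ξ)) hA
    exact h3.trans h2.symm
  · have h1 := mfderiv_comp_mfderivWithin_of_eq (g := D.rho) (D.mdiff_rho y) hmd hu hyy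
    rw [mfderivWithin_eq_fderivWithin] at h1
    have h2 := congrArg (fun L : E n →L[ℝ] ℝ => L ξ) h1
    have h3 := congrArg (fun L : E n →L[ℝ] E n => D.dRho y (L ξ)) hA
    exact h3.trans h2.symm

end BoundaryEmbedding

/-- The map `(V', s) ↦ (V', c s)`. -/
def scale {m : ℕ} (c : ℝ) (V : E (m + 1)) : E (m + 1) := join (front V) (c * height V)

section Scale

variable {m : ℕ}

@[simp] theorem front_scale (c : ℝ) (V : E (m + 1)) : front (scale c V) = front V := by
  simp [scale]

@[simp] theorem height_scale (c : ℝ) (V : E (m + 1)) : height (scale c V) = c * height V := by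
  simp [scale]

theorem scale_add (c : ℝ) (V W : E (m + 1)) : scale c (V + W) = scale c V + scale c W := by
  simp only [scale, front_add, height_add, mul_add, join_add]

theorem scale_smul (c a : ℝ) (V : E (m + 1)) : scale c (a • V) = a • scale c V := by
  simp only [scale, front_smul, height_smul, ← join_smul]
  ring_nf

theorem scale_sub (c : ℝ) (V W : E (m + 1)) : scale c (V - W) = scale c V - scale c W := by
  rw [eq_sub_iff_add_eq, ← scale_add, sub_add_cancel]

/-- `scale c` as a continuous linear map. -/
def scaleL (m : ℕ) (c : ℝ) : E (m + 1) →L[ℝ] E (m + 1) :=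
  (joinL m).toContinuousLinearMap.comp ((frontL m).prod (c • heightL m))

theorem scaleL_apply (c : ℝ) (V : E (m + 1)) : scaleL m c V = scale c V := rfl

theorem contDiff_scale {k : WithTop ℕ∞} :
    ContDiff ℝ k (fun p : ℝ × E (m + 1) => scale p.1 p.2) :=
  contDiff_join.comp (((contDiff_front).comp contDiff_snd).prodMk
    (contDiff_fst.mul ((contDiff_height).comp contDiff_snd)))

theorem contDiff_scaleL {k : WithTop ℕ∞} : ContDiff ℝ k (scaleL m) := by
  have h : scaleL m = fun c =>
      (joinL m).toContinuousLinearMap.comp ((frontL m).prod (0 : E (m + 1) →L[ℝ] ℝ)) +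
        c • (joinL m).toContinuousLinearMap.comp
          ((0 : E (m + 1) →L[ℝ] E m).prod (heightL m)) := by
    funext c
    ext1 V
    simp only [scaleL_apply, scale, add_apply, smul_apply,
      ContinuousLinearMap.comp_apply, ContinuousLinearMap.prod_apply,
      ContinuousLinearEquiv.coe_coe, joinL_apply, zero_apply, frontL_apply,
      heightL_apply, ← join_smul, ← join_add]
    simp
  rw [h]
  fun_prop

@[fun_prop] theorem continuous_scale {Y : Type*} [TopologicalSpace Y] {f : Y → ℝ}
    {g : Y → E (m + 1)} (hf : Continuous f) (hg : Continuous g) :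
    Continuous fun y => scale (f y) (g y) :=
  (contDiff_scale (k := 0)).continuous.comp (hf.prodMk hg)

end Scale

theorem contDiff_clm_prod {V W W' : Type*} [NormedAddCommGroup V] [NormedSpace ℝ V]
    [NormedAddCommGroup W] [NormedSpace ℝ W] [NormedAddCommGroup W'] [NormedSpace ℝ W']
    {k : WithTop ℕ∞} :
    ContDiff ℝ k (fun p : (V →L[ℝ] W) × (V →L[ℝ] W') => p.1.prod p.2) := by
  have h : (fun p : (V →L[ℝ] W) × (V →L[ℝ] W') => p.1.prod p.2) = fun p =>
      (ContinuousLinearMap.inl ℝ W W').comp p.1 + (ContinuousLinearMap.inr ℝ W W').comp p.2 := by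
    funext p
    ext <;> simp
  rw [h]
  exact (contDiff_const.clm_comp contDiff_fst).add (contDiff_const.clm_comp contDiff_snd)

namespace BoundaryEmbedding

variable {n m : ℕ} [NeZero n] {X : Type*} [TopologicalSpace X]
  [ChartedSpace (EuclideanHalfSpace n) X] (D : BoundaryEmbedding n m X)

/-! ### Normal vectors of the Lie algebroid -/

/-- The vectors of `ℝ^(m+1)` orthogonal to the image of the Lie algebroid fibre at `x` under
`A(h)`. At an interior point this is the Euclidean normal space of the embedding `(emb, log rho)`;
at a boundary point it is the normal space of `emb : ∂X → ℝ^m`. -/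
def IsNrm (x : X) (v : E (m + 1)) : Prop :=
  ∀ ξ α, D.dRho x ξ = D.rho x * α → ⟪v, join (D.dEmb x ξ) α⟫ = 0

theorem mem_tangentImage {x : X} {V : E (m + 1)} :
    V ∈ D.tangentImage x ↔ ∃ ξ : E n, join (D.dEmb x ξ) (D.dRho x ξ) = V := by
  constructor
  · rintro ⟨ξ, hξ⟩
    exact ⟨ξ, (D.mfderiv_incl x ξ).symm.trans hξ⟩
  · rintro ⟨ξ, hξ⟩
    exact ⟨ξ, (D.mfderiv_incl x ξ).trans hξ⟩

/-- The image of the Lie algebroid has codimension one in the pairs `(v, α)`, also where `ρ`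
vanishes. -/
theorem exists_transverse (x : X) : ∃ (ν : E n) (κ : ℝ), 0 < D.dRho x ν - D.rho x * κ := by
  by_cases h : D.rho x = 0
  · have h1 : D.dRho x ≠ 0 := D.mfderiv_rho_ne_zero x (mem_boundary h)
    obtain ⟨ν, hν⟩ : ∃ ν, D.dRho x ν ≠ 0 := by
      by_contra hcon
      push Not at hcon
      exact h1 (ContinuousLinearMap.ext hcon)
    rcases lt_or_gt_of_ne hν with h2 | h2
    · exact ⟨-ν, 0, by rw [map_neg]; linarith⟩
    · exact ⟨ν, 0, by linarith⟩
  · exact ⟨0, -1, by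
      have := lt_of_le_of_ne (D.rho_nonneg x) (Ne.symm h)
      simpa using this⟩

/-- A vector of the algebroid normal space whose rescaling is tangent to `X` vanishes. -/
theorem IsNrm.eq_zero_of_scale_mem {D : BoundaryEmbedding n m X} {x : X} {c : E (m + 1)}
    (hc : D.IsNrm x c) (h : scale (D.rho x) c ∈ D.tangentImage x) : c = 0 := by
  obtain ⟨η, hη⟩ := D.mem_tangentImage.1 h
  have h1 : D.dEmb x η = front c := by simpa using congrArg front hη
  have h2 : D.dRho x η = D.rho x * height c := by simpa using congrArg height hη
  have h3 := hc η (height c) h2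
  rw [h1, join_front_height] at h3
  exact inner_self_eq_zero.1 h3

theorem IsNrm.sub {D : BoundaryEmbedding n m X} {x : X} {c c' : E (m + 1)}
    (hc : D.IsNrm x c) (hc' : D.IsNrm x c') : D.IsNrm x (c - c') := fun ξ α h => by
  rw [inner_sub_left, hc ξ α h, hc' ξ α h, sub_zero]

theorem IsNrm.add {D : BoundaryEmbedding n m X} {x : X} {c c' : E (m + 1)}
    (hc : D.IsNrm x c) (hc' : D.IsNrm x c') : D.IsNrm x (c + c') := fun ξ α h => by
  rw [inner_add_left, hc ξ α h, hc' ξ α h, add_zero]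

theorem IsNrm.smul {D : BoundaryEmbedding n m X} {x : X} {c : E (m + 1)}
    (hc : D.IsNrm x c) (a : ℝ) : D.IsNrm x (a • c) := fun ξ α h => by
  rw [inner_smul_left, hc ξ α h, mul_zero]

theorem isNrm_zero (x : X) : D.IsNrm x 0 := fun _ _ _ => inner_zero_left _

/-- Over the boundary the isotropy `(0, α)` lies in the algebroid, so normal vectors are
horizontal. -/
theorem IsNrm.height_eq_zero {D : BoundaryEmbedding n m X} {x : X} {c : E (m + 1)}
    (hc : D.IsNrm x c) (h : D.rho x = 0) : height c = 0 := by
  have := hc 0 1 (by simp [h])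
  rw [inner_eq_front_height] at this
  simpa using this

/-- A class in the normal space has at most one normal representative. -/
theorem IsNrm.unique {D : BoundaryEmbedding n m X} {x : X} {c c' W : E (m + 1)}
    (hc : D.IsNrm x c) (hc' : D.IsNrm x c') (h : scale (D.rho x) c - W ∈ D.tangentImage x)
    (h' : scale (D.rho x) c' - W ∈ D.tangentImage x) : c = c' := by
  refine sub_eq_zero.1 ((hc.sub hc').eq_zero_of_scale_mem ?_)
  rw [scale_sub, ← sub_sub_sub_cancel_right _ _ W]
  exact Submodule.sub_mem _ h h'

variable [IsManifold (𝓡∂ n) ∞ X]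

/-- The differential of `incl` in the chart at `x₀`. -/
def dInclC (x₀ : X) (a : E n) : E n →L[ℝ] E (m + 1) :=
  (joinL m).toContinuousLinearMap.comp ((D.dEmbC x₀ a).prod (D.dRhoC x₀ a))

/-- The linear system `scale² ξ + di η = W`, `diᵀ ξ = λ` in the chart at `x₀`. For `λ = 0` its
solution `ξ` is a conormal vector of `X` and `scale ξ` is the algebroid normal vector which
represents the class of `W` in the normal space. -/
def saddle (x₀ : X) (a : E n) : (E (m + 1) × E n) →L[ℝ] (E (m + 1) × (E n →L[ℝ] ℝ)) :=
  (((scaleL m (D.rhoC x₀ a)).comp (scaleL m (D.rhoC x₀ a))).comp (.fst ℝ _ _) +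
      (D.dInclC x₀ a).comp (.snd ℝ _ _)).prod
    ((((ContinuousLinearMap.compL ℝ (E n) (E (m + 1)) ℝ).flip (D.dInclC x₀ a)).comp
      (innerSL ℝ)).comp (.fst ℝ _ _))

omit [IsManifold (𝓡∂ n) ∞ X] in
theorem saddle_apply (x₀ : X) (a : E n) (ξ : E (m + 1)) (η : E n) :
    D.saddle x₀ a (ξ, η) = (scale (D.rhoC x₀ a) (scale (D.rhoC x₀ a) ξ) + D.dInclC x₀ a η,
      (innerSL ℝ ξ).comp (D.dInclC x₀ a)) := rfl

omit [IsManifold (𝓡∂ n) ∞ X] in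
theorem rhoC_apply {x₀ y : X} (hy : y ∈ (extChartAt (𝓡∂ n) x₀).source) :
    D.rhoC x₀ (extChartAt (𝓡∂ n) x₀ y) = D.rho y :=
  congrArg D.rho ((extChartAt (𝓡∂ n) x₀).left_inv hy)

omit [IsManifold (𝓡∂ n) ∞ X] in
theorem embC_apply {x₀ y : X} (hy : y ∈ (extChartAt (𝓡∂ n) x₀).source) :
    D.embC x₀ (extChartAt (𝓡∂ n) x₀ y) = D.emb y :=
  congrArg D.emb ((extChartAt (𝓡∂ n) x₀).left_inv hy)

theorem mem_tangentImage_chart {x₀ y : X} (hy : y ∈ (extChartAt (𝓡∂ n) x₀).source)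
    {V : E (m + 1)} :
    V ∈ D.tangentImage y ↔ ∃ ξ, D.dInclC x₀ (extChartAt (𝓡∂ n) x₀ y) ξ = V := by
  obtain ⟨A, h1, h2⟩ := D.exists_coordChange hy
  rw [mem_tangentImage,
    A.surjective.exists (p := fun ξ => join (D.dEmb y ξ) (D.dRho y ξ) = V)]
  exact exists_congr fun ξ => by
    rw [h1, h2]
    rfl

theorem isNrm_chart {x₀ y : X} (hy : y ∈ (extChartAt (𝓡∂ n) x₀).source) {v : E (m + 1)} :
    D.IsNrm y v ↔ ∀ ξ α, D.dRhoC x₀ (extChartAt (𝓡∂ n) x₀ y) ξ = D.rho y * α →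
      ⟪v, join (D.dEmbC x₀ (extChartAt (𝓡∂ n) x₀ y) ξ) α⟫ = 0 := by
  obtain ⟨A, h1, h2⟩ := D.exists_coordChange hy
  rw [IsNrm, A.surjective.forall
    (p := fun ξ => ∀ α, D.dRho y ξ = D.rho y * α → ⟪v, join (D.dEmb y ξ) α⟫ = 0)]
  exact forall_congr' fun ξ => by rw [h1, h2]

theorem injective_dEmbC {x₀ y : X} (hy : y ∈ (extChartAt (𝓡∂ n) x₀).source) :
    Function.Injective (D.dEmbC x₀ (extChartAt (𝓡∂ n) x₀ y)) := by
  obtain ⟨A, h1, -⟩ := D.exists_coordChange hy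
  intro ξ η h
  rw [← h1, ← h1] at h
  exact A.injective (D.injective_dEmb y h)

/-- The saddle point system is injective by orthogonality, hence invertible by dimension. It stays
invertible at the boundary, where the rescaling by `ρ` degenerates. -/
theorem saddle_isInvertible {x₀ y : X} (hy : y ∈ (extChartAt (𝓡∂ n) x₀).source) :
    (D.saddle x₀ (extChartAt (𝓡∂ n) x₀ y)).IsInvertible := by
  set a := extChartAt (𝓡∂ n) x₀ y with ha
  have hρ : D.rhoC x₀ a = D.rho y := D.rhoC_apply hy
  have hinj : Function.Injective (D.saddle x₀ a) := by
    rw [injective_iff_map_eq_zero]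
    rintro ⟨ξ, η⟩ h
    have h' : D.saddle x₀ a (ξ, η) = 0 := h
    rw [saddle_apply, Prod.mk_eq_zero, hρ] at h'
    obtain ⟨h1, h2⟩ := h'
    have h2' : ∀ ζ, ⟪ξ, D.dInclC x₀ a ζ⟫ = 0 := fun ζ => by
      have := congrArg (fun L : E n →L[ℝ] ℝ => L ζ) h2
      simpa using this
    have h3 : ⟪ξ, scale (D.rho y) (scale (D.rho y) ξ)⟫ = 0 := by
      have := congrArg (fun V => ⟪ξ, V⟫) h1
      simp only [inner_add_right, h2', add_zero, inner_zero_right] at this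
      exact this
    rw [inner_eq_front_height] at h3
    simp only [front_scale, height_scale, real_inner_self_eq_norm_sq] at h3
    have h4 : height ξ * (D.rho y * (D.rho y * height ξ)) = (D.rho y * height ξ) ^ 2 := by ring
    rw [h4] at h3
    have h5 : ‖front ξ‖ ^ 2 = 0 := by
      nlinarith [sq_nonneg ‖front ξ‖, sq_nonneg (D.rho y * height ξ)]
    have h6 : (D.rho y * height ξ) ^ 2 = 0 := by linarith
    have h7 : front ξ = 0 := norm_eq_zero.1 (pow_eq_zero_iff (two_ne_zero) |>.1 h5)
    have h8 : D.rho y * height ξ = 0 := pow_eq_zero_iff (two_ne_zero) |>.1 h6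
    have h9 : height ξ = 0 := by
      rcases mul_eq_zero.1 h8 with h | h
      · obtain ⟨ν, κ, hν⟩ := D.exists_transverse y
        obtain ⟨A, -, hA⟩ := D.exists_coordChange hy
        obtain ⟨ν', rfl⟩ := A.surjective ν
        have h10 := h2' ν'
        rw [inner_eq_front_height, h7] at h10
        have h11 : height (D.dInclC x₀ a ν') = D.dRho y (A ν') := by
          rw [hA ν']; exact height_join _ _
        rw [h11, inner_zero_left, zero_add] at h10
        rw [h, zero_mul, sub_zero] at hν
        exact (mul_eq_zero.1 h10).resolve_right hν.ne'
      · exact h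
    have hξ : ξ = 0 := by rw [← join_front_height ξ, h7, h9, join_zero]
    subst hξ
    have h12 : D.dInclC x₀ a η = 0 := by
      have e : scale (D.rho y) (scale (D.rho y) (0 : E (m + 1))) = 0 := by simp [scale, join_zero]
      rwa [e, zero_add] at h1
    have h13 : D.dEmbC x₀ a η = 0 := by
      have := congrArg front h12
      rw [front_zero] at this
      exact (front_join _ _).symm.trans this
    have h14 : η = 0 := D.injective_dEmbC hy (by rw [← ha, h13, map_zero])
    rw [h14]
    rfl
  have hdim : Module.finrank ℝ (E (m + 1) × E n)
      = Module.finrank ℝ (E (m + 1) × (E n →L[ℝ] ℝ)) := by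
    rw [Module.finrank_prod, Module.finrank_prod,
      ← (LinearMap.toContinuousLinearMap (𝕜 := ℝ) (E := E n) (F' := ℝ)).finrank_eq]
    congr 1
    exact (Subspace.dual_finrank_eq (K := ℝ) (V := E n)).symm
  let e := LinearEquiv.ofInjectiveOfFinrankEq (D.saddle x₀ a).toLinearMap hinj hdim
  exact ⟨e.toContinuousLinearEquiv, ContinuousLinearMap.ext fun _ => rfl⟩

/-- The algebroid normal vector representing `W` in the normal space, computed in a chart. -/
def nrmC (x₀ : X) (a : E n) (W : E (m + 1)) : E (m + 1) :=
  scale (D.rhoC x₀ a) (((D.saddle x₀ a).inverse (W, 0)).1)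

theorem nrmC_spec {x₀ y : X} (hy : y ∈ (extChartAt (𝓡∂ n) x₀).source) (W : E (m + 1)) :
    D.IsNrm y (D.nrmC x₀ (extChartAt (𝓡∂ n) x₀ y) W) ∧
      scale (D.rho y) (D.nrmC x₀ (extChartAt (𝓡∂ n) x₀ y) W) - W ∈ D.tangentImage y := by
  set a := extChartAt (𝓡∂ n) x₀ y with ha
  have hρ : D.rhoC x₀ a = D.rho y := D.rhoC_apply hy
  have hinv : (D.saddle x₀ a).IsInvertible := D.saddle_isInvertible hy
  have hsol : D.saddle x₀ a ((D.saddle x₀ a).inverse (W, 0)) = (W, 0) := by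
    obtain ⟨e, he⟩ := hinv
    rw [← he, ContinuousLinearMap.inverse_equiv]
    exact e.apply_symm_apply _
  rw [nrmC]
  generalize (D.saddle x₀ a).inverse (W, 0) = s at hsol
  obtain ⟨ξ, η⟩ := s
  rw [saddle_apply, Prod.mk.injEq, hρ] at hsol
  obtain ⟨h1, h2⟩ := hsol
  rw [hρ]
  have h2' : ∀ ζ, ⟪ξ, D.dInclC x₀ a ζ⟫ = 0 := fun ζ => by
    have := congrArg (fun L : E n →L[ℝ] ℝ => L ζ) h2
    simpa using this
  constructor
  · rw [D.isNrm_chart hy, ← ha]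
    intro ζ α hζ
    have h3 := h2' ζ
    rw [inner_eq_front_height] at h3 ⊢
    have e1 : front (D.dInclC x₀ a ζ) = D.dEmbC x₀ a ζ := front_join _ _
    have e2 : height (D.dInclC x₀ a ζ) = D.dRhoC x₀ a ζ := height_join _ _
    rw [e1, e2, hζ] at h3
    simp only [front_scale, height_scale, front_join, height_join]
    linarith
  · rw [D.mem_tangentImage_chart hy, ← ha]
    refine ⟨-η, ?_⟩
    rw [map_neg, ← h1]
    abel

theorem exists_nrm (x : X) (W : E (m + 1)) :
    ∃ c, D.IsNrm x c ∧ scale (D.rho x) c - W ∈ D.tangentImage x :=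
  ⟨_, D.nrmC_spec (mem_extChartAt_source x) W⟩

/-- The unique vector in the algebroid normal space at `x` whose rescaling represents the class of
`W` in the normal space `N_x(X)`. -/
def nrm (x : X) (W : E (m + 1)) : E (m + 1) := (D.exists_nrm x W).choose

theorem isNrm_nrm (x : X) (W : E (m + 1)) : D.IsNrm x (D.nrm x W) :=
  (D.exists_nrm x W).choose_spec.1

theorem scale_nrm_sub_mem (x : X) (W : E (m + 1)) :
    scale (D.rho x) (D.nrm x W) - W ∈ D.tangentImage x :=
  (D.exists_nrm x W).choose_spec.2

variable {D} in
theorem nrm_eq {x : X} {W c : E (m + 1)} (hc : D.IsNrm x c)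
    (h : scale (D.rho x) c - W ∈ D.tangentImage x) : D.nrm x W = c :=
  (D.isNrm_nrm x W).unique hc (D.scale_nrm_sub_mem x W) h

theorem nrm_scale_of_isNrm {x : X} {c : E (m + 1)} (hc : D.IsNrm x c) :
    D.nrm x (scale (D.rho x) c) = c := nrm_eq hc (by simp)

theorem nrm_congr {x : X} {W W' : E (m + 1)} (h : W - W' ∈ D.tangentImage x) :
    D.nrm x W = D.nrm x W' := by
  refine nrm_eq (D.isNrm_nrm x W') ?_
  have := Submodule.sub_mem _ (D.scale_nrm_sub_mem x W') h
  rwa [sub_sub, add_sub_cancel] at this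

theorem nrm_add (x : X) (W W' : E (m + 1)) : D.nrm x (W + W') = D.nrm x W + D.nrm x W' := by
  refine nrm_eq ((D.isNrm_nrm x W).add (D.isNrm_nrm x W')) ?_
  rw [scale_add, add_sub_add_comm]
  exact Submodule.add_mem _ (D.scale_nrm_sub_mem x W) (D.scale_nrm_sub_mem x W')

theorem nrm_smul (x : X) (a : ℝ) (W : E (m + 1)) : D.nrm x (a • W) = a • D.nrm x W := by
  refine nrm_eq ((D.isNrm_nrm x W).smul a) ?_
  rw [scale_smul, ← smul_sub]
  exact Submodule.smul_mem _ a (D.scale_nrm_sub_mem x W)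

theorem mem_tangentImage_of_nrm_eq_zero {x : X} {W : E (m + 1)} (h : D.nrm x W = 0) :
    W ∈ D.tangentImage x := by
  have := D.scale_nrm_sub_mem x W
  rw [h] at this
  have e : scale (D.rho x) (0 : E (m + 1)) = 0 := by simp [scale, join_zero]
  rw [e, zero_sub] at this
  exact (Submodule.neg_mem_iff _).1 this

/-- The difference between `V` and its normal component is orthogonal to the normal space. -/
theorem inner_sub_nrm_scale {x : X} {v : E (m + 1)} (hv : D.IsNrm x v) (V : E (m + 1)) :
    ⟪v, V - D.nrm x (scale (D.rho x) V)⟫ = 0 := by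
  have h := D.scale_nrm_sub_mem x (scale (D.rho x) V)
  rw [← scale_sub] at h
  obtain ⟨η, hη⟩ := D.mem_tangentImage.1 h
  have h1 := congrArg front hη
  have h2 := congrArg height hη
  rw [front_join, front_scale] at h1
  rw [height_join, height_scale] at h2
  have h3 := hv η _ h2
  rw [h1, join_front_height, ← neg_sub, inner_neg_right, neg_eq_zero] at h3
  exact h3

theorem contDiffOn_dInclC (x₀ : X) :
    ContDiffOn ℝ ∞ (D.dInclC x₀) (extChartAt (𝓡∂ n) x₀).target := by
  intro a ha
  have hr := extChartAt_target_subset_range x₀ ha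
  have hu := (𝓡∂ n).uniqueDiffOn
  have h1 : ContDiffWithinAt ℝ ∞ (D.dEmbC x₀) (range (𝓡∂ n)) a :=
    (D.contDiffWithinAt_embC ha).fderivWithin_right hu (by simp) hr
  have h2 : ContDiffWithinAt ℝ ∞ (D.dRhoC x₀) (range (𝓡∂ n)) a :=
    (D.contDiffWithinAt_rhoC ha).fderivWithin_right hu (by simp) hr
  have h3 : ContDiffWithinAt ℝ ∞ (fun a => (D.dEmbC x₀ a).prod (D.dRhoC x₀ a)) (range (𝓡∂ n)) a :=
    (contDiff_clm_prod (V := E n) (W := E m) (W' := ℝ)).comp_contDiffWithinAt (h1.prodMk h2)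
  exact (contDiffWithinAt_const.clm_comp h3).mono (extChartAt_target_subset_range x₀)

theorem contDiffOn_saddle (x₀ : X) :
    ContDiffOn ℝ ∞ (D.saddle x₀) (extChartAt (𝓡∂ n) x₀).target := by
  have h1 := D.contDiffOn_dInclC x₀
  have h2 : ContDiffOn ℝ ∞ (fun a => scaleL m (D.rhoC x₀ a)) (extChartAt (𝓡∂ n) x₀).target :=
    contDiff_scaleL.comp_contDiffOn (D.contDiffOn_rhoC x₀)
  have h4 : ContDiffOn ℝ ∞ (fun a => (ContinuousLinearMap.compL ℝ (E n) (E (m + 1)) ℝ).flip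
      (D.dInclC x₀ a)) (extChartAt (𝓡∂ n) x₀).target :=
    contDiffOn_const.clm_apply h1
  exact contDiff_clm_prod.comp_contDiffOn ((((h2.clm_comp h2).clm_comp contDiffOn_const).add
    (h1.clm_comp contDiffOn_const)).prodMk
      ((h4.clm_comp contDiffOn_const).clm_comp contDiffOn_const))

theorem contDiffOn_nrmC (x₀ : X) :
    ContDiffOn ℝ ∞ (fun p : E n × E (m + 1) => D.nrmC x₀ p.1 p.2)
      ((extChartAt (𝓡∂ n) x₀).target ×ˢ univ) := by
  rintro ⟨a, W⟩ ⟨ha, -⟩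
  simp only at ha
  have hfst : ContDiffWithinAt ℝ ∞ (Prod.fst : E n × E (m + 1) → E n)
      ((extChartAt (𝓡∂ n) x₀).target ×ˢ univ) (a, W) := contDiffWithinAt_fst
  have hmaps : MapsTo (Prod.fst : E n × E (m + 1) → E n)
      ((extChartAt (𝓡∂ n) x₀).target ×ˢ univ) (extChartAt (𝓡∂ n) x₀).target := fun p hp => hp.1
  have h1 := (D.contDiffOn_saddle x₀ a ha).comp (a, W) hfst hmaps
  have h2 := (D.contDiffOn_rhoC x₀ a ha).comp (a, W) hfst hmaps
  have hinv : (D.saddle x₀ a).IsInvertible := by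
    have := D.saddle_isInvertible ((extChartAt (𝓡∂ n) x₀).map_target ha)
    rwa [(extChartAt (𝓡∂ n) x₀).right_inv ha] at this
  obtain ⟨e, he⟩ := hinv
  have h3 : ContDiffAt ℝ ∞ ContinuousLinearMap.inverse (D.saddle x₀ a) := by
    rw [← he]
    exact contDiffAt_map_inverse e
  have h4 := ContDiffAt.comp_contDiffWithinAt (a, W) h3 h1
  have h5 := h4.clm_apply (contDiffWithinAt_snd.prodMk (contDiffWithinAt_const (c := 0)))
  exact contDiff_scale.contDiffAt.comp_contDiffWithinAt _ (h2.prodMk h5.fst)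

/-- The normal representative depends smoothly on the vector, as it solves an invertible linear
system with smooth coefficients. -/
theorem contMDiff_nrm : ContMDiff ((𝓡∂ n).prod (𝓡 (m + 1))) (𝓡 (m + 1)) ∞
    (fun p : X × E (m + 1) => D.nrm p.1 p.2) := by
  rintro ⟨x, W⟩
  have hsrc : (extChartAt (𝓡∂ n) x).source ×ˢ (univ : Set (E (m + 1))) ∈ 𝓝 (x, W) :=
    prod_mem_nhds (extChartAt_source_mem_nhds x) univ_mem
  have h1 : ContMDiffWithinAt ((𝓡∂ n).prod (𝓡 (m + 1))) 𝓘(ℝ, E n × E (m + 1)) ∞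
      (fun p : X × E (m + 1) => (extChartAt (𝓡∂ n) x p.1, p.2))
      ((extChartAt (𝓡∂ n) x).source ×ˢ univ) (x, W) :=
    (((contMDiffAt_extChartAt (x := x)).comp (x, W) contMDiffAt_fst).prodMk_space
      contMDiffAt_snd).contMDiffWithinAt
  have h2 := ContDiffWithinAt.comp_contMDiffWithinAt (x := (x, W))
    (D.contDiffOn_nrmC x (extChartAt (𝓡∂ n) x x, W) ⟨mem_extChartAt_target x, mem_univ _⟩) h1
    (fun p hp => mk_mem_prod ((extChartAt (𝓡∂ n) x).map_source hp.1) (mem_univ p.2))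
  refine (h2.contMDiffAt hsrc).congr_of_eventuallyEq ?_
  filter_upwards [hsrc] with p hp
  obtain ⟨h3, h4⟩ := D.nrmC_spec (x₀ := x) (y := p.1) hp.1 p.2
  exact nrm_eq h3 h4

theorem continuous_nrm : Continuous (fun p : X × E (m + 1) => D.nrm p.1 p.2) :=
  D.contMDiff_nrm.continuous

theorem isClosed_isNrm : IsClosed {p : X × E (m + 1) | D.IsNrm p.1 p.2} := by
  have h : {p : X × E (m + 1) | D.IsNrm p.1 p.2}
      = {p | D.nrm p.1 (scale (D.rho p.1) p.2) = p.2} := by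
    ext p
    exact ⟨fun h => D.nrm_scale_of_isNrm h, fun h => by
      have := D.isNrm_nrm p.1 (scale (D.rho p.1) p.2)
      rwa [h] at this⟩
  rw [h]
  have hr := D.continuous_rho
  refine isClosed_eq ?_ continuous_snd
  exact D.continuous_nrm.comp (continuous_fst.prodMk
    (continuous_scale (hr.comp continuous_fst) continuous_snd))

end BoundaryEmbedding

namespace BoundaryEmbedding

variable {n m : ℕ} [NeZero n] {X : Type*} [TopologicalSpace X]
  [ChartedSpace (EuclideanHalfSpace n) X] (D : BoundaryEmbedding n m X)

/-! ### Boundary points in charts -/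

omit [ChartedSpace (EuclideanHalfSpace n) X] [TopologicalSpace X] in
theorem mem_range_iff {a : E n} : a ∈ range (𝓡∂ n) ↔ 0 ≤ a 0 := by
  rw [range_modelWithCornersEuclideanHalfSpace]
  rfl

variable [IsManifold (𝓡∂ n) ∞ X]

theorem rhoC_eq_zero_iff {x₀ : X} {a : E n} (ha : a ∈ (extChartAt (𝓡∂ n) x₀).target) :
    D.rhoC x₀ a = 0 ↔ a 0 = 0 := by
  have hsrc := (extChartAt (𝓡∂ n) x₀).map_target ha
  have hsrc' := hsrc
  rw [extChartAt_source] at hsrc'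
  have h1 : D.rhoC x₀ a = 0 ↔ (𝓡∂ n).IsBoundaryPoint ((extChartAt (𝓡∂ n) x₀).symm a) :=
    D.rho_eq_zero_iff _
  rw [h1, (𝓡∂ n).isBoundaryPoint_iff_of_mem_atlas (n := ∞) (by simp) (chart_mem_atlas _ x₀) hsrc']
  have h2 : ((chartAt (EuclideanHalfSpace n) x₀).extend (𝓡∂ n))
      ((extChartAt (𝓡∂ n) x₀).symm a) = a := (extChartAt (𝓡∂ n) x₀).right_inv ha
  rw [h2]
  change a ∈ frontier (extChartAt (𝓡∂ n) x₀).target ↔ _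
  have hr : 0 ≤ a 0 := mem_range_iff.1 (extChartAt_target_subset_range x₀ ha)
  constructor
  · intro hf
    by_contra hne
    have hpos : 0 < a 0 := lt_of_le_of_ne hr (Ne.symm hne)
    have hint : range (𝓡∂ n) ∈ 𝓝 a := by
      rw [← mem_interior_iff_mem_nhds, interior_range_modelWithCornersEuclideanHalfSpace]
      exact hpos
    have h3 := extChartAt_target_mem_nhdsWithin_of_mem ha
    rw [nhdsWithin_eq_nhds.2 hint] at h3
    exact hf.2 (mem_interior_iff_mem_nhds.2 h3)
  · intro h0
    refine ⟨subset_closure ha, fun hint => ?_⟩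
    have h3 := interior_mono (extChartAt_target_subset_range x₀) hint
    rw [interior_range_modelWithCornersEuclideanHalfSpace] at h3
    exact (ne_of_gt h3) h0

/-- Derivative of a function in the chart along a line staying in the half space. -/
theorem hasDerivAt_line {W : Type*} [NormedAddCommGroup W] [NormedSpace ℝ W] {f : E n → W}
    {a ξ : E n} (hf : DifferentiableWithinAt ℝ f (range (𝓡∂ n)) a)
    (hline : ∀ᶠ s : ℝ in 𝓝 0, a + s • ξ ∈ range (𝓡∂ n)) :
    HasDerivAt (fun s : ℝ => f (a + s • ξ)) (fderivWithin ℝ f (range (𝓡∂ n)) a ξ) 0 := by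
  have h1 : HasDerivWithinAt (fun s : ℝ => a + s • ξ) ξ {s : ℝ | a + s • ξ ∈ range (𝓡∂ n)} 0 := by
    simpa using (((hasDerivAt_id (0 : ℝ)).smul_const ξ).const_add a).hasDerivWithinAt
  have h2 : HasFDerivWithinAt f (fderivWithin ℝ f (range (𝓡∂ n)) a) (range (𝓡∂ n))
      (a + (0 : ℝ) • ξ) := by simpa using hf.hasFDerivWithinAt
  have h3 := h2.comp_hasDerivWithinAt (0 : ℝ) h1 (fun s hs => hs)
  exact h3.hasDerivAt hline

theorem line_mem_range {a ξ : E n} (ha : a ∈ range (𝓡∂ n)) (h : a 0 = 0 → ξ 0 = 0) :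
    ∀ᶠ s : ℝ in 𝓝 0, a + s • ξ ∈ range (𝓡∂ n) := by
  rw [mem_range_iff] at ha
  rcases ha.eq_or_lt with h0 | h0
  · refine Eventually.of_forall fun s => ?_
    rw [mem_range_iff]
    simp [← h0, h h0.symm]
  · have hc : ContinuousAt (fun s : ℝ => (a + s • ξ) 0) 0 := by
      have : Continuous (fun s : ℝ => (a + s • ξ) 0) := by
        simp only [PiLp.add_apply, PiLp.smul_apply, smul_eq_mul]
        fun_prop
      exact this.continuousAt
    filter_upwards [hc.eventually_const_lt (u := 0) (by simpa using h0)] with s hs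
    exact mem_range_iff.2 hs.le

omit [IsManifold (𝓡∂ n) ∞ X] in
theorem line_mem_target {x₀ : X} {a ξ : E n} (ha : a ∈ (extChartAt (𝓡∂ n) x₀).target)
    (h : a 0 = 0 → ξ 0 = 0) : ∀ᶠ s : ℝ in 𝓝 0, a + s • ξ ∈ (extChartAt (𝓡∂ n) x₀).target := by
  have h1 := extChartAt_target_mem_nhdsWithin_of_mem ha
  have hc : Continuous (fun s : ℝ => a + s • ξ) := by fun_prop
  have h2 : Tendsto (fun s : ℝ => a + s • ξ) (𝓝 0) (𝓝[range (𝓡∂ n)] a) :=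
    tendsto_nhdsWithin_iff.2 ⟨by simpa using hc.tendsto 0,
      line_mem_range (extChartAt_target_subset_range x₀ ha) h⟩
  exact h2 h1

theorem dRhoC_eq_zero_of {x₀ : X} {a ξ : E n} (ha : a ∈ (extChartAt (𝓡∂ n) x₀).target)
    (h0 : a 0 = 0) (hξ : ξ 0 = 0) : D.dRhoC x₀ a ξ = 0 := by
  have h1 := hasDerivAt_line ((D.contDiffWithinAt_rhoC ha).differentiableWithinAt (by simp))
    (line_mem_range (extChartAt_target_subset_range x₀ ha) (fun _ => hξ))
  have h2 : (fun s : ℝ => D.rhoC x₀ (a + s • ξ)) =ᶠ[𝓝 0] fun _ => 0 := by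
    filter_upwards [line_mem_target ha (fun _ => hξ)] with s hs
    rw [D.rhoC_eq_zero_iff hs]
    simp [h0, hξ]
  exact (h1.congr_of_eventuallyEq h2.symm).unique (hasDerivAt_const _ _)

theorem dRhoC_ne_zero {x₀ : X} {a : E n} (ha : a ∈ (extChartAt (𝓡∂ n) x₀).target)
    (h0 : a 0 = 0) : ∃ ν, D.dRhoC x₀ a ν ≠ 0 := by
  obtain ⟨A, -, hA⟩ := D.exists_coordChange ((extChartAt (𝓡∂ n) x₀).map_target ha)
  rw [(extChartAt (𝓡∂ n) x₀).right_inv ha] at hA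
  have hρ : D.rho ((extChartAt (𝓡∂ n) x₀).symm a) = 0 := (D.rhoC_eq_zero_iff ha).2 h0
  obtain ⟨ν, κ, h⟩ := D.exists_transverse ((extChartAt (𝓡∂ n) x₀).symm a)
  rw [hρ, zero_mul, sub_zero] at h
  exact ⟨A.symm ν, by rw [← hA, A.apply_symm_apply]; exact h.ne'⟩

theorem apply_zero_of_dRhoC {x₀ : X} {a ξ : E n} (ha : a ∈ (extChartAt (𝓡∂ n) x₀).target)
    (h0 : a 0 = 0) (hξ : D.dRhoC x₀ a ξ = 0) : ξ 0 = 0 := by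
  by_contra hne
  obtain ⟨ν, hν⟩ := D.dRhoC_ne_zero ha h0
  apply hν
  have h1 : D.dRhoC x₀ a (ν - (ν 0 / ξ 0) • ξ) = 0 :=
    D.dRhoC_eq_zero_of ha h0 (by simp [hne])
  rw [map_sub, map_smul, hξ, smul_zero, sub_zero] at h1
  exact h1

/-- Near a boundary point, `rho` takes all small nonnegative values. -/
theorem eventually_exists_rho_eq {x₀ : X} (h0 : D.rho x₀ = 0) {U : Set X} (hU : U ∈ 𝓝 x₀) :
    ∀ᶠ u in 𝓝[≥] (0 : ℝ), ∃ y ∈ U, D.rho y = u := by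
  set φ := extChartAt (𝓡∂ n) x₀ with hφ
  have ha : φ x₀ ∈ φ.target := mem_extChartAt_target x₀
  have ha0 : (φ x₀) 0 = 0 := by
    rw [← D.rhoC_eq_zero_iff ha, D.rhoC_apply (mem_extChartAt_source x₀), h0]
  let e : E n := EuclideanSpace.single 0 1
  have hmem : ∀ s : ℝ, 0 ≤ s → φ x₀ + s • e ∈ range (𝓡∂ n) := fun s hs => by
    rw [mem_range_iff]; simp [e, ha0, hs]
  have hc : Continuous (fun s : ℝ => φ x₀ + s • e) := by fun_prop
  have htend : Tendsto (fun s : ℝ => φ x₀ + s • e) (𝓝[≥] 0) (𝓝[range (𝓡∂ n)] (φ x₀)) := by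
    refine tendsto_nhdsWithin_iff.2 ⟨?_, ?_⟩
    · exact (by simpa using hc.tendsto 0 : Tendsto _ (𝓝 (0 : ℝ)) _).mono_left inf_le_left
    · filter_upwards [self_mem_nhdsWithin] with s hs using hmem s hs
  have hpre : φ.symm ⁻¹' U ∈ 𝓝[range (𝓡∂ n)] (φ x₀) := by
    have := (continuousAt_extChartAt_symm (I := 𝓡∂ n) x₀)
    have h2 : U ∈ 𝓝 (φ.symm (φ x₀)) := by rwa [extChartAt_to_inv]
    exact mem_nhdsWithin_of_mem_nhds (this h2)
  have hev := htend.eventually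
    (inter_mem hpre (extChartAt_target_mem_nhdsWithin (I := 𝓡∂ n) x₀))
  obtain ⟨δ, hδ, hsub⟩ := (mem_nhdsGE_iff_exists_Icc_subset.1 hev)
  have hδ' : (0 : ℝ) < δ := hδ
  have hcont : ContinuousOn (fun s : ℝ => D.rhoC x₀ (φ x₀ + s • e)) (Icc 0 δ) :=
    (D.contDiffOn_rhoC x₀).continuousOn.comp hc.continuousOn (fun s hs => (hsub hs).2)
  have hpos : 0 < D.rhoC x₀ (φ x₀ + δ • e) := by
    refine lt_of_le_of_ne (D.rho_nonneg _) (Ne.symm fun h => ?_)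
    rw [D.rhoC_eq_zero_iff (hsub (right_mem_Icc.2 hδ'.le)).2] at h
    simp [e, ha0] at h
    exact hδ'.ne' h
  filter_upwards [Icc_mem_nhdsGE hpos] with u hu
  have h00 : D.rhoC x₀ (φ x₀ + (0 : ℝ) • e) = 0 := by
    rw [zero_smul, add_zero, D.rhoC_eq_zero_iff ha, ha0]
  obtain ⟨s, hs, hsu⟩ := intermediate_value_Icc hδ'.le hcont
    (show u ∈ Icc _ _ from ⟨by simp only [h00]; exact hu.1, hu.2⟩)
  exact ⟨φ.symm (φ x₀ + s • e), (hsub hs).1, hsu⟩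

/-! ### Quadratic contact of the b-groupoid with its Lie algebroid -/

/-- In a chart `emb` does not decrease distances by more than a constant factor. -/
theorem exists_norm_sub_le (x₀ : X) : ∃ c : ℝ, 0 < c ∧
    ∃ s ∈ 𝓝[range (𝓡∂ n)] (extChartAt (𝓡∂ n) x₀ x₀), ∀ a ∈ s, ∀ a' ∈ s,
      ‖a' - a‖ ≤ c * ‖D.embC x₀ a' - D.embC x₀ a‖ := by
  set a₀ := extChartAt (𝓡∂ n) x₀ x₀ with ha₀
  have hat : a₀ ∈ (extChartAt (𝓡∂ n) x₀).target := mem_extChartAt_target x₀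
  have har := extChartAt_target_subset_range x₀ hat
  have hconv : Convex ℝ (range (𝓡∂ n)) := (𝓡∂ n).convex_range
  obtain ⟨C, δ, hC, hδ, hT⟩ := exists_taylor_bound hconv (𝓡∂ n).uniqueDiffOn har
    (D.contDiffWithinAt_embC hat)
  have hinj : Function.Injective (D.dEmbC x₀ a₀) :=
    D.injective_dEmbC (mem_extChartAt_source x₀)
  obtain ⟨c₀, hc₀, hanti⟩ := (D.dEmbC x₀ a₀).toLinearMap.exists_antilipschitzWith
    (LinearMap.ker_eq_bot.2 hinj)
  have hbound : ∀ ξ, ‖ξ‖ ≤ c₀ * ‖D.dEmbC x₀ a₀ ξ‖ := fun ξ => by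
    simpa [dist_eq_norm] using hanti.le_mul_dist ξ 0
  have hc₀' : (0 : ℝ) < c₀ := hc₀
  have hcont : ContinuousWithinAt (D.dEmbC x₀) (range (𝓡∂ n)) a₀ :=
    ((D.contDiffWithinAt_embC hat).fderivWithin_right (m := 0) (𝓡∂ n).uniqueDiffOn
      (by simp) har).continuousWithinAt
  have h1 : ∀ᶠ a in 𝓝[range (𝓡∂ n)] a₀, ‖D.dEmbC x₀ a - D.dEmbC x₀ a₀‖ ≤ 1 / (4 * c₀) := by
    filter_upwards [hcont (Metric.closedBall_mem_nhds _
      (show 0 < 1 / (4 * (c₀ : ℝ)) by positivity))] with a ha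
    rwa [mem_preimage, Metric.mem_closedBall, dist_eq_norm] at ha
  set δ' := min δ (1 / (8 * (C + 1) * c₀)) with hδ'
  have hδ'0 : 0 < δ' := lt_min hδ (by positivity)
  refine ⟨2 * c₀, by positivity, _, inter_mem h1 (inter_mem self_mem_nhdsWithin
    (mem_nhdsWithin_of_mem_nhds (Metric.ball_mem_nhds a₀ hδ'0))), ?_⟩
  rintro a ⟨ha1, haS, haB⟩ a' ⟨-, haS', haB'⟩
  have hsub : Metric.ball a₀ δ' ⊆ Metric.ball a₀ δ := Metric.ball_subset_ball (min_le_left _ _)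
  have h2 := hT a ⟨haS, hsub haB⟩ a' ⟨haS', hsub haB'⟩
  set ξ := a' - a with hξ
  have hξ1 : C * ‖ξ‖ ≤ 1 / (4 * c₀) := by
    have h3 : ‖ξ‖ ≤ 2 * δ' := by
      have : ξ = (a' - a₀) - (a - a₀) := by simp [hξ]
      rw [this]
      have := norm_sub_le (a' - a₀) (a - a₀)
      rw [Metric.mem_ball, dist_eq_norm] at haB haB'
      linarith
    have h4 : δ' ≤ 1 / (8 * (C + 1) * c₀) := min_le_right _ _
    calc C * ‖ξ‖ ≤ (C + 1) * (2 * (1 / (8 * (C + 1) * c₀))) :=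
          mul_le_mul (by linarith) (by linarith) (norm_nonneg _) (by positivity)
      _ = 1 / (4 * c₀) := by field_simp; norm_num
  have h5 : ‖D.dEmbC x₀ a ξ - D.dEmbC x₀ a₀ ξ‖ ≤ 1 / (4 * c₀) * ‖ξ‖ := by
    have := (D.dEmbC x₀ a - D.dEmbC x₀ a₀).le_opNorm ξ
    exact this.trans (mul_le_mul_of_nonneg_right ha1 (norm_nonneg _))
  have h6 : ‖D.dEmbC x₀ a₀ ξ‖ ≤ ‖D.embC x₀ a' - D.embC x₀ a‖ + 1 / (4 * c₀) * ‖ξ‖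
      + 1 / (4 * c₀) * ‖ξ‖ := by
    have e : D.dEmbC x₀ a₀ ξ = (D.embC x₀ a' - D.embC x₀ a)
        - (D.embC x₀ a' - D.embC x₀ a - D.dEmbC x₀ a ξ)
        - (D.dEmbC x₀ a ξ - D.dEmbC x₀ a₀ ξ) := by abel
    rw [e]
    refine (norm_sub_le _ _).trans (add_le_add ((norm_sub_le _ _).trans
      (add_le_add le_rfl (h2.trans ?_))) h5)
    rw [sq, ← mul_assoc]
    exact mul_le_mul_of_nonneg_right hξ1 (norm_nonneg _)
  have h7 := (hbound ξ).trans (mul_le_mul_of_nonneg_left h6 hc₀'.le)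
  have e2 : (c₀ : ℝ) * (‖D.embC x₀ a' - D.embC x₀ a‖ + 1 / (4 * c₀) * ‖ξ‖ + 1 / (4 * c₀) * ‖ξ‖)
      = c₀ * ‖D.embC x₀ a' - D.embC x₀ a‖ + ‖ξ‖ / 2 := by field_simp; ring
  rw [e2] at h7
  linarith

/-- Near every point the vectors `h(γ)` of short arrows `γ` of the b-groupoid are tangent to the
algebroid up to second order. At the boundary this uses that an approximately tangent vector can
be corrected by a vector transverse to the boundary. -/
theorem exists_inner_le (x₀ : X) : ∃ K : ℝ, 0 < K ∧ ∃ U ∈ 𝓝 x₀, ∀ y ∈ U, ∀ z ∈ U, ∀ α : ℝ,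
    |α| ≤ 1 → D.rho z = Real.exp α * D.rho y → ∀ v, D.IsNrm y v →
      ⟪v, join (D.emb z - D.emb y) α⟫ ≤ K * ‖v‖ * ‖join (D.emb z - D.emb y) α‖ ^ 2 := by
  set φ := extChartAt (𝓡∂ n) x₀ with hφ
  set a₀ := φ x₀ with ha₀
  have hat : a₀ ∈ φ.target := mem_extChartAt_target x₀
  have har := extChartAt_target_subset_range x₀ hat
  have hconv : Convex ℝ (range (𝓡∂ n)) := (𝓡∂ n).convex_range
  obtain ⟨C₁, δ₁, hC₁, hδ₁, hT₁⟩ := exists_taylor_bound hconv (𝓡∂ n).uniqueDiffOn har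
    (D.contDiffWithinAt_embC hat)
  obtain ⟨C₂, δ₂, hC₂, hδ₂, hT₂⟩ := exists_taylor_bound hconv (𝓡∂ n).uniqueDiffOn har
    (D.contDiffWithinAt_rhoC hat)
  obtain ⟨c, hc, s, hs, hlow⟩ := D.exists_norm_sub_le x₀
  obtain ⟨ν₀, κ, hν₀⟩ := D.exists_transverse x₀
  obtain ⟨A, -, hA⟩ := D.exists_coordChange (mem_extChartAt_source (I := 𝓡∂ n) x₀)
  obtain ⟨ν, rfl⟩ := A.surjective ν₀
  rw [hA, ← D.rhoC_apply (mem_extChartAt_source (I := 𝓡∂ n) x₀)] at hν₀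
  have hcE : ContinuousWithinAt (D.dEmbC x₀) (range (𝓡∂ n)) a₀ :=
    ((D.contDiffWithinAt_embC hat).fderivWithin_right (m := 0) (𝓡∂ n).uniqueDiffOn
      (by simp) har).continuousWithinAt
  have hcR : ContinuousWithinAt (D.dRhoC x₀) (range (𝓡∂ n)) a₀ :=
    ((D.contDiffWithinAt_rhoC hat).fderivWithin_right (m := 0) (𝓡∂ n).uniqueDiffOn
      (by simp) har).continuousWithinAt
  have hcr : ContinuousWithinAt (D.rhoC x₀) (range (𝓡∂ n)) a₀ :=
    (D.contDiffWithinAt_rhoC hat).continuousWithinAt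
  set d := (D.dRhoC x₀ a₀ ν - D.rhoC x₀ a₀ * κ) / 2 with hd
  have hd0 : 0 < d := half_pos hν₀
  have hev1 : ∀ᶠ a in 𝓝[range (𝓡∂ n)] a₀, d < D.dRhoC x₀ a ν - D.rhoC x₀ a * κ :=
    ((hcR.clm_apply continuousWithinAt_const).sub (hcr.mul continuousWithinAt_const)).eventually
      (lt_mem_nhds (half_lt_self hν₀))
  set N := ‖D.dEmbC x₀ a₀ ν‖ + 1 with hN
  have hev2 : ∀ᶠ a in 𝓝[range (𝓡∂ n)] a₀, ‖D.dEmbC x₀ a ν‖ < N :=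
    (hcE.clm_apply continuousWithinAt_const).norm.eventually (gt_mem_nhds (lt_add_one _))
  set R := D.rhoC x₀ a₀ + 1 with hR
  have hev3 : ∀ᶠ a in 𝓝[range (𝓡∂ n)] a₀, D.rhoC x₀ a < R :=
    hcr.eventually (gt_mem_nhds (lt_add_one _))
  have hR0 : 0 < R := by have : 0 ≤ D.rhoC x₀ a₀ := D.rho_nonneg _; positivity
  have hset := inter_mem hs (inter_mem hev1 (inter_mem hev2 (inter_mem hev3
    (inter_mem (inter_mem self_mem_nhdsWithin
      (mem_nhdsWithin_of_mem_nhds (Metric.ball_mem_nhds a₀ hδ₁)))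
      (inter_mem self_mem_nhdsWithin
        (mem_nhdsWithin_of_mem_nhds (Metric.ball_mem_nhds a₀ hδ₂)))))))
  rw [← map_extChartAt_nhds (I := 𝓡∂ n) x₀] at hset
  have hU := mem_map.1 hset
  set L := (C₂ * c ^ 2 + R) / d with hL
  have hL0 : 0 < L := by positivity
  refine ⟨C₁ * c ^ 2 + L * (N + |κ|), by positivity, _,
    inter_mem (extChartAt_source_mem_nhds (I := 𝓡∂ n) x₀) hU, ?_⟩
  rintro y ⟨hy, hys, hy1, hy2, hy3, hyT₁, hyT₂⟩ z ⟨hz, hzs, -, -, -, hzT₁, hzT₂⟩ α hα hrel v hv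
  set a := φ y with hay
  set a' := φ z with haz
  have t1 := hT₁ a hyT₁ a' hzT₁
  have t2 := hT₂ a hyT₂ a' hzT₂
  have t3 := hlow a hys a' hzs
  rw [hay, haz, D.embC_apply hy, D.embC_apply hz] at t1 t3
  rw [hay, haz, D.rhoC_apply hy, D.rhoC_apply hz] at t2
  rw [← hay, ← haz] at t1 t2 t3
  have hy1' : d < D.dRhoC x₀ a ν - D.rho y * κ := by rw [← D.rhoC_apply hy]; exact hy1
  have hy2' : ‖D.dEmbC x₀ a ν‖ < N := hy2
  have hy3' : D.rho y < R := by rw [← D.rhoC_apply hy]; exact hy3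
  set h := join (D.emb z - D.emb y) α with hh
  have hΔ : ‖D.emb z - D.emb y‖ ≤ ‖h‖ := norm_le_norm_join _ _
  have hαh : |α| ≤ ‖h‖ := abs_le_norm_join _ _
  have hξh : ‖a' - a‖ ≤ c * ‖h‖ := t3.trans (mul_le_mul_of_nonneg_left hΔ hc.le)
  have hξh2 : ‖a' - a‖ ^ 2 ≤ c ^ 2 * ‖h‖ ^ 2 := by
    rw [← mul_pow]; exact pow_le_pow_left₀ (norm_nonneg _) hξh 2
  have t1' : ‖D.emb z - D.emb y - D.dEmbC x₀ a (a' - a)‖ ≤ C₁ * (c ^ 2 * ‖h‖ ^ 2) :=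
    t1.trans (mul_le_mul_of_nonneg_left hξh2 hC₁)
  have t2' : |D.rho z - D.rho y - D.dRhoC x₀ a (a' - a)| ≤ C₂ * (c ^ 2 * ‖h‖ ^ 2) :=
    t2.trans (mul_le_mul_of_nonneg_left hξh2 hC₂)
  set den := D.dRhoC x₀ a ν - D.rho y * κ with hden
  have hden0 : 0 < den := hd0.trans hy1'
  set σ := -(D.dRhoC x₀ a (a' - a) - D.rho y * α) / den with hσ
  have hσden : σ * den = -(D.dRhoC x₀ a (a' - a) - D.rho y * α) := div_mul_cancel₀ _ hden0.ne'
  have hnum : |D.dRhoC x₀ a (a' - a) - D.rho y * α| ≤ (C₂ * c ^ 2 + R) * ‖h‖ ^ 2 := by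
    have e : D.dRhoC x₀ a (a' - a) - D.rho y * α
        = -(D.rho z - D.rho y - D.dRhoC x₀ a (a' - a))
          + D.rho y * (Real.exp α - 1 - α) := by rw [hrel]; ring
    rw [e]
    refine (abs_add_le _ _).trans ?_
    rw [abs_neg, abs_mul, abs_of_nonneg (D.rho_nonneg y)]
    have h1 := Real.abs_exp_sub_one_sub_id_le hα
    have h2 : α ^ 2 ≤ ‖h‖ ^ 2 := by
      rw [← sq_abs α]; exact pow_le_pow_left₀ (abs_nonneg _) hαh 2
    have h3 : D.rho y * |Real.exp α - 1 - α| ≤ R * ‖h‖ ^ 2 :=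
      mul_le_mul hy3'.le (h1.trans h2) (abs_nonneg _) hR0.le
    linarith
  have hσL : |σ| ≤ L * ‖h‖ ^ 2 := by
    rw [hσ, abs_div, abs_neg, abs_of_pos hden0, div_le_iff₀ hden0]
    calc _ ≤ (C₂ * c ^ 2 + R) * ‖h‖ ^ 2 := hnum
      _ = L * ‖h‖ ^ 2 * d := by rw [hL]; field_simp
      _ ≤ L * ‖h‖ ^ 2 * den := mul_le_mul_of_nonneg_left hy1'.le (by positivity)
  have hker : D.dRhoC x₀ a (a' - a + σ • ν) = D.rho y * (α + σ * κ) := by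
    rw [map_add, map_smul, smul_eq_mul]
    have : σ * D.dRhoC x₀ a ν = σ * den + σ * (D.rho y * κ) := by rw [hden]; ring
    rw [this, hσden]
    ring
  have horth := (D.isNrm_chart hy).1 hv _ _ hker
  have e3 : h = (h - join (D.dEmbC x₀ a (a' - a + σ • ν)) (α + σ * κ))
      + join (D.dEmbC x₀ a (a' - a + σ • ν)) (α + σ * κ) := by abel
  rw [e3, inner_add_right, horth, add_zero, ← e3]
  have e4 : h - join (D.dEmbC x₀ a (a' - a + σ • ν)) (α + σ * κ)
      = join (D.emb z - D.emb y - D.dEmbC x₀ a (a' - a) - σ • D.dEmbC x₀ a ν) (-(σ * κ)) := by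
    rw [hh, sub_eq_add_neg, ← join_neg, ← join_add, map_add, map_smul]
    congr 1
    · abel
    · ring
  rw [e4]
  refine (real_inner_le_norm _ _).trans ?_
  have h5 : ‖join (D.emb z - D.emb y - D.dEmbC x₀ a (a' - a) - σ • D.dEmbC x₀ a ν) (-(σ * κ))‖
      ≤ (C₁ * c ^ 2 + L * (N + |κ|)) * ‖h‖ ^ 2 := by
    refine (norm_join_le _ _).trans ?_
    have h6 := norm_sub_le (D.emb z - D.emb y - D.dEmbC x₀ a (a' - a)) (σ • D.dEmbC x₀ a ν)
    rw [norm_smul, Real.norm_eq_abs] at h6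
    have h7 : |σ| * ‖D.dEmbC x₀ a ν‖ ≤ L * ‖h‖ ^ 2 * N :=
      mul_le_mul hσL hy2'.le (norm_nonneg _) (by positivity)
    have h8 : |-(σ * κ)| ≤ L * ‖h‖ ^ 2 * |κ| := by
      rw [abs_neg, abs_mul]
      exact mul_le_mul_of_nonneg_right hσL (abs_nonneg _)
    nlinarith
  calc ‖v‖ * _ ≤ ‖v‖ * ((C₁ * c ^ 2 + L * (N + |κ|)) * ‖h‖ ^ 2) :=
        mul_le_mul_of_nonneg_left h5 (norm_nonneg _)
    _ = _ := by ring

end BoundaryEmbedding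

/-- The closed half space `ℝ^m × [0, ∞)`. -/
def half (m : ℕ) : Set (E m × ℝ) := {P | 0 ≤ P.2}

namespace BoundaryEmbedding

variable {n m : ℕ} [NeZero n] {X : Type*} [TopologicalSpace X]
  [ChartedSpace (EuclideanHalfSpace n) X] (D : BoundaryEmbedding n m X)

/-! ### The b-exponential map of the normal directions -/

/-- The radius `r` is good at `x`: closed balls about `x` of radius less than `r` are compact, and
in the ball of radius `r` normal vectors shorter than `r` are almost orthogonal to the vectors
`h(γ)`, with an error which is quadratic in `h(γ)` with a small constant. -/
def Good (x : X) (r : ℝ) : Prop :=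
  (∀ s < r, IsCompact (D.emb ⁻¹' Metric.closedBall (D.emb x) s)) ∧
  ∀ y z α v, dist (D.emb y) (D.emb x) < r → dist (D.emb z) (D.emb x) < r →
    D.rho z = Real.exp α * D.rho y → D.IsNrm y v → ‖v‖ < r →
    ⟪v, join (D.emb z - D.emb y) α⟫ ≤ 1 / 4 * ‖join (D.emb z - D.emb y) α‖ ^ 2

theorem Good.shift {D : BoundaryEmbedding n m X} {x y : X} {r : ℝ} (h : D.Good x r) :
    D.Good y (r - dist (D.emb y) (D.emb x)) := by
  refine ⟨fun s hs => ?_, fun y' z α v hy hz hrel hv hvr => ?_⟩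
  · refine (h.1 (s + dist (D.emb y) (D.emb x)) (by linarith)).of_isClosed_subset
      (Metric.isClosed_closedBall.preimage D.continuous_emb)
      (preimage_mono (Metric.closedBall_subset_closedBall' le_rfl))
  · have := dist_nonneg (x := D.emb y) (y := D.emb x)
    have := dist_triangle (D.emb y') (D.emb y) (D.emb x)
    have := dist_triangle (D.emb z) (D.emb y) (D.emb x)
    exact h.2 y' z α v (by linarith) (by linarith) hrel hv (by linarith)

theorem nhds_basis_emb (x : X) {U : Set X} (hU : U ∈ 𝓝 x) :
    ∃ r > 0, D.emb ⁻¹' Metric.ball (D.emb x) r ⊆ U := by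
  rw [D.isSmoothEmbedding.isEmbedding.isInducing.nhds_eq_comap] at hU
  obtain ⟨s, hs, hsU⟩ := hU
  obtain ⟨r, hr, h⟩ := Metric.mem_nhds_iff.1 hs
  exact ⟨r, hr, (preimage_mono h).trans hsU⟩

theorem exists_good [IsManifold (𝓡∂ n) ∞ X] (x : X) : ∃ r, 0 < r ∧ D.Good x r := by
  have := D.isSmoothEmbedding.isEmbedding.t2Space
  have := Manifold.locallyCompact_of_finiteDimensional (M := X) (𝓡∂ n)
  obtain ⟨K, hK, U, hU, hin⟩ := D.exists_inner_le x
  obtain ⟨C, hC, hCx⟩ := exists_compact_mem_nhds x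
  obtain ⟨r₁, hr₁, h₁⟩ := D.nhds_basis_emb x hU
  obtain ⟨r₂, hr₂, h₂⟩ := D.nhds_basis_emb x hCx
  refine ⟨min (min r₁ r₂) (min (1 / 4) (1 / (4 * K))), by positivity, fun s hs => ?_,
    fun y z α v hy hz hrel hv hvr => ?_⟩
  · refine hC.of_isClosed_subset (Metric.isClosed_closedBall.preimage D.continuous_emb)
      (Subset.trans (preimage_mono (Metric.closedBall_subset_ball ?_)) h₂)
    exact hs.trans_le ((min_le_left _ _).trans (min_le_right _ _))
  · have hr1 : min (min r₁ r₂) (min (1 / 4) (1 / (4 * K))) ≤ r₁ :=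
      (min_le_left _ _).trans (min_le_left _ _)
    have hr3 : ‖v‖ ≤ 1 / 4 := hvr.le.trans ((min_le_right _ _).trans (min_le_left _ _))
    have hr4 : ‖v‖ ≤ 1 / (4 * K) := hvr.le.trans ((min_le_right _ _).trans (min_le_right _ _))
    set h := join (D.emb z - D.emb y) α
    rcases le_or_gt |α| 1 with hα | hα
    · refine (hin y (h₁ (hy.trans_le hr1)) z (h₁ (hz.trans_le hr1)) α hα hrel v hv).trans ?_
      refine mul_le_mul_of_nonneg_right ?_ (by positivity)
      calc K * ‖v‖ ≤ K * (1 / (4 * K)) := mul_le_mul_of_nonneg_left hr4 hK.le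
        _ = 1 / 4 := by field_simp
    · have hh : 1 ≤ ‖h‖ := hα.le.trans (abs_le_norm_join _ _)
      refine (real_inner_le_norm _ _).trans ?_
      nlinarith [norm_nonneg v, norm_nonneg h]

/-- The b-exponential map: `v` is added to the coordinates `(emb, log rho)` of `x`. -/
def expo (x : X) (v : E (m + 1)) : E m × ℝ :=
  (D.emb x + front v, D.rho x * Real.exp (height v))

theorem continuous_expo : Continuous (fun p : X × E (m + 1) => D.expo p.1 p.2) := by
  have := D.continuous_emb
  have := D.continuous_rho
  unfold expo
  fun_prop

theorem expo_mem_half (x : X) (v : E (m + 1)) : D.expo x v ∈ half m :=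
  mul_nonneg (D.rho_nonneg x) (Real.exp_pos _).le

/-- The normal vectors on which the b-exponential map is used. -/
def tube : Set (X × E (m + 1)) :=
  {p | D.IsNrm p.1 p.2 ∧ ∃ r ≤ 1, D.Good p.1 r ∧ 8 * ‖p.2‖ < r}

theorem Good.mono {D : BoundaryEmbedding n m X} {x : X} {r r' : ℝ} (h : D.Good x r)
    (hr : r' ≤ r) : D.Good x r' :=
  ⟨fun s hs => h.1 s (hs.trans_le hr), fun y z α v hy hz hrel hv hvr =>
    h.2 y z α v (hy.trans_le hr) (hz.trans_le hr) hrel hv (hvr.trans_le hr)⟩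

theorem zero_mem_tube [IsManifold (𝓡∂ n) ∞ X] (x : X) : (x, (0 : E (m + 1))) ∈ D.tube := by
  obtain ⟨r, hr, h⟩ := D.exists_good x
  exact ⟨D.isNrm_zero x, min r 1, min_le_right _ _, h.mono (min_le_left _ _), by simp [hr]⟩

theorem smul_mem_tube {x : X} {v : E (m + 1)} (h : (x, v) ∈ D.tube) {c : ℝ} (hc : |c| ≤ 1) :
    (x, c • v) ∈ D.tube := by
  obtain ⟨hv, r, hr, hg, hlt⟩ := h
  refine ⟨hv.smul c, r, hr, hg, lt_of_le_of_lt ?_ hlt⟩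
  simp only [norm_smul, Real.norm_eq_abs]
  nlinarith [norm_nonneg v]

/-- The quadratic contact, applied at both foot points, shows that two normal vectors with the
same exponential agree. -/
theorem expo_injOn : InjOn (fun p : X × E (m + 1) => D.expo p.1 p.2) D.tube := by
  rintro ⟨x, v⟩ hx ⟨y, w⟩ hy he
  wlog hle : ∃ r r', r' ≤ r ∧ D.Good x r ∧ 8 * ‖v‖ < r ∧ 8 * ‖w‖ < r' generalizing x v y w
  · refine (this y w hy x v hx he.symm ?_).symm
    obtain ⟨-, r, -, hg, hlt⟩ := hx
    obtain ⟨-, r', -, hg', hlt'⟩ := hy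
    have : ¬ r' ≤ r := fun h => hle ⟨r, r', h, hg, hlt, hlt'⟩
    exact ⟨r', r, by linarith, hg', hlt', hlt⟩
  obtain ⟨r, r', hrr, hg, hlt, hlt'⟩ := hle
  obtain ⟨hv, -⟩ := hx
  obtain ⟨hw, -⟩ := hy
  simp only at hv hw
  have he1 : D.emb x + front v = D.emb y + front w := congrArg Prod.fst he
  have he2 : D.rho x * Real.exp (height v) = D.rho y * Real.exp (height w) := congrArg Prod.snd he
  have hf : D.emb y - D.emb x = front (v - w) := by
    rw [front_sub, sub_eq_sub_iff_add_eq_add, ← he1, add_comm]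
  have hj : join (D.emb y - D.emb x) (height v - height w) = v - w := by
    rw [hf, ← height_sub, join_front_height]
  have hj' : join (D.emb x - D.emb y) (height w - height v) = -(v - w) := by
    rw [← hj, ← join_neg, neg_sub, neg_sub]
  have hd : dist (D.emb y) (D.emb x) < r := by
    rw [dist_eq_norm, hf]
    have h1 := norm_front_le (v - w)
    have h2 := norm_sub_le v w
    have := norm_nonneg v
    have := norm_nonneg w
    linarith
  have hr0 : 0 < r := lt_of_le_of_lt dist_nonneg hd
  have h1 := hg.2 x y (height v - height w) v (by rwa [dist_self]) hd
    (by rw [sub_eq_add_neg, Real.exp_add, mul_right_comm, mul_comm (Real.exp _), he2, Real.exp_neg]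
        field_simp) hv (by have := norm_nonneg v; linarith)
  have h2 := hg.2 y x (height w - height v) w hd (by rwa [dist_self])
    (by rw [sub_eq_add_neg, Real.exp_add, mul_right_comm, mul_comm (Real.exp _), ← he2,
          Real.exp_neg]
        field_simp) hw (by have := norm_nonneg w; linarith)
  rw [hj] at h1
  rw [hj', norm_neg, inner_neg_right] at h2
  have h3 : ⟪v, v - w⟫ - ⟪w, v - w⟫ = ‖v - w‖ ^ 2 := by
    rw [← inner_sub_left, real_inner_self_eq_norm_sq]
  have h4 : ‖v - w‖ = 0 := by nlinarith [norm_nonneg (v - w)]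
  have hvw : v = w := sub_eq_zero.1 (norm_eq_zero.1 h4)
  subst hvw
  have : x = y := D.injective_emb (add_right_cancel he1)
  rw [this]

theorem eventually_mem_tube {p₀ : X × E (m + 1)} (h : p₀ ∈ D.tube) :
    ∀ᶠ p in 𝓝 p₀, D.IsNrm p.1 p.2 → p ∈ D.tube := by
  obtain ⟨-, r, hr, hg, hlt⟩ := h
  have hc : Continuous fun p : X × E (m + 1) =>
      r - dist (D.emb p.1) (D.emb p₀.1) - 8 * ‖p.2‖ := by
    have := D.continuous_emb
    fun_prop
  filter_upwards [(hc.tendsto p₀).eventually_const_lt (u := 0) (by simpa using hlt)] with p hp hn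
  have := dist_nonneg (x := D.emb p.1) (y := D.emb p₀.1)
  exact ⟨hn, r - dist (D.emb p.1) (D.emb p₀.1), by linarith, hg.shift, by linarith⟩

variable [IsManifold (𝓡∂ n) ∞ X]

/-- A shortest vector in the coordinates `(emb, log rho)` is normal. -/
theorem isNrm_of_isLocalMin {y : X} {p : E m} {c : ℝ}
    (hmin : ∀ᶠ q : X × ℝ in 𝓝 (y, c), D.rho q.1 * Real.exp q.2 = D.rho y * Real.exp c →
      ‖p - D.emb y‖ ^ 2 + c ^ 2 ≤ ‖p - D.emb q.1‖ ^ 2 + q.2 ^ 2) :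
    D.IsNrm y (join (p - D.emb y) c) := by
  have hy := mem_extChartAt_source (I := 𝓡∂ n) y
  rw [D.isNrm_chart hy]
  intro ξ α hξ
  set φ := extChartAt (𝓡∂ n) y with hφ
  set a := φ y with ha
  have hat : a ∈ φ.target := mem_extChartAt_target y
  have har := extChartAt_target_subset_range y hat
  have hρa : D.rhoC y a = D.rho y := D.rhoC_apply hy
  have hea : D.embC y a = D.emb y := D.embC_apply hy
  have hline : a 0 = 0 → ξ 0 = 0 := fun h0 => by
    refine D.apply_zero_of_dRhoC hat h0 ?_
    rw [hξ, ← hρa, (D.rhoC_eq_zero_iff hat).2 h0, zero_mul]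
  have hrange := line_mem_range har hline
  have hdE := hasDerivAt_line ((D.contDiffWithinAt_embC hat).differentiableWithinAt (by simp))
    hrange
  have hdR := hasDerivAt_line ((D.contDiffWithinAt_rhoC hat).differentiableWithinAt (by simp))
    hrange
  obtain ⟨A, hA0, hA, hAc⟩ : ∃ A : ℝ → ℝ, A 0 = c ∧ HasDerivAt A (-α) 0 ∧
      ∀ᶠ s in 𝓝 0, D.rhoC y (a + s • ξ) * Real.exp (A s) = D.rho y * Real.exp c := by
    rcases (D.rho_nonneg y).eq_or_lt with h0 | h0
    · refine ⟨fun s => c + s * (-α), by simp, ?_, ?_⟩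
      · simpa using ((hasDerivAt_id (0 : ℝ)).mul_const (-α)).const_add c
      · have ha0 : a 0 = 0 := (D.rhoC_eq_zero_iff hat).1 (hρa.trans h0.symm)
        filter_upwards [line_mem_target hat hline] with s hs
        rw [(D.rhoC_eq_zero_iff hs).2 (by simp [ha0, hline ha0]), ← h0, zero_mul, zero_mul]
    · have hpos : D.rhoC y (a + (0 : ℝ) • ξ) ≠ 0 := by
        rw [zero_smul, add_zero, hρa]; exact h0.ne'
      refine ⟨fun s => c + Real.log (D.rho y) - Real.log (D.rhoC y (a + s • ξ)), by simp [hρa],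
        ?_, ?_⟩
      · have h1 := (hdR.log hpos).const_sub (c + Real.log (D.rho y))
        have e : -α = -(D.dRhoC y a ξ / D.rhoC y (a + (0 : ℝ) • ξ)) := by
          rw [hξ, zero_smul, add_zero, hρa, mul_comm, mul_div_cancel_right₀ _ h0.ne']
        rw [e]
        exact h1
      · have h2 := hdR.continuousAt.tendsto.eventually_const_lt (u := 0)
          (by simp only [zero_smul, add_zero, hρa]; exact h0)
        filter_upwards [h2] with s hs
        rw [Real.exp_sub, Real.exp_add, Real.exp_log h0, Real.exp_log hs]
        field_simp
  have hpath : Tendsto (fun s : ℝ => (φ.symm (a + s • ξ), A s)) (𝓝 0) (𝓝 (y, c)) := by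
    have h1 : Tendsto (fun s : ℝ => a + s • ξ) (𝓝 0) (𝓝 a) := by
      have hc : Continuous (fun s : ℝ => a + s • ξ) := by fun_prop
      simpa using hc.tendsto 0
    have h2 : Tendsto φ.symm (𝓝 a) (𝓝 y) := by
      have := continuousAt_extChartAt_symm (I := 𝓡∂ n) y
      rw [ContinuousAt, extChartAt_to_inv] at this
      exact this
    have h3 : Tendsto A (𝓝 0) (𝓝 c) := by
      have := hA.continuousAt
      rw [ContinuousAt, hA0] at this
      exact this
    exact (h2.comp h1).prodMk_nhds h3
  have hd : HasDerivAt (fun s : ℝ => ‖p - D.embC y (a + s • ξ)‖ ^ 2 + A s ^ 2)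
      (2 * ⟪p - D.emb y, -(D.dEmbC y a ξ)⟫ + 2 * c * (-α)) 0 := by
    have h1 := (hdE.const_sub p).norm_sq
    have h2 := hA.pow 2
    simp only [zero_smul, add_zero, hea] at h1
    rw [hA0] at h2
    have h3 := h1.add h2
    simp only [Nat.cast_ofNat, Nat.add_one_sub_one, pow_one] at h3
    exact h3
  have hlm : IsLocalMin (fun s : ℝ => ‖p - D.embC y (a + s • ξ)‖ ^ 2 + A s ^ 2) 0 := by
    filter_upwards [hpath.eventually hmin, hAc] with s hs hsc
    simp only [zero_smul, add_zero, hea, hA0]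
    exact hs hsc
  have h0 := hlm.hasDerivAt_eq_zero hd
  rw [inner_neg_right] at h0
  rw [inner_eq_front_height, front_join, height_join, front_join, height_join]
  linarith

theorem eventually_exists_rho_mul_exp_eq {x₀ : X} {c₀ : ℝ} {V : Set (X × ℝ)}
    (hV : V ∈ 𝓝 (x₀, c₀)) :
    ∀ᶠ u in 𝓝[Ici 0] (D.rho x₀ * Real.exp c₀), ∃ q ∈ V, D.rho q.1 * Real.exp q.2 = u := by
  rcases (D.rho_nonneg x₀).eq_or_lt with h0 | h0
  · obtain ⟨V₃, hV₃, V₄, hV₄, hV34⟩ := mem_nhds_prod_iff.1 hV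
    have ht : Tendsto (fun u : ℝ => u * Real.exp (-c₀)) (𝓝[Ici 0] (D.rho x₀ * Real.exp c₀))
        (𝓝[≥] 0) := by
      refine tendsto_nhdsWithin_iff.2 ⟨?_, ?_⟩
      · rw [← h0, zero_mul]
        have hc : Continuous fun u : ℝ => u * Real.exp (-c₀) := by fun_prop
        have h1 := hc.tendsto 0
        rw [zero_mul] at h1
        exact h1.mono_left inf_le_left
      · filter_upwards [self_mem_nhdsWithin] with u hu
        exact mul_nonneg hu (Real.exp_pos _).le
    filter_upwards [ht.eventually (D.eventually_exists_rho_eq h0.symm hV₃)] with u ⟨y, hy, hyu⟩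
    refine ⟨(y, c₀), hV34 ⟨hy, mem_of_mem_nhds hV₄⟩, ?_⟩
    simp only
    rw [hyu, mul_assoc, ← Real.exp_add, neg_add_cancel, Real.exp_zero, mul_one]
  · set u₀ := D.rho x₀ * Real.exp c₀ with hu₀
    have hu₀0 : 0 < u₀ := mul_pos h0 (Real.exp_pos _)
    have ht : Tendsto (fun u : ℝ => (x₀, Real.log (u / D.rho x₀))) (𝓝 u₀) (𝓝 (x₀, c₀)) := by
      refine tendsto_const_nhds.prodMk_nhds ?_
      have e : c₀ = Real.log (u₀ / D.rho x₀) := by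
        rw [hu₀, mul_comm, mul_div_cancel_right₀ _ h0.ne', Real.log_exp]
      rw [e]
      exact Tendsto.log (tendsto_id.div_const _) (div_pos hu₀0 h0).ne'
    filter_upwards [mem_nhdsWithin_of_mem_nhds (ht hV), mem_nhdsWithin_of_mem_nhds
      (lt_mem_nhds hu₀0)] with u hu hu2
    refine ⟨_, hu, ?_⟩
    simp only
    rw [Real.exp_log (div_pos hu2 h0), mul_div_cancel₀ _ h0.ne']

/-- Every point near a point of the image of the tube is in the image of nearby points of the
tube: a nearest point in the coordinates `(emb, log rho)` exists by compactness. -/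
theorem exists_expo_eq {x₀ : X} {v₀ : E (m + 1)} (h : (x₀, v₀) ∈ D.tube) {U : Set (X × E (m + 1))}
    (hU : U ∈ 𝓝 (x₀, v₀)) :
    ∀ᶠ P in 𝓝[half m] (D.expo x₀ v₀), ∃ q ∈ U, q ∈ D.tube ∧ D.expo q.1 q.2 = P := by
  have htube := D.eventually_mem_tube h
  obtain ⟨hv₀, r, hr1, hg, hlt⟩ := h
  simp only at hv₀ hg hlt
  set P₀ := D.expo x₀ v₀ with hP₀
  set c₀ := height v₀ with hc₀
  have hce := D.continuous_emb
  have hcr := D.continuous_rho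
  have hr0 : 0 < r := by have := norm_nonneg v₀; linarith
  -- the vector attached to a competitor depends continuously on it
  let Ψ : (X × ℝ) × E m → X × E (m + 1) := fun z => (z.1.1, join (z.2 - D.emb z.1.1) z.1.2)
  have hΨ : Continuous Ψ := by fun_prop
  have hΨ0 : Ψ ((x₀, c₀), P₀.1) = (x₀, v₀) := by
    simp only [Ψ, hP₀, expo, add_sub_cancel_left, hc₀, join_front_height]
  have hpre : Ψ ⁻¹' (U ∩ {q | D.IsNrm q.1 q.2 → q ∈ D.tube}) ∈ 𝓝 ((x₀, c₀), P₀.1) := by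
    refine hΨ.continuousAt.preimage_mem_nhds ?_
    rw [hΨ0]
    exact inter_mem hU htube
  obtain ⟨W₁, hW₁, W₂, hW₂, hW⟩ := mem_nhds_prod_iff.1 hpre
  obtain ⟨W₃, hW₃, W₄, hW₄, hW34⟩ := mem_nhds_prod_iff.1 hW₁
  obtain ⟨ε₁, hε₁, hsub₁⟩ := D.nhds_basis_emb x₀ hW₃
  obtain ⟨ε₂, hε₂, hsub₂⟩ := Metric.mem_nhds_iff.1 hW₄
  set ε := min (min ε₁ ε₂) (r / 2) with hε
  have hε0 : 0 < ε := by positivity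
  let g : X × ℝ → ℝ := fun q => ‖D.emb q.1 - D.emb x₀‖ ^ 2 + (c₀ - q.2) ^ 2
  have hgc : Continuous g := by fun_prop
  have hNε : ∀ q, g q < ε ^ 2 → ‖D.emb q.1 - D.emb x₀‖ < ε ∧ |c₀ - q.2| < ε := fun q hq => by
    constructor
    · refine lt_of_pow_lt_pow_left₀ 2 hε0.le (lt_of_le_of_lt ?_ hq)
      exact le_add_of_nonneg_right (sq_nonneg _)
    · refine abs_lt_of_sq_lt_sq (lt_of_le_of_lt ?_ hq) hε0.le
      exact le_add_of_nonneg_left (sq_nonneg _)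
  set N : Set (X × ℝ) := {q | g q < ε ^ 2} with hN
  have hNo : IsOpen N := isOpen_lt hgc continuous_const
  have hNW : N ⊆ W₁ := fun q hq => by
    obtain ⟨h1, h2⟩ := hNε q hq
    refine hW34 ⟨hsub₁ ?_, hsub₂ ?_⟩
    · rw [mem_preimage, Metric.mem_ball, dist_eq_norm]
      exact h1.trans_le ((min_le_left _ _).trans (min_le_left _ _))
    · rw [Metric.mem_ball, dist_comm, Real.dist_eq]
      exact h2.trans_le ((min_le_left _ _).trans (min_le_right _ _))
  set K : Set (X × ℝ) := (D.emb ⁻¹' Metric.closedBall (D.emb x₀) (r / 2)) ×ˢ Icc (-1) 1 with hK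
  have hKc : IsCompact K := (hg.1 _ (half_lt_self hr0)).prod isCompact_Icc
  have hc₀r : |c₀| < r / 8 := by have := abs_height_le v₀; linarith
  have hNK : N ⊆ K := fun q hq => by
    obtain ⟨h1, h2⟩ := hNε q hq
    have h3 : ε ≤ r / 2 := min_le_right _ _
    rw [abs_lt] at h2 hc₀r
    refine ⟨?_, by linarith, by linarith⟩
    rw [mem_preimage, Metric.mem_closedBall, dist_eq_norm]
    linarith
  -- far competitors are longer than `v₀` by a definite amount
  have hfar : ∀ᶠ P in 𝓝 P₀, ∀ q ∈ K \ N, D.rho q.1 * Real.exp q.2 = P.2 →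
      ‖v₀‖ ^ 2 + ε ^ 2 / 4 < ‖P.1 - D.emb q.1‖ ^ 2 + q.2 ^ 2 := by
    refine (hKc.diff hNo).eventually_forall_of_forall_eventually fun q hq => ?_
    by_cases hrel : D.rho q.1 * Real.exp q.2 = P₀.2
    · have hgq : ε ^ 2 ≤ g q := not_lt.1 hq.2
      have hkey : ‖v₀‖ ^ 2 + ε ^ 2 / 4 < ‖P₀.1 - D.emb q.1‖ ^ 2 + q.2 ^ 2 := by
        have hqK := hq.1.1
        rw [mem_preimage, Metric.mem_closedBall] at hqK
        have h1 := hg.2 x₀ q.1 (c₀ - q.2) v₀ (by rwa [dist_self]) (by linarith)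
          (by
            simp only [hP₀, expo] at hrel
            rw [sub_eq_add_neg, Real.exp_add, mul_right_comm, mul_comm (Real.exp _), hc₀, ← hrel,
              Real.exp_neg]
            field_simp) hv₀ (by have := norm_nonneg v₀; linarith)
        set h := join (D.emb q.1 - D.emb x₀) (c₀ - q.2) with hh
        have h2 : ‖h‖ ^ 2 = g q := by
          rw [norm_sq_eq_front_height, hh, front_join, height_join]
        have h3 : ‖v₀ - h‖ ^ 2 = ‖P₀.1 - D.emb q.1‖ ^ 2 + q.2 ^ 2 := by
          rw [norm_sq_eq_front_height, hh, front_sub, height_sub, front_join, height_join]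
          simp only [hP₀, expo]
          congr 3
          · abel
          · rw [hc₀]; ring
        rw [← h3, norm_sub_sq_real]
        have : 0 < ε ^ 2 := by positivity
        linarith
      have hc1 : Continuous fun z : (E m × ℝ) × (X × ℝ) =>
          ‖z.1.1 - D.emb z.2.1‖ ^ 2 + z.2.2 ^ 2 := by fun_prop
      filter_upwards [(hc1.tendsto (P₀, q)).eventually_const_lt hkey] with z hz _
      exact hz
    · have hc1 : Continuous fun z : (E m × ℝ) × (X × ℝ) =>
          D.rho z.2.1 * Real.exp z.2.2 - z.1.2 := by fun_prop
      filter_upwards [(hc1.tendsto (P₀, q)).eventually_ne (sub_ne_zero.2 hrel)] with z hz hz'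
      exact absurd (sub_eq_zero.2 hz') hz
  -- there are competitors whose length is close to that of `v₀`
  have hnear : ∀ᶠ P in 𝓝[half m] P₀, ∃ q ∈ N, D.rho q.1 * Real.exp q.2 = P.2 ∧
      ‖P.1 - D.emb q.1‖ ^ 2 + q.2 ^ 2 < ‖v₀‖ ^ 2 + ε ^ 2 / 4 := by
    have hc1 : Continuous fun z : (E m × ℝ) × (X × ℝ) =>
        ‖z.1.1 - D.emb z.2.1‖ ^ 2 + z.2.2 ^ 2 := by fun_prop
    have h1 : {z : (E m × ℝ) × (X × ℝ) | z.2 ∈ N ∧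
        ‖z.1.1 - D.emb z.2.1‖ ^ 2 + z.2.2 ^ 2 < ‖v₀‖ ^ 2 + ε ^ 2 / 4} ∈ 𝓝 (P₀, (x₀, c₀)) := by
      refine ((hNo.preimage continuous_snd).inter (isOpen_lt hc1 continuous_const)).mem_nhds
        ⟨?_, ?_⟩
      · have h0 : g (x₀, c₀) = 0 := by simp [g]
        change g (x₀, c₀) < ε ^ 2
        rw [h0]
        positivity
      · simp only [mem_ofPred_eq, hP₀, expo, add_sub_cancel_left, hc₀]
        rw [← norm_sq_eq_front_height]
        have : 0 < ε ^ 2 := by positivity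
        linarith
    obtain ⟨V₁, hV₁, V₂, hV₂, hV⟩ := mem_nhds_prod_iff.1 h1
    suffices ∀ᶠ P in 𝓝[half m] P₀, ∃ q ∈ V₂, D.rho q.1 * Real.exp q.2 = P.2 by
      filter_upwards [this, mem_nhdsWithin_of_mem_nhds hV₁] with P ⟨q, hq, hqP⟩ hP
      obtain ⟨h2, h3⟩ := hV (mk_mem_prod hP hq)
      exact ⟨q, h2, hqP, h3⟩
    have ht : Tendsto (fun P : E m × ℝ => P.2) (𝓝[half m] P₀) (𝓝[Ici 0] P₀.2) :=
      tendsto_nhdsWithin_iff.2 ⟨(continuous_snd.tendsto P₀).mono_left inf_le_left,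
        self_mem_nhdsWithin⟩
    exact ht.eventually (D.eventually_exists_rho_mul_exp_eq hV₂)
  filter_upwards [hnear, mem_nhdsWithin_of_mem_nhds hfar,
    mem_nhdsWithin_of_mem_nhds (continuous_fst.continuousAt hW₂)]
    with P ⟨q₁, hq₁N, hq₁, hq₁f⟩ hfP hP
  have hcomp : IsCompact (K ∩ {q | D.rho q.1 * Real.exp q.2 = P.2}) :=
    hKc.inter_right (isClosed_eq (by fun_prop) continuous_const)
  have hcf : Continuous fun q : X × ℝ => ‖P.1 - D.emb q.1‖ ^ 2 + q.2 ^ 2 := by fun_prop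
  obtain ⟨q, ⟨hqK, hq⟩, hqmin⟩ := hcomp.exists_isMinOn ⟨q₁, hNK hq₁N, hq₁⟩ hcf.continuousOn
  have hqN : q ∈ N := by
    by_contra hqN
    have h1 := hfP q ⟨hqK, hqN⟩ hq
    have h2 := hqmin ⟨hNK hq₁N, hq₁⟩
    simp only [mem_ofPred_eq] at h2
    linarith
  have hnrm : D.IsNrm q.1 (join (P.1 - D.emb q.1) q.2) := by
    refine D.isNrm_of_isLocalMin ?_
    filter_upwards [hNo.mem_nhds hqN] with q' hq' hrel
    exact hqmin ⟨hNK hq', hrel.trans hq⟩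
  obtain ⟨h1, h2⟩ := hW (mk_mem_prod (hNW hqN) hP)
  refine ⟨Ψ (q, P.1), h1, h2 hnrm, ?_⟩
  simp only [Ψ, expo, front_join, height_join, add_sub_cancel]
  rw [show D.rho q.1 * Real.exp q.2 = P.2 from hq]

end BoundaryEmbedding

/-- The parametrization `(P, s) ↦ (P, e^s)` of the open half space. -/
def logc {m : ℕ} (W : E (m + 1)) : E m × ℝ := (front W, Real.exp (height W))

theorem logc_mem_half {m : ℕ} (W : E (m + 1)) : logc W ∈ half m := (Real.exp_pos _).le

@[fun_prop] theorem continuous_logc {m : ℕ} : Continuous (logc (m := m)) := by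
  unfold logc; fun_prop

namespace BoundaryEmbedding

variable {n m : ℕ} [NeZero n] {X : Type*} [TopologicalSpace X]
  [ChartedSpace (EuclideanHalfSpace n) X] (D : BoundaryEmbedding n m X)

/-! ### The tubular neighbourhood and its smooth inverse -/

/-- The neighbourhood of `X` in the half space which is covered by the tube. -/
def tubeImage : Set (E m × ℝ) := (fun p : X × E (m + 1) => D.expo p.1 p.2) '' D.tube

theorem expo_mem_tubeImage {D : BoundaryEmbedding n m X} {x : X} {v : E (m + 1)}
    (h : (x, v) ∈ D.tube) : D.expo x v ∈ D.tubeImage := ⟨(x, v), h, rfl⟩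

theorem norm_lt_of_mem_tube {D : BoundaryEmbedding n m X} {q : X × E (m + 1)} (h : q ∈ D.tube) :
    ‖q.2‖ < 1 / 8 := by
  obtain ⟨-, r, hr, -, hlt⟩ := h
  linarith

/-- The foot point is a nondegenerate local minimum of the distance along the source fibre of the
b-groupoid. -/
theorem norm_sq_add_le_of_mem_tube {x₀ : X} {v₀ : E (m + 1)} (h : (x₀, v₀) ∈ D.tube) :
    ∃ r > 0, ∀ z α, dist (D.emb z) (D.emb x₀) < r → D.rho z = Real.exp α * D.rho x₀ →
      ‖v₀‖ ^ 2 + 1 / 2 * ‖join (D.emb z - D.emb x₀) α‖ ^ 2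
        ≤ ‖v₀ - join (D.emb z - D.emb x₀) α‖ ^ 2 := by
  obtain ⟨hv, r, -, hg, hlt⟩ := h
  have h0 := norm_nonneg v₀
  simp only at hv hg hlt
  refine ⟨r, by linarith, fun z α hz hrel => ?_⟩
  have h1 := hg.2 x₀ z α v₀ (by rw [dist_self]; linarith) hz hrel hv (by linarith)
  rw [norm_sub_sq_real]
  linarith

variable [Nonempty X]

/-- The inverse of the b-exponential map on the image of the tube. -/
def expoInv : E m × ℝ → X × E (m + 1) :=
  Function.invFunOn (fun p : X × E (m + 1) => D.expo p.1 p.2) D.tube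

/-- The normal vector `v` at the point `expo x v` of the image of the tube. -/
def vec (P : E m × ℝ) : E (m + 1) := (D.expoInv P).2

theorem expoInv_mem {P : E m × ℝ} (h : P ∈ D.tubeImage) : D.expoInv P ∈ D.tube :=
  Function.invFunOn_mem h

theorem expo_expoInv {P : E m × ℝ} (h : P ∈ D.tubeImage) :
    D.expo (D.expoInv P).1 (D.vec P) = P :=
  Function.invFunOn_eq h

theorem expoInv_expo {x : X} {v : E (m + 1)} (h : (x, v) ∈ D.tube) :
    D.expoInv (D.expo x v) = (x, v) :=
  D.expo_injOn (D.expoInv_mem (expo_mem_tubeImage h)) h (D.expo_expoInv (expo_mem_tubeImage h))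

theorem vec_expo {x : X} {v : E (m + 1)} (h : (x, v) ∈ D.tube) : D.vec (D.expo x v) = v := by
  rw [vec, D.expoInv_expo h]

theorem emb_expoInv {P : E m × ℝ} (h : P ∈ D.tubeImage) :
    D.emb (D.expoInv P).1 = P.1 - front (D.vec P) :=
  eq_sub_of_add_eq (congrArg Prod.fst (D.expo_expoInv h))

theorem rho_expoInv {P : E m × ℝ} (h : P ∈ D.tubeImage) :
    D.rho (D.expoInv P).1 * Real.exp (height (D.vec P)) = P.2 :=
  congrArg Prod.snd (D.expo_expoInv h)

theorem isNrm_vec {P : E m × ℝ} (h : P ∈ D.tubeImage) : D.IsNrm (D.expoInv P).1 (D.vec P) :=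
  (D.expoInv_mem h).1

variable [IsManifold (𝓡∂ n) ∞ X]

omit [Nonempty X] in
theorem tubeImage_mem_nhdsWithin {P : E m × ℝ} (h : P ∈ D.tubeImage) :
    D.tubeImage ∈ 𝓝[half m] P := by
  obtain ⟨q, hq, rfl⟩ := h
  filter_upwards [D.exists_expo_eq (x₀ := q.1) (v₀ := q.2) hq univ_mem] with P ⟨q', _, h1, h2⟩
  exact ⟨q', h1, h2⟩

theorem tendsto_expoInv {P : E m × ℝ} (h : P ∈ D.tubeImage) :
    Tendsto D.expoInv (𝓝[half m] P) (𝓝 (D.expoInv P)) := by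
  intro U hU
  have h1 := D.exists_expo_eq (x₀ := (D.expoInv P).1) (v₀ := (D.expoInv P).2) (D.expoInv_mem h) hU
  have h2 := D.expo_expoInv h
  rw [vec] at h2
  rw [h2] at h1
  rw [mem_map]
  filter_upwards [h1] with Q ⟨q, hqU, hq, hqQ⟩
  rw [mem_preimage, ← hqQ, D.expoInv_expo hq]
  exact hqU

theorem tendsto_vec {P : E m × ℝ} (h : P ∈ D.tubeImage) :
    Tendsto D.vec (𝓝[half m] P) (𝓝 (D.vec P)) :=
  (continuous_snd.tendsto _).comp (D.tendsto_expoInv h)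

/-- Over the open half space, in logarithmic coordinates, the normal vector depends smoothly on
the point: it is the shortest vector to the submanifold `(emb, log rho)`. -/
theorem contDiffAt_vec_logc {W₀ : E (m + 1)} (h : logc W₀ ∈ D.tubeImage) :
    ContDiffAt ℝ ∞ (fun W : E (m + 1) => D.vec (logc W)) W₀ := by
  set x₀ := (D.expoInv (logc W₀)).1 with hx₀
  set v₀ := D.vec (logc W₀) with hv₀
  have hmem : (x₀, v₀) ∈ D.tube := D.expoInv_mem h
  have hρ : ∀ W, logc W ∈ D.tubeImage → 0 < D.rho (D.expoInv (logc W)).1 ∧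
      Real.log (D.rho (D.expoInv (logc W)).1) = height W - height (D.vec (logc W)) := by
    intro W hW
    have h1 := D.rho_expoInv hW
    have h2 : (0 : ℝ) < (logc W).2 := Real.exp_pos _
    have h3 : 0 < D.rho (D.expoInv (logc W)).1 := by
      rw [← h1] at h2
      exact pos_of_mul_pos_left h2 (Real.exp_pos _).le
    refine ⟨h3, ?_⟩
    have h4 := congrArg Real.log h1
    rw [Real.log_mul h3.ne' (Real.exp_pos _).ne', Real.log_exp, logc, Real.log_exp] at h4
    simp only [logc] at h4 ⊢
    linarith
  obtain ⟨hρ₀, hlog₀⟩ := hρ W₀ h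
  rw [← hx₀, ← hv₀] at hlog₀
  rw [← hx₀] at hρ₀
  have hsrc := mem_extChartAt_source (I := 𝓡∂ n) x₀
  set χ := extChartAt (𝓡∂ n) x₀ with hχ
  set a₀ := χ x₀ with ha₀
  have hat : a₀ ∈ χ.target := mem_extChartAt_target x₀
  have har : ∀ a ∈ χ.target, 0 < D.rhoC x₀ a → χ.target ∈ 𝓝 a := fun a ha hpos => by
    have h0 : a 0 ≠ 0 := fun h0 => hpos.ne' ((D.rhoC_eq_zero_iff ha).2 h0)
    have h1 : 0 ≤ a 0 := mem_range_iff.1 (extChartAt_target_subset_range x₀ ha)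
    have hint : range (𝓡∂ n) ∈ 𝓝 a := by
      rw [← mem_interior_iff_mem_nhds, interior_range_modelWithCornersEuclideanHalfSpace]
      exact lt_of_le_of_ne h1 (Ne.symm h0)
    have h3 := extChartAt_target_mem_nhdsWithin_of_mem ha
    rwa [nhdsWithin_eq_nhds.2 hint] at h3
  have hρC₀ : D.rhoC x₀ a₀ = D.rho x₀ := D.rhoC_apply hsrc
  have hEC₀ : D.embC x₀ a₀ = D.emb x₀ := D.embC_apply hsrc
  have hnb : χ.target ∈ 𝓝 a₀ := har a₀ hat (by rw [hρC₀]; exact hρ₀)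
  have hE : ∀ a ∈ χ.target, 0 < D.rhoC x₀ a → ContDiffAt ℝ ∞ (D.embC x₀) a := fun a ha hp =>
    ((D.contDiffOn_embC x₀) a ha).contDiffAt (har a ha hp)
  have hR : ∀ a ∈ χ.target, 0 < D.rhoC x₀ a → ContDiffAt ℝ ∞ (D.rhoC x₀) a := fun a ha hp =>
    ((D.contDiffOn_rhoC x₀) a ha).contDiffAt (har a ha hp)
  let φ : E n → E (m + 1) := fun a => join (D.embC x₀ a) (Real.log (D.rhoC x₀ a))
  have hpos₀ : 0 < D.rhoC x₀ a₀ := by rw [hρC₀]; exact hρ₀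
  have hφ : ContDiffAt ℝ ∞ φ a₀ :=
    contDiff_join.contDiffAt.comp a₀ ((hE a₀ hat hpos₀).prodMk ((hR a₀ hat hpos₀).log hpos₀.ne'))
  let α : E (m + 1) → E n := fun W => χ (D.expoInv (logc W)).1
  have htl : Tendsto (fun W : E (m + 1) => logc W) (𝓝 W₀) (𝓝[half m] (logc W₀)) :=
    tendsto_nhdsWithin_iff.2 ⟨continuous_logc.tendsto _, Eventually.of_forall logc_mem_half⟩
  have htx : Tendsto (fun W : E (m + 1) => (D.expoInv (logc W)).1) (𝓝 W₀) (𝓝 x₀) :=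
    (continuous_fst.tendsto _).comp ((D.tendsto_expoInv h).comp htl)
  have hα : ContinuousAt α W₀ := by
    have h1 : Tendsto χ (𝓝 x₀) (𝓝 a₀) := continuousAt_extChartAt (I := 𝓡∂ n) x₀
    exact h1.comp htx
  have hWv : W₀ - φ a₀ = v₀ := by
    simp only [φ]
    rw [hEC₀, hρC₀, hlog₀, D.emb_expoInv h, ← hv₀, ← height_sub,
      show (logc W₀).1 - front v₀ = front (W₀ - v₀) from rfl, join_front_height, sub_sub_cancel]
  obtain ⟨c, hc, s, hs, hlow⟩ := D.exists_norm_sub_le x₀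
  obtain ⟨r, hr, hmin⟩ := D.norm_sq_add_le_of_mem_tube hmem
  have hev : ∀ᶠ W in 𝓝 W₀, logc W ∈ D.tubeImage := htl (D.tubeImage_mem_nhdsWithin h)
  have hsrc_ev : ∀ᶠ W in 𝓝 W₀, (D.expoInv (logc W)).1 ∈ χ.source :=
    htx (extChartAt_source_mem_nhds (I := 𝓡∂ n) x₀)
  have hvec : ∀ᶠ W in 𝓝 W₀, W - φ (α W) = D.vec (logc W) := by
    filter_upwards [hev, hsrc_ev] with W hW hWs
    simp only [φ, α]
    rw [D.embC_apply hWs, D.rhoC_apply hWs, (hρ W hW).2, D.emb_expoInv hW, ← height_sub,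
      show (logc W).1 - front (D.vec (logc W)) = front (W - D.vec (logc W)) from rfl,
      join_front_height, sub_sub_cancel]
  have hsm : ContDiffAt ℝ ∞ α W₀ := by
    refine contDiffAt_of_critical (φ := φ) (a₀ := a₀) (κ := 1 / (2 * c ^ 2)) hφ (by positivity)
      ?_ hα rfl ?_
    · have hs' : s ∈ 𝓝 a₀ := by
        have hint : range (𝓡∂ n) ∈ 𝓝 a₀ :=
          mem_of_superset hnb (extChartAt_target_subset_range x₀)
        rwa [nhdsWithin_eq_nhds.2 hint] at hs
      have hd : ∀ᶠ a in 𝓝 a₀, dist (D.embC x₀ a) (D.embC x₀ a₀) < r :=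
        (hE a₀ hat hpos₀).continuousAt.eventually (Metric.ball_mem_nhds _ hr)
      filter_upwards [hs', hnb, hd, (hR a₀ hat hpos₀).continuousAt.tendsto.eventually_const_lt
        hpos₀] with a has hat' had hap
      have h1 := hlow a₀ (mem_of_mem_nhds hs') a has
      have h2 := hmin (χ.symm a) (Real.log (D.rhoC x₀ a) - Real.log (D.rho x₀))
        (by rw [← hEC₀]; exact had)
        (by rw [Real.exp_sub, Real.exp_log hap, Real.exp_log hρ₀, div_mul_cancel₀ _ hρ₀.ne']; rfl)
      have e : join (D.emb (χ.symm a) - D.emb x₀) (Real.log (D.rhoC x₀ a) - Real.log (D.rho x₀))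
          = φ a - φ a₀ := by
        simp only [φ]
        rw [hEC₀, hρC₀, sub_eq_add_neg (Real.log _), sub_eq_add_neg, join_add, join_neg,
          ← sub_eq_add_neg]
        rfl
      rw [e] at h2
      have e2 : v₀ - (φ a - φ a₀) = W₀ - φ a := by rw [← hWv]; abel
      rw [e2] at h2
      rw [hWv]
      refine le_trans (add_le_add le_rfl ?_) h2
      have h3 : ‖D.embC x₀ a - D.embC x₀ a₀‖ ≤ ‖φ a - φ a₀‖ := by
        rw [← e, hEC₀]
        exact norm_le_norm_join _ _
      have h4 : ‖a - a₀‖ ^ 2 ≤ c ^ 2 * ‖φ a - φ a₀‖ ^ 2 := by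
        rw [← mul_pow]
        exact pow_le_pow_left₀ (norm_nonneg _) (h1.trans (mul_le_mul_of_nonneg_left h3 hc.le)) 2
      calc 1 / (2 * c ^ 2) * ‖a - a₀‖ ^ 2
          ≤ 1 / (2 * c ^ 2) * (c ^ 2 * ‖φ a - φ a₀‖ ^ 2) :=
            mul_le_mul_of_nonneg_left h4 (by positivity)
        _ = 1 / 2 * ‖φ a - φ a₀‖ ^ 2 := by field_simp
    · filter_upwards [hev, hsrc_ev, hvec] with W hW hWs hWv' ξ
      rw [hWv']
      have hat' : α W ∈ χ.target := χ.map_source hWs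
      have hρW : D.rhoC x₀ (α W) = D.rho (D.expoInv (logc W)).1 := D.rhoC_apply hWs
      have hp : 0 < D.rhoC x₀ (α W) := by rw [hρW]; exact (hρ W hW).1
      have hnb' := har _ hat' hp
      have hint : range (𝓡∂ n) ∈ 𝓝 (α W) :=
        mem_of_superset hnb' (extChartAt_target_subset_range x₀)
      have hdE : HasFDerivAt (D.embC x₀) (D.dEmbC x₀ (α W)) (α W) := by
        rw [dEmbC, fderivWithin_of_mem_nhds hint]
        exact ((hE _ hat' hp).differentiableAt (by simp)).hasFDerivAt
      have hdR : HasFDerivAt (D.rhoC x₀) (D.dRhoC x₀ (α W)) (α W) := by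
        rw [dRhoC, fderivWithin_of_mem_nhds hint]
        exact ((hR _ hat' hp).differentiableAt (by simp)).hasFDerivAt
      have hdφ : HasFDerivAt φ (((joinL m : (E m × ℝ) →L[ℝ] E (m + 1))).comp
          ((D.dEmbC x₀ (α W)).prod ((D.rhoC x₀ (α W))⁻¹ • D.dRhoC x₀ (α W)))) (α W) :=
        ((joinL m : (E m × ℝ) →L[ℝ] E (m + 1))).hasFDerivAt.comp (α W)
          (hdE.prodMk (hdR.log hp.ne'))
      rw [hdφ.fderiv]
      refine (D.isNrm_chart hWs).1 (D.isNrm_vec hW) ξ ((D.rhoC x₀ (α W))⁻¹ * D.dRhoC x₀ (α W) ξ) ?_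
      rw [← hρW, mul_inv_cancel_left₀ hp.ne']
  have hfin : ContDiffAt ℝ ∞ (fun W => W - φ (α W)) W₀ :=
    contDiffAt_id.sub (ContDiffAt.comp (g := φ) W₀ hφ hsm)
  exact hfin.congr_of_eventuallyEq (hvec.mono fun W hW => hW.symm)

/-- On the boundary of the half space the normal vector depends smoothly on the point: it is the
shortest vector to the submanifold `emb` of `∂X`. -/
theorem contDiffAt_vec_slice {p₀ : E m} (h : (p₀, (0 : ℝ)) ∈ D.tubeImage) :
    ContDiffAt ℝ ∞ (fun p : E m => D.vec (p, 0)) p₀ := by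
  set x₀ := (D.expoInv (p₀, 0)).1 with hx₀
  set v₀ := D.vec (p₀, 0) with hv₀
  have hmem : (x₀, v₀) ∈ D.tube := D.expoInv_mem h
  have hρ : ∀ p, (p, (0 : ℝ)) ∈ D.tubeImage → D.rho (D.expoInv (p, 0)).1 = 0 := fun p hp =>
    (mul_eq_zero.1 (D.rho_expoInv hp)).resolve_right (Real.exp_pos _).ne'
  have hvj : ∀ p, (p, (0 : ℝ)) ∈ D.tubeImage → D.vec (p, 0) = join (front (D.vec (p, 0))) 0 :=
    fun p hp => by
      have h1 := (D.isNrm_vec hp).height_eq_zero (hρ p hp)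
      have h2 := join_front_height (D.vec (p, 0))
      rw [h1] at h2
      exact h2.symm
  have hρ₀ : D.rho x₀ = 0 := hρ p₀ h
  have hsrc := mem_extChartAt_source (I := 𝓡∂ n) x₀
  set χ := extChartAt (𝓡∂ n) x₀ with hχ
  set a₀ := χ x₀ with ha₀
  have hat : a₀ ∈ χ.target := mem_extChartAt_target x₀
  have hρC₀ : D.rhoC x₀ a₀ = D.rho x₀ := D.rhoC_apply hsrc
  have hEC₀ : D.embC x₀ a₀ = D.emb x₀ := D.embC_apply hsrc
  have ha₀0 : a₀ 0 = 0 := (D.rhoC_eq_zero_iff hat).1 (hρC₀.trans hρ₀)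
  let V : Submodule ℝ (E n) := LinearMap.ker (EuclideanSpace.proj (𝕜 := ℝ) (0 : Fin n)).toLinearMap
  have hV : ∀ w : E n, w ∈ V ↔ w 0 = 0 := fun w => Iff.rfl
  have hVr : ∀ w : V, a₀ + w ∈ range (𝓡∂ n) := fun w => by
    rw [mem_range_iff, PiLp.add_apply, ha₀0, (hV w).1 w.2, add_zero]
  let ι : V → E n := fun w => a₀ + w
  have hι : ContDiff ℝ ∞ ι := contDiff_const.add V.subtypeL.contDiff
  have hιd : ∀ w, HasFDerivAt ι V.subtypeL w := fun w => V.subtypeL.hasFDerivAt.const_add a₀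
  let φ : V → E m := fun w => D.embC x₀ (ι w)
  have hι0 : ι 0 = a₀ := by simp [ι]
  have hφ : ContDiffAt ℝ ∞ φ 0 := by
    have h1 : ContDiffWithinAt ℝ ∞ (D.embC x₀) (range (𝓡∂ n)) (ι 0) := by
      rw [hι0]; exact D.contDiffWithinAt_embC hat
    have h2 := h1.comp (0 : V) (s := univ) hι.contDiffAt.contDiffWithinAt (fun w _ => hVr w)
    exact contDiffWithinAt_univ.1 h2
  have hφd : ∀ w, ι w ∈ χ.target →
      HasFDerivAt φ ((D.dEmbC x₀ (ι w)).comp V.subtypeL) w := fun w hw => by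
    have h1 := ((D.contDiffWithinAt_embC hw).differentiableWithinAt (by simp)).hasFDerivWithinAt
    exact (h1.comp w (s := univ) (hιd w).hasFDerivWithinAt
      (fun w _ => hVr w)).hasFDerivAt univ_mem
  let α : E m → V := fun p => V.orthogonalProjectionOnto (χ (D.expoInv (p, 0)).1 - a₀)
  have htl : Tendsto (fun p : E m => (p, (0 : ℝ))) (𝓝 p₀) (𝓝[half m] (p₀, 0)) :=
    tendsto_nhdsWithin_iff.2 ⟨by
      have : Continuous fun p : E m => (p, (0 : ℝ)) := by fun_prop
      exact this.tendsto _, Eventually.of_forall fun p => le_refl (0 : ℝ)⟩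
  have htx : Tendsto (fun p : E m => (D.expoInv (p, 0)).1) (𝓝 p₀) (𝓝 x₀) :=
    (continuous_fst.tendsto _).comp ((D.tendsto_expoInv h).comp htl)
  have hα0 : α p₀ = 0 := by
    simp only [α]
    rw [← hx₀, ← ha₀, sub_self, map_zero]
  have hα : ContinuousAt α p₀ := by
    have h1 : Tendsto χ (𝓝 x₀) (𝓝 a₀) := continuousAt_extChartAt (I := 𝓡∂ n) x₀
    exact V.orthogonalProjectionOnto.continuous.continuousAt.tendsto.comp
      ((h1.comp htx).sub tendsto_const_nhds)
  have hev : ∀ᶠ p in 𝓝 p₀, (p, (0 : ℝ)) ∈ D.tubeImage := htl (D.tubeImage_mem_nhdsWithin h)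
  have hsrc_ev : ∀ᶠ p in 𝓝 p₀, (D.expoInv (p, 0)).1 ∈ χ.source :=
    htx (extChartAt_source_mem_nhds (I := 𝓡∂ n) x₀)
  have hια : ∀ p, (p, (0 : ℝ)) ∈ D.tubeImage → (D.expoInv (p, 0)).1 ∈ χ.source →
      ι (α p) = χ (D.expoInv (p, 0)).1 := fun p hp hps => by
    have h0 : (χ (D.expoInv (p, 0)).1) 0 = 0 :=
      (D.rhoC_eq_zero_iff (χ.map_source hps)).1 ((D.rhoC_apply hps).trans (hρ p hp))
    have h1 : χ (D.expoInv (p, 0)).1 - a₀ ∈ V := by rw [hV, PiLp.sub_apply, h0, ha₀0, sub_zero]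
    simp only [ι, α]
    rw [Submodule.coe_orthogonalProjectionOnto_apply, Submodule.starProjection_eq_self_iff.2 h1]
    abel
  have hvec : ∀ᶠ p in 𝓝 p₀, p - φ (α p) = front (D.vec (p, 0)) := by
    filter_upwards [hev, hsrc_ev] with p hp hps
    simp only [φ]
    rw [hια p hp hps, D.embC_apply hps, D.emb_expoInv hp, sub_sub_cancel]
  have hpv : p₀ - φ 0 = front v₀ := by
    have := hvec.self_of_nhds
    rwa [hα0] at this
  obtain ⟨c, hc, s, hs, hlow⟩ := D.exists_norm_sub_le x₀
  obtain ⟨r, hr, hmin⟩ := D.norm_sq_add_le_of_mem_tube hmem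
  have hsm : ContDiffAt ℝ ∞ α p₀ := by
    refine contDiffAt_of_critical (φ := φ) (a₀ := 0) (κ := 1 / (2 * c ^ 2)) hφ (by positivity)
      ?_ hα hα0 ?_
    · have hιt : Tendsto ι (𝓝 0) (𝓝[range (𝓡∂ n)] a₀) := by
        refine tendsto_nhdsWithin_iff.2 ⟨?_, Eventually.of_forall fun w => hVr w⟩
        have := hι.continuous.tendsto 0
        rwa [hι0] at this
      have hd : ∀ᶠ w in 𝓝 (0 : V), dist (φ w) (φ 0) < r :=
        hφ.continuousAt.eventually (Metric.ball_mem_nhds _ hr)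
      filter_upwards [hιt hs, hιt (extChartAt_target_mem_nhdsWithin (I := 𝓡∂ n) x₀), hd]
        with w hws hwt hwd
      have h1 := hlow a₀ (mem_of_mem_nhdsWithin
        (extChartAt_target_subset_range x₀ hat) hs) (ι w) hws
      have hφ0 : φ 0 = D.emb x₀ := by simp only [φ]; rw [hι0, hEC₀]
      have hρw : D.rho (χ.symm (ι w)) = 0 :=
        (D.rhoC_eq_zero_iff hwt).2 (by
          simp only [ι]; rw [PiLp.add_apply, ha₀0, (hV w).1 w.2, add_zero])
      have h2 := hmin (χ.symm (ι w)) 0 (by rw [← hφ0]; exact hwd) (by rw [hρw, hρ₀, mul_zero])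
      have e1 : D.emb (χ.symm (ι w)) - D.emb x₀ = φ w - φ 0 := by rw [hφ0]; rfl
      have hv₀j : v₀ = join (front v₀) 0 := hvj p₀ h
      rw [e1, hv₀j] at h2
      rw [sub_eq_add_neg (join _ _), ← join_neg, ← join_add] at h2
      simp only [norm_sq_eq_front_height, front_join, height_join] at h2
      have e2 : front v₀ + -(φ w - φ 0) = p₀ - φ w := by rw [← hpv]; abel
      rw [e2] at h2
      rw [hpv, sub_zero]
      have h4 : ‖(w : E n)‖ ^ 2 ≤ c ^ 2 * ‖φ w - φ 0‖ ^ 2 := by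
        rw [← mul_pow]
        refine pow_le_pow_left₀ (norm_nonneg _) ?_ 2
        have : φ 0 = D.embC x₀ a₀ := by simp only [φ]; rw [hι0]
        rw [this]
        simpa [ι] using h1
      have h5 : 1 / (2 * c ^ 2) * ‖w‖ ^ 2 ≤ 1 / 2 * ‖φ w - φ 0‖ ^ 2 :=
        calc 1 / (2 * c ^ 2) * ‖w‖ ^ 2 ≤ 1 / (2 * c ^ 2) * (c ^ 2 * ‖φ w - φ 0‖ ^ 2) :=
              mul_le_mul_of_nonneg_left h4 (by positivity)
          _ = 1 / 2 * ‖φ w - φ 0‖ ^ 2 := by field_simp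
      linarith
    · filter_upwards [hev, hsrc_ev, hvec] with p hp hps hpv' ξ
      have hat' : ι (α p) ∈ χ.target := by rw [hια p hp hps]; exact χ.map_source hps
      rw [hpv', (hφd _ hat').fderiv]
      have h0 : (ι (α p)) 0 = 0 := by
        simp only [ι]; rw [PiLp.add_apply, ha₀0, (hV _).1 (α p).2, add_zero]
      have h1 : D.dRhoC x₀ (ι (α p)) ξ = 0 := D.dRhoC_eq_zero_of hat' h0 ((hV _).1 ξ.2)
      have h2 := (D.isNrm_chart hps).1 (D.isNrm_vec hp) ξ 0
        (by rw [← hια p hp hps, h1, mul_zero])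
      rw [inner_eq_front_height, front_join, height_join, mul_zero, add_zero,
        ← hια p hp hps] at h2
      exact h2
  have hfin : ContDiffAt ℝ ∞ (fun p => join (p - φ (α p)) 0) p₀ := by
    have h1 : ContDiffAt ℝ ∞ (fun p => p - φ (α p)) p₀ :=
      contDiffAt_id.sub (ContDiffAt.comp (g := φ) p₀ (by rw [hα0]; exact hφ) hsm)
    exact contDiff_join.contDiffAt.comp p₀ (h1.prodMk contDiffAt_const)
  refine hfin.congr_of_eventuallyEq ?_
  filter_upwards [hvec, hev] with p hp hp'
  rw [hp, ← hvj p hp']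

end BoundaryEmbedding

namespace BoundaryEmbedding

variable {n m : ℕ} [NeZero n] {X : Type*} [TopologicalSpace X]
  [ChartedSpace (EuclideanHalfSpace n) X] (D : BoundaryEmbedding n m X)

/-! ### Cutoff functions supported in the tubular neighbourhood -/

section Pull

variable [Nonempty X] {W : Type*} [NormedAddCommGroup W]

open Classical in
/-- A function of the foot point `emb x` and of the normal vector `v`, regarded as a function of
`expo x v`; it is extended by zero. -/
def pull (f : E m × E (m + 1) → W) (P : E m × ℝ) : W :=
  if P ∈ D.tubeImage then f (P.1 - front (D.vec P), D.vec P) else 0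

theorem pull_of_mem (f : E m × E (m + 1) → W) {P : E m × ℝ} (h : P ∈ D.tubeImage) :
    D.pull f P = f (P.1 - front (D.vec P), D.vec P) := if_pos h

theorem pull_of_notMem (f : E m × E (m + 1) → W) {P : E m × ℝ} (h : P ∉ D.tubeImage) :
    D.pull f P = 0 := if_neg h

theorem pull_expo (f : E m × E (m + 1) → W) {x : X} {v : E (m + 1)} (h : (x, v) ∈ D.tube) :
    D.pull f (D.expo x v) = f (D.emb x, v) := by
  rw [D.pull_of_mem f (expo_mem_tubeImage h), ← D.emb_expoInv (expo_mem_tubeImage h),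
    D.vec_expo h, D.expoInv_expo h]

theorem mem_of_pull_ne_zero {f : E m × E (m + 1) → W} {K : Set (X × E (m + 1))}
    (hf : ∀ x v, D.IsNrm x v → f (D.emb x, v) ≠ 0 → (x, v) ∈ K) {P : E m × ℝ}
    (h : D.pull f P ≠ 0) : P ∈ (fun p : X × E (m + 1) => D.expo p.1 p.2) '' K := by
  by_cases hP : P ∈ D.tubeImage
  · rw [D.pull_of_mem f hP, ← D.emb_expoInv hP] at h
    exact ⟨_, hf _ _ (D.isNrm_vec hP) h, D.expo_expoInv hP⟩
  · exact absurd (D.pull_of_notMem f hP) h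

variable [IsManifold (𝓡∂ n) ∞ X] {f : E m × E (m + 1) → W} {K : Set (X × E (m + 1))}
  (hK : IsCompact K) (hKt : K ⊆ D.tube)
  (hfK : ∀ x v, D.IsNrm x v → f (D.emb x, v) ≠ 0 → (x, v) ∈ K)

include hK hKt hfK

omit [IsManifold (𝓡∂ n) ∞ X] in
/-- The support of `f` is compact in the tube, so the extension by zero is smooth across the
boundary of the image of the tube. -/
theorem eventually_pull_eq_zero {P : E m × ℝ} (h : P ∉ D.tubeImage) :
    ∀ᶠ Q in 𝓝 P, D.pull f Q = 0 := by
  have hcl : IsClosed ((fun p : X × E (m + 1) => D.expo p.1 p.2) '' K) :=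
    (hK.image D.continuous_expo).isClosed
  filter_upwards [hcl.isOpen_compl.mem_nhds (fun hP => h (image_mono hKt hP))] with Q hQ
  by_contra hne
  exact hQ (D.mem_of_pull_ne_zero hfK hne)

theorem continuousOn_pull (hf : Continuous f) : ContinuousOn (D.pull f) (half m) := by
  intro P hP
  by_cases h : P ∈ D.tubeImage
  · have h1 : ContinuousWithinAt (fun Q => f (Q.1 - front (D.vec Q), D.vec Q)) (half m) P := by
      have hv : ContinuousWithinAt D.vec (half m) P := D.tendsto_vec h
      have h2 : ContinuousWithinAt (fun Q : E m × ℝ => (Q.1 - front (D.vec Q), D.vec Q))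
          (half m) P :=
        (continuous_fst.continuousWithinAt.sub
          (continuous_front.continuousAt.comp_continuousWithinAt hv)).prodMk hv
      exact hf.continuousAt.comp_continuousWithinAt h2
    refine h1.congr_of_eventuallyEq ?_ (D.pull_of_mem f h)
    filter_upwards [D.tubeImage_mem_nhdsWithin h] with Q hQ using D.pull_of_mem f hQ
  · have h1 := D.eventually_pull_eq_zero hK hKt hfK h
    refine (continuousWithinAt_const (b := (0 : W))).congr_of_eventuallyEq
      (mem_nhdsWithin_of_mem_nhds h1) (D.pull_of_notMem f h)

variable [NormedSpace ℝ W]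

theorem contDiff_pull_logc (hf : ContDiff ℝ ∞ f) : ContDiff ℝ ∞ (fun W₁ => D.pull f (logc W₁)) := by
  rw [contDiff_iff_contDiffAt]
  intro W₀
  by_cases h : logc W₀ ∈ D.tubeImage
  · have hv := D.contDiffAt_vec_logc h
    have h1 : ContDiffAt ℝ ∞ (fun W₁ : E (m + 1) =>
        f ((logc W₁).1 - front (D.vec (logc W₁)), D.vec (logc W₁))) W₀ :=
      hf.contDiffAt.comp W₀ (((frontL m).contDiff.contDiffAt.sub
        ((frontL m).contDiff.contDiffAt.comp W₀ hv)).prodMk hv)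
    have htl : Tendsto (fun W : E (m + 1) => logc W) (𝓝 W₀) (𝓝[half m] (logc W₀)) :=
      tendsto_nhdsWithin_iff.2 ⟨continuous_logc.tendsto _, Eventually.of_forall logc_mem_half⟩
    refine h1.congr_of_eventuallyEq ?_
    filter_upwards [htl (D.tubeImage_mem_nhdsWithin h)] with W₁ hW using D.pull_of_mem f hW
  · refine (contDiffAt_const (c := (0 : W))).congr_of_eventuallyEq ?_
    exact (continuous_logc.tendsto W₀).eventually (D.eventually_pull_eq_zero hK hKt hfK h)

theorem contDiff_pull_slice (hf : ContDiff ℝ ∞ f) :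
    ContDiff ℝ ∞ (fun p : E m => D.pull f (p, 0)) := by
  rw [contDiff_iff_contDiffAt]
  intro p₀
  have hc : Continuous fun p : E m => (p, (0 : ℝ)) := by fun_prop
  by_cases h : (p₀, (0 : ℝ)) ∈ D.tubeImage
  · have hv := D.contDiffAt_vec_slice h
    have h1 : ContDiffAt ℝ ∞ (fun p : E m =>
        f (p - front (D.vec (p, 0)), D.vec (p, 0))) p₀ :=
      hf.contDiffAt.comp p₀ ((contDiffAt_id.sub
        ((frontL m).contDiff.contDiffAt.comp p₀ hv)).prodMk hv)
    have htl : Tendsto (fun p : E m => (p, (0 : ℝ))) (𝓝 p₀) (𝓝[half m] (p₀, 0)) :=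
      tendsto_nhdsWithin_iff.2 ⟨hc.tendsto _, Eventually.of_forall fun p => le_refl (0 : ℝ)⟩
    refine h1.congr_of_eventuallyEq ?_
    filter_upwards [htl (D.tubeImage_mem_nhdsWithin h)] with p hp using D.pull_of_mem f hp
  · refine (contDiffAt_const (c := (0 : W))).congr_of_eventuallyEq ?_
    exact (hc.tendsto p₀).eventually (D.eventually_pull_eq_zero hK hKt hfK h)

end Pull

/-- The function `β(p, |v|²)` of a foot point `p` and a normal vector `v`. -/
def wgt (β : E m × ℝ → ℝ) (q : E m × E (m + 1)) : ℝ := β (q.1, ‖q.2‖ ^ 2)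

/-- The vector `β(p, |v|²) v`. -/
def wvec (β : E m × ℝ → ℝ) (q : E m × E (m + 1)) : E (m + 1) := wgt β q • q.2

theorem contDiff_wgt {β : E m × ℝ → ℝ} (h : ContDiff ℝ ∞ β) : ContDiff ℝ ∞ (wgt β) :=
  h.comp (contDiff_fst.prodMk (contDiff_snd.norm_sq ℝ))

theorem contDiff_wvec {β : E m × ℝ → ℝ} (h : ContDiff ℝ ∞ β) : ContDiff ℝ ∞ (wvec β) :=
  (contDiff_wgt h).smul contDiff_snd

/-- A bump function near a point of `X`. -/
theorem exists_bump [IsManifold (𝓡∂ n) ∞ X] (x : X) :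
    ∃ (β : E m × ℝ → ℝ) (K : Set (X × E (m + 1))), ContDiff ℝ ∞ β ∧ (∀ z, 0 ≤ β z) ∧
      (∀ z, β z ≤ 1) ∧ (∀ p, Antitone fun r => β (p, r)) ∧ IsCompact K ∧ K ⊆ D.tube ∧
      (∀ y v, D.IsNrm y v → β (D.emb y, ‖v‖ ^ 2) ≠ 0 → (y, v) ∈ K) ∧
      ∃ U ∈ 𝓝 x, ∀ y ∈ U, 0 < β (D.emb y, 0) := by
  obtain ⟨r₀, hr₀, hg₀⟩ := D.exists_good x
  set r := min r₀ 1 with hr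
  have hr0 : 0 < r := by positivity
  have hg : D.Good x r := hg₀.mono (min_le_left _ _)
  set ε := r / 16 with hε
  have hε0 : 0 < ε := by positivity
  let g : ContDiffBump (D.emb x) := ⟨ε / 2, ε, by positivity, by linarith⟩
  let β : E m × ℝ → ℝ := fun z => g z.1 * Real.smoothTransition (1 - z.2 / ε ^ 2)
  have hsm : ContDiff ℝ ∞ β :=
    (g.contDiff.comp contDiff_fst).mul
      (Real.smoothTransition.contDiff.comp (contDiff_const.sub (contDiff_snd.div_const _)))
  let K : Set (X × E (m + 1)) :=
    ((D.emb ⁻¹' Metric.closedBall (D.emb x) ε) ×ˢ Metric.closedBall 0 ε)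
      ∩ {p | D.IsNrm p.1 p.2}
  refine ⟨β, K, hsm, fun z => mul_nonneg g.nonneg (Real.smoothTransition.nonneg _),
    fun z => mul_le_one₀ g.le_one (Real.smoothTransition.nonneg _) (Real.smoothTransition.le_one _),
    fun p a b hab => ?_, ?_, ?_, fun y v hv hne => ?_, D.emb ⁻¹' Metric.ball (D.emb x) ε, ?_,
    fun y hy => ?_⟩
  · refine mul_le_mul_of_nonneg_left (Real.smoothTransition.monotone ?_) g.nonneg
    have : a / ε ^ 2 ≤ b / ε ^ 2 := by gcongr
    simp only
    linarith
  · exact ((hg.1 ε (by linarith)).prod (isCompact_closedBall _ _)).inter_right D.isClosed_isNrm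
  · rintro ⟨y, v⟩ ⟨⟨hy, hv⟩, hn⟩
    rw [mem_preimage, Metric.mem_closedBall] at hy
    rw [mem_closedBall_zero_iff] at hv
    have := dist_nonneg (x := D.emb y) (y := D.emb x)
    have hr1 : r ≤ 1 := min_le_right _ _
    simp only at hv hy
    exact ⟨hn, r - dist (D.emb y) (D.emb x), by linarith, hg.shift, by simp only; linarith⟩
  · have h1 : g (D.emb y) ≠ 0 := left_ne_zero_of_mul hne
    have h2 : Real.smoothTransition (1 - ‖v‖ ^ 2 / ε ^ 2) ≠ 0 := right_ne_zero_of_mul hne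
    have h3 : D.emb y ∈ Metric.ball (D.emb x) ε := by
      have := g.support_eq
      rw [← this]
      exact h1
    have h4 : 0 < 1 - ‖v‖ ^ 2 / ε ^ 2 := by
      by_contra h
      exact h2 (Real.smoothTransition.zero_of_nonpos (not_lt.1 h))
    have h5 : ‖v‖ ^ 2 < ε ^ 2 := by
      rw [sub_pos, div_lt_one (by positivity)] at h4
      exact h4
    exact ⟨⟨Metric.ball_subset_closedBall h3, mem_closedBall_zero_iff.2
      (lt_of_pow_lt_pow_left₀ 2 hε0.le h5).le⟩, hv⟩
  · exact D.continuous_emb.continuousAt.preimage_mem_nhds (Metric.ball_mem_nhds _ hε0)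
  · refine mul_pos ?_ (Real.smoothTransition.pos_of_pos (by simp))
    refine lt_of_le_of_ne g.nonneg (Ne.symm ?_)
    have : D.emb y ∈ Function.support g := by rw [g.support_eq]; exact hy
    exact this

/-- A cutoff function `β(p, r)` of the foot point and the squared length of a normal vector. It is
positive on the zero section and vanishes outside the tube, so fast towards the boundary of
the tube that `β` and `β v`, extended by zero, are smooth. -/
structure Cutoff [Nonempty X] where
  β : E m × ℝ → ℝ
  contDiff : ContDiff ℝ ∞ β
  nonneg : ∀ z, 0 ≤ β z
  antitone : ∀ p, Antitone fun r => β (p, r)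
  pos : ∀ x, 0 < β (D.emb x, 0)
  mem_tube : ∀ x v, D.IsNrm x v → 0 < β (D.emb x, ‖v‖ ^ 2) → (x, v) ∈ D.tube
  continuousOn_wgt : ContinuousOn (D.pull (wgt β)) (half m)
  continuousOn_wvec : ContinuousOn (D.pull (wvec β)) (half m)
  contDiff_wgt_logc : ContDiff ℝ ∞ fun W => D.pull (wgt β) (logc W)
  contDiff_wvec_logc : ContDiff ℝ ∞ fun W => D.pull (wvec β) (logc W)
  contDiff_wgt_slice : ContDiff ℝ ∞ fun p : E m => D.pull (wgt β) (p, 0)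
  contDiff_wvec_slice : ContDiff ℝ ∞ fun p : E m => D.pull (wvec β) (p, 0)

/-- A cutoff function is a series of bump functions on the tube; the coefficients are chosen so
small that the series and all its pullbacks converge smoothly. -/
theorem nonempty_cutoff [Nonempty X] [IsManifold (𝓡∂ n) ∞ X] : Nonempty D.Cutoff := by
  have := D.isSmoothEmbedding.isEmbedding.secondCountableTopology
  choose B K hsm hnn hle hanti hKc hKt hBK U hU hpos using D.exists_bump
  obtain ⟨s, hs, hcov⟩ := TopologicalSpace.countable_cover_nhds hU
  have hsne : s.Nonempty := by
    obtain ⟨x⟩ := ‹Nonempty X›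
    have : x ∈ ⋃ x ∈ s, U x := by rw [hcov]; trivial
    obtain ⟨y, hy, -⟩ := mem_iUnion₂.1 this
    exact ⟨y, hy⟩
  obtain ⟨x, rfl⟩ := hs.exists_eq_range hsne
  have hg : ∀ i y v, D.IsNrm y v → wgt (B (x i)) (D.emb y, v) ≠ 0 → (y, v) ∈ K (x i) :=
    fun i y v hv hne => hBK (x i) y v hv hne
  have hG : ∀ i y v, D.IsNrm y v → wvec (B (x i)) (D.emb y, v) ≠ 0 → (y, v) ∈ K (x i) :=
    fun i y v hv hne => hBK (x i) y v hv (left_ne_zero_of_smul hne)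
  obtain ⟨c₁, hc₁, h₁⟩ := exists_coeff_contDiff_tsum (fun i => B (x i)) fun i => hsm _
  obtain ⟨c₂, hc₂, h₂⟩ := exists_coeff_contDiff_tsum
    (fun i (W : E (m + 1)) => D.pull (wgt (B (x i))) (logc W)) fun i =>
      D.contDiff_pull_logc (hKc _) (hKt _) (hg i) (contDiff_wgt (hsm _))
  obtain ⟨c₃, hc₃, h₃⟩ := exists_coeff_contDiff_tsum
    (fun i (W : E (m + 1)) => D.pull (wvec (B (x i))) (logc W)) fun i =>
      D.contDiff_pull_logc (hKc _) (hKt _) (hG i) (contDiff_wvec (hsm _))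
  obtain ⟨c₄, hc₄, h₄⟩ := exists_coeff_contDiff_tsum
    (fun i (p : E m) => D.pull (wgt (B (x i))) (p, 0)) fun i =>
      D.contDiff_pull_slice (hKc _) (hKt _) (hg i) (contDiff_wgt (hsm _))
  obtain ⟨c₅, hc₅, h₅⟩ := exists_coeff_contDiff_tsum
    (fun i (p : E m) => D.pull (wvec (B (x i))) (p, 0)) fun i =>
      D.contDiff_pull_slice (hKc _) (hKt _) (hG i) (contDiff_wvec (hsm _))
  let c : ℕ → ℝ := fun i =>
    min (min (min (c₁ i) (c₂ i)) (min (c₃ i) (c₄ i))) (min (c₅ i) ((1 / 2) ^ i))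
  have hc : ∀ i, 0 < c i := fun i => by
    have := hc₁ i; have := hc₂ i; have := hc₃ i; have := hc₄ i; have := hc₅ i
    positivity
  have hcg : ∀ i, c i ≤ (1 / 2) ^ i := fun i => (min_le_right _ _).trans (min_le_right _ _)
  let β : E m × ℝ → ℝ := fun z => ∑' i, c i • B (x i) z
  have hterm : ∀ z i, 0 ≤ c i • B (x i) z := fun z i => mul_nonneg (hc i).le (hnn _ _)
  have hsummable : ∀ z, Summable fun i => c i • B (x i) z := fun z =>
    Summable.of_nonneg_of_le (hterm z) (fun i => by
      rw [smul_eq_mul]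
      exact (mul_le_of_le_one_right (hc i).le (hle _ _)).trans (hcg i))
      (summable_geometric_of_lt_one (by norm_num) (by norm_num : (1 / 2 : ℝ) < 1))
  have hwgt : ∀ P, D.pull (wgt β) P = ∑' i, c i • D.pull (wgt (B (x i))) P := fun P => by
    by_cases hP : P ∈ D.tubeImage
    · simp only [D.pull_of_mem _ hP]
      rfl
    · simp only [D.pull_of_notMem _ hP, smul_zero, tsum_zero]
  have hwvec : ∀ P, D.pull (wvec β) P = ∑' i, c i • D.pull (wvec (B (x i))) P := fun P => by
    by_cases hP : P ∈ D.tubeImage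
    · simp only [D.pull_of_mem _ hP, wvec]
      change (∑' i, c i • B (x i) _) • _ = _
      rw [← (hsummable _).tsum_smul_const]
      simp only [smul_smul, smul_eq_mul, wgt]
    · simp only [D.pull_of_notMem _ hP, smul_zero, tsum_zero]
  have hb1 : ∀ i P, ‖c i • D.pull (wgt (B (x i))) P‖ ≤ (1 / 2) ^ i := fun i P => by
    rw [norm_smul, Real.norm_of_nonneg (hc i).le]
    refine (mul_le_of_le_one_right (hc i).le ?_).trans (hcg i)
    by_cases hP : P ∈ D.tubeImage
    · rw [D.pull_of_mem _ hP, wgt, Real.norm_of_nonneg (hnn _ _)]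
      exact hle _ _
    · rw [D.pull_of_notMem _ hP, norm_zero]
      exact zero_le_one
  have hb2 : ∀ i P, ‖c i • D.pull (wvec (B (x i))) P‖ ≤ (1 / 2) ^ i := fun i P => by
    rw [norm_smul, Real.norm_of_nonneg (hc i).le]
    refine (mul_le_of_le_one_right (hc i).le ?_).trans (hcg i)
    by_cases hP : P ∈ D.tubeImage
    · rw [D.pull_of_mem _ hP, wvec, norm_smul, wgt, Real.norm_of_nonneg (hnn _ _)]
      refine mul_le_one₀ (hle _ _) (norm_nonneg _) ?_
      have h1 : ‖D.vec P‖ < 1 / 8 := norm_lt_of_mem_tube (D.expoInv_mem hP)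
      simp only
      linarith
    · rw [D.pull_of_notMem _ hP, norm_zero]
      exact zero_le_one
  have hgeo := summable_geometric_of_lt_one (by norm_num) (by norm_num : (1 / 2 : ℝ) < 1)
  refine ⟨{ β := β, contDiff := ?_, nonneg := fun z => tsum_nonneg (hterm z), antitone := ?_,
            pos := ?_, mem_tube := ?_, continuousOn_wgt := ?_, continuousOn_wvec := ?_,
            contDiff_wgt_logc := ?_, contDiff_wvec_logc := ?_, contDiff_wgt_slice := ?_,
            contDiff_wvec_slice := ?_ }⟩
  · refine h₁ c fun i => ⟨(hc i).le, ?_⟩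
    exact (min_le_left _ _).trans ((min_le_left _ _).trans (min_le_left _ _))
  · intro p a b hab
    exact (hsummable _).tsum_le_tsum
      (fun i => mul_le_mul_of_nonneg_left (hanti (x i) p hab) (hc i).le) (hsummable _)
  · intro y
    have : y ∈ ⋃ z ∈ range x, U z := by rw [hcov]; trivial
    obtain ⟨z, ⟨i, rfl⟩, hy⟩ := mem_iUnion₂.1 this
    exact (hsummable _).tsum_pos (hterm _) i (mul_pos (hc i) (hpos _ y hy))
  · intro y v hv hp
    by_contra hmem
    have : ∀ i, c i • B (x i) (D.emb y, ‖v‖ ^ 2) = 0 := fun i => by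
      by_contra hne
      exact hmem (hKt _ (hBK (x i) y v hv (right_ne_zero_of_smul hne)))
    have h0 : β (D.emb y, ‖v‖ ^ 2) = 0 := by
      simp only [β, this, tsum_zero]
    exact hp.ne' h0
  · have h := continuousOn_tsum (s := half m) (u := fun i : ℕ => (1 / 2 : ℝ) ^ i)
      (f := fun i P => c i • D.pull (wgt (B (x i))) P)
      (fun i => (D.continuousOn_pull (hKc _) (hKt _) (hg i)
        (contDiff_wgt (hsm _)).continuous).const_smul (c i)) hgeo (fun i P _ => hb1 i P)
    exact h.congr fun P _ => hwgt P
  · have h := continuousOn_tsum (s := half m) (u := fun i : ℕ => (1 / 2 : ℝ) ^ i)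
      (f := fun i P => c i • D.pull (wvec (B (x i))) P)
      (fun i => (D.continuousOn_pull (hKc _) (hKt _) (hG i)
        (contDiff_wvec (hsm _)).continuous).const_smul (c i)) hgeo (fun i P _ => hb2 i P)
    exact h.congr fun P _ => hwvec P
  · simp only [hwgt]
    refine h₂ c fun i => ⟨(hc i).le, ?_⟩
    exact (min_le_left _ _).trans ((min_le_left _ _).trans (min_le_right _ _))
  · simp only [hwvec]
    refine h₃ c fun i => ⟨(hc i).le, ?_⟩
    exact (min_le_left _ _).trans ((min_le_right _ _).trans (min_le_left _ _))
  · simp only [hwgt]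
    refine h₄ c fun i => ⟨(hc i).le, ?_⟩
    exact (min_le_left _ _).trans ((min_le_right _ _).trans (min_le_right _ _))
  · simp only [hwvec]
    refine h₅ c fun i => ⟨(hc i).le, ?_⟩
    exact (min_le_right _ _).trans (min_le_left _ _)

end BoundaryEmbedding

/-! ### Translations in logarithmic coordinates -/

/-- Translation of a point of the half space in the coordinates `(P, log u)`. -/
def shift {m : ℕ} (P : E m × ℝ) (d : E (m + 1)) : E m × ℝ :=
  (P.1 + front d, P.2 * Real.exp (height d))

section Shift

variable {m : ℕ}

theorem shift_shift (P : E m × ℝ) (d d' : E (m + 1)) : shift (shift P d) d' = shift P (d + d') := by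
  simp only [shift, front_add, height_add, Real.exp_add, add_assoc, mul_assoc]

@[simp] theorem shift_zero (P : E m × ℝ) : shift P 0 = P := by
  simp [shift]

theorem shift_logc (W d : E (m + 1)) : shift (logc W) d = logc (W + d) := by
  simp [shift, logc, Real.exp_add]

theorem shift_slice (p : E m) (d : E (m + 1)) : shift (p, 0) d = (p + front d, 0) := by
  simp [shift]

@[fun_prop] theorem continuous_shift :
    Continuous (fun q : (E m × ℝ) × E (m + 1) => shift q.1 q.2) := by
  unfold shift; fun_prop

theorem shift_mem_half {P : E m × ℝ} (h : P ∈ half m) (d : E (m + 1)) : shift P d ∈ half m :=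
  mul_nonneg h (Real.exp_pos _).le

theorem logc_injective : Function.Injective (logc (m := m)) := fun W W' h => by
  have h1 : front W = front W' := congrArg Prod.fst h
  have h2 : height W = height W' := Real.exp_injective (congrArg Prod.snd h)
  rw [← join_front_height W, h1, h2, join_front_height]

end Shift

namespace BoundaryEmbedding

variable {n m : ℕ} [NeZero n] {X : Type*} [TopologicalSpace X]
  [ChartedSpace (EuclideanHalfSpace n) X] {D : BoundaryEmbedding n m X}

theorem expo_eq_shift (x : X) (v : E (m + 1)) : D.expo x v = shift (D.emb x, D.rho x) v := rfl

namespace Cutoff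

variable [Nonempty X] (B : D.Cutoff)

/-! ### The deformation of the half space onto its rescalings along the normal directions -/

/-- The cutoff as a function on the half space. -/
def b (P : E m × ℝ) : ℝ := D.pull (wgt B.β) P

/-- The cutoff times the normal vector, as a function on the half space. -/
def F (P : E m × ℝ) : E (m + 1) := D.pull (wvec B.β) P

theorem b_nonneg (P : E m × ℝ) : 0 ≤ B.b P := by
  by_cases h : P ∈ D.tubeImage
  · rw [b, D.pull_of_mem _ h]; exact B.nonneg _
  · rw [b, D.pull_of_notMem _ h]

theorem F_eq {P : E m × ℝ} (h : P ∈ D.tubeImage) : B.F P = B.b P • D.vec P := by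
  rw [F, b, D.pull_of_mem _ h, D.pull_of_mem _ h]; rfl

theorem norm_F_le (P : E m × ℝ) : ‖B.F P‖ ≤ B.b P := by
  by_cases h : P ∈ D.tubeImage
  · rw [B.F_eq h, norm_smul, Real.norm_of_nonneg (B.b_nonneg P)]
    refine mul_le_of_le_one_right (B.b_nonneg P) ?_
    have h1 : ‖D.vec P‖ < 1 / 8 := norm_lt_of_mem_tube (D.expoInv_mem h)
    linarith
  · rw [F, b, D.pull_of_notMem _ h, D.pull_of_notMem _ h, norm_zero]

theorem b_expo {x : X} {v : E (m + 1)} (h : (x, v) ∈ D.tube) :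
    B.b (D.expo x v) = B.β (D.emb x, ‖v‖ ^ 2) := D.pull_expo _ h

theorem F_expo {x : X} {v : E (m + 1)} (h : (x, v) ∈ D.tube) :
    B.F (D.expo x v) = B.b (D.expo x v) • v := by
  rw [B.F_eq (expo_mem_tubeImage h), D.vec_expo h]

theorem b_eq_zero {P : E m × ℝ} (h : P ∉ D.tubeImage) : B.b P = 0 := D.pull_of_notMem _ h

theorem F_eq_zero {P : E m × ℝ} (h : P ∉ D.tubeImage) : B.F P = 0 := D.pull_of_notMem _ h

theorem mem_tubeImage_of_b_ne_zero {P : E m × ℝ} (h : B.b P ≠ 0) : P ∈ D.tubeImage := by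
  by_contra hP
  exact h (B.b_eq_zero hP)

/-- The dilation factor: the solution `τ` of `τ = t + β(emb x, |τ c|²)`. -/
def dil (x : X) (t : ℝ) (c : E (m + 1)) : ℝ := tau B.β (D.emb x) t (‖c‖ ^ 2)

theorem dil_eq (x : X) {t : ℝ} (ht : 0 ≤ t) (c : E (m + 1)) :
    B.dil x t c = t + B.β (D.emb x, ‖B.dil x t c • c‖ ^ 2) := by
  rw [norm_smul, mul_pow, Real.norm_eq_abs, sq_abs]
  exact (tau_spec B.contDiff B.nonneg B.antitone ht (sq_nonneg _)).2

theorem dil_pos (x : X) {t : ℝ} (ht : 0 ≤ t) (c : E (m + 1)) : 0 < B.dil x t c := by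
  refine lt_of_le_of_ne (tau_spec B.contDiff B.nonneg B.antitone ht (sq_nonneg _)).1 fun h => ?_
  have h1 := B.dil_eq x ht c
  rw [← h, zero_smul, norm_zero, zero_pow two_ne_zero] at h1
  have := B.pos x
  linarith

theorem dil_unique {x : X} {t τ : ℝ} {c : E (m + 1)} (ht : 0 ≤ t) (h0 : 0 ≤ τ)
    (h : τ = t + B.β (D.emb x, ‖τ • c‖ ^ 2)) : B.dil x t c = τ := by
  rw [norm_smul, mul_pow, Real.norm_eq_abs, sq_abs] at h
  exact tau_eq B.contDiff B.nonneg B.antitone ht (sq_nonneg _) h0 h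

/-- The point of the half space with normal coordinate `c` at scale `t` over `x`. -/
def lift (x : X) (t : ℝ) (c : E (m + 1)) : E m × ℝ := D.expo x (B.dil x t c • c)

variable [IsManifold (𝓡∂ n) ∞ X]

omit [IsManifold (𝓡∂ n) ∞ X] in
theorem dil_mem_tube {x : X} {t : ℝ} {c : E (m + 1)} (ht : 0 ≤ t) (hc : D.IsNrm x c)
    (h : (x, t • c) ∈ D.tube) : (x, B.dil x t c • c) ∈ D.tube := by
  by_cases h0 : 0 < B.β (D.emb x, ‖B.dil x t c • c‖ ^ 2)
  · exact B.mem_tube x _ (hc.smul _) h0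
  · have h1 := B.dil_eq x ht c
    rw [le_antisymm (not_lt.1 h0) (B.nonneg _), add_zero] at h1
    rwa [h1]

theorem dil_zero_mem_tube {x : X} {c : E (m + 1)} (hc : D.IsNrm x c) :
    (x, B.dil x 0 c • c) ∈ D.tube :=
  B.dil_mem_tube le_rfl hc (by rw [zero_smul]; exact D.zero_mem_tube x)

omit [IsManifold (𝓡∂ n) ∞ X] in
theorem b_lift {x : X} {t : ℝ} {c : E (m + 1)} (ht : 0 ≤ t) (hc : D.IsNrm x c)
    (h : (x, t • c) ∈ D.tube) : B.b (B.lift x t c) + t = B.dil x t c := by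
  rw [lift, B.b_expo (B.dil_mem_tube ht hc h), add_comm]
  exact (B.dil_eq x ht c).symm

omit [IsManifold (𝓡∂ n) ∞ X] in
theorem vec_lift {x : X} {t : ℝ} {c : E (m + 1)} (ht : 0 ≤ t) (hc : D.IsNrm x c)
    (h : (x, t • c) ∈ D.tube) : D.vec (B.lift x t c) = B.dil x t c • c :=
  D.vec_expo (B.dil_mem_tube ht hc h)

omit [IsManifold (𝓡∂ n) ∞ X] in
/-- Inverts the lift: the dilation factor at `v / (b + t)` is `b + t`. -/
theorem lift_smul_vec {x : X} {t : ℝ} {v : E (m + 1)} (ht : 0 ≤ t) (h : (x, v) ∈ D.tube)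
    (hpos : 0 < B.b (D.expo x v) + t) :
    B.lift x t ((B.b (D.expo x v) + t)⁻¹ • v) = D.expo x v := by
  have h1 : B.dil x t ((B.b (D.expo x v) + t)⁻¹ • v) = B.b (D.expo x v) + t := by
    refine B.dil_unique ht hpos.le ?_
    rw [smul_smul, mul_inv_cancel₀ hpos.ne', one_smul, ← B.b_expo h, add_comm]
  rw [lift, h1, smul_smul, mul_inv_cancel₀ hpos.ne', one_smul]

/-- The map which multiplies the normal vector `v` by `t / (b + t)`. -/
def Θ (t : ℝ) (P : E m × ℝ) : E m × ℝ := shift P (-((B.b P + t)⁻¹ • B.F P))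

omit [IsManifold (𝓡∂ n) ∞ X] in
/-- `Θ t` takes the dilated vector `τ c` to `t c`. -/
theorem Θ_lift {x : X} {t : ℝ} {c : E (m + 1)} (ht : 0 ≤ t) (hc : D.IsNrm x c)
    (h : (x, t • c) ∈ D.tube) : B.Θ t (B.lift x t c) = D.expo x (t • c) := by
  have h1 := B.b_lift ht hc h
  have h2 := B.dil_pos x ht c
  rw [Θ, h1, lift, B.F_expo (B.dil_mem_tube ht hc h), ← lift, eq_sub_of_add_eq h1, lift,
    expo_eq_shift, expo_eq_shift, shift_shift, ← sub_eq_add_neg, smul_smul, smul_smul, ← sub_smul]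
  congr 2
  field_simp
  ring

open Classical in
/-- The displacement, in logarithmic coordinates, of the inverse of `Θ`. -/
def disp (t : ℝ) (Q : E m × ℝ) : E (m + 1) :=
  if Q ∈ D.tubeImage then
    (tau B.β (Q.1 - front (D.vec Q)) t (‖t⁻¹ • D.vec Q‖ ^ 2) * t⁻¹ - 1) • D.vec Q
  else 0

/-- The inverse of `Θ`. -/
def G (t : ℝ) (Q : E m × ℝ) : E m × ℝ := shift Q (B.disp t Q)

omit [IsManifold (𝓡∂ n) ∞ X] in
theorem disp_of_mem {t : ℝ} {Q : E m × ℝ} (h : Q ∈ D.tubeImage) : B.disp t Q =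
    (tau B.β (Q.1 - front (D.vec Q)) t (‖t⁻¹ • D.vec Q‖ ^ 2) * t⁻¹ - 1) • D.vec Q := if_pos h

omit [IsManifold (𝓡∂ n) ∞ X] in
theorem G_of_notMem {t : ℝ} {Q : E m × ℝ} (h : Q ∉ D.tubeImage) : B.G t Q = Q := by
  rw [G, disp, if_neg h, shift_zero]

omit [IsManifold (𝓡∂ n) ∞ X] in
theorem Θ_of_notMem {t : ℝ} {Q : E m × ℝ} (h : Q ∉ D.tubeImage) : B.Θ t Q = Q := by
  rw [Θ, B.F_eq_zero h, smul_zero, neg_zero, shift_zero]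

omit [IsManifold (𝓡∂ n) ∞ X] in
theorem G_expo {x : X} {t : ℝ} {w : E (m + 1)} (h : (x, w) ∈ D.tube) :
    B.G t (D.expo x w) = B.lift x t (t⁻¹ • w) := by
  rw [G, B.disp_of_mem (expo_mem_tubeImage h), ← D.emb_expoInv (expo_mem_tubeImage h), D.vec_expo h,
    D.expoInv_expo h, lift, expo_eq_shift, expo_eq_shift, shift_shift, dil, smul_smul]
  congr 1
  rw [sub_smul, one_smul, add_sub_cancel]

omit [IsManifold (𝓡∂ n) ∞ X] in
theorem Θ_G {t : ℝ} (ht : 0 < t) (Q : E m × ℝ) : B.Θ t (B.G t Q) = Q := by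
  by_cases h : Q ∈ D.tubeImage
  · obtain ⟨⟨x, w⟩, hw, rfl⟩ := h
    simp only
    have e : t • t⁻¹ • w = w := by rw [smul_smul, mul_inv_cancel₀ ht.ne', one_smul]
    rw [B.G_expo hw, B.Θ_lift ht.le (hw.1.smul _) (by rwa [e]), e]
  · rw [B.G_of_notMem h, B.Θ_of_notMem h]

omit [IsManifold (𝓡∂ n) ∞ X] in
theorem G_Θ {t : ℝ} (ht : 0 < t) (P : E m × ℝ) : B.G t (B.Θ t P) = P := by
  by_cases h : P ∈ D.tubeImage
  · obtain ⟨⟨x, v⟩, hv, rfl⟩ := h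
    simp only
    have hpos : 0 < B.b (D.expo x v) + t := add_pos_of_nonneg_of_pos (B.b_nonneg _) ht
    have hmem : (x, t • (B.b (D.expo x v) + t)⁻¹ • v) ∈ D.tube := by
      rw [smul_smul]
      refine D.smul_mem_tube hv ?_
      rw [abs_of_nonneg (by positivity), ← div_eq_mul_inv, div_le_one hpos]
      linarith [B.b_nonneg (D.expo x v)]
    have h1 := B.lift_smul_vec ht.le hv hpos
    conv_lhs => rw [← h1]
    rw [B.Θ_lift ht.le (hv.1.smul _) hmem, B.G_expo hmem, smul_smul t⁻¹, inv_mul_cancel₀ ht.ne',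
      one_smul, h1]
  · rw [B.Θ_of_notMem h, B.G_of_notMem h]

omit [IsManifold (𝓡∂ n) ∞ X] in
theorem G_mem_half {t : ℝ} {Q : E m × ℝ} (h : Q ∈ half m) : B.G t Q ∈ half m := shift_mem_half h _

omit [IsManifold (𝓡∂ n) ∞ X] in
theorem Θ_mem_half {t : ℝ} {Q : E m × ℝ} (h : Q ∈ half m) : B.Θ t Q ∈ half m := shift_mem_half h _

omit [IsManifold (𝓡∂ n) ∞ X] in
theorem continuousOn_Θ :
    ContinuousOn (fun q : ℝ × (E m × ℝ) => B.Θ q.1 q.2) (Ioi 0 ×ˢ half m) := by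
  have hb : ContinuousOn (fun q : ℝ × (E m × ℝ) => B.b q.2) (Ioi 0 ×ˢ half m) :=
    B.continuousOn_wgt.comp continuousOn_snd fun q hq => hq.2
  have hF : ContinuousOn (fun q : ℝ × (E m × ℝ) => B.F q.2) (Ioi 0 ×ˢ half m) :=
    B.continuousOn_wvec.comp continuousOn_snd fun q hq => hq.2
  have h1 : ContinuousOn (fun q : ℝ × (E m × ℝ) => (q.2, -((B.b q.2 + q.1)⁻¹ • B.F q.2)))
      (Ioi 0 ×ˢ half m) :=
    continuousOn_snd.prodMk ((((hb.add continuousOn_fst).inv₀ fun q hq =>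
      (add_pos_of_nonneg_of_pos (B.b_nonneg _) hq.1).ne').smul hF).neg)
  exact continuous_shift.comp_continuousOn h1

omit [IsManifold (𝓡∂ n) ∞ X] in
/-- The inverse of `Θ` is continuous because `Θ` moves points by bounded displacements, hence is
proper. -/
theorem continuousOn_G :
    ContinuousOn (fun q : ℝ × (E m × ℝ) => B.G q.1 q.2) (Ioi 0 ×ˢ half m) := by
  rintro ⟨t₀, Q₀⟩ ⟨ht₀, hQ₀⟩
  rw [ContinuousWithinAt, tendsto_iff_ultrafilter]
  intro u hu
  let a : ℝ × (E m × ℝ) → E (m + 1) := fun q =>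
    (B.b (B.G q.1 q.2) + q.1)⁻¹ • B.F (B.G q.1 q.2)
  have hmem : ∀ᶠ q in (u : Filter (ℝ × (E m × ℝ))), q ∈ Ioi (0 : ℝ) ×ˢ half m :=
    hu self_mem_nhdsWithin
  have hshift : ∀ q ∈ Ioi (0 : ℝ) ×ˢ half m, B.G q.1 q.2 = shift q.2 (a q) := fun q hq => by
    have h1 := B.Θ_G hq.1 q.2
    rw [Θ] at h1
    conv_rhs => rw [← h1]
    rw [shift_shift, neg_add_cancel, shift_zero]
  have ha : ∀ᶠ q in (u : Filter (ℝ × (E m × ℝ))), a q ∈ Metric.closedBall (0 : E (m + 1)) 1 := by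
    filter_upwards [hmem] with q hq
    have hq1 : 0 < q.1 := hq.1
    have hpos : 0 < B.b (B.G q.1 q.2) + q.1 := add_pos_of_nonneg_of_pos (B.b_nonneg _) hq1
    rw [mem_closedBall_zero_iff, norm_smul, norm_inv, Real.norm_of_nonneg hpos.le,
      inv_mul_le_iff₀ hpos, mul_one]
    linarith [B.norm_F_le (B.G q.1 q.2)]
  obtain ⟨a₀, -, ha₀⟩ := (isCompact_closedBall (0 : E (m + 1)) 1).ultrafilter_le_nhds'
    (u.map a) ha
  have hat : Tendsto a u (𝓝 a₀) := ha₀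
  have hid : Tendsto (fun q : ℝ × (E m × ℝ) => q) u (𝓝 (t₀, Q₀)) := hu.trans inf_le_left
  have ht1 : Tendsto (fun q : ℝ × (E m × ℝ) => q.1) u (𝓝 t₀) := (continuous_fst.tendsto _).comp hid
  have ht2 : Tendsto (fun q : ℝ × (E m × ℝ) => q.2) u (𝓝 Q₀) := (continuous_snd.tendsto _).comp hid
  have hG : Tendsto (fun q : ℝ × (E m × ℝ) => B.G q.1 q.2) u (𝓝 (shift Q₀ a₀)) := by
    have h1 : Tendsto (fun q : ℝ × (E m × ℝ) => shift q.2 (a q)) u (𝓝 (shift Q₀ a₀)) :=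
      (continuous_shift.tendsto (Q₀, a₀)).comp (ht2.prodMk_nhds hat)
    exact h1.congr' (hmem.mono fun q hq => (hshift q hq).symm)
  have hΘ : Tendsto (fun q : ℝ × (E m × ℝ) => B.Θ q.1 (B.G q.1 q.2)) u
      (𝓝 (B.Θ t₀ (shift Q₀ a₀))) := by
    have h1 : Tendsto (fun q : ℝ × (E m × ℝ) => B.Θ q.1 q.2)
        (𝓝[Ioi 0 ×ˢ half m] (t₀, shift Q₀ a₀)) (𝓝 (B.Θ t₀ (shift Q₀ a₀))) :=
      B.continuousOn_Θ (t₀, shift Q₀ a₀) ⟨ht₀, shift_mem_half hQ₀ _⟩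
    have h2 : Tendsto (fun q : ℝ × (E m × ℝ) => (q.1, B.G q.1 q.2)) u
        (𝓝[Ioi 0 ×ˢ half m] (t₀, shift Q₀ a₀)) := by
      refine tendsto_nhdsWithin_iff.2 ⟨ht1.prodMk_nhds hG, ?_⟩
      filter_upwards [hmem] with q hq using ⟨hq.1, B.G_mem_half hq.2⟩
    have h3 := h1.comp h2
    simp only [Function.comp_def] at h3
    exact h3
  have hlim : B.Θ t₀ (shift Q₀ a₀) = Q₀ :=
    tendsto_nhds_unique (hΘ.congr' (hmem.mono fun q hq => B.Θ_G hq.1 q.2)) ht2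
  have e : shift Q₀ a₀ = B.G t₀ Q₀ := by
    rw [← B.G_Θ ht₀ (shift Q₀ a₀), hlim]
  rw [e] at hG
  exact hG

/-! ### Smoothness of the deformation -/

omit [IsManifold (𝓡∂ n) ∞ X] in
theorem logc_add_disp (t : ℝ) (W : E (m + 1)) : logc (W + B.disp t (logc W)) = B.G t (logc W) := by
  rw [G, shift_logc]

omit [IsManifold (𝓡∂ n) ∞ X] in
theorem slice_add_disp (t : ℝ) (p : E m) :
    (p + front (B.disp t (p, 0)), (0 : ℝ)) = B.G t (p, 0) := by
  rw [G, shift_slice]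

section Smooth

variable {V : Type*} [NormedAddCommGroup V] [NormedSpace ℝ V]

omit [IsManifold (𝓡∂ n) ∞ X] in
/-- In the image of the tube the displacement is as smooth as the normal vector. -/
theorem contDiffAt_disp {g : V → E m × ℝ} {p : ℝ × V} (ht : 0 < p.1)
    (hT : ∀ᶠ v in 𝓝 p.2, g v ∈ D.tubeImage)
    (hg : ContDiffAt ℝ ∞ (fun v => (g v).1) p.2) (hv : ContDiffAt ℝ ∞ (fun v => D.vec (g v)) p.2) :
    ContDiffAt ℝ ∞ (fun q : ℝ × V => B.disp q.1 (g q.2)) p := by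
  have hvq : ContDiffAt ℝ ∞ (fun q : ℝ × V => D.vec (g q.2)) p := hv.comp p contDiffAt_snd
  have hgq : ContDiffAt ℝ ∞ (fun q : ℝ × V => (g q.2).1) p := hg.comp p contDiffAt_snd
  have hinv : ContDiffAt ℝ ∞ (fun q : ℝ × V => q.1⁻¹) p := contDiffAt_fst.inv ht.ne'
  let z : ℝ × V → E m × ℝ × ℝ := fun q =>
    ((g q.2).1 - front (D.vec (g q.2)), q.1, ‖q.1⁻¹ • D.vec (g q.2)‖ ^ 2)
  have hz : ContDiffAt ℝ ∞ z p :=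
    (hgq.sub ((frontL m).contDiff.contDiffAt.comp p hvq)).prodMk
      (contDiffAt_fst.prodMk ((hinv.smul hvq).norm_sq ℝ))
  have hpos : 0 < tau B.β (z p).1 (z p).2.1 (z p).2.2 := by
    have h1 := (tau_spec B.contDiff B.nonneg B.antitone (p := (z p).1) (t := (z p).2.1)
      (q := (z p).2.2) ht.le (sq_nonneg _)).2
    rw [h1]
    exact add_pos_of_pos_of_nonneg ht (B.nonneg _)
  obtain ⟨σ, hσ, hσe⟩ := exists_contDiffAt_tau B.contDiff B.nonneg B.antitone (p := (z p).1)
    (t := (z p).2.1) (q := (z p).2.2) ht.le (sq_nonneg _) hpos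
  have h2 : ContDiffAt ℝ ∞ (fun q : ℝ × V => (σ (z q) * q.1⁻¹ - 1) • D.vec (g q.2)) p :=
    (((ContDiffAt.comp (g := σ) p hσ hz).mul hinv).sub contDiffAt_const).smul hvq
  refine h2.congr_of_eventuallyEq ?_
  filter_upwards [hz.continuousAt.eventually hσe, (continuous_snd.tendsto p).eventually hT,
    (continuous_fst.tendsto p).eventually (lt_mem_nhds ht)] with q hq hqT hqt
  rw [B.disp_of_mem hqT, ← hq (le_of_lt hqt) (sq_nonneg _)]

end Smooth

theorem contDiffAt_add_disp_logc {t : ℝ} (ht : 0 < t) (W₀ : E (m + 1)) :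
    ContDiffAt ℝ ∞ (fun q : ℝ × E (m + 1) => q.2 + B.disp q.1 (logc q.2)) (t, W₀) := by
  by_cases h : logc W₀ ∈ D.tubeImage
  · have htl : Tendsto (fun W : E (m + 1) => logc W) (𝓝 W₀) (𝓝[half m] (logc W₀)) :=
      tendsto_nhdsWithin_iff.2 ⟨continuous_logc.tendsto _, Eventually.of_forall logc_mem_half⟩
    exact contDiffAt_snd.add (B.contDiffAt_disp (p := (t, W₀)) ht
      (htl (D.tubeImage_mem_nhdsWithin h)) (frontL m).contDiff.contDiffAt
      (D.contDiffAt_vec_logc h))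
  · refine contDiffAt_inverse_of_eq_zero (b := fun W => B.b (logc W)) (F := fun W => B.F (logc W))
      (g := fun t W => W + B.disp t (logc W)) B.contDiff_wgt_logc B.contDiff_wvec_logc
      (fun W => B.b_nonneg _) (fun W => B.norm_F_le _) (fun t ht W => ?_) (B.b_eq_zero h) ht
    apply logc_injective
    rw [B.logc_add_disp, sub_eq_add_neg, ← shift_logc]
    exact B.G_Θ ht _

theorem contDiffAt_add_disp_slice {t : ℝ} (ht : 0 < t) (p₀ : E m) :
    ContDiffAt ℝ ∞ (fun q : ℝ × E m => q.2 + front (B.disp q.1 (q.2, 0))) (t, p₀) := by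
  by_cases h : (p₀, (0 : ℝ)) ∈ D.tubeImage
  · have hc : Continuous fun p : E m => (p, (0 : ℝ)) := by fun_prop
    have htl : Tendsto (fun p : E m => (p, (0 : ℝ))) (𝓝 p₀) (𝓝[half m] (p₀, 0)) :=
      tendsto_nhdsWithin_iff.2 ⟨hc.tendsto _, Eventually.of_forall fun p => le_refl (0 : ℝ)⟩
    exact contDiffAt_snd.add ((frontL m).contDiff.contDiffAt.comp (t, p₀)
      (B.contDiffAt_disp (g := fun p : E m => (p, (0 : ℝ))) (p := (t, p₀)) ht
      (htl (D.tubeImage_mem_nhdsWithin h)) contDiffAt_id (D.contDiffAt_vec_slice h)))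
  · refine contDiffAt_inverse_of_eq_zero (b := fun p => B.b (p, 0))
      (F := fun p => front (B.F (p, 0)))
      (g := fun t p => p + front (B.disp t (p, 0))) B.contDiff_wgt_slice
      ((frontL m).contDiff.comp B.contDiff_wvec_slice)
      (fun p => B.b_nonneg _) (fun p => (norm_front_le _).trans (B.norm_F_le _))
      (fun t ht p => ?_) (B.b_eq_zero h) ht
    have h1 := B.G_Θ ht (p, 0)
    rw [Θ, shift_slice, ← slice_add_disp] at h1
    have h2 := congrArg Prod.fst h1
    rw [sub_eq_add_neg]
    exact h2

/-! ### Continuity and smoothness of the lifted points -/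

omit [IsManifold (𝓡∂ n) ∞ X] in
theorem exists_contDiffAt_dil (x : X) {t : ℝ} (ht : 0 ≤ t) (c : E (m + 1)) :
    ∃ σ : E m × ℝ × ℝ → ℝ, ContDiffAt ℝ ∞ σ (D.emb x, t, ‖c‖ ^ 2) ∧
      ∀ᶠ q : X × ℝ × E (m + 1) in 𝓝 (x, t, c), 0 ≤ q.2.1 →
        B.dil q.1 q.2.1 q.2.2 = σ (D.emb q.1, q.2.1, ‖q.2.2‖ ^ 2) := by
  obtain ⟨σ, hσ, hσe⟩ := exists_contDiffAt_tau B.contDiff B.nonneg B.antitone (p := D.emb x)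
    (t := t) (q := ‖c‖ ^ 2) ht (sq_nonneg _) (B.dil_pos x ht c)
  refine ⟨σ, hσ, ?_⟩
  have hc : Continuous fun q : X × ℝ × E (m + 1) => (D.emb q.1, q.2.1, ‖q.2.2‖ ^ 2) := by
    have := D.continuous_emb
    fun_prop
  filter_upwards [(hc.tendsto (x, t, c)).eventually hσe] with q hq h0
  exact hq h0 (sq_nonneg _)

omit [IsManifold (𝓡∂ n) ∞ X] in
theorem continuousOn_dil :
    ContinuousOn (fun q : X × ℝ × E (m + 1) => B.dil q.1 q.2.1 q.2.2) {q | 0 ≤ q.2.1} := by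
  rintro ⟨x, t, c⟩ ht
  obtain ⟨σ, hσ, hσe⟩ := B.exists_contDiffAt_dil x (t := t) ht c
  have hc : Continuous fun q : X × ℝ × E (m + 1) => (D.emb q.1, q.2.1, ‖q.2.2‖ ^ 2) := by
    have := D.continuous_emb
    fun_prop
  have h1 : ContinuousAt (fun q : X × ℝ × E (m + 1) => σ (D.emb q.1, q.2.1, ‖q.2.2‖ ^ 2))
      (x, t, c) := ContinuousAt.comp (g := σ) hσ.continuousAt hc.continuousAt
  refine h1.continuousWithinAt.congr_of_eventuallyEq ?_ (hσe.self_of_nhds ht)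
  filter_upwards [mem_nhdsWithin_of_mem_nhds hσe, self_mem_nhdsWithin] with q hq h0 using hq h0

omit [IsManifold (𝓡∂ n) ∞ X] in
theorem continuousOn_lift :
    ContinuousOn (fun q : X × ℝ × E (m + 1) => B.lift q.1 q.2.1 q.2.2) {q | 0 ≤ q.2.1} := by
  have h1 : ContinuousOn (fun q : X × ℝ × E (m + 1) => (q.1, B.dil q.1 q.2.1 q.2.2 • q.2.2))
      {q | 0 ≤ q.2.1} :=
    continuousOn_fst.prodMk
      (B.continuousOn_dil.smul (continuous_snd.comp continuous_snd).continuousOn)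
  exact D.continuous_expo.comp_continuousOn h1

end Cutoff

end BoundaryEmbedding

namespace BoundaryEmbedding

variable {n m : ℕ} [NeZero n] {X : Type*} [TopologicalSpace X]
  [ChartedSpace (EuclideanHalfSpace n) X] {D : BoundaryEmbedding n m X}

theorem rho_pos_of_expo_pos {x : X} {v : E (m + 1)} (h : 0 < (D.expo x v).2) : 0 < D.rho x :=
  pos_of_mul_pos_left h (Real.exp_pos _).le

theorem expo_of_rho_eq_zero {x : X} {v : E (m + 1)} (h : D.rho x = 0) :
    D.expo x v = (D.emb x + front v, 0) := by
  simp [expo, h]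

theorem expo_of_rho_pos {x : X} {v : E (m + 1)} (h : 0 < D.rho x) :
    D.expo x v = logc (v + join (D.emb x) (Real.log (D.rho x))) := by
  simp only [expo, logc, front_add, height_add, front_join, height_join, Real.exp_add,
    Real.exp_log h]
  rw [add_comm, mul_comm]

/-- The vector `h(γ)` of the arrow joining two points of the same fibre of the b-exponential map. -/
theorem join_of_expo_eq {x y : X} {v w : E (m + 1)} (h : D.expo x v = D.expo y w) :
    D.rho x = Real.exp (height w - height v) * D.rho y ∧
      join (D.emb x - D.emb y) (height w - height v) = w - v := by
  have h1 : D.emb x + front v = D.emb y + front w := congrArg Prod.fst h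
  have h2 : D.rho x * Real.exp (height v) = D.rho y * Real.exp (height w) := congrArg Prod.snd h
  constructor
  · rw [Real.exp_sub]
    field_simp
    rw [h2, mul_comm]
  · have : D.emb x - D.emb y = front (w - v) := by
      rw [front_sub, sub_eq_sub_iff_add_eq_add, h1, add_comm]
    rw [this, ← height_sub, join_front_height]

theorem expo_eq_of_join {x y : X} {v : E (m + 1)} {α : ℝ} (h : D.rho x = Real.exp α * D.rho y) :
    D.expo y (v + join (D.emb x - D.emb y) α) = D.expo x v := by
  simp only [expo, front_add, height_add, front_join, height_join, Real.exp_add, h]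
  refine Prod.ext ?_ ?_
  · simp only; abel
  · simp only; ring

variable [IsManifold (𝓡∂ n) ∞ X]

/-- Quadratic contact of the b-exponential map with the projection to the normal space: if a
short normal vector `w` at `y` has the same exponential as `t V` at `x`, then `w / t` is close to
the normal component of `V`. -/
theorem norm_sub_nrm_le {x₀ x y : X} {r t : ℝ} (hg : D.Good x₀ r) (ht : 0 < t)
    (hx : dist (D.emb x) (D.emb x₀) < r) (hy : dist (D.emb y) (D.emb x₀) < r)
    {V w : E (m + 1)} (hw : D.IsNrm y w) (hwr : ‖w‖ < r) (he : D.expo y w = D.expo x (t • V)) :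
    ‖t⁻¹ • w‖ ≤ ‖V‖ ∧
      r * ‖t⁻¹ • w - D.nrm y (scale (D.rho y) V)‖ ^ 2
        ≤ 2 * (‖t⁻¹ • w - D.nrm y (scale (D.rho y) V)‖ + 1) * (t * ‖V‖ ^ 2) := by
  have hr0 : 0 < r := lt_of_le_of_lt dist_nonneg hx
  obtain ⟨hrel, hjoin⟩ := join_of_expo_eq he.symm
  set c := t⁻¹ • w with hc
  have hw' : w = t • c := by rw [hc, smul_smul, mul_inv_cancel₀ ht.ne', one_smul]
  have hcV : ∀ v, D.IsNrm y v → ‖v‖ < r → ⟪v, c - V⟫ ≤ t * (1 / 4 * ‖c - V‖ ^ 2) := by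
    intro v hv hvr
    have h1 := hg.2 y x _ v hy hx hrel hv hvr
    rw [hjoin, hw', ← smul_sub, inner_smul_right, norm_smul, Real.norm_of_nonneg ht.le] at h1
    have h2 : t * ⟪v, c - V⟫ ≤ t * (t * (1 / 4 * ‖c - V‖ ^ 2)) := by
      refine h1.trans (le_of_eq ?_); ring
    exact le_of_mul_le_mul_left h2 ht
  have hle : ‖c‖ ≤ ‖V‖ := by
    have h1 := hcV w hw hwr
    rw [hw', real_inner_smul_left] at h1
    have h2 : ⟪c, c - V⟫ ≤ 1 / 4 * ‖c - V‖ ^ 2 := le_of_mul_le_mul_left h1 ht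
    rw [inner_sub_right, real_inner_self_eq_norm_sq, norm_sub_sq_real] at h2
    have h3 := real_inner_le_norm c V
    by_contra hlt
    nlinarith [norm_nonneg c, norm_nonneg V]
  refine ⟨hle, ?_⟩
  set d := c - D.nrm y (scale (D.rho y) V) with hd
  have hdn : D.IsNrm y d := (hw.smul _).sub (D.isNrm_nrm _ _)
  set l := r / (2 * (‖d‖ + 1)) with hl
  have hl0 : 0 < l := by positivity
  have h1 := hcV (l • d) (hdn.smul l) (by
    rw [norm_smul, Real.norm_of_nonneg hl0.le, hl, div_mul_eq_mul_div, div_lt_iff₀ (by positivity)]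
    nlinarith [norm_nonneg d])
  have h2 : ⟪d, c - V⟫ = ‖d‖ ^ 2 := by
    have h3 := D.inner_sub_nrm_scale hdn V
    have e : c - V = d - (V - D.nrm y (scale (D.rho y) V)) := by rw [hd]; abel
    rw [e, inner_sub_right, h3, sub_zero, real_inner_self_eq_norm_sq]
  rw [real_inner_smul_left, h2] at h1
  have h3 : 1 / 4 * ‖c - V‖ ^ 2 ≤ ‖V‖ ^ 2 := by
    have h4 := norm_sub_le c V
    nlinarith [norm_nonneg (c - V), norm_nonneg c, norm_nonneg V]
  have h4 : l * ‖d‖ ^ 2 ≤ t * ‖V‖ ^ 2 := h1.trans (mul_le_mul_of_nonneg_left h3 ht.le)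
  calc r * ‖d‖ ^ 2 = 2 * (‖d‖ + 1) * (l * ‖d‖ ^ 2) := by rw [hl]; field_simp
    _ ≤ _ := mul_le_mul_of_nonneg_left h4 (by positivity)

/-! ### The global coordinates of `B_F` -/

/-- The map from the normal space to normal vectors. -/
def nrmQ (x : X) (w : D.NormalSpace x) : E (m + 1) :=
  Quotient.liftOn' w (D.nrm x) fun _ _ h => D.nrm_congr ((Submodule.quotientRel_def _).1 h)

theorem nrmQ_mk (x : X) (W : E (m + 1)) :
    nrmQ (D := D) x (Submodule.Quotient.mk W) = D.nrm x W := rfl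

theorem isNrm_nrmQ (x : X) (w : D.NormalSpace x) : D.IsNrm x (nrmQ x w) := by
  obtain ⟨W, rfl⟩ := Submodule.Quotient.mk_surjective _ w
  exact D.isNrm_nrm x W

theorem nrmQ_injective (x : X) : Function.Injective (nrmQ (D := D) x) := by
  intro w w' h
  obtain ⟨W, rfl⟩ := Submodule.Quotient.mk_surjective _ w
  obtain ⟨W', rfl⟩ := Submodule.Quotient.mk_surjective _ w'
  rw [nrmQ_mk, nrmQ_mk] at h
  rw [Submodule.Quotient.eq]
  apply D.mem_tangentImage_of_nrm_eq_zero
  rw [sub_eq_add_neg, ← neg_one_smul ℝ W', D.nrm_add, D.nrm_smul, h, neg_one_smul, add_neg_cancel]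

namespace Cutoff

variable [Nonempty X] (B : D.Cutoff)

/-- The global coordinates of `N_sing(X)`. -/
def modelSing : D.Nsing → ℝ × (E m × ℝ)
  | .normal x w => (0, B.lift x 0 (nrmQ x w))
  | .cyl t p => (t, B.G t (p, 0))

/-- The global coordinates of `B_F`, with values in `[0,1] × ℝ^m × [0, ∞)`. -/
def model : D.BF → ℝ × (E m × ℝ)
  | .sing z => B.modelSing z
  | .pos t P => (t, B.G t (logc P))

/-- The image of the global coordinates. -/
def region : Set (ℝ × (E m × ℝ)) :=
  {z | z.1 ∈ Icc 0 1 ∧ z.2 ∈ half m ∧ 0 < B.b z.2 + z.1 ∧ (z.1 = 1 → 0 < z.2.2)}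

theorem model_qF_of_eq_zero {a : D.XF × E (m + 1)} (h : a.1.1.2 = 0) :
    B.model (D.qF a) = (0, B.lift a.1.1.1 0 (D.nrm a.1.1.1 (scale (D.rho a.1.1.1) a.2))) := by
  rw [qF, dif_pos (Or.inl h)]
  simp only [model, qSing]
  rw [dif_pos h]
  rfl

theorem model_qF_of_pos {a : D.XF × E (m + 1)} (h : 0 < a.1.1.2) :
    B.model (D.qF a) = (a.1.1.2, B.G a.1.1.2 (D.expo a.1.1.1 (a.1.1.2 • a.2))) := by
  by_cases hb : a.1.1.1 ∈ (𝓡∂ n).boundary X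
  · have h0 : D.rho a.1.1.1 = 0 := (D.rho_eq_zero_iff _).2 hb
    rw [qF, dif_pos (Or.inr hb)]
    simp only [model, qSing]
    rw [dif_neg h.ne', expo_of_rho_eq_zero h0]
    rfl
  · have h0 : 0 < D.rho a.1.1.1 := D.rho_pos_iff.2 hb
    rw [qF, dif_neg (by rintro (h1 | h1); exacts [h.ne' h1, hb h1]), expo_of_rho_pos h0]
    rfl

theorem model_qF_fst (a : D.XF × E (m + 1)) : (B.model (D.qF a)).1 = a.1.1.2 := by
  rcases a.1.2.1.1.eq_or_lt with h | h
  · rw [B.model_qF_of_eq_zero h.symm]; exact h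
  · rw [B.model_qF_of_pos h]

/-- `N(X)` is injected into the half space. -/
theorem lift_zero_injective {x y : X} {c d : E (m + 1)} (hc : D.IsNrm x c) (hd : D.IsNrm y d)
    (h : B.lift x 0 c = B.lift y 0 d) : x = y ∧ c = d := by
  have h1 := D.expo_injOn (B.dil_zero_mem_tube hc) (B.dil_zero_mem_tube hd) h
  have hxy : x = y := congrArg Prod.fst h1
  have hcd : B.dil x 0 c • c = B.dil y 0 d • d := congrArg Prod.snd h1
  have h2 := B.b_lift le_rfl hc (by rw [zero_smul]; exact D.zero_mem_tube x)
  have h3 := B.b_lift le_rfl hd (by rw [zero_smul]; exact D.zero_mem_tube y)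
  rw [h, h3] at h2
  rw [← h2] at hcd
  exact ⟨hxy, smul_right_injective _ (B.dil_pos y le_rfl d).ne' hcd⟩

omit [IsManifold (𝓡∂ n) ∞ X] in
theorem G_injective {t : ℝ} (ht : 0 < t) : Function.Injective (B.G t) :=
  Function.LeftInverse.injective (B.Θ_G ht)

theorem modelSing_injective : Function.Injective B.modelSing := by
  rintro (⟨x, w⟩ | ⟨t, p⟩) (⟨y, w'⟩ | ⟨s, q⟩) h
  · obtain ⟨rfl, h2⟩ := B.lift_zero_injective (isNrm_nrmQ x w) (isNrm_nrmQ y w')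
      (congrArg Prod.snd h)
    rw [nrmQ_injective x h2]
  · exact absurd (congrArg Prod.fst h : (0 : ℝ) = s) s.2.1.ne
  · exact absurd (congrArg Prod.fst h : (t : ℝ) = 0) t.2.1.ne'
  · obtain rfl : t = s := Subtype.ext (congrArg Prod.fst h)
    have h1 := B.G_injective t.2.1 (congrArg Prod.snd h)
    have h2 : p = q := congrArg Prod.fst h1
    rw [h2]

theorem model_injective : Function.Injective B.model := by
  have hne : ∀ z t P, B.model (.sing z) ≠ B.model (.pos t P) := by
    rintro (⟨x, w⟩ | ⟨s, p⟩) t P h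
    · exact absurd (congrArg Prod.fst h : (0 : ℝ) = t) t.2.1.ne
    · have hs : (s : ℝ) = t := congrArg Prod.fst h
      have h1 : B.G s (p, 0) = B.G t (logc P) := congrArg Prod.snd h
      rw [hs] at h1
      have h2 := congrArg Prod.snd (B.G_injective t.2.1 h1)
      exact (Real.exp_pos (height P)).ne h2
  rintro (z | ⟨t, P⟩) (z' | ⟨s, Q⟩) h
  · rw [B.modelSing_injective h]
  · exact absurd h (hne _ _ _)
  · exact absurd h.symm (hne _ _ _)
  · obtain rfl : t = s := Subtype.ext (congrArg Prod.fst h)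
    rw [logc_injective (B.G_injective t.2.1 (congrArg Prod.snd h))]

theorem model_qF_mem_region (a : D.XF × E (m + 1)) : B.model (D.qF a) ∈ B.region := by
  rcases a.1.2.1.1.eq_or_lt with h | h
  · rw [B.model_qF_of_eq_zero h.symm]
    refine ⟨⟨le_rfl, zero_le_one⟩, D.expo_mem_half _ _, ?_, fun h => absurd h zero_ne_one⟩
    have h1 := B.b_lift le_rfl (D.isNrm_nrm a.1.1.1 (scale (D.rho a.1.1.1) a.2))
      (by rw [zero_smul]; exact D.zero_mem_tube _)
    exact (B.dil_pos _ le_rfl _).trans_eq h1.symm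
  · rw [B.model_qF_of_pos h]
    refine ⟨⟨h.le, a.1.2.1.2⟩, B.G_mem_half (D.expo_mem_half _ _),
      add_pos_of_nonneg_of_pos (B.b_nonneg _) h, fun h1 => ?_⟩
    have h2 : 0 < D.rho a.1.1.1 := D.rho_pos_iff.2 fun hb => a.1.2.2 ⟨hb, h1⟩
    exact mul_pos (mul_pos h2 (Real.exp_pos _)) (Real.exp_pos _)

/-- At `t = 0` the global coordinates are continuous: this is the deformation to the normal cone. -/
theorem tendsto_model_qF_zero {a₀ : D.XF × E (m + 1)} (h₀ : a₀.1.1.2 = 0) :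
    Tendsto (fun a => B.model (D.qF a)) (𝓝 a₀) (𝓝 (B.model (D.qF a₀))) := by
  set x₀ := a₀.1.1.1 with hx₀
  have hX : Continuous fun a : D.XF × E (m + 1) => a.1.1.1 :=
    continuous_fst.comp (continuous_subtype_val.comp continuous_fst)
  have hT : Continuous fun a : D.XF × E (m + 1) => a.1.1.2 :=
    continuous_snd.comp (continuous_subtype_val.comp continuous_fst)
  have hV : Continuous fun a : D.XF × E (m + 1) => a.2 := continuous_snd
  let Q : D.XF × E (m + 1) → E m × ℝ := fun a => D.expo a.1.1.1 (a.1.1.2 • a.2)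
  have hQ : Continuous Q := D.continuous_expo.comp (hX.prodMk (hT.smul hV))
  have hQ₀ : Q a₀ = D.expo x₀ 0 := by simp only [Q]; rw [h₀, zero_smul]
  have hz₀ := D.zero_mem_tube x₀
  have hQt : Tendsto Q (𝓝 a₀) (𝓝[half m] (D.expo x₀ 0)) := by
    rw [← hQ₀]
    exact tendsto_nhdsWithin_iff.2 ⟨hQ.tendsto _, Eventually.of_forall fun a => D.expo_mem_half _ _⟩
  have hmem : ∀ᶠ a in 𝓝 a₀, Q a ∈ D.tubeImage :=
    hQt (D.tubeImage_mem_nhdsWithin (expo_mem_tubeImage hz₀))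
  have hinv : Tendsto (fun a => D.expoInv (Q a)) (𝓝 a₀) (𝓝 (x₀, 0)) := by
    have h1 := D.tendsto_expoInv (expo_mem_tubeImage hz₀)
    rw [D.expoInv_expo hz₀] at h1
    exact h1.comp hQt
  have hfoot : Tendsto (fun a => (D.expoInv (Q a)).1) (𝓝 a₀) (𝓝 x₀) :=
    (continuous_fst.tendsto _).comp hinv
  have hvec : Tendsto (fun a => D.vec (Q a)) (𝓝 a₀) (𝓝 0) := (continuous_snd.tendsto _).comp hinv
  -- the rescaled normal vector converges to the normal component of `V`
  let N : D.XF × E (m + 1) → E (m + 1) := fun a =>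
    D.nrm (D.expoInv (Q a)).1 (scale (D.rho (D.expoInv (Q a)).1) a.2)
  have hN : Tendsto N (𝓝 a₀) (𝓝 (D.nrm x₀ (scale (D.rho x₀) a₀.2))) := by
    have hc : Continuous fun p : X × E (m + 1) => D.nrm p.1 (scale (D.rho p.1) p.2) :=
      D.continuous_nrm.comp (continuous_fst.prodMk ((contDiff_scale (k := 0)).continuous.comp
        ((D.continuous_rho.comp continuous_fst).prodMk continuous_snd)))
    exact (hc.tendsto (x₀, a₀.2)).comp (hfoot.prodMk_nhds (hV.tendsto a₀))
  let c : D.XF × E (m + 1) → E (m + 1) := fun a =>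
    if a.1.1.2 = 0 then N a else a.1.1.2⁻¹ • D.vec (Q a)
  have hc : Tendsto c (𝓝 a₀) (𝓝 (D.nrm x₀ (scale (D.rho x₀) a₀.2))) := by
    obtain ⟨r, hr, hg⟩ := D.exists_good x₀
    have hd : Tendsto (fun a => c a - N a) (𝓝 a₀) (𝓝 0) := by
      have hbd : Tendsto (fun a : D.XF × E (m + 1) =>
          Real.sqrt (r⁻¹ * (2 * (‖a.2‖ + ‖N a‖ + 1) * (a.1.1.2 * ‖a.2‖ ^ 2)))) (𝓝 a₀) (𝓝 0) := by
        have h1 : Tendsto (fun a : D.XF × E (m + 1) =>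
          r⁻¹ * (2 * (‖a.2‖ + ‖N a‖ + 1) * (a.1.1.2 * ‖a.2‖ ^ 2))) (𝓝 a₀)
          (𝓝 (r⁻¹ * (2 * (‖a₀.2‖ + ‖D.nrm x₀ (scale (D.rho x₀) a₀.2)‖ + 1)
            * (a₀.1.1.2 * ‖a₀.2‖ ^ 2)))) :=
          ((((hV.tendsto a₀).norm.add hN.norm).add_const 1).const_mul 2 |>.mul
            ((hT.tendsto a₀).mul ((hV.tendsto a₀).norm.pow 2))).const_mul _
        have h2 := h1.sqrt
        rw [h₀, zero_mul, mul_zero, mul_zero, Real.sqrt_zero] at h2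
        exact h2
      refine squeeze_zero_norm' ?_ hbd
      have hx : ∀ᶠ a in 𝓝 a₀, dist (D.emb a.1.1.1) (D.emb x₀) < r :=
        ((D.continuous_emb.comp hX).tendsto a₀).eventually (Metric.ball_mem_nhds _ hr)
      have hy : ∀ᶠ a in 𝓝 a₀, dist (D.emb (D.expoInv (Q a)).1) (D.emb x₀) < r :=
        ((D.continuous_emb.tendsto x₀).comp hfoot).eventually (Metric.ball_mem_nhds _ hr)
      have hw : ∀ᶠ a in 𝓝 a₀, ‖D.vec (Q a)‖ < r := by
        have := hvec.norm
        rw [norm_zero] at this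
        exact this.eventually (gt_mem_nhds hr)
      filter_upwards [hx, hy, hw, hmem] with a hax hay haw ham
      rcases a.1.2.1.1.eq_or_lt with h | h
      · have : c a = N a := if_pos h.symm
        rw [this, sub_self, norm_zero]
        exact Real.sqrt_nonneg _
      · have hca : c a = a.1.1.2⁻¹ • D.vec (Q a) := if_neg h.ne'
        obtain ⟨h1, h2⟩ := norm_sub_nrm_le hg h hax hay (D.isNrm_vec ham) haw
          (D.expo_expoInv ham)
        rw [← hca] at h1 h2
        change r * ‖c a - N a‖ ^ 2 ≤ 2 * (‖c a - N a‖ + 1) * _ at h2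
        apply Real.le_sqrt_of_sq_le
        rw [← div_eq_inv_mul, le_div_iff₀ hr, mul_comm]
        refine h2.trans (mul_le_mul_of_nonneg_right ?_ (by positivity))
        have := norm_sub_le (c a) (N a)
        linarith
    have h1 := hd.add hN
    simp only [sub_add_cancel, zero_add] at h1
    exact h1
  have hlift : Tendsto (fun a => B.lift (D.expoInv (Q a)).1 a.1.1.2 (c a)) (𝓝 a₀)
      (𝓝 (B.lift x₀ 0 (D.nrm x₀ (scale (D.rho x₀) a₀.2)))) := by
    have h1 : Tendsto (fun q : X × ℝ × E (m + 1) => B.lift q.1 q.2.1 q.2.2)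
        (𝓝[{q | 0 ≤ q.2.1}] (x₀, 0, D.nrm x₀ (scale (D.rho x₀) a₀.2)))
        (𝓝 (B.lift x₀ 0 (D.nrm x₀ (scale (D.rho x₀) a₀.2)))) :=
      B.continuousOn_lift (x₀, 0, D.nrm x₀ (scale (D.rho x₀) a₀.2)) (le_refl (0 : ℝ))
    have h2 : Tendsto (fun a : D.XF × E (m + 1) => ((D.expoInv (Q a)).1, a.1.1.2, c a)) (𝓝 a₀)
        (𝓝[{q | 0 ≤ q.2.1}] (x₀, 0, D.nrm x₀ (scale (D.rho x₀) a₀.2))) := by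
      refine tendsto_nhdsWithin_iff.2 ⟨hfoot.prodMk_nhds (Tendsto.prodMk_nhds ?_ hc),
        Eventually.of_forall fun a => a.1.2.1.1⟩
      have := hT.tendsto a₀
      rwa [h₀] at this
    have h3 := h1.comp h2
    simp only [Function.comp_def] at h3
    exact h3
  rw [B.model_qF_of_eq_zero h₀]
  have hT0 := hT.tendsto a₀
  rw [h₀] at hT0
  refine (hT0.prodMk_nhds hlift).congr' ?_
  filter_upwards [hmem] with a ham
  rcases a.1.2.1.1.eq_or_lt with h | h
  · rw [B.model_qF_of_eq_zero h.symm]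
    have hQa : Q a = D.expo a.1.1.1 0 := by simp only [Q]; rw [← h, zero_smul]
    have hfa : (D.expoInv (Q a)).1 = a.1.1.1 := by
      rw [hQa, D.expoInv_expo (D.zero_mem_tube _)]
    have hca : c a = N a := if_pos h.symm
    rw [hca, hfa, ← h]
    simp only [N]
    rw [hfa]
  · rw [B.model_qF_of_pos h]
    have hca : c a = a.1.1.2⁻¹ • D.vec (Q a) := if_neg h.ne'
    have h1 := B.G_expo (x := (D.expoInv (Q a)).1) (t := a.1.1.2) (w := (D.expoInv (Q a)).2)
      (D.expoInv_mem ham)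
    have h2 : D.expo (D.expoInv (Q a)).1 (D.expoInv (Q a)).2 = Q a := D.expo_expoInv ham
    rw [h2] at h1
    rw [hca]
    exact Prod.ext rfl h1.symm

theorem continuous_model : Continuous B.model := by
  rw [continuous_coinduced_dom, continuous_iff_continuousAt]
  intro a₀
  rcases a₀.1.2.1.1.eq_or_lt with h | h
  · exact B.tendsto_model_qF_zero h.symm
  · have hX : Continuous fun a : D.XF × E (m + 1) => a.1.1.1 :=
      continuous_fst.comp (continuous_subtype_val.comp continuous_fst)
    have hT : Continuous fun a : D.XF × E (m + 1) => a.1.1.2 :=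
      continuous_snd.comp (continuous_subtype_val.comp continuous_fst)
    have hV : Continuous fun a : D.XF × E (m + 1) => a.2 := continuous_snd
    have hQ : Continuous fun a : D.XF × E (m + 1) => D.expo a.1.1.1 (a.1.1.2 • a.2) :=
      D.continuous_expo.comp (hX.prodMk (hT.smul hV))
    have hpos : ∀ᶠ a in 𝓝 a₀, 0 < a.1.1.2 := (hT.tendsto a₀).eventually (lt_mem_nhds h)
    have h1 : Tendsto (fun q : ℝ × (E m × ℝ) => B.G q.1 q.2)
        (𝓝[Ioi 0 ×ˢ half m] (a₀.1.1.2, D.expo a₀.1.1.1 (a₀.1.1.2 • a₀.2)))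
        (𝓝 (B.G a₀.1.1.2 (D.expo a₀.1.1.1 (a₀.1.1.2 • a₀.2)))) :=
      B.continuousOn_G (_, _) ⟨h, D.expo_mem_half _ _⟩
    have h2 : Tendsto (fun a : D.XF × E (m + 1) =>
        (a.1.1.2, D.expo a.1.1.1 (a.1.1.2 • a.2))) (𝓝 a₀)
        (𝓝[Ioi 0 ×ˢ half m] (a₀.1.1.2, D.expo a₀.1.1.1 (a₀.1.1.2 • a₀.2))) := by
      refine tendsto_nhdsWithin_iff.2 ⟨(hT.prodMk hQ).tendsto _, ?_⟩
      filter_upwards [hpos] with a ha using ⟨ha, D.expo_mem_half _ _⟩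
    have h3 := h1.comp h2
    simp only [Function.comp_def] at h3
    have h4 : Tendsto (fun a => B.model (D.qF a)) (𝓝 a₀) (𝓝 (B.model (D.qF a₀))) := by
      rw [B.model_qF_of_pos h]
      refine ((hT.tendsto a₀).prodMk_nhds h3).congr' ?_
      filter_upwards [hpos] with a ha using (B.model_qF_of_pos ha).symm
    exact h4

end Cutoff

end BoundaryEmbedding

namespace BoundaryEmbedding

variable {n m : ℕ} [NeZero n] {X : Type*} [TopologicalSpace X]
  [ChartedSpace (EuclideanHalfSpace n) X] {D : BoundaryEmbedding n m X}

/-! ### The topology of `B_F` and of `N_sing(X)` -/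

theorem exists_nhds_XF {a : D.XF × E (m + 1)} {N : Set (D.XF × E (m + 1))} (hN : N ∈ 𝓝 a) :
    ∃ W ∈ 𝓝 ((a.1.1, a.2) : (X × ℝ) × E (m + 1)), ∀ a' : D.XF × E (m + 1),
      ((a'.1.1, a'.2) : (X × ℝ) × E (m + 1)) ∈ W → a' ∈ N := by
  have h : IsInducing (fun a : D.XF × E (m + 1) => ((a.1.1, a.2) : (X × ℝ) × E (m + 1))) :=
    IsInducing.subtypeVal.prodMap IsInducing.id
  rw [h.nhds_eq_comap] at hN
  obtain ⟨W, hW, hWN⟩ := hN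
  exact ⟨W, hW, fun a' ha' => hWN ha'⟩

theorem exists_rho_pos [IsManifold (𝓡∂ n) ∞ X] (hbd : ((𝓡∂ n).boundary X).Nonempty) :
    ∃ y, 0 < D.rho y := by
  obtain ⟨x, hx⟩ := hbd
  have h1 := D.eventually_exists_rho_eq ((D.rho_eq_zero_iff x).2 hx) univ_mem
  have h2 : ∀ᶠ u in 𝓝[>] (0 : ℝ), ∃ y ∈ univ, D.rho y = u :=
    h1.filter_mono (nhdsWithin_mono _ Ioi_subset_Ici_self)
  obtain ⟨u, ⟨y, -, hy⟩, hu⟩ := (h2.and self_mem_nhdsWithin).exists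
  exact ⟨y, by rw [hy]; exact hu⟩

/-- Over every positive `t` the map `(x, V) ↦ expo x (t V)` is onto the half space. -/
theorem exists_expo_smul_eq [IsManifold (𝓡∂ n) ∞ X] (hbd : ((𝓡∂ n).boundary X).Nonempty) {t : ℝ}
    (ht : 0 < t) {Q : E m × ℝ} (hQ : Q ∈ half m) : ∃ x V, D.expo x (t • V) = Q := by
  have key : ∀ x c, D.rho x * Real.exp c = Q.2 →
      D.expo x (t • t⁻¹ • join (Q.1 - D.emb x) c) = Q := fun x c h => by
    rw [smul_smul, mul_inv_cancel₀ ht.ne', one_smul]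
    simp only [expo, front_join, height_join, add_sub_cancel, h]
  rcases (show 0 ≤ Q.2 from hQ).eq_or_lt with h | h
  · obtain ⟨x, hx⟩ := hbd
    exact ⟨x, _, key x 0 (by rw [(D.rho_eq_zero_iff x).2 hx, zero_mul, h])⟩
  · obtain ⟨x, hx⟩ := D.exists_rho_pos hbd
    exact ⟨x, _, key x (Real.log (Q.2 / D.rho x))
      (by rw [Real.exp_log (div_pos h hx), mul_div_cancel₀ _ hx.ne'])⟩

theorem continuous_qF : Continuous D.qF := continuous_coinduced_rng

theorem continuous_qSing : Continuous D.qSing := continuous_coinduced_rng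

theorem qF_eq_sing {a : D.XF × E (m + 1)} (h : a.1.1.2 = 0 ∨ a.1.1.1 ∈ (𝓡∂ n).boundary X) :
    D.qF a = .sing (D.qSing (⟨a.1, h⟩, a.2)) := dif_pos h

theorem continuous_sing : Continuous (BF.sing (D := D)) := by
  rw [continuous_coinduced_dom]
  have h1 : (BF.sing ∘ D.qSing : D.XBd × E (m + 1) → D.BF) = fun a => D.qF (a.1.1, a.2) := by
    funext a
    exact (qF_eq_sing (a := (a.1.1, a.2)) a.1.2).symm
  rw [h1]
  exact continuous_qF.comp ((continuous_subtype_val.comp continuous_fst).prodMk continuous_snd)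

theorem exists_of_qF_eq_sing {a : D.XF × E (m + 1)} {z : D.Nsing} (h : D.qF a = .sing z) :
    ∃ h' : a.1.1.2 = 0 ∨ a.1.1.1 ∈ (𝓡∂ n).boundary X, D.qSing (⟨a.1, h'⟩, a.2) = z := by
  by_cases h' : a.1.1.2 = 0 ∨ a.1.1.1 ∈ (𝓡∂ n).boundary X
  · refine ⟨h', ?_⟩
    rw [qF_eq_sing h'] at h
    exact BF.sing.inj h
  · rw [qF, dif_neg h'] at h
    cases h

namespace Cutoff

variable [Nonempty X] [IsManifold (𝓡∂ n) ∞ X] (B : D.Cutoff)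

/-- The global coordinates, composed with the quotient map, are open at `a` onto the region. -/
def OpenAt (a : D.XF × E (m + 1)) : Prop :=
  ∀ N ∈ 𝓝 a, ∀ᶠ z in 𝓝[B.region] (B.model (D.qF a)), ∃ a' ∈ N, B.model (D.qF a') = z

omit [IsManifold (𝓡∂ n) ∞ X] in
theorem tendsto_Θ {z₀ : ℝ × (E m × ℝ)} (h : z₀ ∈ B.region) (h0 : 0 < z₀.1) :
    Tendsto (fun z : ℝ × (E m × ℝ) => B.Θ z.1 z.2) (𝓝[B.region] z₀) (𝓝 (B.Θ z₀.1 z₀.2)) := by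
  have h1 : Tendsto (fun z : ℝ × (E m × ℝ) => B.Θ z.1 z.2) (𝓝[Ioi 0 ×ˢ half m] z₀)
      (𝓝 (B.Θ z₀.1 z₀.2)) := B.continuousOn_Θ z₀ ⟨h0, h.2.1⟩
  refine h1.mono_left (nhdsWithin_le_iff.2 ?_)
  filter_upwards [self_mem_nhdsWithin, mem_nhdsWithin_of_mem_nhds
    ((continuous_fst.tendsto z₀).eventually (lt_mem_nhds h0))] with z hz hz0 using ⟨hz0, hz.2.1⟩

/-- For `t > 0` the model is `G t (expo x (t V))`. A nearby point is reached by moving `x` and the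
last coordinate of `V` so as to match its height, and then adjusting `V'`; over `∂X` the first
step moves `x` into the interior. -/
theorem openAt_of_pos {a : D.XF × E (m + 1)} (h : 0 < a.1.1.2) : B.OpenAt a := by
  intro N hN
  obtain ⟨W, hW, hWN⟩ := exists_nhds_XF hN
  set x₀ := a.1.1.1 with hx₀
  set t₀ := a.1.1.2 with ht₀
  set Q₀ := D.expo x₀ (t₀ • a.2) with hQ₀
  set c₀ := t₀ * height a.2 with hc₀
  have hreg := B.model_qF_mem_region a
  rw [B.model_qF_of_pos h] at hreg ⊢
  let Ψ : (X × ℝ) × (ℝ × (E m × ℝ)) → (X × ℝ) × E (m + 1) := fun p =>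
    ((p.1.1, p.2.1), p.2.1⁻¹ • join (p.2.2.1 - D.emb p.1.1) p.1.2)
  have hΨ0 : Ψ ((x₀, c₀), (t₀, Q₀)) = (a.1.1, a.2) := by
    refine Prod.ext rfl ?_
    simp only [Ψ, hQ₀, expo, add_sub_cancel_left, front_smul, hc₀]
    rw [join_smul, join_front_height, smul_smul, inv_mul_cancel₀ h.ne', one_smul]
  have hΨ : ContinuousAt Ψ ((x₀, c₀), (t₀, Q₀)) := by
    have h1 : Continuous fun p : (X × ℝ) × (ℝ × (E m × ℝ)) =>
        join (p.2.2.1 - D.emb p.1.1) p.1.2 := by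
      have := D.continuous_emb
      fun_prop
    have h2 : ContinuousAt (fun p : (X × ℝ) × (ℝ × (E m × ℝ)) => p.2.1⁻¹)
        ((x₀, c₀), (t₀, Q₀)) :=
      (continuous_fst.comp continuous_snd).continuousAt.inv₀ h.ne'
    have h3 : Continuous fun p : (X × ℝ) × (ℝ × (E m × ℝ)) => (p.1.1, p.2.1) := by fun_prop
    exact h3.continuousAt.prodMk (h2.smul h1.continuousAt)
  rw [← hΨ0] at hW
  obtain ⟨W₁, hW₁, W₂, hW₂, hW12⟩ := mem_nhds_prod_iff.1 (hΨ hW)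
  have hΘ := B.tendsto_Θ hreg h
  simp only at hΘ
  rw [B.Θ_G h, ← ht₀, ← hQ₀] at hΘ
  have hev : ∀ᶠ z in 𝓝[B.region] (t₀, B.G t₀ Q₀), (z.1, B.Θ z.1 z.2) ∈ W₂ := by
    have h1 : Tendsto (fun z : ℝ × (E m × ℝ) => (z.1, B.Θ z.1 z.2))
        (𝓝[B.region] (t₀, B.G t₀ Q₀)) (𝓝 (t₀, Q₀)) :=
      ((continuous_fst.tendsto _).mono_left inf_le_left).prodMk_nhds hΘ
    exact h1 hW₂
  have hrel : ∀ᶠ z in 𝓝[B.region] (t₀, B.G t₀ Q₀),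
      ∃ q ∈ W₁, D.rho q.1 * Real.exp q.2 = (B.Θ z.1 z.2).2 := by
    have h1 : Tendsto (fun z : ℝ × (E m × ℝ) => (B.Θ z.1 z.2).2)
        (𝓝[B.region] (t₀, B.G t₀ Q₀)) (𝓝[Ici 0] (D.rho x₀ * Real.exp c₀)) := by
      refine tendsto_nhdsWithin_iff.2 ⟨?_, ?_⟩
      · exact (continuous_snd.tendsto Q₀).comp hΘ
      · filter_upwards [self_mem_nhdsWithin] with z hz
        exact B.Θ_mem_half hz.2.1
    exact h1.eventually (D.eventually_exists_rho_mul_exp_eq hW₁)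
  filter_upwards [hev, hrel, self_mem_nhdsWithin, mem_nhdsWithin_of_mem_nhds
    ((continuous_fst.tendsto (t₀, B.G t₀ Q₀)).eventually (lt_mem_nhds h))] with z hz hz2 hzr hz0
  obtain ⟨q, hq, hqz⟩ := hz2
  have hbd : ¬(q.1 ∈ (𝓡∂ n).boundary X ∧ z.1 = 1) := fun ⟨h1, h2⟩ => by
    have h3 : 0 < (B.Θ z.1 z.2).2 := mul_pos (hzr.2.2.2 h2) (Real.exp_pos _)
    rw [← hqz, (D.rho_eq_zero_iff _).2 h1, zero_mul] at h3
    exact lt_irrefl _ h3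
  have hz0' : 0 < z.1 := hz0
  refine ⟨(⟨(q.1, z.1), hzr.1, hbd⟩, z.1⁻¹ • join ((B.Θ z.1 z.2).1 - D.emb q.1) q.2),
    hWN _ (hW12 (mk_mem_prod hq hz)), ?_⟩
  rw [B.model_qF_of_pos (by exact hz0')]
  have e : D.expo q.1 (z.1 • z.1⁻¹ • join ((B.Θ z.1 z.2).1 - D.emb q.1) q.2) = B.Θ z.1 z.2 := by
    rw [smul_smul, mul_inv_cancel₀ hz0'.ne', one_smul]
    simp only [expo, front_join, height_join, add_sub_cancel, hqz]
  exact Prod.ext rfl ((congrArg (B.G z.1) e).trans (B.G_Θ hz0' z.2))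

/-- The normal coordinate of a point of the image of the tube. -/
theorem model_section {z : ℝ × (E m × ℝ)} (hz : z ∈ B.region) (hT : z.2 ∈ D.tubeImage)
    (h : z.1 ∈ Icc (0 : ℝ) 1 ∧ ¬((D.expoInv z.2).1 ∈ (𝓡∂ n).boundary X ∧ z.1 = 1)) :
    B.model (D.qF (⟨((D.expoInv z.2).1, z.1), h⟩, (B.b z.2 + z.1)⁻¹ • D.vec z.2)) = z := by
  set x := (D.expoInv z.2).1 with hx
  set v := D.vec z.2 with hv
  have hmem : (x, v) ∈ D.tube := D.expoInv_mem hT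
  have he : D.expo x v = z.2 := D.expo_expoInv hT
  have hpos := hz.2.2.1
  have hl := B.lift_smul_vec hz.1.1 hmem (by rw [he]; exact hpos)
  rw [he] at hl
  rcases hz.1.1.eq_or_lt with h0 | h0
  · rw [B.model_qF_of_eq_zero (by exact h0.symm)]
    simp only
    rw [D.nrm_scale_of_isNrm (hmem.1.smul _)]
    refine Prod.ext h0 ?_
    simp only
    conv_rhs => rw [← hl]
    rw [← h0]
  · rw [B.model_qF_of_pos (by exact h0)]
    refine Prod.ext rfl ?_
    simp only
    have hm : (x, z.1 • (B.b z.2 + z.1)⁻¹ • v) ∈ D.tube := by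
      rw [smul_smul]
      refine D.smul_mem_tube hmem ?_
      rw [abs_of_nonneg (by positivity), ← div_eq_mul_inv, div_le_one hpos]
      linarith [B.b_nonneg z.2]
    rw [B.G_expo hm, smul_smul z.1⁻¹, inv_mul_cancel₀ h0.ne', one_smul, hl]

omit [IsManifold (𝓡∂ n) ∞ X] in
theorem not_boundary_of_mem_region {z : ℝ × (E m × ℝ)} (hz : z ∈ B.region)
    (hT : z.2 ∈ D.tubeImage) : ¬((D.expoInv z.2).1 ∈ (𝓡∂ n).boundary X ∧ z.1 = 1) := by
  rintro ⟨h1, h2⟩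
  have h3 := hz.2.2.2 h2
  rw [← D.rho_expoInv hT, (D.rho_eq_zero_iff _).2 h1, zero_mul] at h3
  exact lt_irrefl _ h3

/-- The local section of `model_section` is continuous, which gives openness at its values. -/
theorem openAt_section {z₀ : ℝ × (E m × ℝ)} (hz₀ : z₀ ∈ B.region) (hT₀ : z₀.2 ∈ D.tubeImage) :
    B.OpenAt (⟨((D.expoInv z₀.2).1, z₀.1), hz₀.1, B.not_boundary_of_mem_region hz₀ hT₀⟩,
      (B.b z₀.2 + z₀.1)⁻¹ • D.vec z₀.2) := by
  intro N hN
  rw [B.model_section hz₀ hT₀]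
  obtain ⟨W, hW, hWN⟩ := exists_nhds_XF hN
  have ht2 : Tendsto (fun z : ℝ × (E m × ℝ) => z.2) (𝓝[B.region] z₀) (𝓝[half m] z₀.2) := by
    refine tendsto_nhdsWithin_iff.2 ⟨(continuous_snd.tendsto _).mono_left inf_le_left, ?_⟩
    filter_upwards [self_mem_nhdsWithin] with z hz using hz.2.1
  have ht1 : Tendsto (fun z : ℝ × (E m × ℝ) => z.1) (𝓝[B.region] z₀) (𝓝 z₀.1) :=
    (continuous_fst.tendsto _).mono_left inf_le_left
  have hb : Tendsto B.b (𝓝[half m] z₀.2) (𝓝 (B.b z₀.2)) := B.continuousOn_wgt z₀.2 hz₀.2.1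
  have hs : Tendsto (fun z : ℝ × (E m × ℝ) =>
      (((D.expoInv z.2).1, z.1), (B.b z.2 + z.1)⁻¹ • D.vec z.2)) (𝓝[B.region] z₀)
      (𝓝 (((D.expoInv z₀.2).1, z₀.1), (B.b z₀.2 + z₀.1)⁻¹ • D.vec z₀.2)) := by
    refine Tendsto.prodMk_nhds (Tendsto.prodMk_nhds ?_ ht1) (Tendsto.smul (Tendsto.inv₀ ?_ ?_) ?_)
    · exact (continuous_fst.tendsto _).comp ((D.tendsto_expoInv hT₀).comp ht2)
    · exact (hb.comp ht2).add ht1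
    · exact hz₀.2.2.1.ne'
    · exact (D.tendsto_vec hT₀).comp ht2
  filter_upwards [hs hW, ht2 (D.tubeImage_mem_nhdsWithin hT₀), self_mem_nhdsWithin]
    with z hzW hzT hz
  exact ⟨_, hWN (⟨((D.expoInv z.2).1, z.1), hz.1, B.not_boundary_of_mem_region hz hzT⟩,
    (B.b z.2 + z.1)⁻¹ • D.vec z.2) hzW, B.model_section hz hzT _⟩

omit [IsManifold (𝓡∂ n) ∞ X] in
theorem mem_tubeImage_of_eq_zero {z : ℝ × (E m × ℝ)} (hz : z ∈ B.region) (h : z.1 = 0) :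
    z.2 ∈ D.tubeImage := by
  refine B.mem_tubeImage_of_b_ne_zero ?_
  have := hz.2.2.1
  rw [h, add_zero] at this
  exact this.ne'

theorem model_qF_surjective (hbd : ((𝓡∂ n).boundary X).Nonempty) {z : ℝ × (E m × ℝ)}
    (hz : z ∈ B.region) : ∃ a, B.model (D.qF a) = z := by
  rcases hz.1.1.eq_or_lt with h | h
  · have hT := B.mem_tubeImage_of_eq_zero hz h.symm
    exact ⟨_, B.model_section hz hT ⟨hz.1, B.not_boundary_of_mem_region hz hT⟩⟩
  · obtain ⟨x, V, hxV⟩ := D.exists_expo_smul_eq hbd h (B.Θ_mem_half (t := z.1) hz.2.1)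
    have hx : ¬(x ∈ (𝓡∂ n).boundary X ∧ z.1 = 1) := fun ⟨h1, h2⟩ => by
      have h3 : 0 < (B.Θ z.1 z.2).2 := mul_pos (hz.2.2.2 h2) (Real.exp_pos _)
      rw [← hxV] at h3
      exact (rho_pos_of_expo_pos h3).ne' ((D.rho_eq_zero_iff x).2 h1)
    refine ⟨(⟨(x, z.1), hz.1, hx⟩, V), ?_⟩
    rw [B.model_qF_of_pos (by exact h)]
    exact Prod.ext rfl ((congrArg (B.G z.1) hxV).trans (B.G_Θ h z.2))

include B in
theorem qF_surjective (hbd : ((𝓡∂ n).boundary X).Nonempty) : Function.Surjective D.qF := by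
  have hcase : ∀ β : D.BF, B.model β ∈ B.region := by
    rintro ((⟨x, w⟩ | ⟨t, p⟩) | ⟨t, P⟩)
    · obtain ⟨W, rfl⟩ := Submodule.Quotient.mk_surjective _ w
      have h1 := B.model_qF_mem_region (⟨(x, 0), ⟨le_rfl, zero_le_one⟩, by simp⟩, D.nrm x W)
      rw [B.model_qF_of_eq_zero (by rfl)] at h1
      simp only at h1
      rwa [D.nrm_scale_of_isNrm (D.isNrm_nrm x W)] at h1
    · exact ⟨⟨t.2.1.le, t.2.2.le⟩, B.G_mem_half (le_refl (0 : ℝ)),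
        add_pos_of_nonneg_of_pos (B.b_nonneg _) t.2.1, fun h => absurd h t.2.2.ne⟩
    · exact ⟨⟨t.2.1.le, t.2.2⟩, B.G_mem_half (logc_mem_half P),
        add_pos_of_nonneg_of_pos (B.b_nonneg _) t.2.1,
        fun _ => mul_pos (Real.exp_pos _) (Real.exp_pos _)⟩
  intro β
  obtain ⟨a, ha⟩ := B.model_qF_surjective hbd (hcase β)
  exact ⟨a, B.model_injective ha⟩

theorem range_model (hbd : ((𝓡∂ n).boundary X).Nonempty) : range B.model = B.region := by
  ext z
  constructor
  · rintro ⟨β, rfl⟩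
    obtain ⟨a, rfl⟩ := B.qF_surjective hbd β
    exact B.model_qF_mem_region a
  · intro hz
    obtain ⟨a, ha⟩ := B.model_qF_surjective hbd hz
    exact ⟨_, ha⟩

theorem exists_openAt (hbd : ((𝓡∂ n).boundary X).Nonempty) (β : D.BF) :
    ∃ a, D.qF a = β ∧ B.OpenAt a := by
  obtain ⟨a, rfl⟩ := B.qF_surjective hbd β
  rcases a.1.2.1.1.eq_or_lt with h | h
  · have hz := B.model_qF_mem_region a
    have hT := B.mem_tubeImage_of_eq_zero hz (by rw [B.model_qF_fst]; exact h.symm)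
    exact ⟨_, B.model_injective (B.model_section hz hT
      ⟨hz.1, B.not_boundary_of_mem_region hz hT⟩), B.openAt_section hz hT⟩
  · exact ⟨a, rfl, B.openAt_of_pos h⟩

/-- Every point of `B_F` has a representative at which the quotient map is open onto the region.
-/
theorem isEmbedding_model (hbd : ((𝓡∂ n).boundary X).Nonempty) : IsEmbedding B.model := by
  refine ⟨isInducing_iff_nhds.2 fun β => le_antisymm
    (map_le_iff_le_comap.1 (B.continuous_model.tendsto β)) fun U hU => ?_, B.model_injective⟩
  obtain ⟨a, rfl, ha⟩ := B.exists_openAt hbd β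
  have h1 := ha _ (continuous_qF.continuousAt.preimage_mem_nhds hU)
  rw [eventually_nhdsWithin_iff] at h1
  refine ⟨_, h1, fun β' hβ' => ?_⟩
  obtain ⟨b', rfl⟩ := B.qF_surjective hbd β'
  obtain ⟨a', ha', he⟩ := hβ' (B.model_qF_mem_region b')
  rw [← B.model_injective he]
  exact ha'

theorem isEmbedding_modelSing (hbd : ((𝓡∂ n).boundary X).Nonempty) :
    IsEmbedding B.modelSing := by
  have hc : Continuous B.modelSing := B.continuous_model.comp continuous_sing
  refine ⟨isInducing_iff_nhds.2 fun z => le_antisymm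
    (map_le_iff_le_comap.1 (hc.tendsto z)) fun U hU => ?_, B.modelSing_injective⟩
  obtain ⟨a, hqa, ha⟩ := B.exists_openAt hbd (.sing z)
  obtain ⟨h', rfl⟩ := exists_of_qF_eq_sing hqa
  have h1 := continuous_qSing.continuousAt.preimage_mem_nhds hU
  have hind : IsInducing (fun a : D.XBd × E (m + 1) => ((a.1.1, a.2) : D.XF × E (m + 1))) :=
    IsInducing.subtypeVal.prodMap IsInducing.id
  rw [hind.nhds_eq_comap] at h1
  obtain ⟨N, hN, hNU⟩ := h1
  have h2 := ha N hN
  rw [eventually_nhdsWithin_iff, hqa] at h2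
  refine ⟨_, h2, fun z' hz' => ?_⟩
  obtain ⟨b', hb'⟩ := B.qF_surjective hbd (.sing z')
  have hreg := B.model_qF_mem_region b'
  rw [hb'] at hreg
  obtain ⟨a', ha', he⟩ := hz' hreg
  obtain ⟨h3, h4⟩ := exists_of_qF_eq_sing (B.model_injective (a₂ := .sing z') he)
  rw [← h4]
  exact hNU (show (a'.1, a'.2) ∈ N from ha')

theorem range_sing : range (BF.sing (D := D)) = B.model ⁻¹' {z | z.1 * z.2.2 = 0} := by
  ext β
  constructor
  · rintro ⟨⟨x, w⟩ | ⟨t, p⟩, rfl⟩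
    · exact zero_mul _
    · change (t : ℝ) * (0 * _) = 0
      rw [zero_mul, mul_zero]
  · rcases β with z | ⟨t, P⟩
    · exact fun _ => ⟨z, rfl⟩
    · intro h
      exact absurd h (mul_pos t.2.1 (mul_pos (Real.exp_pos _) (Real.exp_pos _))).ne'

/-! ### The orbit space -/

include B in
/-- Two points of `X_F × ℝ^N` lie in the same orbit exactly when they have the same image in
`B_F`. -/
theorem qF_eq_iff (a a' : D.XF × E (m + 1)) : D.qF a = D.qF a' ↔ D.orbitSetoid a a' := by
  constructor
  · intro h
    have hm := congrArg B.model h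
    have ht : a.1.1.2 = a'.1.1.2 := by rw [← B.model_qF_fst, hm, B.model_qF_fst]
    obtain ⟨⟨⟨x, t⟩, hx⟩, V⟩ := a
    obtain ⟨⟨⟨y, s⟩, hy⟩, V'⟩ := a'
    obtain rfl : t = s := ht
    rcases hx.1.1.eq_or_lt with h0 | h0
    · obtain rfl : (0 : ℝ) = t := h0
      rw [B.model_qF_of_eq_zero (by rfl), B.model_qF_of_eq_zero (by rfl)] at hm
      obtain ⟨h1, h2⟩ := B.lift_zero_injective (D.isNrm_nrm _ _) (D.isNrm_nrm _ _)
        (congrArg Prod.snd hm)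
      simp only at h1 h2
      subst h1
      have h3 : scale (D.rho x) (V' - V) ∈ D.tangentImage x := by
        apply D.mem_tangentImage_of_nrm_eq_zero
        rw [scale_sub, sub_eq_add_neg, ← neg_one_smul ℝ (scale _ V), D.nrm_add, D.nrm_smul, h2,
          neg_one_smul, add_neg_cancel]
      obtain ⟨ξ, hξ⟩ := D.mem_tangentImage.1 h3
      have hξ1 : D.dEmb x ξ = front (V' - V) := by
        have := congrArg front hξ
        rwa [front_join, front_scale] at this
      have hξ2 : D.dRho x ξ = D.rho x * height (V' - V) := by
        have := congrArg height hξ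
        rwa [height_join, height_scale] at this
      refine ⟨.alg x ⟨(ξ, height (V' - V)), hξ2⟩, rfl, rfl, ?_⟩
      simp only [FredholmArrow.hom, algebroidHom]
      rw [hξ1, join_front_height, add_sub_cancel]
    · rw [B.model_qF_of_pos h0, B.model_qF_of_pos h0] at hm
      have h1 := B.G_injective h0 (congrArg Prod.snd hm)
      obtain ⟨h2, h3⟩ := join_of_expo_eq h1
      refine ⟨.pos ⟨x, y, _, h2⟩ t ⟨h0, hx.1.2⟩ hx.2 hy.2, rfl, rfl, ?_⟩
      simp only [FredholmArrow.hom, BGroupoid.hom]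
      simp only at h3
      rw [h3, ← smul_sub, smul_smul, inv_mul_cancel₀ h0.ne', one_smul, add_sub_cancel]
  · rintro ⟨γ, h1, h2, h3⟩
    obtain ⟨a, V⟩ := a
    obtain ⟨a', V'⟩ := a'
    simp only at h1 h2 h3
    subst h1 h2 h3
    apply B.model_injective
    cases γ with
    | alg x ξ =>
      rw [B.model_qF_of_eq_zero (by rfl), B.model_qF_of_eq_zero (by rfl)]
      refine Prod.ext rfl ?_
      change B.lift x 0 (D.nrm x (scale (D.rho x) V)) =
        B.lift x 0 (D.nrm x (scale (D.rho x) (V + D.algebroidHom x ξ)))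
      congr 1
      apply D.nrm_congr
      rw [← scale_sub, D.mem_tangentImage]
      refine ⟨-ξ.1.1, ?_⟩
      have h4 : D.dRho x ξ.1.1 = D.rho x * ξ.1.2 := ξ.2
      rw [sub_add_cancel_left, map_neg, map_neg, join_neg, h4]
      simp only [scale, algebroidHom]
      rw [← join_neg, ← join_neg, front_join, height_join, mul_neg]
    | pos γ t ht h4 h5 =>
      rw [B.model_qF_of_pos (by exact ht.1), B.model_qF_of_pos (by exact ht.1)]
      refine Prod.ext rfl ?_
      change B.G t (D.expo γ.tgt (t • V)) = B.G t (D.expo γ.src (t • (V + t⁻¹ • γ.hom)))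
      rw [smul_add, smul_smul, mul_inv_cancel₀ ht.1.ne', one_smul, BGroupoid.hom,
        expo_eq_of_join γ.rel]

include B in
theorem exists_homeomorph (hbd : ((𝓡∂ n).boundary X).Nonempty) :
    ∃ Φ : D.OrbitSpace ≃ₜ D.BF, ∀ a, Φ (D.toOrbit a) = D.qF a := by
  let f : D.OrbitSpace → D.BF := Quotient.lift D.qF fun a a' h => (B.qF_eq_iff a a').2 h
  have hf : Function.Bijective f := by
    constructor
    · rintro ⟨a⟩ ⟨a'⟩ h
      exact Quotient.sound ((B.qF_eq_iff a a').1 h)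
    · intro β
      obtain ⟨a, rfl⟩ := B.qF_surjective hbd β
      exact ⟨D.toOrbit a, rfl⟩
  let e := Equiv.ofBijective f hf
  have he : ∀ a, e (D.toOrbit a) = D.qF a := fun a => rfl
  refine ⟨{ e with
    continuous_toFun := continuous_qF.quotient_lift _
    continuous_invFun := ?_ }, fun a => rfl⟩
  change Continuous e.symm
  rw [continuous_coinduced_dom]
  have h1 : e.symm ∘ D.qF = D.toOrbit := by
    funext a
    rw [Function.comp_apply, ← he, e.symm_apply_apply]
  rw [h1]
  exact continuous_quotient_mk'

end Cutoff

end BoundaryEmbedding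

section Corner

/-! ### Coordinates of half spaces and the unfolding of a corner -/

variable {k m : ℕ}

/-- The point `(w, z)` of `ℝ × ℝ^k = ℝ^(k+1)`. -/
def cons (w : ℝ) (z : E k) : E (k + 1) :=
  WithLp.toLp 2 (Fin.cons (α := fun _ => ℝ) w (fun i => z i))

/-- The last `k` coordinates of a vector of `ℝ^(k+1)`. -/
def tail (x : E (k + 1)) : E k := WithLp.toLp 2 (fun i => x i.succ)

@[simp] theorem cons_apply_zero (w : ℝ) (z : E k) : cons w z 0 = w := rfl

@[simp] theorem cons_apply_succ (w : ℝ) (z : E k) (i : Fin k) : cons w z i.succ = z i := rfl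

@[simp] theorem tail_cons (w : ℝ) (z : E k) : tail (cons w z) = z := rfl

@[simp] theorem cons_tail (x : E (k + 1)) : cons (x 0) (tail x) = x := by
  ext i
  refine Fin.cases ?_ (fun j => ?_) i <;> rfl

/-- `cons` as a linear isomorphism. -/
def consL (k : ℕ) : (ℝ × E k) ≃L[ℝ] E (k + 1) :=
  LinearEquiv.toContinuousLinearEquiv
    { toFun := fun p => cons p.1 p.2
      invFun := fun x => (x 0, tail x)
      map_add' := fun p q => by
        ext i
        refine Fin.cases ?_ (fun j => ?_) i <;> rfl
      map_smul' := fun c p => by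
        ext i
        refine Fin.cases ?_ (fun j => ?_) i <;> rfl
      left_inv := fun p => rfl
      right_inv := fun x => cons_tail x }

@[simp] theorem consL_apply (p : ℝ × E k) : consL k p = cons p.1 p.2 := rfl

@[simp] theorem consL_symm_apply (x : E (k + 1)) : (consL k).symm x = (x 0, tail x) := rfl

@[fun_prop] theorem contDiff_tail {r : WithTop ℕ∞} : ContDiff ℝ r (tail (k := k)) :=
  contDiff_snd.comp (consL k).symm.contDiff

@[fun_prop] theorem contDiff_head {r : WithTop ℕ∞} : ContDiff ℝ r (fun x : E (k + 1) => x 0) :=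
  contDiff_fst.comp (consL k).symm.contDiff

@[fun_prop] theorem continuous_tail : Continuous (tail (k := k)) :=
  (contDiff_tail (r := 0)).continuous

@[fun_prop] theorem continuous_cons {Y : Type*} [TopologicalSpace Y] {f : Y → ℝ} {g : Y → E k}
    (hf : Continuous f) (hg : Continuous g) : Continuous (fun y => cons (f y) (g y)) :=
  (consL k).continuous.comp (hf.prodMk hg)

/-- Multiplication of the last coordinate by `ε`. -/
def flip (ε : ℝ) : E (k + 1) →L[ℝ] E (k + 1) :=
  (joinL k : (E k × ℝ) →L[ℝ] E (k + 1)) ∘L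
    ((ContinuousLinearMap.id ℝ (E k)).prodMap (ε • ContinuousLinearMap.id ℝ ℝ)) ∘L
      ((joinL k).symm : E (k + 1) →L[ℝ] E k × ℝ)

theorem flip_apply (ε : ℝ) (V : E (k + 1)) : flip ε V = join (front V) (ε * height V) := rfl

theorem flip_flip {ε : ℝ} (h : ε * ε = 1) (V : E (k + 1)) : flip ε (flip ε V) = V := by
  simp only [flip_apply, front_join, height_join, ← mul_assoc, h, one_mul, join_front_height]

@[simp] theorem flip_one (V : E (k + 1)) : flip 1 V = V := by
  simp [flip_apply]

theorem flip_cons (ε w : ℝ) (z : E (k + 1)) : flip ε (cons w z) = cons w (flip ε z) := by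
  ext i
  refine Fin.cases ?_ (fun j => ?_) i
  · have : (0 : Fin (k + 2)) = (0 : Fin (k + 1)).castSucc := rfl
    rw [this]
    simp only [flip_apply, join, Fin.snoc_castSucc]
    rfl
  · rw [cons_apply_succ]
    refine Fin.lastCases ?_ (fun l => ?_) j
    · simp only [flip_apply, join, Fin.succ_last, Fin.snoc_last]
      rfl
    · simp only [flip_apply, join, Fin.succ_castSucc, Fin.snoc_castSucc]
      rfl

theorem det_flip (ε : ℝ) : (flip (k := k) ε).det = ε := by
  have h : ((flip (k := k) ε : E (k + 1) →L[ℝ] E (k + 1)) : E (k + 1) →ₗ[ℝ] E (k + 1)) =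
      (Matrix.toLin (EuclideanSpace.basisFun (Fin (k + 1)) ℝ).toBasis
        (EuclideanSpace.basisFun (Fin (k + 1)) ℝ).toBasis)
        (Matrix.diagonal (Fin.snoc (α := fun _ => ℝ) (fun _ : Fin k => (1 : ℝ)) ε)) := by
    refine (EuclideanSpace.basisFun (Fin (k + 1)) ℝ).toBasis.ext fun j => ?_
    rw [Matrix.toLin_self]
    simp only [OrthonormalBasis.coe_toBasis, EuclideanSpace.basisFun_apply,
      ContinuousLinearMap.coe_coe, Matrix.diagonal_apply]
    rw [Finset.sum_eq_single j (fun i _ hij => by simp [hij]) (by simp)]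
    ext i
    refine Fin.lastCases ?_ (fun l => ?_) i <;> refine Fin.lastCases ?_ (fun l' => ?_) j <;>
      simp [flip_apply, join, front, height]
  rw [ContinuousLinearMap.det, h, LinearMap.det_toLin, Matrix.det_diagonal, Fin.prod_univ_castSucc]
  simp

/-- The map `(t, p, u) ↦ (t u, (p, t - u))`, which unfolds the corner `t = u = 0` of the
quadrant `t, u ≥ 0` to a boundary point of a half space. -/
def corner (z : ℝ × (E m × ℝ)) : E (m + 2) :=
  cons (z.1 * z.2.2) (join z.2.1 (z.1 - z.2.2))

/-- The discriminant `(t + u)²` in terms of the coordinates `(t u, (p, t - u))`. -/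
def disc (y : E (m + 2)) : ℝ := height (tail y) ^ 2 + 4 * y 0

/-- The inverse of `corner`. -/
def cornerInv (y : E (m + 2)) : ℝ × (E m × ℝ) :=
  ((height (tail y) + Real.sqrt (disc y)) / 2,
    (front (tail y), (Real.sqrt (disc y) - height (tail y)) / 2))

@[fun_prop] theorem contDiff_disc {r : WithTop ℕ∞} : ContDiff ℝ r (disc (m := m)) := by
  unfold disc; fun_prop

theorem disc_corner (z : ℝ × (E m × ℝ)) : disc (corner z) = (z.1 + z.2.2) ^ 2 := by
  simp only [disc, corner, tail_cons, height_join, cons_apply_zero]; ring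

theorem cornerInv_corner {z : ℝ × (E m × ℝ)} (h1 : 0 ≤ z.1) (h2 : 0 ≤ z.2.2) :
    cornerInv (corner z) = z := by
  have h : Real.sqrt (disc (corner z)) = z.1 + z.2.2 := by
    rw [disc_corner, Real.sqrt_sq (by linarith)]
  simp only [cornerInv]
  rw [h]
  simp only [corner, tail_cons, height_join, front_join]
  refine Prod.ext ?_ (Prod.ext rfl ?_) <;> simp only <;> ring

theorem abs_height_le_sqrt_disc {y : E (m + 2)} (hy : 0 ≤ y 0) :
    |height (tail y)| ≤ Real.sqrt (disc y) := by
  rw [← Real.sqrt_sq_eq_abs]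
  exact Real.sqrt_le_sqrt (by unfold disc; linarith)

theorem cornerInv_nonneg {y : E (m + 2)} (hy : 0 ≤ y 0) :
    0 ≤ (cornerInv y).1 ∧ 0 ≤ (cornerInv y).2.2 := by
  have h := abs_le.1 (abs_height_le_sqrt_disc hy)
  constructor <;> simp only [cornerInv] <;> linarith [h.1, h.2]

theorem cornerInv_mul {y : E (m + 2)} (hy : 0 ≤ y 0) :
    (cornerInv y).1 * (cornerInv y).2.2 = y 0 := by
  have h : Real.sqrt (disc y) ^ 2 = disc y :=
    Real.sq_sqrt (by unfold disc; positivity)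
  simp only [cornerInv]
  have : disc y = height (tail y) ^ 2 + 4 * y 0 := rfl
  nlinarith

theorem corner_cornerInv {y : E (m + 2)} (hy : 0 ≤ y 0) : corner (cornerInv y) = y := by
  have h := cornerInv_mul hy
  rw [corner, h]
  have h2 : (cornerInv y).1 - (cornerInv y).2.2 = height (tail y) := by
    simp only [cornerInv]; ring
  rw [h2]
  simp [cornerInv]

theorem cornerInv_pos {y : E (m + 2)} (hy : 0 < y 0) :
    0 < (cornerInv y).1 ∧ 0 < (cornerInv y).2.2 := by
  have h1 := cornerInv_nonneg hy.le
  have h2 := cornerInv_mul hy.le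
  constructor
  · exact h1.1.lt_of_ne fun h => by rw [← h, zero_mul] at h2; exact hy.ne h2
  · exact h1.2.lt_of_ne fun h => by rw [← h, mul_zero] at h2; exact hy.ne h2

theorem continuous_corner : Continuous (corner (m := m)) := by
  unfold corner
  exact continuous_cons (by fun_prop) (continuous_join (by fun_prop) (by fun_prop))

theorem contDiff_corner {r : WithTop ℕ∞} : ContDiff ℝ r (corner (m := m)) := by
  have h : ContDiff ℝ r fun z : ℝ × (E m × ℝ) => (z.1 * z.2.2, joinL m (z.2.1, z.1 - z.2.2)) := by
    fun_prop
  exact (consL (m + 1)).contDiff.comp h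

theorem continuous_cornerInv : Continuous (cornerInv (m := m)) := by
  unfold cornerInv
  have h1 : Continuous (disc (m := m)) := (contDiff_disc (r := 0)).continuous
  fun_prop

theorem contDiffAt_cornerInv {r : WithTop ℕ∞} {y : E (m + 2)} (hy : 0 < y 0) :
    ContDiffAt ℝ r (cornerInv (m := m)) y := by
  have h1 : ContDiffAt ℝ r (fun y : E (m + 2) => Real.sqrt (disc y)) y :=
    (contDiff_disc (r := r)).contDiffAt.sqrt (by unfold disc; positivity)
  have h2 : ContDiff ℝ r (fun y : E (m + 2) => height (tail y)) :=
    contDiff_height.comp contDiff_tail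
  have h3 : ContDiff ℝ r (fun y : E (m + 2) => front (tail y)) := contDiff_front.comp contDiff_tail
  unfold cornerInv
  have := h2.contDiffAt (x := y)
  have := h3.contDiffAt (x := y)
  fun_prop

/-- The coordinates `(p, log u)`, inverse to `logc`. -/
def lnc (P : E m × ℝ) : E (m + 1) := join P.1 (Real.log P.2)

@[simp] theorem lnc_logc (W : E (m + 1)) : lnc (logc W) = W := by
  simp [lnc, logc]

theorem logc_lnc {P : E m × ℝ} (h : 0 < P.2) : logc (lnc P) = P := by
  simp [lnc, logc, Real.exp_log h]

theorem contDiff_logc {r : WithTop ℕ∞} : ContDiff ℝ r (logc (m := m)) := by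
  unfold logc
  have h1 : ContDiff ℝ r (height (m := m)) := contDiff_height
  have h2 : ContDiff ℝ r (front (m := m)) := contDiff_front
  fun_prop

theorem contDiffAt_lnc {r : WithTop ℕ∞} {P : E m × ℝ} (h : 0 < P.2) :
    ContDiffAt ℝ r (lnc (m := m)) P := by
  have h1 : ContDiffAt ℝ r (fun P : E m × ℝ => (P.1, Real.log P.2)) P :=
    contDiffAt_fst.prodMk (contDiffAt_snd.log h.ne')
  exact (joinL m).contDiff.contDiffAt.comp P h1

/-! ### Jacobian determinants -/

theorem det_pos_or_neg_of_isPreconnected {V : Type*} [NormedAddCommGroup V] [NormedSpace ℝ V]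
    [FiniteDimensional ℝ V] {f : V → V} {U : Set V} (hU : IsPreconnected U) (hUo : IsOpen U)
    (hf : ContDiffOn ℝ 1 f U) (h0 : ∀ x ∈ U, (fderiv ℝ f x).det ≠ 0) :
    (∀ x ∈ U, 0 < (fderiv ℝ f x).det) ∨ (∀ x ∈ U, (fderiv ℝ f x).det < 0) := by
  have hc : ContinuousOn (fun x => (fderiv ℝ f x).det) U :=
    ContinuousLinearMap.continuous_det.comp_continuousOn
      (hf.continuousOn_fderiv_of_isOpen hUo le_rfl)
  have h1 : (fun x => (fderiv ℝ f x).det) '' U ⊆ Iio 0 ∪ Ioi 0 := by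
    rintro _ ⟨x, hx, rfl⟩
    exact lt_or_gt_of_ne (h0 x hx)
  rcases (hU.image _ hc).subset_or_subset isOpen_Iio isOpen_Ioi
    (Set.disjoint_left.2 fun x h2 h3 => lt_asymm h2 h3) h1 with h | h
  · exact Or.inr fun x hx => h ⟨x, hx, rfl⟩
  · exact Or.inl fun x hx => h ⟨x, hx, rfl⟩

theorem det_fderiv_mul_eq_one {V : Type*} [NormedAddCommGroup V] [NormedSpace ℝ V]
    {f g : V → V} {x : V} (hf : DifferentiableAt ℝ f x)
    (hg : DifferentiableAt ℝ g (f x)) (h : ∀ᶠ y in 𝓝 x, g (f y) = y) :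
    (fderiv ℝ g (f x)).det * (fderiv ℝ f x).det = 1 := by
  have h1 : HasFDerivAt (g ∘ f) ((fderiv ℝ g (f x)).comp (fderiv ℝ f x)) x :=
    hg.hasFDerivAt.comp x hf.hasFDerivAt
  have h2 : HasFDerivAt (g ∘ f) (ContinuousLinearMap.id ℝ V) x :=
    (hasFDerivAt_id x).congr_of_eventuallyEq h
  have h3 := h1.unique h2
  have h4 : LinearMap.det ((fderiv ℝ g (f x) : V →ₗ[ℝ] V) ∘ₗ (fderiv ℝ f x : V →ₗ[ℝ] V)) = 1 := by
    have : ((fderiv ℝ g (f x) : V →ₗ[ℝ] V) ∘ₗ (fderiv ℝ f x : V →ₗ[ℝ] V)) = LinearMap.id := by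
      have := congrArg (fun L : V →L[ℝ] V => (L : V →ₗ[ℝ] V)) h3
      simpa using this
    rw [this, LinearMap.det_id]
  rwa [LinearMap.det_comp] at h4

end Corner

theorem flip_apply_zero {k : ℕ} (ε : ℝ) (y : E (k + 2)) : flip ε y 0 = y 0 := by
  rw [← cons_tail y, flip_cons]; rfl

theorem tail_flip {k : ℕ} (ε : ℝ) (y : E (k + 2)) : tail (flip ε y) = flip ε (tail y) := by
  rw [← cons_tail y, flip_cons]; rfl

theorem logc_snd_pos {m : ℕ} (W : E (m + 1)) : 0 < (logc W).2 := Real.exp_pos _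

namespace BoundaryEmbedding

variable {n m : ℕ} [NeZero n] {X : Type*} [TopologicalSpace X]
  [ChartedSpace (EuclideanHalfSpace n) X] {D : BoundaryEmbedding n m X}

instance : Nonempty D.BF := ⟨.pos ⟨1, by simp⟩ 0⟩

instance : Nonempty D.Nsing := ⟨.cyl ⟨1 / 2, by norm_num, by norm_num⟩ 0⟩

namespace Cutoff

variable [Nonempty X] [IsManifold (𝓡∂ n) ∞ X] (B : D.Cutoff)

omit [IsManifold (𝓡∂ n) ∞ X] in
theorem continuousOn_b : ContinuousOn B.b (half m) := B.continuousOn_wgt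

omit [IsManifold (𝓡∂ n) ∞ X] in
theorem contDiff_b_logc : ContDiff ℝ ∞ fun W => B.b (logc W) := B.contDiff_wgt_logc

omit [IsManifold (𝓡∂ n) ∞ X] in
theorem contDiff_F_logc : ContDiff ℝ ∞ fun W => B.F (logc W) := B.contDiff_wvec_logc

/-! ### The chart of `N_sing(X)` -/

theorem model_mem_region (hbd : ((𝓡∂ n).boundary X).Nonempty) (β : D.BF) :
    B.model β ∈ B.region := by
  rw [← B.range_model hbd]; exact mem_range_self β

theorem modelSing_mem_region (hbd : ((𝓡∂ n).boundary X).Nonempty) (z : D.Nsing) :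
    B.modelSing z ∈ B.region := B.model_mem_region hbd (.sing z)

theorem modelSing_mul_eq_zero (z : D.Nsing) : (B.modelSing z).1 * (B.modelSing z).2.2 = 0 := by
  have h : BF.sing z ∈ range (BF.sing (D := D)) := mem_range_self z
  rw [B.range_sing] at h
  exact h

theorem modelSing_fst_lt_one (hbd : ((𝓡∂ n).boundary X).Nonempty) (z : D.Nsing) :
    (B.modelSing z).1 < 1 := by
  have h := B.modelSing_mem_region hbd z
  refine h.1.2.lt_of_ne fun h1 => ?_
  have h2 := h.2.2.2 h1
  have h3 := B.modelSing_mul_eq_zero z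
  rw [h1, one_mul] at h3
  exact h2.ne' h3

/-- The global coordinate `(p, ε (t - u))` on `N_sing(X)`, where `(t, p, u) = modelSing z`. The sign
`ε` fixes the orientation. -/
def singCoord (ε : ℝ) (z : D.Nsing) : E (m + 1) := tail (flip ε (corner (B.modelSing z)))

theorem cons_singCoord (ε : ℝ) (z : D.Nsing) :
    cons 0 (B.singCoord ε z) = flip ε (corner (B.modelSing z)) := by
  conv_rhs => rw [← cons_tail (flip ε (corner (B.modelSing z)))]
  rw [flip_apply_zero, corner, cons_apply_zero, B.modelSing_mul_eq_zero]
  rfl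

theorem cornerInv_cons_singCoord (hbd : ((𝓡∂ n).boundary X).Nonempty) {ε : ℝ} (hε : ε * ε = 1)
    (z : D.Nsing) : cornerInv (flip ε (cons 0 (B.singCoord ε z))) = B.modelSing z := by
  have h := B.modelSing_mem_region hbd z
  rw [cons_singCoord, flip_flip hε, cornerInv_corner h.1.1 h.2.1]

omit [IsManifold (𝓡∂ n) ∞ X] in
/-- The part `t < 1` of the image of `model` is open in the quadrant `t, u ≥ 0`. -/
theorem isOpen_cornerInv_preimage {Y : Type*} [TopologicalSpace Y] {f : Y → E (m + 2)}
    (hf : Continuous f) (h0 : ∀ y, 0 ≤ f y 0) :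
    IsOpen {y | cornerInv (f y) ∈ B.region ∧ (cornerInv (f y)).1 < 1} := by
  have h1 : Continuous fun y => cornerInv (f y) := continuous_cornerInv.comp hf
  have h2 : Continuous fun y => B.b (cornerInv (f y)).2 + (cornerInv (f y)).1 := by
    refine Continuous.add ?_ (continuous_fst.comp h1)
    exact B.continuousOn_b.comp_continuous (continuous_snd.comp h1)
      fun y => (cornerInv_nonneg (h0 y)).2
  convert (isOpen_lt continuous_const h2).inter
    (isOpen_lt (continuous_fst.comp h1) continuous_const) using 1
  ext y
  have h3 := cornerInv_nonneg (h0 y)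
  constructor
  · rintro ⟨h4, h5⟩
    exact ⟨h4.2.2.1, h5⟩
  · rintro ⟨h4, h5⟩
    exact ⟨⟨⟨h3.1, le_of_lt h5⟩, h3.2, h4, fun h6 => absurd h5 (by simp [h6])⟩, h5⟩

/-- The image of the chart of `N_sing(X)` is the boundary of the image of the chart of `B_F`. -/
theorem range_singCoord (hbd : ((𝓡∂ n).boundary X).Nonempty) {ε : ℝ} (hε : ε * ε = 1) :
    range (B.singCoord ε) = {y | cornerInv (flip ε (cons 0 y)) ∈ B.region ∧
      (cornerInv (flip ε (cons 0 y))).1 < 1} := by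
  ext y
  constructor
  · rintro ⟨z, rfl⟩
    simp only [mem_ofPred_eq, B.cornerInv_cons_singCoord hbd hε]
    exact ⟨B.modelSing_mem_region hbd z, B.modelSing_fst_lt_one hbd z⟩
  · rintro ⟨h1, h2⟩
    have h0 : flip ε (cons 0 y) 0 = 0 := by rw [flip_apply_zero]; rfl
    rw [← B.range_model hbd] at h1
    obtain ⟨β, hβ⟩ := h1
    have h3 : β ∈ range (BF.sing (D := D)) := by
      rw [B.range_sing]
      change (B.model β).1 * (B.model β).2.2 = 0
      rw [hβ, cornerInv_mul h0.ge, h0]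
    obtain ⟨z, rfl⟩ := h3
    refine ⟨z, ?_⟩
    rw [singCoord, show B.modelSing z = _ from hβ, corner_cornerInv h0.ge, flip_flip hε, tail_cons]

theorem isOpenEmbedding_singCoord (hbd : ((𝓡∂ n).boundary X).Nonempty) {ε : ℝ}
    (hε : ε * ε = 1) : IsOpenEmbedding (B.singCoord ε) := by
  have hc : Continuous (B.singCoord ε) :=
    continuous_tail.comp ((flip ε).continuous.comp
      (continuous_corner.comp (B.isEmbedding_modelSing hbd).continuous))
  have h1 : Continuous fun y : E (m + 1) => flip ε (cons 0 y) :=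
    (flip ε).continuous.comp (continuous_cons continuous_const continuous_id)
  refine ⟨?_, ?_⟩
  · refine IsEmbedding.of_comp hc (continuous_cornerInv.comp h1) ?_
    have : (cornerInv ∘ fun y : E (m + 1) => flip ε (cons 0 y)) ∘ B.singCoord ε = B.modelSing := by
      funext z
      exact B.cornerInv_cons_singCoord hbd hε z
    rw [this]
    exact B.isEmbedding_modelSing hbd
  · rw [B.range_singCoord hbd hε]
    exact B.isOpen_cornerInv_preimage h1 fun y => by rw [flip_apply_zero]; rfl

/-! ### The charts of `B_F` -/

/-- Two maps `f`, `g` which are inverse to each other between a set of the image of `model` and a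
set of the half space define a chart of `B_F`. -/
def chartOf (hbd : ((𝓡∂ n).boundary X).Nonempty) (S : Set (ℝ × (E m × ℝ)))
    (T : Set (EuclideanHalfSpace (m + 2))) (f : ℝ × (E m × ℝ) → E (m + 2))
    (g : E (m + 2) → ℝ × (E m × ℝ)) (hS : IsOpen (B.model ⁻¹' S)) (hT : IsOpen T)
    (hf : ContinuousOn f S) (hg : ContinuousOn (fun h : EuclideanHalfSpace (m + 2) => g h.1) T)
    (h0 : ∀ z ∈ S, 0 ≤ f z 0) (hmap : ∀ z ∈ S, (𝓡∂ (m + 2)).symm (f z) ∈ T)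
    (hmap' : ∀ h ∈ T, g h.1 ∈ S ∩ B.region) (hgf : ∀ z ∈ S, g (f z) = z)
    (hfg : ∀ h ∈ T, f (g h.1) = h.1) :
    OpenPartialHomeomorph D.BF (EuclideanHalfSpace (m + 2)) :=
  have hr : ∀ z ∈ S, ((𝓡∂ (m + 2)).symm (f z)).1 = f z := fun z hz =>
    (𝓡∂ (m + 2)).right_inv (by rw [mem_range_iff]; exact h0 z hz)
  have hm : ∀ h ∈ T, B.model (Function.invFun B.model (g h.1)) = g h.1 := fun h hh =>
    Function.invFun_eq (by
      have := (hmap' h hh).2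
      rw [← B.range_model hbd] at this
      exact this)
  { toFun := fun β => (𝓡∂ (m + 2)).symm (f (B.model β))
    invFun := fun h => Function.invFun B.model (g h.1)
    source := B.model ⁻¹' S
    target := T
    map_source' := fun β hβ => hmap _ hβ
    map_target' := fun h hh => by
      change B.model _ ∈ S
      rw [hm h hh]
      exact (hmap' h hh).1
    left_inv' := fun β hβ => by
      rw [hr _ hβ, hgf _ hβ]
      exact Function.leftInverse_invFun B.model_injective β
    right_inv' := fun h hh => by
      rw [hm h hh, hfg h hh]
      exact (𝓡∂ (m + 2)).left_inv h
    open_source := hS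
    open_target := hT
    continuousOn_toFun := by
      refine (𝓡∂ (m + 2)).continuous_symm.comp_continuousOn ?_
      exact hf.comp B.continuous_model.continuousOn fun β hβ => hβ
    continuousOn_invFun := by
      rw [(B.isEmbedding_model hbd).isInducing.continuousOn_iff]
      exact hg.congr fun h hh => hm h hh }

section chartOf

variable {B}
variable {hbd : ((𝓡∂ n).boundary X).Nonempty} {S : Set (ℝ × (E m × ℝ))}
    {T : Set (EuclideanHalfSpace (m + 2))} {f : ℝ × (E m × ℝ) → E (m + 2)}
    {g : E (m + 2) → ℝ × (E m × ℝ)} {hS : IsOpen (B.model ⁻¹' S)} {hT : IsOpen T}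
    {hf : ContinuousOn f S} {hg : ContinuousOn (fun h : EuclideanHalfSpace (m + 2) => g h.1) T}
    {h0 : ∀ z ∈ S, 0 ≤ f z 0} {hmap : ∀ z ∈ S, (𝓡∂ (m + 2)).symm (f z) ∈ T}
    {hmap' : ∀ h ∈ T, g h.1 ∈ S ∩ B.region} {hgf : ∀ z ∈ S, g (f z) = z}
    {hfg : ∀ h ∈ T, f (g h.1) = h.1}

theorem chartOf_coe {β : D.BF} (hβ : B.model β ∈ S) :
    (B.chartOf hbd S T f g hS hT hf hg h0 hmap hmap' hgf hfg β).1 = f (B.model β) :=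
  (𝓡∂ (m + 2)).right_inv (by rw [mem_range_iff]; exact h0 _ hβ)

theorem model_chartOf_symm {h : EuclideanHalfSpace (m + 2)} (hh : h ∈ T) :
    B.model ((B.chartOf hbd S T f g hS hT hf hg h0 hmap hmap' hgf hfg).symm h) = g h.1 :=
  Function.invFun_eq (by
    have := (hmap' h hh).2
    rw [← B.range_model hbd] at this
    exact this)

end chartOf

/-- The chart of `B_F` on `{t < 1}` which contains `N_sing(X)`. -/
def singChart (hbd : ((𝓡∂ n).boundary X).Nonempty) {ε : ℝ} (hε : ε * ε = 1) :
    OpenPartialHomeomorph D.BF (EuclideanHalfSpace (m + 2)) :=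
  B.chartOf hbd {z | z ∈ B.region ∧ z.1 < 1}
    {h | cornerInv (flip ε h.1) ∈ B.region ∧ (cornerInv (flip ε h.1)).1 < 1}
    (fun z => flip ε (corner z)) (fun y => cornerInv (flip ε y))
    (by
      convert isOpen_lt (continuous_fst.comp B.continuous_model) continuous_const using 1
      ext β
      exact ⟨fun h => h.2, fun h => ⟨B.model_mem_region hbd β, h⟩⟩)
    (B.isOpen_cornerInv_preimage ((flip ε).continuous.comp continuous_subtype_val)
      fun h => by rw [flip_apply_zero]; exact h.2)
    ((flip ε).continuous.comp continuous_corner).continuousOn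
    (continuous_cornerInv.comp
      ((flip ε).continuous.comp continuous_subtype_val)).continuousOn
    (fun z hz => by
      rw [flip_apply_zero]
      exact mul_nonneg hz.1.1.1 hz.1.2.1)
    (fun z hz => by
      have h : ((𝓡∂ (m + 2)).symm (flip ε (corner z))).1 = flip ε (corner z) :=
        (𝓡∂ (m + 2)).right_inv (by
          rw [mem_range_iff, flip_apply_zero]
          exact mul_nonneg hz.1.1.1 hz.1.2.1)
      simp only [mem_ofPred_eq, h]
      rw [flip_flip hε, cornerInv_corner hz.1.1.1 hz.1.2.1]
      exact hz)
    (fun h hh => ⟨hh, hh.1⟩)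
    (fun z hz => by rw [flip_flip hε, cornerInv_corner hz.1.1.1 hz.1.2.1])
    (fun h hh => by
      rw [corner_cornerInv (by rw [flip_apply_zero]; exact h.2), flip_flip hε])

/-- The coordinates `(1 - t, R P)` of the cylinder, where `R` is the reflection in the last
coordinate, which makes `(1 - t, R P)` an oriented coordinate system for which the outward normal
at `t = 1` comes first. -/
def posFun (z : ℝ × (E m × ℝ)) : E (m + 2) :=
  cons (1 - z.1) (flip (-1) (lnc (B.Θ z.1 z.2)))

/-- The inverse of `posFun`. -/
def posInv (y : E (m + 2)) : ℝ × (E m × ℝ) :=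
  (1 - y 0, B.G (1 - y 0) (logc (flip (-1) (tail y))))

omit [IsManifold (𝓡∂ n) ∞ X] in
theorem Θ_snd_pos {t : ℝ} {P : E m × ℝ} (hP : 0 < P.2) : 0 < (B.Θ t P).2 := by
  simp only [Θ, shift]; positivity

omit [IsManifold (𝓡∂ n) ∞ X] in
theorem G_snd_pos {t : ℝ} {P : E m × ℝ} (hP : 0 < P.2) : 0 < (B.G t P).2 := by
  simp only [G, shift]; positivity

omit [IsManifold (𝓡∂ n) ∞ X] in
theorem posInv_posFun {z : ℝ × (E m × ℝ)} (h1 : 0 < z.1) (h2 : 0 < z.2.2) :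
    B.posInv (B.posFun z) = z := by
  simp only [posInv, posFun, cons_apply_zero, tail_cons, sub_sub_cancel]
  rw [flip_flip (by norm_num), logc_lnc (B.Θ_snd_pos h2), B.G_Θ h1]

omit [IsManifold (𝓡∂ n) ∞ X] in
theorem posFun_posInv {y : E (m + 2)} (h1 : y 0 < 1) : B.posFun (B.posInv y) = y := by
  simp only [posInv, posFun, sub_sub_cancel]
  rw [B.Θ_G (by linarith), lnc_logc, flip_flip (by norm_num), cons_tail]

/-- The chart of `B_F` on `(0,1] × ℝ^(m+1)`. -/
def posChart (hbd : ((𝓡∂ n).boundary X).Nonempty) :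
    OpenPartialHomeomorph D.BF (EuclideanHalfSpace (m + 2)) :=
  B.chartOf hbd {z | z ∈ B.region ∧ 0 < z.1 * z.2.2} {h | h.1 0 < 1} B.posFun B.posInv
    (by
      convert isOpen_lt continuous_const ((continuous_fst.comp B.continuous_model).mul
        ((continuous_snd.comp continuous_snd).comp B.continuous_model)) using 1
      ext β
      exact ⟨fun h => h.2, fun h => ⟨B.model_mem_region hbd β, h⟩⟩)
    (isOpen_lt ((contDiff_head (r := 0)).continuous.comp continuous_subtype_val) continuous_const)
    (by
      rintro z ⟨h1, h2⟩
      have h3 : 0 < z.1 := pos_of_mul_pos_left h2 h1.2.1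
      have h4 : 0 < z.2.2 := pos_of_mul_pos_right h2 h1.1.1
      have h5 : ContinuousWithinAt (fun z : ℝ × (E m × ℝ) => B.Θ z.1 z.2)
          {z | z ∈ B.region ∧ 0 < z.1 * z.2.2} z :=
        (B.continuousOn_Θ z ⟨h3, h1.2.1⟩).mono
          fun w hw => ⟨pos_of_mul_pos_left hw.2 hw.1.2.1, hw.1.2.1⟩
      have h6 : ContinuousAt (lnc (m := m)) (B.Θ z.1 z.2) :=
        (contDiffAt_lnc (r := 0) (B.Θ_snd_pos h4)).continuousAt
      have h7 := (flip (k := m) (-1)).continuous.continuousAt.comp_continuousWithinAt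
        (ContinuousAt.comp_continuousWithinAt (f := fun z : ℝ × (E m × ℝ) => B.Θ z.1 z.2) h6 h5)
      exact (consL (m + 1)).continuous.continuousAt.comp_continuousWithinAt
        (((continuous_const.sub continuous_fst).continuousWithinAt).prodMk h7))
    (by
      have h1 : Continuous fun h : EuclideanHalfSpace (m + 2) => 1 - h.1 0 :=
        continuous_const.sub ((contDiff_head (r := 0)).continuous.comp continuous_subtype_val)
      have h2 : Continuous fun h : EuclideanHalfSpace (m + 2) => logc (flip (-1) (tail h.1)) :=
        continuous_logc.comp ((flip (-1)).continuous.comp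
          (continuous_tail.comp continuous_subtype_val))
      exact h1.continuousOn.prodMk (B.continuousOn_G.comp (h1.prodMk h2).continuousOn
        fun h hh => ⟨show 0 < 1 - h.1 0 from sub_pos.2 hh, logc_mem_half _⟩))
    (fun z hz => sub_nonneg.2 hz.1.1.2)
    (fun z hz => by
      have h : ((𝓡∂ (m + 2)).symm (B.posFun z)).1 = B.posFun z :=
        (𝓡∂ (m + 2)).right_inv (by
          rw [mem_range_iff]
          exact sub_nonneg.2 hz.1.1.2)
      simp only [mem_ofPred_eq, h]
      have := pos_of_mul_pos_left hz.2 hz.1.2.1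
      simp only [posFun, cons_apply_zero]
      linarith)
    (fun h hh => by
      have h1 : 0 < 1 - h.1 0 := sub_pos.2 hh
      have h2 : 0 < (B.G (1 - h.1 0) (logc (flip (-1) (tail h.1)))).2 :=
        B.G_snd_pos (logc_snd_pos _)
      have h3 : B.posInv h.1 ∈ B.region :=
        ⟨⟨h1.le, by simp only [posInv]; linarith [h.2]⟩, h2.le,
          add_pos_of_nonneg_of_pos (B.b_nonneg _) h1, fun _ => h2⟩
      exact ⟨⟨h3, mul_pos h1 h2⟩, h3⟩)
    (fun z hz => B.posInv_posFun (pos_of_mul_pos_left hz.2 hz.1.2.1)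
      (pos_of_mul_pos_right hz.2 hz.1.1.1))
    (fun h hh => B.posFun_posInv hh)

end Cutoff

end BoundaryEmbedding

theorem det_fderivWithin_extend_self {F H M : Type*} [NormedAddCommGroup F] [NormedSpace ℝ F]
    [TopologicalSpace H] {I : ModelWithCorners ℝ F H} [TopologicalSpace M]
    (e : OpenPartialHomeomorph M H) {x : M} (hx : x ∈ e.source) :
    (fderivWithin ℝ (e.extend I ∘ (e.extend I).symm) (range I) (e.extend I x)).det = 1 := by
  have h1 : (e.extend I ∘ (e.extend I).symm) =ᶠ[𝓝[range I] (e.extend I x)] id := by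
    filter_upwards [e.extend_target_mem_nhdsWithin (I := I) hx] with y hy
    exact (e.extend I).right_inv hy
  have h2 : e.extend I x ∈ range I := mem_range_self _
  rw [h1.fderivWithin_eq_of_mem h2,
    fderivWithin_id (I.uniqueDiffOn _ h2)]
  exact LinearMap.det_id

theorem isOrientedAtlas_singleton {F H M : Type*} [NormedAddCommGroup F] [NormedSpace ℝ F]
    [TopologicalSpace H] {I : ModelWithCorners ℝ F H} [TopologicalSpace M] [ChartedSpace H M]
    (e : OpenPartialHomeomorph M H) (h : atlas H M = {e}) : IsOrientedAtlas I M := by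
  intro e₁ h₁ e₂ h₂ x hx
  rw [h, mem_singleton_iff] at h₁ h₂
  subst h₁ h₂
  rw [det_fderivWithin_extend_self _ hx.1]
  exact one_pos

theorem lnc_shift {m : ℕ} {P : E m × ℝ} (hP : 0 < P.2) (d : E (m + 1)) :
    lnc (shift P d) = lnc P + d := by
  conv_lhs => rw [← logc_lnc hP]
  rw [shift_logc, lnc_logc]

namespace BoundaryEmbedding

variable {n m : ℕ} [NeZero n] {X : Type*} [TopologicalSpace X]
  [ChartedSpace (EuclideanHalfSpace n) X] {D : BoundaryEmbedding n m X}

namespace Cutoff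

variable [Nonempty X] (B : D.Cutoff)

/-! ### The change of coordinates of `B_F` -/

/-- The change of coordinates from the chart of the cylinder to the chart around `N_sing(X)`. -/
def trans (ε : ℝ) (y : E (m + 2)) : E (m + 2) := flip ε (corner (B.posInv y))

/-- The change of coordinates from the chart around `N_sing(X)` to the chart of the cylinder. -/
def transInv (ε : ℝ) (y : E (m + 2)) : E (m + 2) := B.posFun (cornerInv (flip ε y))

theorem contDiffAt_trans [IsManifold (𝓡∂ n) ∞ X] (ε : ℝ) {y : E (m + 2)} (hy : y 0 < 1) :
    ContDiffAt ℝ ∞ (B.trans ε) y := by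
  have h1 : ContDiff ℝ ∞ fun y : E (m + 2) => ((1 - y 0, flip (-1) (tail y)) : ℝ × E (m + 1)) :=
    (contDiff_const.sub contDiff_head).prodMk ((flip (-1)).contDiff.comp contDiff_tail)
  have h2 := (B.contDiffAt_add_disp_logc (sub_pos.2 hy) (flip (-1) (tail y))).comp y
    h1.contDiffAt
  have h3 := (contDiff_logc (r := ∞)).contDiffAt.comp y h2
  have h4 : ContDiffAt ℝ ∞ B.posInv y := by
    have h5 : ContDiff ℝ ∞ fun y : E (m + 2) => (1 : ℝ) - y 0 := contDiff_const.sub contDiff_head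
    refine (h5.contDiffAt.prodMk h3).congr_of_eventuallyEq (Eventually.of_forall fun y' => ?_)
    simp only [posInv, Function.comp_apply, B.logc_add_disp]
  exact (flip ε).contDiff.contDiffAt.comp y (contDiff_corner.contDiffAt.comp y h4)

theorem contDiffAt_posFun {z : ℝ × (E m × ℝ)} (h1 : 0 < z.1) (h2 : 0 < z.2.2) :
    ContDiffAt ℝ ∞ B.posFun z := by
  have hl : ContDiffAt ℝ ∞ (fun z : ℝ × (E m × ℝ) => lnc z.2) z :=
    (contDiffAt_lnc h2).comp z contDiffAt_snd
  have hb := B.contDiff_b_logc.contDiffAt.comp z hl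
  have hF := B.contDiff_F_logc.contDiffAt.comp z hl
  have h3 : ContDiffAt ℝ ∞ (fun z : ℝ × (E m × ℝ) =>
      lnc z.2 + -((B.b (logc (lnc z.2)) + z.1)⁻¹ • B.F (logc (lnc z.2)))) z := by
    refine hl.add (((hb.add contDiffAt_fst).inv ?_).smul hF).neg
    exact (add_pos_of_nonneg_of_pos (B.b_nonneg _) h1).ne'
  have h4 := (consL (m + 1)).contDiff.contDiffAt.comp z
    ((contDiffAt_const (c := (1 : ℝ)).sub contDiffAt_fst).prodMk
      ((flip (-1)).contDiff.contDiffAt.comp z h3))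
  refine h4.congr_of_eventuallyEq ?_
  have h5 : ∀ᶠ w : ℝ × (E m × ℝ) in 𝓝 z, 0 < w.2.2 :=
    (continuous_snd.comp continuous_snd).continuousAt.eventually (lt_mem_nhds h2)
  filter_upwards [h5] with w hw
  simp only [posFun, Function.comp_apply, consL_apply, Θ, lnc_shift hw, logc_lnc hw]

theorem contDiffAt_transInv (ε : ℝ) {y : E (m + 2)} (hy : 0 < y 0) :
    ContDiffAt ℝ ∞ (B.transInv ε) y := by
  have hy' : 0 < flip ε y 0 := by rwa [flip_apply_zero]
  have h := cornerInv_pos hy'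
  exact (B.contDiffAt_posFun h.1 h.2).comp y
    ((contDiffAt_cornerInv hy').comp y (flip ε).contDiff.contDiffAt)

theorem posInv_pos {y : E (m + 2)} (hy : y 0 < 1) :
    0 < (B.posInv y).1 ∧ 0 < (B.posInv y).2.2 :=
  ⟨sub_pos.2 hy, B.G_snd_pos (logc_snd_pos _)⟩

theorem trans_apply_zero (ε : ℝ) {y : E (m + 2)} (hy : y 0 < 1) : 0 < B.trans ε y 0 := by
  rw [trans, flip_apply_zero]
  exact mul_pos (B.posInv_pos hy).1 (B.posInv_pos hy).2

theorem transInv_trans {ε : ℝ} (hε : ε * ε = 1) {y : E (m + 2)} (hy : y 0 < 1) :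
    B.transInv ε (B.trans ε y) = y := by
  have h := B.posInv_pos hy
  rw [transInv, trans, flip_flip hε, cornerInv_corner h.1.le h.2.le, B.posFun_posInv hy]

theorem trans_transInv {ε : ℝ} (hε : ε * ε = 1) {y : E (m + 2)} (hy : 0 < y 0) :
    B.trans ε (B.transInv ε y) = y := by
  have hy' : 0 < flip ε y 0 := by rwa [flip_apply_zero]
  have h := cornerInv_pos hy'
  rw [transInv, trans, B.posInv_posFun h.1 h.2, corner_cornerInv hy'.le, flip_flip hε]

theorem transInv_apply_zero (ε : ℝ) {y : E (m + 2)} (hy : 0 < y 0) : B.transInv ε y 0 < 1 := by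
  have hy' : 0 < flip ε y 0 := by rwa [flip_apply_zero]
  have := (cornerInv_pos hy').1
  simp only [transInv, posFun, cons_apply_zero]
  linarith

/-- The change of coordinates has the smooth inverse `transInv`. -/
theorem det_trans_ne_zero [IsManifold (𝓡∂ n) ∞ X] {ε : ℝ} (hε : ε * ε = 1) {y : E (m + 2)}
    (hy : y 0 < 1) : (fderiv ℝ (B.trans ε) y).det ≠ 0 := by
  have h1 := (B.contDiffAt_trans ε hy).differentiableAt (by simp)
  have h2 := (B.contDiffAt_transInv ε (B.trans_apply_zero ε hy)).differentiableAt (by simp)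
  have h3 : ∀ᶠ y' in 𝓝 y, B.transInv ε (B.trans ε y') = y' := by
    have h4 : ∀ᶠ y' : E (m + 2) in 𝓝 y, y' 0 < 1 :=
      (contDiff_head (r := 0)).continuous.continuousAt.eventually (gt_mem_nhds hy)
    filter_upwards [h4] with y' hy' using B.transInv_trans hε hy'
  exact right_ne_zero_of_mul_eq_one (det_fderiv_mul_eq_one h1 h2 h3)

theorem fderiv_trans [IsManifold (𝓡∂ n) ∞ X] (ε : ℝ) {y : E (m + 2)} (hy : y 0 < 1) :
    (fderiv ℝ (B.trans ε) y).det = ε * (fderiv ℝ (B.trans 1) y).det := by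
  have h1 := ((B.contDiffAt_trans 1 hy).differentiableAt (by simp)).hasFDerivAt
  have h2 : HasFDerivAt (B.trans ε) ((flip ε).comp (fderiv ℝ (B.trans 1) y)) y := by
    refine ((flip ε).hasFDerivAt.comp y h1).congr_of_eventuallyEq
      (Eventually.of_forall fun y' => ?_)
    simp only [trans, Function.comp_apply, flip_one]
  rw [h2.fderiv]
  conv_rhs => rw [← det_flip (k := m + 1) ε]
  exact LinearMap.det_comp _ _

theorem isPreconnected_strip : IsPreconnected {y : E (m + 2) | y 0 < 1} := by
  refine Convex.isPreconnected fun y hy z hz a b ha hb hab => ?_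
  change a * y 0 + b * z 0 < 1
  have hy : y 0 < 1 := hy
  have hz : z 0 < 1 := hz
  rcases ha.eq_or_lt with rfl | ha
  · obtain rfl : b = 1 := by linarith
    linarith
  · nlinarith

/-- As the cylinder is connected, one of the two orientations of the chart around `N_sing(X)` is
compatible with the chart of the cylinder. -/
theorem exists_sign [IsManifold (𝓡∂ n) ∞ X] : ∃ ε : ℝ, ε * ε = 1 ∧
    ∀ y : E (m + 2), y 0 < 1 → 0 < (fderiv ℝ (B.trans ε) y).det := by
  have hU : IsOpen {y : E (m + 2) | y 0 < 1} :=
    isOpen_lt (contDiff_head (r := 0)).continuous continuous_const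
  rcases det_pos_or_neg_of_isPreconnected (f := B.trans 1) isPreconnected_strip hU
    (fun y hy => ((B.contDiffAt_trans 1 hy).of_le (by simp)).contDiffWithinAt)
    (fun y hy => B.det_trans_ne_zero (by norm_num) hy) with h | h
  · exact ⟨1, by norm_num, h⟩
  · refine ⟨-1, by norm_num, fun y hy => ?_⟩
    rw [B.fderiv_trans _ hy]
    have : (fderiv ℝ (B.trans 1) y).det < 0 := h y hy
    linarith

/-! ### The atlas of `B_F` -/

variable [IsManifold (𝓡∂ n) ∞ X] (hbd : ((𝓡∂ n).boundary X).Nonempty) {ε : ℝ} (hε : ε * ε = 1)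

theorem singChart_coe {β : D.BF} (h : (B.model β).1 < 1) :
    (B.singChart hbd hε β).1 = flip ε (corner (B.model β)) :=
  chartOf_coe (S := {z | z ∈ B.region ∧ z.1 < 1}) ⟨B.model_mem_region hbd β, h⟩

theorem mem_singChart_source {β : D.BF} :
    β ∈ (B.singChart hbd hε).source ↔ (B.model β).1 < 1 :=
  ⟨fun h => h.2, fun h => ⟨B.model_mem_region hbd β, h⟩⟩

theorem mem_singChart_target {h : EuclideanHalfSpace (m + 2)} :
    h ∈ (B.singChart hbd hε).target ↔
      cornerInv (flip ε h.1) ∈ B.region ∧ (cornerInv (flip ε h.1)).1 < 1 := Iff.rfl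

theorem model_singChart_symm {h : EuclideanHalfSpace (m + 2)}
    (hh : h ∈ (B.singChart hbd hε).target) :
    B.model ((B.singChart hbd hε).symm h) = cornerInv (flip ε h.1) :=
  model_chartOf_symm hh

theorem posChart_coe {β : D.BF} (h : 0 < (B.model β).1 * (B.model β).2.2) :
    (B.posChart hbd β).1 = B.posFun (B.model β) :=
  chartOf_coe (S := {z | z ∈ B.region ∧ 0 < z.1 * z.2.2}) ⟨B.model_mem_region hbd β, h⟩

theorem mem_posChart_source {β : D.BF} :
    β ∈ (B.posChart hbd).source ↔ 0 < (B.model β).1 * (B.model β).2.2 :=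
  ⟨fun h => h.2, fun h => ⟨B.model_mem_region hbd β, h⟩⟩

theorem model_posChart_symm {h : EuclideanHalfSpace (m + 2)} (hh : h.1 0 < 1) :
    B.model ((B.posChart hbd).symm h) = B.posInv h.1 :=
  model_chartOf_symm (T := {h : EuclideanHalfSpace (m + 2) | h.1 0 < 1}) hh

theorem sing_mem_source (z : D.Nsing) : BF.sing z ∈ (B.singChart hbd hε).source :=
  (B.mem_singChart_source hbd hε).2 (B.modelSing_fst_lt_one hbd z)

theorem pos_mem_source (t : Ioc (0 : ℝ) 1) (P : E (m + 1)) :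
    BF.pos t P ∈ (B.posChart hbd).source :=
  (B.mem_posChart_source hbd).2 (mul_pos t.2.1 (B.G_snd_pos (logc_snd_pos P)))

theorem singChart_sing (z : D.Nsing) :
    (B.singChart hbd hε (.sing z)).1 = cons 0 (B.singCoord ε z) := by
  rw [B.singChart_coe hbd hε (β := .sing z) (B.modelSing_fst_lt_one hbd z), B.cons_singCoord]
  rfl

theorem posChart_pos (t : Ioc (0 : ℝ) 1) (P : E (m + 1)) :
    (B.posChart hbd (.pos t P)).1 = cons (1 - t) (flip (-1) P) := by
  rw [B.posChart_coe hbd (β := .pos t P) (mul_pos t.2.1 (B.G_snd_pos (logc_snd_pos P)))]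
  simp only [posFun, model, B.Θ_G t.2.1, lnc_logc]

/-- The atlas of `B_F` which consists of `singChart` and `posChart`. -/
@[reducible] def chartedSpaceBF : ChartedSpace (EuclideanHalfSpace (m + 2)) D.BF where
  atlas := {B.singChart hbd hε, B.posChart hbd}
  chartAt
    | .sing _ => B.singChart hbd hε
    | .pos _ _ => B.posChart hbd
  mem_chart_source
    | .sing z => B.sing_mem_source hbd hε z
    | .pos t P => B.pos_mem_source hbd t P
  chart_mem_atlas
    | .sing _ => Or.inl rfl
    | .pos _ _ => Or.inr rfl

/-- The chart of `N_sing(X)` given by `singCoord`. -/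
@[reducible] def chartedSpaceNsing : ChartedSpace (E (m + 1)) D.Nsing :=
  (B.isOpenEmbedding_singCoord hbd hε).singletonChartedSpace

theorem val_symm_eq {y : E (m + 2)} (hy : 0 ≤ y 0) : ((𝓡∂ (m + 2)).symm y).1 = y :=
  (𝓡∂ (m + 2)).right_inv (by rw [mem_range_iff]; exact hy)

theorem singChart_posChart_symm {y : E (m + 2)} (h0 : 0 < y 0) (h1 : y 0 < 1) :
    (B.singChart hbd hε ((B.posChart hbd).symm ((𝓡∂ (m + 2)).symm y))).1 = B.trans ε y := by
  have h2 := val_symm_eq h0.le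
  have h3 : B.model ((B.posChart hbd).symm ((𝓡∂ (m + 2)).symm y)) = B.posInv y := by
    rw [B.model_posChart_symm hbd (by rw [h2]; exact h1), h2]
  rw [B.singChart_coe hbd hε (by rw [h3]; simp only [posInv]; linarith), h3, trans]

theorem posChart_singChart_symm {y : E (m + 2)} (h0 : 0 < y 0)
    (h1 : (cornerInv (flip ε y)).1 < 1) :
    (B.posChart hbd ((B.singChart hbd hε).symm ((𝓡∂ (m + 2)).symm y))).1 = B.transInv ε y := by
  have h2 := val_symm_eq h0.le
  have hy' : 0 < flip ε y 0 := by rwa [flip_apply_zero]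
  have h := cornerInv_pos hy'
  have h3 : B.model ((B.singChart hbd hε).symm ((𝓡∂ (m + 2)).symm y)) = cornerInv (flip ε y) := by
    rw [B.model_singChart_symm hbd hε, h2]
    rw [B.mem_singChart_target, h2]
    exact ⟨⟨⟨h.1.le, h1.le⟩, h.2.le, add_pos_of_nonneg_of_pos (B.b_nonneg _) h.1, fun _ => h.2⟩, h1⟩
  rw [B.posChart_coe hbd (by rw [h3]; exact mul_pos h.1 h.2), h3, transInv]

theorem isManifold_BF :
    @IsManifold ℝ _ _ _ _ _ _ (𝓡∂ (m + 2)) ∞ D.BF _ (B.chartedSpaceBF hbd hε) := by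
  let _ := B.chartedSpaceBF hbd hε
  have hself : ∀ e : OpenPartialHomeomorph D.BF (EuclideanHalfSpace (m + 2)),
      ContDiffOn ℝ ∞ ((𝓡∂ (m + 2)) ∘ (e.symm ≫ₕ e) ∘ (𝓡∂ (m + 2)).symm)
        ((𝓡∂ (m + 2)).symm ⁻¹' (e.symm ≫ₕ e).source ∩ range (𝓡∂ (m + 2))) := fun e => by
    refine contDiffOn_id.congr fun y hy => ?_
    have h1 : (𝓡∂ (m + 2)).symm y ∈ e.target := hy.1.1
    simp only [Function.comp_apply, OpenPartialHomeomorph.coe_trans, e.right_inv h1, id]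
    exact (𝓡∂ (m + 2)).right_inv hy.2
  have hps : ContDiffOn ℝ ∞ ((𝓡∂ (m + 2)) ∘ ((B.posChart hbd).symm ≫ₕ B.singChart hbd hε) ∘
      (𝓡∂ (m + 2)).symm) ((𝓡∂ (m + 2)).symm ⁻¹' ((B.posChart hbd).symm ≫ₕ
        B.singChart hbd hε).source ∩ range (𝓡∂ (m + 2))) := by
    refine ContDiffOn.congr (f := B.trans ε) (fun y hy => ?_) (fun y hy => ?_)
    · have h1 : ((𝓡∂ (m + 2)).symm y).1 0 < 1 := hy.1.1
      rw [val_symm_eq (mem_range_iff.1 hy.2)] at h1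
      exact (B.contDiffAt_trans ε h1).contDiffWithinAt
    · have h1 : ((𝓡∂ (m + 2)).symm y).1 0 < 1 := hy.1.1
      have h2 := hy.1.2
      rw [mem_preimage, B.mem_singChart_source] at h2
      have h4 := B.model_posChart_symm hbd h1
      rw [val_symm_eq (mem_range_iff.1 hy.2)] at h1 h4
      have h3 : 0 < y 0 := by
        have h5 : (B.posInv y).1 < 1 := by rw [← h4]; exact h2
        simp only [posInv] at h5
        linarith
      exact B.singChart_posChart_symm hbd hε h3 h1
  have hsp : ContDiffOn ℝ ∞ ((𝓡∂ (m + 2)) ∘ ((B.singChart hbd hε).symm ≫ₕ B.posChart hbd) ∘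
      (𝓡∂ (m + 2)).symm) ((𝓡∂ (m + 2)).symm ⁻¹' ((B.singChart hbd hε).symm ≫ₕ
        B.posChart hbd).source ∩ range (𝓡∂ (m + 2))) := by
    have key : ∀ y ∈ ((𝓡∂ (m + 2)).symm ⁻¹' ((B.singChart hbd hε).symm ≫ₕ
        B.posChart hbd).source ∩ range (𝓡∂ (m + 2))),
        0 < y 0 ∧ (cornerInv (flip ε y)).1 < 1 := fun y hy => by
      have h1 := hy.1.1
      have h2 := hy.1.2
      rw [mem_preimage, B.mem_posChart_source] at h2
      have h3 : B.model ((B.singChart hbd hε).symm ((𝓡∂ (m + 2)).symm y)) =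
        cornerInv (flip ε ((𝓡∂ (m + 2)).symm y).1) := B.model_singChart_symm hbd hε h1
      have h4 : ((𝓡∂ (m + 2)).symm y) ∈ (B.singChart hbd hε).target := h1
      rw [B.mem_singChart_target] at h4
      have h5 := val_symm_eq ((mem_range_iff).1 hy.2)
      have h7 : 0 ≤ flip ε y 0 := by rw [flip_apply_zero]; exact mem_range_iff.1 hy.2
      have h6 : 0 < (cornerInv (flip ε y)).1 * (cornerInv (flip ε y)).2.2 := by
        rw [h5] at h3; rw [← h3]; exact h2
      rw [cornerInv_mul h7, flip_apply_zero] at h6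
      rw [h5] at h4
      exact ⟨h6, h4.2⟩
    refine ContDiffOn.congr (f := B.transInv ε) (fun y hy => ?_) (fun y hy => ?_)
    · exact (B.contDiffAt_transInv ε (key y hy).1).contDiffWithinAt
    · exact B.posChart_singChart_symm hbd hε (key y hy).1 (key y hy).2
  refine isManifold_of_contDiffOn _ _ _ fun e e' he he' => ?_
  rcases he with rfl | rfl <;> rcases he' with rfl | rfl
  exacts [hself _, hsp, hps, hself _]

/-- The only nontrivial change of coordinates is `trans`, together with its inverse. -/
theorem isOrientedAtlas_BF
    (hpos : ∀ y : E (m + 2), y 0 < 1 → 0 < (fderiv ℝ (B.trans ε) y).det) :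
    @IsOrientedAtlas _ _ _ _ _ (𝓡∂ (m + 2)) D.BF _ (B.chartedSpaceBF hbd hε) := by
  let _ := B.chartedSpaceBF hbd hε
  have hU : ∀ y : E (m + 2), 0 < y 0 → {y : E (m + 2) | 0 < y 0} ∈ 𝓝 y := fun y hy =>
    (isOpen_lt continuous_const (contDiff_head (r := 0)).continuous).mem_nhds hy
  have hR : ∀ y : E (m + 2), 0 < y 0 → range (𝓡∂ (m + 2)) ∈ 𝓝 y := fun y hy =>
    mem_of_superset (hU y hy) fun z hz => mem_range_iff.2 (le_of_lt hz)
  have hps : ∀ x ∈ (B.posChart hbd).source ∩ (B.singChart hbd hε).source,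
      0 < (fderivWithin ℝ ((B.singChart hbd hε).extend (𝓡∂ (m + 2)) ∘
        ((B.posChart hbd).extend (𝓡∂ (m + 2))).symm) (range (𝓡∂ (m + 2)))
          ((B.posChart hbd).extend (𝓡∂ (m + 2)) x)).det := by
    rintro x ⟨h1, h2⟩
    rw [mem_posChart_source] at h1
    rw [mem_singChart_source] at h2
    have h3 : (B.posChart hbd).extend (𝓡∂ (m + 2)) x = B.posFun (B.model x) :=
      B.posChart_coe hbd h1
    have hx := B.model_mem_region hbd x
    have h4 : 0 < B.posFun (B.model x) 0 := by simp only [posFun, cons_apply_zero]; linarith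
    have h5 : B.posFun (B.model x) 0 < 1 := by
      have := pos_of_mul_pos_left h1 hx.2.1
      simp only [posFun, cons_apply_zero]; linarith
    rw [h3, fderivWithin_of_mem_nhds (hR _ h4)]
    have h6 : (B.singChart hbd hε).extend (𝓡∂ (m + 2)) ∘
        ((B.posChart hbd).extend (𝓡∂ (m + 2))).symm =ᶠ[𝓝 (B.posFun (B.model x))] B.trans ε := by
      filter_upwards [hU _ h4, (isOpen_lt (contDiff_head (r := 0)).continuous
        continuous_const).mem_nhds h5] with y hy hy'
      exact B.singChart_posChart_symm hbd hε hy hy'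
    rw [h6.fderiv_eq]
    exact hpos _ h5
  have hsp : ∀ x ∈ (B.singChart hbd hε).source ∩ (B.posChart hbd).source,
      0 < (fderivWithin ℝ ((B.posChart hbd).extend (𝓡∂ (m + 2)) ∘
        ((B.singChart hbd hε).extend (𝓡∂ (m + 2))).symm) (range (𝓡∂ (m + 2)))
          ((B.singChart hbd hε).extend (𝓡∂ (m + 2)) x)).det := by
    rintro x ⟨h2, h1⟩
    rw [mem_posChart_source] at h1
    rw [mem_singChart_source] at h2
    have h3 : (B.singChart hbd hε).extend (𝓡∂ (m + 2)) x = flip ε (corner (B.model x)) :=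
      B.singChart_coe hbd hε h2
    have hx := B.model_mem_region hbd x
    set y := flip ε (corner (B.model x)) with hydef
    have h4 : 0 < y 0 := by rw [hydef, flip_apply_zero]; exact h1
    have h5 : (cornerInv (flip ε y)).1 < 1 := by
      rw [hydef, flip_flip hε, cornerInv_corner hx.1.1 hx.2.1]; exact h2
    rw [h3, fderivWithin_of_mem_nhds (hR _ h4)]
    have h6 : (B.posChart hbd).extend (𝓡∂ (m + 2)) ∘
        ((B.singChart hbd hε).extend (𝓡∂ (m + 2))).symm =ᶠ[𝓝 y] B.transInv ε := by
      filter_upwards [hU _ h4, (isOpen_lt (continuous_fst.comp (continuous_cornerInv.comp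
        (flip ε).continuous)) continuous_const).mem_nhds h5] with y hy hy'
      exact B.posChart_singChart_symm hbd hε hy hy'
    rw [h6.fderiv_eq]
    have h7 := B.transInv_apply_zero ε h4
    have h8 := det_fderiv_mul_eq_one ((B.contDiffAt_transInv ε h4).differentiableAt (by simp))
      ((B.contDiffAt_trans ε h7).differentiableAt (by simp))
      (by filter_upwards [hU _ h4] with y hy using B.trans_transInv hε hy)
    exact pos_of_mul_pos_right (h8 ▸ one_pos) (hpos _ h7).le
  intro e he e' he' x hx
  rcases he with rfl | rfl <;> rcases he' with rfl | rfl
  · rw [det_fderivWithin_extend_self _ hx.1]; exact one_pos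
  · exact hsp x hx
  · exact hps x hx
  · rw [det_fderivWithin_extend_self _ hx.1]; exact one_pos

end Cutoff

end BoundaryEmbedding

/-! ### Boundary frames -/

theorem flip_single {k : ℕ} (δ : ℝ) (j : Fin (k + 1)) :
    flip δ (EuclideanSpace.single j (1 : ℝ)) =
      (Fin.snoc (α := fun _ => ℝ) (fun _ : Fin k => (1 : ℝ)) δ j) • EuclideanSpace.single j 1 := by
  ext i
  refine Fin.lastCases ?_ (fun l => ?_) i <;> refine Fin.lastCases ?_ (fun l' => ?_) j <;>
    simp [flip_apply, join, front, height]

theorem cons_zero_single {k : ℕ} (j : Fin k) :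
    cons 0 (EuclideanSpace.single j (1 : ℝ)) = EuclideanSpace.single j.succ 1 := by
  ext i
  refine Fin.cases ?_ (fun l => ?_) i
  · simp [cons]
  · simp only [cons_apply_succ, PiLp.single_apply, Fin.succ_inj]

/-- The map `z ↦ (0, R z)`, where `R` multiplies the last coordinate by `δ`. -/
def inclBd (k : ℕ) (δ : ℝ) : E (k + 1) →L[ℝ] E (k + 2) :=
  ((consL (k + 1) : (ℝ × E (k + 1)) →L[ℝ] E (k + 2)) ∘L
    ContinuousLinearMap.inr ℝ ℝ (E (k + 1))) ∘L flip δ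

theorem inclBd_apply {k : ℕ} (δ : ℝ) (z : E (k + 1)) : inclBd k δ z = cons 0 (flip δ z) := rfl

/-- The frame "outward normal first" of the boundary of the half space, transported by `inclBd`,
has determinant `-δ`. -/
theorem det_frame {k : ℕ} (δ : ℝ) :
    (EuclideanSpace.basisFun (Fin (k + 2)) ℝ).toBasis.det
      (Fin.cons (α := fun _ => E (k + 2)) (-EuclideanSpace.single 0 (1 : ℝ))
        (fun i => inclBd k δ (EuclideanSpace.single i 1))) = -δ := by
  have h : (Fin.cons (α := fun _ => E (k + 2)) (-EuclideanSpace.single 0 (1 : ℝ))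
        (fun i => inclBd k δ (EuclideanSpace.single i 1))) =
      fun i => (Fin.cons (α := fun _ => ℝ) (-1)
        (Fin.snoc (α := fun _ => ℝ) (fun _ : Fin k => (1 : ℝ)) δ) : Fin (k + 2) → ℝ) i •
          (EuclideanSpace.basisFun (Fin (k + 2)) ℝ).toBasis i := by
    funext i
    refine Fin.cases ?_ (fun l => ?_) i
    · simp
    · have h1 : cons 0 (flip δ (EuclideanSpace.single l (1 : ℝ))) =
          (Fin.snoc (α := fun _ => ℝ) (fun _ : Fin k => (1 : ℝ)) δ l) •
            (EuclideanSpace.single l.succ (1 : ℝ) : E (k + 2)) := by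
        rw [flip_single, ← cons_zero_single]
        have := (consL (k + 1)).map_smul
          (Fin.snoc (α := fun _ => ℝ) (fun _ : Fin k => (1 : ℝ)) δ l)
          ((0 : ℝ), (EuclideanSpace.single l (1 : ℝ) : E (k + 1)))
        simpa using this
      simpa [inclBd_apply] using h1
  rw [h, AlternatingMap.map_smul_univ, Module.Basis.det_self, Fin.prod_univ_succ,
    Fin.prod_univ_castSucc]
  simp

/-- Reflection in the last coordinate and insertion of a first coordinate, as an isomorphism. -/
def bdEquiv (k : ℕ) {δ : ℝ} (hδ : δ * δ = 1) : (E (k + 1) × ℝ) ≃L[ℝ] E (k + 2) :=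
  (((ContinuousLinearEquiv.equivOfInverse (flip δ) (flip δ) (flip_flip hδ)
    (flip_flip hδ)).prodCongr (ContinuousLinearEquiv.refl ℝ ℝ)).trans
      (ContinuousLinearEquiv.prodComm ℝ (E (k + 1)) ℝ)).trans (consL (k + 1))

/-- A map to a manifold with boundary which is `z ↦ (0, R z)` in the preferred charts. -/
theorem hasMFDerivAt_inclBd {k : ℕ} {δ : ℝ} {M W : Type*} [TopologicalSpace M]
    [ChartedSpace (E (k + 1)) M] [TopologicalSpace W]
    [ChartedSpace (EuclideanHalfSpace (k + 2)) W] {j : M → W} {p : M} (hj : ContinuousAt j p)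
    (h : ∀ y ∈ (chartAt (E (k + 1)) p).target,
      (chartAt (EuclideanHalfSpace (k + 2)) (j p) (j ((chartAt (E (k + 1)) p).symm y))).1 =
        inclBd k δ y) :
    HasMFDerivAt (𝓡 (k + 1)) (𝓡∂ (k + 2)) j p (inclBd k δ) := by
  refine ⟨hj, ?_⟩
  refine ((inclBd k δ).hasFDerivAt.hasFDerivWithinAt).congr_of_eventuallyEq ?_ ?_
  · filter_upwards [extChartAt_target_mem_nhdsWithin (I := 𝓡 (k + 1)) p] with y hy
    refine h y ?_
    simpa [extChartAt] using hy
  · exact h _ ((chartAt (E (k + 1)) p).map_source (mem_chart_source _ p))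

/-- The outward normal in the half space is `-e₀`, so `z ↦ (0, R z)` has boundary sign `-det R`.
-/
theorem boundarySign_eq {k : ℕ} {δ : ℝ} {M W : Type*} [TopologicalSpace M]
    [ChartedSpace (E (k + 1)) M] [TopologicalSpace W]
    [ChartedSpace (EuclideanHalfSpace (k + 2)) W] {j : M → W} {p : M}
    (h : HasMFDerivAt (𝓡 (k + 1)) (𝓡∂ (k + 2)) j p (inclBd k δ)) :
    boundarySign (d := k + 1) j p = -δ := by
  rw [boundarySign, boundaryFrame, h.mfderiv]
  exact det_frame δ

namespace BoundaryEmbedding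

variable {n m : ℕ} [NeZero n] {X : Type*} [TopologicalSpace X]
  [ChartedSpace (EuclideanHalfSpace n) X] {D : BoundaryEmbedding n m X}

namespace Cutoff

variable [Nonempty X] [IsManifold (𝓡∂ n) ∞ X] (B : D.Cutoff)
  (hbd : ((𝓡∂ n).boundary X).Nonempty) {ε : ℝ} (hε : ε * ε = 1)

/-! ### The cylinder in `B_F` -/

theorem range_pos :
    range (fun p : Ioc (0 : ℝ) 1 × E (m + 1) => BF.pos (D := D) p.1 p.2) =
      (B.posChart hbd).source := by
  ext β
  constructor
  · rintro ⟨p, rfl⟩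
    exact B.pos_mem_source hbd p.1 p.2
  · intro hβ
    rw [mem_posChart_source] at hβ
    cases β with
    | sing z => exact absurd (B.modelSing_mul_eq_zero z) hβ.ne'
    | pos t P => exact ⟨(t, P), rfl⟩

/-- The coordinates `(t, P)` in terms of the coordinates of `posChart`. -/
def unCoord (m : ℕ) (y : E (m + 2)) : ℝ × E (m + 1) := (1 - y 0, flip (-1) (tail y))

theorem contDiff_unCoord : ContDiff ℝ ∞ (unCoord m) := by
  have h1 : ContDiff ℝ ∞ fun y : E (m + 2) => (1 : ℝ) - y 0 := contDiff_const.sub contDiff_head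
  exact h1.prodMk ((flip (-1)).contDiff.comp contDiff_tail)

theorem unCoord_posChart (t : Ioc (0 : ℝ) 1) (P : E (m + 1)) :
    unCoord m (B.posChart hbd (.pos t P)).1 = ((t : ℝ), P) := by
  rw [posChart_pos, unCoord, cons_apply_zero, tail_cons, sub_sub_cancel, flip_flip (by norm_num)]

theorem coord_eq {β : D.BF} (hβ : β ∈ (B.posChart hbd).source) :
    D.coord β = unCoord m (B.posChart hbd β).1 := by
  rw [← B.range_pos hbd] at hβ
  obtain ⟨⟨t, P⟩, rfl⟩ := hβ
  rw [unCoord_posChart]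
  rfl

include B hbd in
theorem continuous_pos :
    Continuous (fun p : Ioc (0 : ℝ) 1 × E (m + 1) => BF.pos (D := D) p.1 p.2) := by
  rw [(B.isEmbedding_model hbd).isInducing.continuous_iff]
  have h1 : Continuous fun p : Ioc (0 : ℝ) 1 × E (m + 1) => (p.1 : ℝ) :=
    continuous_subtype_val.comp continuous_fst
  have h2 : Continuous fun p : Ioc (0 : ℝ) 1 × E (m + 1) => logc p.2 :=
    continuous_logc.comp continuous_snd
  exact h1.prodMk (B.continuousOn_G.comp_continuous (h1.prodMk h2)
    fun p => ⟨p.1.2.1, logc_mem_half _⟩)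

include B hbd in
theorem isOpenEmbedding_pos :
    IsOpenEmbedding (fun p : Ioc (0 : ℝ) 1 × E (m + 1) => BF.pos (D := D) p.1 p.2) := by
  refine ⟨⟨?_, ?_⟩, ?_⟩
  · rw [isInducing_iff_nhds]
    rintro ⟨t, P⟩
    refine le_antisymm (B.continuous_pos hbd).continuousAt.le_comap ?_
    have h1 : IsInducing fun p : Ioc (0 : ℝ) 1 × E (m + 1) => ((p.1 : ℝ), p.2) :=
      IsInducing.subtypeVal.prodMap IsInducing.id
    have h2 : ContinuousAt (fun β : D.BF => unCoord m (B.posChart hbd β).1) (.pos t P) :=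
      (contDiff_unCoord.continuous.comp continuous_subtype_val).continuousAt.comp
        ((B.posChart hbd).continuousAt (B.pos_mem_source hbd t P))
    have h3 := h2.tendsto.le_comap
    rw [h1.nhds_eq_comap]
    rw [unCoord_posChart] at h3
    refine (comap_mono h3).trans ?_
    rw [comap_comap]
    refine le_of_eq (congrArg (fun f => comap f _) ?_)
    funext p
    exact B.unCoord_posChart hbd p.1 p.2
  · rintro ⟨t, P⟩ ⟨t', P'⟩ h
    simp only [BF.pos.injEq] at h
    exact Prod.ext h.1 h.2
  · rw [B.range_pos hbd]
    exact (B.posChart hbd).open_source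

/-- The derivative of `unCoord`. -/
def unCoordL (m : ℕ) : E (m + 2) →L[ℝ] ℝ × E (m + 1) :=
  ((-ContinuousLinearMap.id ℝ ℝ).prodMap (flip (-1))) ∘L
    ((consL (m + 1)).symm : E (m + 2) →L[ℝ] ℝ × E (m + 1))

theorem hasFDerivAt_unCoord (y : E (m + 2)) : HasFDerivAt (unCoord m) (unCoordL m) y := by
  have h : unCoord m = fun y => ((1 : ℝ), (0 : E (m + 1))) + unCoordL m y := by
    funext y
    refine Prod.ext ?_ ?_
    · simp [unCoord, unCoordL, sub_eq_add_neg]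
    · simp [unCoord, unCoordL]
  rw [h]
  exact (unCoordL m).hasFDerivAt.const_add _

theorem unCoordL_apply (y : E (m + 2)) : unCoordL m y = (-y 0, flip (-1) (tail y)) := rfl

theorem bijective_unCoordL : Function.Bijective (unCoordL m) := by
  have h : Function.LeftInverse (fun q : ℝ × E (m + 1) => cons (-q.1) (flip (-1) q.2))
      (unCoordL m) := fun y => by
    rw [unCoordL_apply]
    simp only [neg_neg]
    rw [flip_flip (by norm_num), cons_tail]
  have h' : Function.RightInverse (fun q : ℝ × E (m + 1) => cons (-q.1) (flip (-1) q.2))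
      (unCoordL m) := fun q => by
    rw [unCoordL_apply]
    simp only [cons_apply_zero, tail_cons, neg_neg]
    rw [flip_flip (by norm_num)]
  exact ⟨h.injective, h'.surjective⟩

theorem isStandardOnCylinder :
    @IsStandardOnCylinder n m _ X _ _ D (B.chartedSpaceBF hbd hε) := by
  let _ := B.chartedSpaceBF hbd hε
  have _ := B.isManifold_BF hbd hε
  refine ⟨B.isOpenEmbedding_pos hbd, ?_, fun t P => ?_⟩
  · rw [B.range_pos hbd]
    have h1 : B.posChart hbd ∈ IsManifold.maximalAtlas (𝓡∂ (m + 2)) ∞ D.BF :=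
      IsManifold.subset_maximalAtlas (Or.inr rfl)
    have h2 := (B.posChart hbd).contMDiffOn_extend h1
    exact (contDiff_unCoord.contMDiff.comp_contMDiffOn h2).congr fun β hβ => B.coord_eq hbd hβ
  · have h : HasMFDerivAt (𝓡∂ (m + 2)) 𝓘(ℝ, ℝ × E (m + 1)) D.coord (.pos t P) (unCoordL m) := by
      refine ⟨?_, ?_⟩
      · have h2 : ContinuousAt (fun β : D.BF => unCoord m (B.posChart hbd β).1) (.pos t P) :=
          (contDiff_unCoord.continuous.comp continuous_subtype_val).continuousAt.comp
            ((B.posChart hbd).continuousAt (B.pos_mem_source hbd t P))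
        refine h2.congr ?_
        filter_upwards [(B.posChart hbd).open_source.mem_nhds (B.pos_mem_source hbd t P)] with β hβ
        exact (B.coord_eq hbd hβ).symm
      · refine ((hasFDerivAt_unCoord _).hasFDerivWithinAt).congr_of_eventuallyEq ?_ ?_
        · filter_upwards [extChartAt_target_mem_nhdsWithin (I := 𝓡∂ (m + 2))
            (BF.pos t P : D.BF)] with y hy
          have h3 : (extChartAt (𝓡∂ (m + 2)) (BF.pos t P : D.BF)).symm y ∈
              (B.posChart hbd).source := by
            have := (extChartAt (𝓡∂ (m + 2)) (BF.pos t P : D.BF)).map_target hy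
            rwa [extChartAt_source] at this
          refine (B.coord_eq hbd h3).trans (congrArg _ ?_)
          exact (extChartAt (𝓡∂ (m + 2)) (BF.pos t P : D.BF)).right_inv hy
        · have h3 : (extChartAt (𝓡∂ (m + 2)) (BF.pos t P : D.BF)).symm
              (extChartAt (𝓡∂ (m + 2)) (BF.pos t P : D.BF) (BF.pos t P)) = BF.pos t P :=
            extChartAt_to_inv _
          simp only [writtenInExtChartAt, Function.comp_apply, h3]
          exact B.coord_eq hbd (B.pos_mem_source hbd t P)
    rw [h.mfderiv]
    exact bijective_unCoordL

/-! ### The cobordism -/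

include hbd in
theorem range_topEnd : range D.topEnd = B.model ⁻¹' {z | z.1 = 1} := by
  ext β
  constructor
  · rintro ⟨P, rfl⟩
    rfl
  · intro h
    cases β with
    | sing z => exact absurd h (B.modelSing_fst_lt_one hbd z).ne
    | pos t P =>
      obtain rfl : t = ⟨1, by simp⟩ := Subtype.ext h
      exact ⟨P, rfl⟩

include B hbd in
theorem isEmbedding_topEnd : IsEmbedding D.topEnd :=
  (B.isOpenEmbedding_pos hbd).isEmbedding.comp 
    (isEmbedding_prodMkRight (⟨1, by simp⟩ : Ioc (0 : ℝ) 1))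

include B hbd in
theorem isEmbedding_sing : IsEmbedding (BF.sing (D := D)) :=
  IsEmbedding.of_comp continuous_sing B.continuous_model (B.isEmbedding_modelSing hbd)

theorem chart_sing {y : E (m + 1)} (hy : y ∈ range (B.singCoord ε)) :
    (B.singChart hbd hε (.sing (((B.isOpenEmbedding_singCoord hbd hε).toOpenPartialHomeomorph
      _).symm y))).1 = inclBd m 1 y := by
  obtain ⟨z, rfl⟩ := hy
  rw [IsOpenEmbedding.toOpenPartialHomeomorph_left_inv, B.singChart_sing, inclBd_apply, flip_one]

theorem chart_topEnd (P : E (m + 1)) :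
    (B.posChart hbd (D.topEnd P)).1 = inclBd m (-1) P := by
  rw [topEnd, B.posChart_pos, inclBd_apply]
  simp

theorem isOrientedCobordism
    (hpos : ∀ y : E (m + 2), y 0 < 1 → 0 < (fderiv ℝ (B.trans ε) y).det) :
    @IsOrientedCobordism (m + 1) D.Nsing (E (m + 1)) D.BF _ (B.chartedSpaceNsing hbd hε) _ _ _
      (B.chartedSpaceBF hbd hε) BF.sing D.topEnd := by
  let _ := B.chartedSpaceBF hbd hε
  let _ := B.chartedSpaceNsing hbd hε
  have _ := B.isManifold_BF hbd hε
  have _ : IsManifold (𝓡 (m + 1)) ∞ D.Nsing :=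
    (B.isOpenEmbedding_singCoord hbd hε).isManifold_singleton
  have h₀ : ∀ p, HasMFDerivAt (𝓡 (m + 1)) (𝓡∂ (m + 2)) (BF.sing (D := D)) p (inclBd m 1) :=
    fun p => hasMFDerivAt_inclBd continuous_sing.continuousAt fun y hy =>
      B.chart_sing hbd hε (by
        have h : y ∈ ((B.isOpenEmbedding_singCoord hbd hε).toOpenPartialHomeomorph _).target := hy
        rwa [IsOpenEmbedding.toOpenPartialHomeomorph_target] at h)
  have h₁ : ∀ p, HasMFDerivAt (𝓡 (m + 1)) (𝓡∂ (m + 2)) D.topEnd p (inclBd m (-1)) :=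
    fun p => hasMFDerivAt_inclBd (B.isEmbedding_topEnd hbd).continuous.continuousAt
      fun y _ => B.chart_topEnd hbd y
  refine
    { t2 := (B.isEmbedding_model hbd).t2Space
      secondCountable := (B.isEmbedding_model hbd).secondCountableTopology
      smooth := inferInstance
      smooth₀ := inferInstance
      smooth₁ := inferInstance
      oriented := B.isOrientedAtlas_BF hbd hε hpos
      oriented₀ := isOrientedAtlas_singleton _ rfl
      oriented₁ := isOrientedAtlas_singleton (OpenPartialHomeomorph.refl _) rfl
      embedding₀ := ⟨⟨ℝ, inferInstance, inferInstance, fun p => ?_⟩, B.isEmbedding_sing hbd⟩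
      embedding₁ := ⟨⟨ℝ, inferInstance, inferInstance, fun p => ?_⟩, B.isEmbedding_topEnd hbd⟩
      isClosed₀ := ?_
      isClosed₁ := ?_
      disjoint := ?_
      boundary_eq := ?_
      reverses := fun p => by rw [boundarySign_eq (h₀ p)]; norm_num
      preserves := fun p => by rw [boundarySign_eq (h₁ p)]; norm_num }
  · refine Manifold.IsImmersionAtOfComplement.mk_of_continuousAt continuous_sing.continuousAt
      (bdEquiv m (δ := 1) (by norm_num)) (chartAt _ p) (B.singChart hbd hε) (mem_chart_source _ p)
      (B.sing_mem_source hbd hε p) (IsManifold.chart_mem_maximalAtlas p)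
      (IsManifold.subset_maximalAtlas (Or.inl rfl)) fun y hy => ?_
    refine B.chart_sing hbd hε ?_
    have h : y ∈ ((B.isOpenEmbedding_singCoord hbd hε).toOpenPartialHomeomorph _).target := by
      have := (OpenPartialHomeomorph.extend_target (I := 𝓡 (m + 1))
        (chartAt (E (m + 1)) p)) ▸ hy
      exact this.1
    rwa [IsOpenEmbedding.toOpenPartialHomeomorph_target] at h
  · refine Manifold.IsImmersionAtOfComplement.mk_of_continuousAt
      (B.isEmbedding_topEnd hbd).continuous.continuousAt
      (bdEquiv m (δ := -1) (by norm_num)) (chartAt _ p) (B.posChart hbd) (mem_chart_source _ p)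
      (B.pos_mem_source hbd _ p) (IsManifold.chart_mem_maximalAtlas p)
      (IsManifold.subset_maximalAtlas (Or.inr rfl)) fun y hy => ?_
    exact B.chart_topEnd hbd y
  · rw [B.range_sing]
    exact (isClosed_eq (continuous_fst.mul (continuous_snd.comp continuous_snd))
      continuous_const).preimage B.continuous_model
  · rw [B.range_topEnd hbd]
    exact (isClosed_eq continuous_fst continuous_const).preimage B.continuous_model
  · rw [Set.disjoint_left]
    rintro _ ⟨z, rfl⟩ ⟨P, h⟩
    cases h
  · ext β
    rw [ModelWithCorners.boundary, mem_ofPred_eq, ModelWithCorners.IsBoundaryPoint,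
      frontier_range_modelWithCornersEuclideanHalfSpace, mem_ofPred_eq]
    cases β with
    | sing z =>
      refine iff_of_true ?_ (Or.inl ⟨z, rfl⟩)
      have h := B.singChart_sing hbd hε z
      change (0 : ℝ) = (B.singChart hbd hε (.sing z)).1 0
      rw [h, cons_apply_zero]
    | pos t P =>
      change (0 : ℝ) = (B.posChart hbd (.pos t P)).1 0 ↔ _
      rw [B.posChart_pos hbd, cons_apply_zero]
      constructor
      · intro h
        obtain rfl : t = ⟨1, by simp⟩ := Subtype.ext (by simp only; linarith)
        exact Or.inr ⟨P, rfl⟩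
      · rintro (⟨z, h⟩ | ⟨Q, h⟩)
        · cases h
        · simp only [topEnd, BF.pos.injEq] at h
          rw [← h.1]
          simp

include B hbd in
theorem locallyCompactSpace_BF : LocallyCompactSpace D.BF := by
  let _ := B.chartedSpaceBF hbd (ε := 1) (by norm_num)
  exact Manifold.locallyCompact_of_finiteDimensional (𝓡∂ (m + 2))

end Cutoff

end BoundaryEmbedding

/-! ### Derivatives along lines -/

/-- Derivative of a function along a line staying in a set. -/
theorem hasDerivAt_line_of_hasFDerivWithinAt {V W : Type*} [NormedAddCommGroup V]
    [NormedSpace ℝ V] [NormedAddCommGroup W] [NormedSpace ℝ W] {f : V → W} {f' : V →L[ℝ] W}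
    {S : Set V} {a ξ : V} (hf : HasFDerivWithinAt f f' S a)
    (hline : ∀ᶠ s : ℝ in 𝓝 0, a + s • ξ ∈ S) :
    HasDerivAt (fun s : ℝ => f (a + s • ξ)) (f' ξ) 0 := by
  have h1 : HasDerivWithinAt (fun s : ℝ => a + s • ξ) ξ {s : ℝ | a + s • ξ ∈ S} 0 := by
    simpa using (((hasDerivAt_id (0 : ℝ)).smul_const ξ).const_add a).hasDerivWithinAt
  have h2 : HasFDerivWithinAt f f' S (a + (0 : ℝ) • ξ) := by simpa using hf
  have h3 := h2.comp_hasDerivWithinAt (0 : ℝ) h1 (fun s hs => hs)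
  exact h3.hasDerivAt hline

theorem hasDerivAt_chart_line {V W H M : Type*} [NormedAddCommGroup V] [NormedSpace ℝ V]
    [NormedAddCommGroup W] [NormedSpace ℝ W] [TopologicalSpace H] {I : ModelWithCorners ℝ V H}
    [TopologicalSpace M] [ChartedSpace H M] {f : M → W} {x : M}
    (hf : MDifferentiableAt I 𝓘(ℝ, W) f x) {ξ : V}
    (hline : ∀ᶠ s : ℝ in 𝓝 0, extChartAt I x x + s • ξ ∈ range I) :
    HasDerivAt (fun s : ℝ => f ((extChartAt I x).symm (extChartAt I x x + s • ξ)))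
      ((mfderiv I 𝓘(ℝ, W) f x : V →L[ℝ] W) ξ) 0 := by
  have h1 := hf.hasMFDerivAt.2
  have h2 : HasFDerivWithinAt (f ∘ (extChartAt I x).symm) (mfderiv I 𝓘(ℝ, W) f x : V →L[ℝ] W)
      (range I) (extChartAt I x x) := by
    simpa only [writtenInExtChartAt, extChartAt_model_space_eq_id, PartialEquiv.refl_coe,
      Function.id_comp] using h1
  exact hasDerivAt_line_of_hasFDerivWithinAt h2 hline

/-- The chain rule along a curve with velocity zero. -/
theorem hasDerivAt_comp_zero {V W : Type*} [NormedAddCommGroup V] [NormedSpace ℝ V]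
    [NormedAddCommGroup W] [NormedSpace ℝ W] {g : V → W} {γ : ℝ → V} {s : ℝ}
    (hg : DifferentiableAt ℝ g (γ s)) (hγ : HasDerivAt γ 0 s) :
    HasDerivAt (fun s => g (γ s)) 0 s := by
  have := hg.hasFDerivAt.comp_hasDerivAt s hγ
  rwa [map_zero] at this

namespace BoundaryEmbedding

variable {n m : ℕ} [NeZero n] {X : Type*} [TopologicalSpace X]
  [ChartedSpace (EuclideanHalfSpace n) X] {D : BoundaryEmbedding n m X}

namespace Cutoff

variable [Nonempty X] [IsManifold (𝓡∂ n) ∞ X] (B : D.Cutoff)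

/-! ### The normal bundle in `N_sing(X)` -/

theorem lift_zero_mem_tubeImage {x : X} {c : E (m + 1)} (hc : D.IsNrm x c) :
    B.lift x 0 c ∈ D.tubeImage :=
  expo_mem_tubeImage (B.dil_zero_mem_tube hc)

theorem b_lift_zero {x : X} {c : E (m + 1)} (hc : D.IsNrm x c) :
    B.b (B.lift x 0 c) = B.dil x 0 c := by
  have h := B.b_lift le_rfl hc (by rw [zero_smul]; exact D.zero_mem_tube x)
  rwa [add_zero] at h

theorem vec_lift_zero {x : X} {c : E (m + 1)} (hc : D.IsNrm x c) :
    D.vec (B.lift x 0 c) = B.dil x 0 c • c :=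
  B.vec_lift le_rfl hc (by rw [zero_smul]; exact D.zero_mem_tube x)

theorem emb_eq_of_lift {x : X} {c : E (m + 1)} (hc : D.IsNrm x c) :
    D.emb x = (B.lift x 0 c).1 - front (D.vec (B.lift x 0 c)) := by
  rw [B.vec_lift_zero hc, lift, expo, add_sub_cancel_right]

theorem eq_of_lift {x : X} {c : E (m + 1)} (hc : D.IsNrm x c) :
    c = (B.b (B.lift x 0 c))⁻¹ • D.vec (B.lift x 0 c) := by
  rw [B.vec_lift_zero hc, B.b_lift_zero hc, smul_smul,
    inv_mul_cancel₀ (B.dil_pos x le_rfl c).ne', one_smul]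

/-- `modelSing` is an immersion on `N(X)`: if the image of a curve `(x, [W]_x)`, which lies in the
boundary if it starts there, has velocity zero, then so have `emb x` and the normal part of `W`. -/
theorem hasDerivAt_zero_of_lift {x : ℝ → X} {c : ℝ → E (m + 1)} (hc : ∀ s, D.IsNrm (x s) (c s))
    (h : HasDerivAt (fun s => B.lift (x s) 0 (c s)) 0 0)
    (h0 : D.rho (x 0) = 0 → ∀ᶠ s in 𝓝 0, D.rho (x s) = 0) :
    HasDerivAt (fun s => D.emb (x s)) 0 0 ∧ HasDerivAt c 0 0 := by
  have hfst : HasDerivAt (fun s => (B.lift (x s) 0 (c s)).1) 0 0 :=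
    hasDerivAt_comp_zero (g := Prod.fst) (V := E m × ℝ) differentiableAt_fst h
  have key : HasDerivAt (fun s => D.vec (B.lift (x s) 0 (c s))) 0 0 ∧
      HasDerivAt (fun s => B.b (B.lift (x s) 0 (c s))) 0 0 := by
    rcases (D.rho_nonneg (x 0)).eq_or_lt with h1 | h1
    · have h2 : ∀ᶠ s in 𝓝 0, B.lift (x s) 0 (c s) = ((B.lift (x s) 0 (c s)).1, (0 : ℝ)) := by
        filter_upwards [h0 h1.symm] with s hs
        rw [lift, expo_of_rho_eq_zero hs]
      have h3 := B.lift_zero_mem_tubeImage (hc 0)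
      rw [h2.self_of_nhds] at h3
      have h4 := hasDerivAt_comp_zero (γ := fun s => (B.lift (x s) 0 (c s)).1)
        ((D.contDiffAt_vec_slice h3).differentiableAt (by simp)) hfst
      have h5 := hasDerivAt_comp_zero (γ := fun s => (B.lift (x s) 0 (c s)).1)
        (B.contDiff_wgt_slice.differentiable (by simp) _) hfst
      refine ⟨h4.congr_of_eventuallyEq ?_, h5.congr_of_eventuallyEq ?_⟩
      · filter_upwards [h2] with s hs
        rw [hs]
      · filter_upwards [h2] with s hs
        rw [hs]
        rfl
    · have h2 : 0 < (B.lift (x 0) 0 (c 0)).2 := mul_pos h1 (Real.exp_pos _)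
      have h3 : ∀ᶠ s in 𝓝 0, 0 < (B.lift (x s) 0 (c s)).2 :=
        (continuous_snd.continuousAt.comp h.continuousAt).eventually (lt_mem_nhds h2)
      have h4 : HasDerivAt (fun s => lnc (B.lift (x s) 0 (c s))) 0 0 :=
        hasDerivAt_comp_zero ((contDiffAt_lnc (r := 1) h2).differentiableAt (by simp)) h
      have h6 : logc (lnc (B.lift (x 0) 0 (c 0))) ∈ D.tubeImage := by
        rw [logc_lnc h2]; exact B.lift_zero_mem_tubeImage (hc 0)
      have h7 := hasDerivAt_comp_zero (γ := fun s => lnc (B.lift (x s) 0 (c s)))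
        ((D.contDiffAt_vec_logc h6).differentiableAt (by simp)) h4
      have h8 := hasDerivAt_comp_zero (γ := fun s => lnc (B.lift (x s) 0 (c s)))
        (B.contDiff_b_logc.differentiable (by simp) _) h4
      refine ⟨h7.congr_of_eventuallyEq ?_, h8.congr_of_eventuallyEq ?_⟩
      · filter_upwards [h3] with s hs
        rw [logc_lnc hs]
      · filter_upwards [h3] with s hs
        rw [logc_lnc hs]
  constructor
  · have h1 := hfst.sub (hasDerivAt_comp_zero
      ((contDiff_front (k := 1)).differentiable (by simp) _) key.1)
    rw [sub_zero] at h1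
    refine h1.congr_of_eventuallyEq (Eventually.of_forall fun s => ?_)
    exact B.emb_eq_of_lift (hc s)
  · have h2 : B.b (B.lift (x 0) 0 (c 0)) ≠ 0 := by
      rw [B.b_lift_zero (hc 0)]
      exact (B.dil_pos _ le_rfl _).ne'
    have h1 := (hasDerivAt_comp_zero (γ := fun s => B.b (B.lift (x s) 0 (c s)))
      (g := fun r : ℝ => r⁻¹) (differentiableAt_inv h2) key.2).smul key.1
    rw [smul_zero, zero_smul, add_zero] at h1
    exact h1.congr_of_eventuallyEq (Eventually.of_forall fun s => B.eq_of_lift (hc s))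

theorem contMDiff_dil_nrm : ContMDiff ((𝓡∂ n).prod (𝓡 (m + 1))) 𝓘(ℝ, ℝ) ∞
    fun p : X × E (m + 1) => B.dil p.1 0 (D.nrm p.1 p.2) := by
  intro p
  obtain ⟨σ, h1, h2⟩ := B.exists_contDiffAt_dil p.1 le_rfl (D.nrm p.1 p.2)
  have h3 : ContMDiffAt ((𝓡∂ n).prod (𝓡 (m + 1))) 𝓘(ℝ, E m × ℝ × ℝ) ∞
      (fun p : X × E (m + 1) => (D.emb p.1, (0 : ℝ), ‖D.nrm p.1 p.2‖ ^ 2)) p := by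
    refine ContMDiffAt.prodMk_space ((D.contMDiff_emb.comp contMDiff_fst) p)
      (contMDiffAt_const.prodMk_space ?_)
    exact ((contDiff_norm_sq ℝ (n := ∞)).contMDiff.comp D.contMDiff_nrm) p
  have h4 := h1.contMDiffAt.comp p h3
  refine h4.congr_of_eventuallyEq ?_
  have h5 : ContinuousAt (fun p : X × E (m + 1) => (p.1, (0 : ℝ), D.nrm p.1 p.2)) p :=
    (continuous_fst.prodMk (continuous_const.prodMk D.continuous_nrm)).continuousAt
  filter_upwards [h5.eventually h2] with q hq
  exact hq le_rfl

theorem contMDiff_dil_smul : ContMDiff ((𝓡∂ n).prod (𝓡 (m + 1))) (𝓡 (m + 1)) ∞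
    fun p : X × E (m + 1) => B.dil p.1 0 (D.nrm p.1 p.2) • D.nrm p.1 p.2 :=
  B.contMDiff_dil_nrm.smul D.contMDiff_nrm

theorem contMDiff_lift_fst : ContMDiff ((𝓡∂ n).prod (𝓡 (m + 1))) (𝓡 m) ∞
    fun p : X × E (m + 1) => (B.lift p.1 0 (D.nrm p.1 p.2)).1 :=
  (D.contMDiff_emb.comp contMDiff_fst).add
    ((contDiff_front (k := ∞)).contMDiff.comp B.contMDiff_dil_smul)

theorem contMDiff_lift_snd : ContMDiff ((𝓡∂ n).prod (𝓡 (m + 1))) 𝓘(ℝ, ℝ) ∞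
    fun p : X × E (m + 1) => (B.lift p.1 0 (D.nrm p.1 p.2)).2 :=
  (D.contMDiff_rho.comp contMDiff_fst).mul
    (Real.contDiff_exp.contMDiff.comp
      ((contDiff_height (k := ∞)).contMDiff.comp B.contMDiff_dil_smul))

theorem modelSing_normalMap (p : X × E (m + 1)) :
    B.modelSing (D.normalMap p) = (0, B.lift p.1 0 (D.nrm p.1 p.2)) := by
  simp only [normalMap, modelSing, nrmQ_mk]

/-- The coordinate of `N_sing(X)` as a linear function of the model coordinates. -/
def singL (m : ℕ) (ε : ℝ) : (E m × ℝ) →L[ℝ] E (m + 1) :=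
  flip ε ∘L (joinL m : (E m × ℝ) →L[ℝ] E (m + 1))

theorem singCoord_eq (ε : ℝ) (z : D.Nsing) : B.singCoord ε z =
    singL m ε ((B.modelSing z).2.1, (B.modelSing z).1 - (B.modelSing z).2.2) := by
  rw [singCoord, tail_flip, corner, tail_cons]
  rfl

theorem singL_injective {ε : ℝ} (hε : ε * ε = 1) : Function.Injective (singL m ε) := by
  intro a b h
  have h1 := congrArg (flip ε) h
  simp only [singL, ContinuousLinearMap.comp_apply] at h1
  rw [flip_flip hε, flip_flip hε] at h1
  exact (joinL m).injective h1

theorem singCoord_normalMap (ε : ℝ) (p : X × E (m + 1)) : B.singCoord ε (D.normalMap p) =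
    singL m ε ((B.lift p.1 0 (D.nrm p.1 p.2)).1, -(B.lift p.1 0 (D.nrm p.1 p.2)).2) := by
  rw [singCoord_eq, modelSing_normalMap, zero_sub]

theorem contMDiff_singCoord_normalMap (ε : ℝ) : ContMDiff ((𝓡∂ n).prod (𝓡 (m + 1))) (𝓡 (m + 1)) ∞
    (B.singCoord ε ∘ D.normalMap) := by
  have h := (singL m ε).contMDiff.comp (B.contMDiff_lift_fst.prodMk_space B.contMDiff_lift_snd.neg)
    (n := ∞)
  exact h.congr fun p => B.singCoord_normalMap ε p

end Cutoff

end BoundaryEmbedding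

namespace BoundaryEmbedding

variable {n m : ℕ} [NeZero n] {X : Type*} [TopologicalSpace X]
  [ChartedSpace (EuclideanHalfSpace n) X] {D : BoundaryEmbedding n m X}

namespace Cutoff

variable [Nonempty X] [IsManifold (𝓡∂ n) ∞ X] (B : D.Cutoff)

theorem contMDiff_lift : ContMDiff ((𝓡∂ n).prod (𝓡 (m + 1))) 𝓘(ℝ, E m × ℝ) ∞
    fun p : X × E (m + 1) => B.lift p.1 0 (D.nrm p.1 p.2) :=
  B.contMDiff_lift_fst.prodMk_space B.contMDiff_lift_snd

/-- The differential of `(x, V) ↦ [V]_x` in the model coordinates. -/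
def dLift (p : X × E (m + 1)) : E n × E (m + 1) →L[ℝ] E m × ℝ :=
  mfderiv ((𝓡∂ n).prod (𝓡 (m + 1))) 𝓘(ℝ, E m × ℝ)
    (fun p : X × E (m + 1) => B.lift p.1 0 (D.nrm p.1 p.2)) p

theorem dRho_eq_zero_of_dLift {p : X × E (m + 1)} {v : E n × E (m + 1)}
    (h0 : D.rho p.1 = 0) (hv : B.dLift p v = 0) : D.dRho p.1 v.1 = 0 := by
  have hρ : HasMFDerivAt ((𝓡∂ n).prod (𝓡 (m + 1))) 𝓘(ℝ, ℝ) (fun q : X × E (m + 1) => D.rho q.1) p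
      ((D.dRho p.1).comp (ContinuousLinearMap.fst ℝ (E n) (E (m + 1))) :
        E n × E (m + 1) →L[ℝ] ℝ) :=
    (D.mdiff_rho p.1).hasMFDerivAt.comp p (hasMFDerivAt_fst p)
  have he : MDifferentiableAt ((𝓡∂ n).prod (𝓡 (m + 1))) 𝓘(ℝ, ℝ)
      (fun q : X × E (m + 1) =>
        Real.exp (height (B.dil q.1 0 (D.nrm q.1 q.2) • D.nrm q.1 q.2))) p :=
    (Real.contDiff_exp.contMDiff.comp ((contDiff_height (k := ∞)).contMDiff.comp
      B.contMDiff_dil_smul)).mdifferentiableAt (by simp)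
  have h1 := hρ.mul he.hasMFDerivAt
  have h2 : HasMFDerivAt ((𝓡∂ n).prod (𝓡 (m + 1))) 𝓘(ℝ, ℝ)
      (fun q : X × E (m + 1) => (B.lift q.1 0 (D.nrm q.1 q.2)).2) p
      ((ContinuousLinearMap.snd ℝ (E m) ℝ).comp (B.dLift p) : E n × E (m + 1) →L[ℝ] ℝ) := by
    have h3 : HasMFDerivAt ((𝓡∂ n).prod (𝓡 (m + 1))) 𝓘(ℝ, E m × ℝ) _ p (B.dLift p) :=
      (B.contMDiff_lift.mdifferentiableAt (by simp) (x := p)).hasMFDerivAt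
    exact (ContinuousLinearMap.snd ℝ (E m) ℝ).hasMFDerivAt.comp p h3
  have h4 := hasMFDerivAt_unique h1 h2
  have h5 := congrArg (fun L : E n × E (m + 1) →L[ℝ] ℝ => L v) h4
  let d : E n × E (m + 1) →L[ℝ] ℝ := mfderiv ((𝓡∂ n).prod (𝓡 (m + 1))) 𝓘(ℝ, ℝ)
    (fun q : X × E (m + 1) => Real.exp (height (B.dil q.1 0 (D.nrm q.1 q.2) • D.nrm q.1 q.2))) p
  have h6 : D.rho p.1 * d v +
      Real.exp (height (B.dil p.1 0 (D.nrm p.1 p.2) • D.nrm p.1 p.2)) * D.dRho p.1 v.1 =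
      (B.dLift p v).2 := h5
  rw [h0, zero_mul, zero_add] at h6
  rw [hv] at h6
  exact (mul_eq_zero.1 h6).resolve_left (Real.exp_pos _).ne'

omit [Nonempty X] [IsManifold (𝓡∂ n) ∞ X] in
theorem dRho_eq_dRhoC (x : X) (ξ : E n) : D.dRho x ξ = D.dRhoC x (extChartAt (𝓡∂ n) x x) ξ := by
  have h := (D.mdiff_rho x).mfderiv
  rw [dRho, h]
  simp only [writtenInExtChartAt, extChartAt_model_space_eq_id, PartialEquiv.refl_coe,
      Function.id_comp]
  rfl

/-- The kernel of the differential of `(x, V) ↦ [V]_x` is `0 × T_x X`. -/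
theorem eq_zero_of_dLift {p : X × E (m + 1)} {v : E n × E (m + 1)} (hv : B.dLift p v = 0) :
    v.1 = 0 ∧ v.2 ∈ D.tangentImage p.1 := by
  obtain ⟨x, V⟩ := p
  obtain ⟨ξ, w⟩ := v
  have ha := mem_extChartAt_target (I := 𝓡∂ n) x
  have hξ : (extChartAt (𝓡∂ n) x x) 0 = 0 → ξ 0 = 0 := fun h => by
    refine D.apply_zero_of_dRhoC ha h ?_
    rw [← dRho_eq_dRhoC]
    refine B.dRho_eq_zero_of_dLift (p := (x, V)) (v := (ξ, w)) ?_ hv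
    have := (D.rhoC_eq_zero_iff ha).2 h
    rwa [rhoC, Function.comp_apply, extChartAt_to_inv] at this
  have hl : ∀ᶠ s : ℝ in 𝓝 0, extChartAt ((𝓡∂ n).prod (𝓡 (m + 1))) (x, V) (x, V) + s • (ξ, w) ∈
      range ((𝓡∂ n).prod (𝓡 (m + 1))) := by
    filter_upwards [line_mem_range (extChartAt_target_subset_range x ha) hξ] with s hs
    rw [modelWithCorners_prod_coe, range_prodMap]
    exact ⟨hs, by simp⟩
  set q : ℝ → X × E (m + 1) := fun s => (extChartAt ((𝓡∂ n).prod (𝓡 (m + 1))) (x, V)).symm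
    (extChartAt ((𝓡∂ n).prod (𝓡 (m + 1))) (x, V) (x, V) + s • (ξ, w)) with hq
  have hq1 : ∀ s, q s = ((extChartAt (𝓡∂ n) x).symm (extChartAt (𝓡∂ n) x x + s • ξ), V + s • w) :=
    fun s => by
      rw [hq]
      simp only [extChartAt_prod, PartialEquiv.prod_coe, PartialEquiv.prod_coe_symm]
      rfl
  have hq0 : q 0 = (x, V) := by
      rw [hq1, zero_smul, zero_smul, add_zero, add_zero, extChartAt_to_inv]
  have h1 : HasDerivAt (fun s => B.lift (q s).1 0 (D.nrm (q s).1 (q s).2)) 0 0 := by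
    have := hasDerivAt_chart_line (B.contMDiff_lift.mdifferentiableAt (by simp) (x := (x, V))) hl
    rw [show (mfderiv ((𝓡∂ n).prod (𝓡 (m + 1))) 𝓘(ℝ, E m × ℝ) (fun p : X × E (m + 1) =>
      B.lift p.1 0 (D.nrm p.1 p.2)) (x, V) : E n × E (m + 1) →L[ℝ] E m × ℝ) (ξ, w) = 0 from hv]
      at this
    exact this
  have h2 : D.rho (q 0).1 = 0 → ∀ᶠ s in 𝓝 0, D.rho (q s).1 = 0 := fun h => by
    rw [hq0] at h
    have h3 : (extChartAt (𝓡∂ n) x x) 0 = 0 := by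
      rw [← D.rhoC_eq_zero_iff ha, rhoC, Function.comp_apply, extChartAt_to_inv]
      exact h
    filter_upwards [line_mem_target ha hξ] with s hs
    rw [hq1]
    change D.rhoC x _ = 0
    rw [D.rhoC_eq_zero_iff hs]
    rw [PiLp.add_apply, PiLp.smul_apply, h3, hξ h3, smul_zero, add_zero]
  obtain ⟨h3, h4⟩ := B.hasDerivAt_zero_of_lift (fun s => D.isNrm_nrm (q s).1 (q s).2) h1 h2
  have h5 : ξ = 0 := by
    have h6 := hasDerivAt_chart_line (f := fun p : X × E (m + 1) => D.emb p.1) (x := (x, V))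
      ((D.contMDiff_emb.comp contMDiff_fst).mdifferentiableAt (by simp)) hl
    have h7 := h6.unique h3
    have h8 : HasMFDerivAt ((𝓡∂ n).prod (𝓡 (m + 1))) (𝓡 m) (fun q : X × E (m + 1) => D.emb q.1)
        (x, V) ((D.dEmb x).comp (ContinuousLinearMap.fst ℝ (E n) (E (m + 1))) :
          E n × E (m + 1) →L[ℝ] E m) :=
      (D.mdiff_emb x).hasMFDerivAt.comp (x, V) (hasMFDerivAt_fst (x, V))
    rw [h8.mfderiv] at h7
    exact D.injective_dEmb x (h7.trans (map_zero _).symm)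
  refine ⟨h5, D.mem_tangentImage_of_nrm_eq_zero ?_⟩
  subst h5
  have h6 : (fun s => D.nrm (q s).1 (q s).2) = fun s : ℝ => D.nrm x V + s • D.nrm x w := by
    funext s
    rw [hq1]
    simp only [smul_zero, add_zero, extChartAt_to_inv]
    rw [nrm_add, nrm_smul]
  rw [h6] at h4
  have h7 : HasDerivAt (fun s : ℝ => D.nrm x V + s • D.nrm x w) (D.nrm x w) 0 := by
    simpa using ((hasDerivAt_id (0 : ℝ)).smul_const (D.nrm x w)).const_add (D.nrm x V)
  exact h7.unique h4

variable (hbd : ((𝓡∂ n).boundary X).Nonempty) {ε : ℝ} (hε : ε * ε = 1)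

theorem contMDiff_normalMap :
    letI := B.chartedSpaceNsing hbd hε
    ContMDiff ((𝓡∂ n).prod (𝓡 (m + 1))) (𝓡 (m + 1)) ∞ D.normalMap :=
  ContMDiff.of_comp_isOpenEmbedding (B.isOpenEmbedding_singCoord hbd hε)
    (B.contMDiff_singCoord_normalMap ε)

omit [Nonempty X] [IsManifold (𝓡∂ n) ∞ X] in
theorem finrank_tangentImage_le (x : X) : Module.finrank ℝ (D.tangentImage x) ≤ n := by
  have key : ∀ L : E n →L[ℝ] E (m + 1), Module.finrank ℝ (LinearMap.range L.toLinearMap) ≤ n :=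
    fun L => (LinearMap.finrank_range_le L.toLinearMap).trans
      (finrank_euclideanSpace_fin (𝕜 := ℝ) (n := n)).le
  exact key _

/-- The kernel of the differential is `0 × T_x X`, of dimension at most `n`, so the differential
is onto. -/
theorem surjective_mfderiv_normalMap (p : X × E (m + 1)) :
    letI := B.chartedSpaceNsing hbd hε
    Function.Surjective (mfderiv ((𝓡∂ n).prod (𝓡 (m + 1))) (𝓡 (m + 1)) D.normalMap p) := by
  let _ := B.chartedSpaceNsing hbd hε
  have hN := (B.contMDiff_normalMap hbd hε).mdifferentiableAt (by simp) (x := p)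
  have hS : MDifferentiableAt (𝓡 (m + 1)) (𝓡 (m + 1)) (B.singCoord ε) (D.normalMap p) :=
    (contMDiff_isOpenEmbedding (I := 𝓡 (m + 1)) (n := ∞)
      (B.isOpenEmbedding_singCoord hbd hε)).mdifferentiableAt (by simp)
  set L : E n × E (m + 1) →L[ℝ] E (m + 1) :=
    mfderiv ((𝓡∂ n).prod (𝓡 (m + 1))) (𝓡 (m + 1)) D.normalMap p with hL
  have hker : ∀ v, L v = 0 → B.dLift p v = 0 := fun v hv => by
    have h1 := hS.hasMFDerivAt.comp p hN.hasMFDerivAt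
    have h2 : HasMFDerivAt ((𝓡∂ n).prod (𝓡 (m + 1))) 𝓘(ℝ, E m × ℝ) _ p (B.dLift p) :=
      (B.contMDiff_lift.mdifferentiableAt (by simp) (x := p)).hasMFDerivAt
    let R : (E m × ℝ) →L[ℝ] E (m + 1) := singL m ε ∘L
      ((ContinuousLinearMap.id ℝ (E m)).prodMap (-ContinuousLinearMap.id ℝ ℝ))
    have h3 : HasMFDerivAt ((𝓡∂ n).prod (𝓡 (m + 1))) (𝓡 (m + 1))
        (B.singCoord ε ∘ D.normalMap) p (R.comp (B.dLift p)) := by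
      have := R.hasMFDerivAt.comp p h2
      refine this.congr_of_eventuallyEq (Eventually.of_forall fun q => ?_)
      exact B.singCoord_normalMap ε q
    have h4 := hasMFDerivAt_unique h1 h3
    have h5 := congrArg (fun L : E n × E (m + 1) →L[ℝ] E (m + 1) => L v) h4
    have h6 : R (B.dLift p v) = 0 := by
      refine h5.symm.trans ?_
      change mfderiv (𝓡 (m + 1)) (𝓡 (m + 1)) (B.singCoord ε) (D.normalMap p) (L v) = 0
      rw [hv]
      exact map_zero _
    have h7 : singL m ε ((B.dLift p v).1, -(B.dLift p v).2) = singL m ε 0 := by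
      rw [map_zero]; exact h6
    have h8 := singL_injective hε h7
    exact Prod.ext (Prod.mk.inj h8).1 (neg_eq_zero.1 (Prod.mk.inj h8).2)
  refine surjective_of_finrank_ker_le (L : E n × E (m + 1) →ₗ[ℝ] E (m + 1)) (k := n) ?_ ?_
  · have h1 : LinearMap.ker (L : E n × E (m + 1) →ₗ[ℝ] E (m + 1)) ≤
        (D.tangentImage p.1).map (LinearMap.inr ℝ (E n) (E (m + 1))) := fun v hv => by
      have h2 := B.eq_zero_of_dLift (hker v hv)
      exact ⟨v.2, h2.2, Prod.ext h2.1.symm rfl⟩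
    exact (Submodule.finrank_mono h1).trans
      ((Submodule.finrank_map_le _ _).trans (finrank_tangentImage_le p.1))
  · rw [Module.finrank_prod]
    simp

end Cutoff

end BoundaryEmbedding

namespace BoundaryEmbedding

variable {n m : ℕ} [NeZero n] {X : Type*} [TopologicalSpace X]
  [ChartedSpace (EuclideanHalfSpace n) X] {D : BoundaryEmbedding n m X}

namespace Cutoff

variable [Nonempty X] [IsManifold (𝓡∂ n) ∞ X] (B : D.Cutoff)

/-! ### The deformation to the normal cone in `N_sing(X)` -/

/-- The first component of `coneMap x t V` in the model coordinates. -/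
def conePt (x : X) (t : ℝ) (V : E m) : E m := (B.modelSing (D.coneMap x t V)).2.1

omit [Nonempty X] [IsManifold (𝓡∂ n) ∞ X] in
theorem coneMap_of_pos {x : X} {t : ℝ} (h0 : 0 < t) (h1 : t < 1) (V : E m) :
    D.coneMap x t V = .cyl ⟨t, h0, h1⟩ (D.emb x + t • V) := by
  rw [coneMap, dif_pos ⟨h0, h1⟩]

omit [Nonempty X] [IsManifold (𝓡∂ n) ∞ X] in
theorem coneMap_zero (x : X) (V : E m) :
    D.coneMap x 0 V = .normal x (Submodule.Quotient.mk (join V 0)) := by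
  rw [coneMap, dif_neg (fun h => lt_irrefl _ h.1)]

theorem conePt_of_pos {x : X} {t : ℝ} (h0 : 0 < t) (h1 : t < 1) (V : E m) :
    B.conePt x t V = (B.G t (D.emb x + t • V, 0)).1 := by
  rw [conePt, coneMap_of_pos h0 h1]; rfl

theorem conePt_zero (x : X) (V : E m) :
    B.conePt x 0 V = (B.lift x 0 (D.nrm x (join V 0))).1 := by
  rw [conePt, coneMap_zero]
  simp only [modelSing, nrmQ_mk]

theorem modelSing_coneMap {x : X} (hx : D.rho x = 0) {t : ℝ} (h0 : 0 ≤ t) (h1 : t < 1) (V : E m) :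
    B.modelSing (D.coneMap x t V) = (t, (B.conePt x t V, 0)) := by
  rcases h0.eq_or_lt with rfl | h0
  · rw [conePt_zero, coneMap_zero]
    simp only [modelSing, nrmQ_mk, lift, expo_of_rho_eq_zero hx]
  · rw [B.conePt_of_pos h0 h1, coneMap_of_pos h0 h1]
    simp only [modelSing, G, shift, zero_mul]

theorem singCoord_coneMap (ε : ℝ) {x : X} (hx : D.rho x = 0) {t : ℝ} (h0 : 0 ≤ t) (h1 : t < 1)
    (V : E m) : B.singCoord ε (D.coneMap x t V) = singL m ε (B.conePt x t V, t) := by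
  rw [singCoord_eq, B.modelSing_coneMap hx h0 h1, sub_zero]

theorem continuousOn_conePt (hbd : ((𝓡∂ n).boundary X).Nonempty) {x : X} (hx : D.rho x = 0)
    (V : E m) : ContinuousOn (fun t => B.conePt x t V) (Ico 0 1) := by
  have hxb := D.mem_boundary hx
  let g : Ico (0 : ℝ) 1 → D.XBd × E (m + 1) := fun t =>
    (⟨⟨(x, t.1), ⟨t.2.1, t.2.2.le⟩, fun h => t.2.2.ne h.2⟩, Or.inr hxb⟩, join V 0)
  have hg : Continuous g := by
    refine Continuous.prodMk ?_ continuous_const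
    exact Continuous.subtype_mk (Continuous.subtype_mk
      (continuous_const.prodMk continuous_subtype_val) _) _
  have h1 : ∀ t : Ico (0 : ℝ) 1, D.qSing (g t) = D.coneMap x t.1 V := by
    rintro ⟨t, h0, h1⟩
    rcases h0.eq_or_lt with rfl | h0
    · rw [coneMap_zero, qSing, dif_pos rfl]
      simp [g]
    · rw [coneMap_of_pos h0 h1, qSing, dif_neg (by exact h0.ne')]
      simp [g]
  rw [continuousOn_iff_continuous_domRestrict]
  have h2 : Continuous fun t => (B.modelSing (D.qSing (g t))).2.1 :=
    continuous_fst.comp (continuous_snd.comp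
      ((B.isEmbedding_modelSing hbd).continuous.comp (continuous_qSing.comp hg)))
  refine h2.congr fun t => ?_
  rw [h1]; rfl

theorem expoInv_emb_zero {x : X} (hx : D.rho x = 0) : D.expoInv (D.emb x, (0 : ℝ)) = (x, 0) := by
  have h := D.expoInv_expo (D.zero_mem_tube x)
  rwa [expo_of_rho_eq_zero hx, front_zero, add_zero] at h

omit [Nonempty X] in
theorem emb_mem_tubeImage {x : X} (hx : D.rho x = 0) : (D.emb x, (0 : ℝ)) ∈ D.tubeImage := by
  have h := expo_mem_tubeImage (D.zero_mem_tube x)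
  rwa [expo_of_rho_eq_zero hx, front_zero, add_zero] at h

section Param

variable {k : ℕ} {O : Set (E k)} {c : E k → X} (hO : IsOpen O)
  (hc : ContMDiffOn (𝓡 k) (𝓡∂ n) ∞ c O) (hcb : ∀ y ∈ O, c y ∈ (𝓡∂ n).boundary X)

include hO hc

omit [Nonempty X] [IsManifold (𝓡∂ n) ∞ X] in
theorem contDiffAt_emb_comp {y : E k} (hy : y ∈ O) :
    ContDiffAt ℝ ∞ (fun y => D.emb (c y)) y :=
  (D.contMDiff_emb.comp_contMDiffOn hc).contDiffOn.contDiffAt (hO.mem_nhds hy)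

/-- For `t > 0` the deformation to the normal cone is smooth, as `G` is. -/
theorem contDiffAt_conePt_of_pos {p : E k × ℝ × E m} (hy : p.1 ∈ O) (h0 : 0 < p.2.1)
    (h1 : p.2.1 < 1) :
    ContDiffAt ℝ ∞ (fun p : E k × ℝ × E m => B.conePt (c p.1) p.2.1 p.2.2) p := by
  have h2 : ContDiffAt ℝ ∞ (fun p : E k × ℝ × E m =>
      (p.2.1, D.emb (c p.1) + p.2.1 • p.2.2)) p := by
    have he : ContDiffAt ℝ ∞ (fun p : E k × ℝ × E m => D.emb (c p.1)) p :=
      (contDiffAt_emb_comp (D := D) hO hc hy).comp p contDiffAt_fst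
    fun_prop
  have h3 := (B.contDiffAt_add_disp_slice h0 (D.emb (c p.1) + p.2.1 • p.2.2)).comp p h2
  refine h3.congr_of_eventuallyEq ?_
  have h4 : ∀ᶠ q : E k × ℝ × E m in 𝓝 p, q.2.1 ∈ Ioo (0 : ℝ) 1 :=
    (continuous_fst.comp continuous_snd).continuousAt.eventually (Ioo_mem_nhds h0 h1)
  filter_upwards [h4] with q hq
  rw [B.conePt_of_pos hq.1 hq.2, ← B.slice_add_disp]
  rfl

include hcb

/-- At `t = 0` the deformation to the normal cone is smooth: the normal part of
`(emb x + t V, 0)` vanishes at `t = 0`, hence is divisible by `t`. -/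
theorem exists_contDiffAt_conePt (hbd : ((𝓡∂ n).boundary X).Nonempty) {y₀ : E k} (hy₀ : y₀ ∈ O)
    (V₀ : E m) : ∃ f : (E k × E m) × ℝ → E m, ContDiffAt ℝ ∞ f ((y₀, V₀), 0) ∧
      ∀ᶠ r in 𝓝 ((y₀, V₀), (0 : ℝ)), 0 ≤ r.2 → B.conePt (c r.1.1) r.2 r.1.2 = f r := by
  have hρ : ∀ y ∈ O, D.rho (c y) = 0 := fun y hy => (D.rho_eq_zero_iff _).2 (hcb y hy)
  set e : E k → E m := fun y => D.emb (c y) with he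
  have hes : ∀ y ∈ O, ContDiffAt ℝ ∞ e y := fun y hy => contDiffAt_emb_comp hO hc hy
  set φ : (E k × E m) × ℝ → E m := fun r => e r.1.1 + r.2 • r.1.2 with hφ
  have hφs : ∀ r : (E k × E m) × ℝ, r.1.1 ∈ O → ContDiffAt ℝ ∞ φ r := fun r hr => by
    have h1 : ContDiffAt ℝ ∞ (fun r : (E k × E m) × ℝ => e r.1.1) r :=
      ContDiffAt.comp (g := e) r (hes r.1.1 hr) (contDiffAt_fst.comp r contDiffAt_fst)
    fun_prop
  have hφ0 : φ ((y₀, V₀), 0) = e y₀ := by simp [hφ]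
  have hT0 : (φ ((y₀, V₀), 0), (0 : ℝ)) ∈ D.tubeImage := by
    rw [hφ0]; exact emb_mem_tubeImage (hρ y₀ hy₀)
  have hφt : Tendsto (fun r => (φ r, (0 : ℝ))) (𝓝 ((y₀, V₀), 0))
      (𝓝[half m] (φ ((y₀, V₀), 0), (0 : ℝ))) :=
    tendsto_nhdsWithin_iff.2 ⟨((hφs ((y₀, V₀), 0) hy₀).continuousAt.prodMk continuousAt_const),
      Eventually.of_forall fun r => show (0 : ℝ) ≤ 0 from le_rfl⟩
  have hT : ∀ᶠ r in 𝓝 ((y₀, V₀), (0 : ℝ)), (φ r, (0 : ℝ)) ∈ D.tubeImage :=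
    hφt (D.tubeImage_mem_nhdsWithin hT0)
  have hOe : ∀ᶠ r : (E k × E m) × ℝ in 𝓝 ((y₀, V₀), (0 : ℝ)), r.1.1 ∈ O :=
    (continuous_fst.comp continuous_fst).continuousAt.eventually (hO.mem_nhds hy₀)
  obtain ⟨K, hK, hKe⟩ := exists_contDiffAt_eq_smul (H := fun r => D.vec (φ r, 0))
    (z₀ := (y₀, V₀)) (by
      filter_upwards [hT, hOe] with r h1 h2
      exact (D.contDiffAt_vec_slice h1).comp r (hφs r h2)) (by
      have : ∀ᶠ z : E k × E m in 𝓝 (y₀, V₀), z.1 ∈ O :=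
        continuous_fst.continuousAt.eventually (hO.mem_nhds hy₀)
      filter_upwards [this] with z hz
      have h1 : φ (z, 0) = D.emb (c z.1) := by simp [hφ, he]
      rw [h1, vec, expoInv_emb_zero (hρ _ hz)])
  obtain ⟨σ, hσ, hσe⟩ := B.exists_contDiffAt_dil (c y₀) le_rfl (K ((y₀, V₀), 0))
  set A : (E k × E m) × ℝ → E m := fun r => φ r - r.2 • front (K r) with hA
  have hfK : ContDiffAt ℝ ∞ (fun r => front (K r)) ((y₀, V₀), 0) :=
    (contDiff_front (k := ∞)).contDiffAt.comp _ hK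
  have hAs : ContDiffAt ℝ ∞ A ((y₀, V₀), 0) :=
    (hφs ((y₀, V₀), 0) hy₀).sub (contDiffAt_snd.smul hfK)
  have hA0 : A ((y₀, V₀), 0) = D.emb (c y₀) := by simp [hA, hφ0, he]
  have hσs : ContDiffAt ℝ ∞ (fun r : (E k × E m) × ℝ => σ (A r, r.2, ‖K r‖ ^ 2))
      ((y₀, V₀), 0) := by
    refine ContDiffAt.comp (g := σ) ((y₀, V₀), (0 : ℝ)) ?_
      (hAs.prodMk (contDiffAt_snd.prodMk (hK.norm_sq ℝ)))
    simp only
    rw [hA0]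
    exact hσ
  have hfs : ContDiffAt ℝ ∞ (fun r => A r + σ (A r, r.2, ‖K r‖ ^ 2) • front (K r))
      ((y₀, V₀), 0) := hAs.add (hσs.smul hfK)
  refine ⟨_, hfs, ?_⟩
  have hxt : Tendsto (fun r => ((D.expoInv (φ r, 0)).1, r.2, K r)) (𝓝 ((y₀, V₀), (0 : ℝ)))
      (𝓝 (c y₀, 0, K ((y₀, V₀), 0))) := by
    refine Tendsto.prodMk_nhds ?_ (Tendsto.prodMk_nhds continuous_snd.continuousAt
      hK.continuousAt)
    have h1 := (D.tendsto_expoInv hT0).comp hφt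
    have h2 := (continuous_fst.tendsto _).comp h1
    rw [hφ0, he, expoInv_emb_zero (hρ y₀ hy₀)] at h2
    exact h2
  have hlt : ∀ᶠ r : (E k × E m) × ℝ in 𝓝 ((y₀, V₀), (0 : ℝ)), r.2 < 1 :=
    continuous_snd.continuousAt.eventually (gt_mem_nhds one_pos)
  have hpos : ∀ᶠ r in 𝓝 ((y₀, V₀), (0 : ℝ)), 0 < r.2 → B.conePt (c r.1.1) r.2 r.1.2 =
      A r + σ (A r, r.2, ‖K r‖ ^ 2) • front (K r) := by
    filter_upwards [hT, hlt, hKe, hxt.eventually hσe] with r h1 h2 h3 h4 h5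
    have h6 : D.expo (D.expoInv (φ r, 0)).1 (D.vec (φ r, 0)) = (φ r, 0) := D.expo_expoInv h1
    have h7 : ((D.expoInv (φ r, 0)).1, D.vec (φ r, 0)) ∈ D.tube := D.expoInv_mem h1
    have h8 := B.G_expo (x := (D.expoInv (φ r, 0)).1) (w := D.vec (φ r, 0)) (t := r.2) h7
    have h9 : r.2⁻¹ • D.vec (φ r, 0) = K r := by
      rw [h3, smul_smul, inv_mul_cancel₀ h5.ne', one_smul]
    have h10 : D.emb (D.expoInv (φ r, 0)).1 = A r := by
      rw [D.emb_expoInv h1, h3]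
      rfl
    rw [B.conePt_of_pos h5 h2]
    change (B.G r.2 (φ r, 0)).1 = _
    rw [h6, h9] at h8
    rw [h8, lift, h4 h5.le, h10]
    change D.emb _ + _ = _
    rw [h10]
    rfl
  have hcont : ∀ᶠ r in 𝓝 ((y₀, V₀), (0 : ℝ)),
      ContinuousAt (fun r => A r + σ (A r, r.2, ‖K r‖ ^ 2) • front (K r)) r := by
    filter_upwards [(hfs.of_le (m := 1) (by simp)).eventually (by simp)] with r hr
    exact hr.continuousAt
  filter_upwards [hpos, hpos.eventually_nhds, hcont, hOe] with r h1 h2 h3 h4 h5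
  rcases h5.eq_or_lt with h6 | h6
  · obtain ⟨z, t⟩ := r
    obtain rfl : 0 = t := h6
    have h7 : Tendsto (fun t : ℝ => B.conePt (c z.1) t z.2) (𝓝[>] 0)
        (𝓝 (B.conePt (c z.1) 0 z.2)) :=
      ((B.continuousOn_conePt hbd (hρ z.1 h4) z.2) 0 ⟨le_rfl, one_pos⟩).tendsto.mono_left
        (by
          rw [← nhdsWithin_Ioo_eq_nhdsGT (zero_lt_one' ℝ)]
          exact nhdsWithin_mono _ Ioo_subset_Ico_self)
    have h8 : Tendsto (fun t : ℝ => (z, t)) (𝓝[>] 0) (𝓝 (z, 0)) :=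
      (continuous_const.prodMk continuous_id).continuousAt.tendsto.mono_left nhdsWithin_le_nhds
    have h9 := h3.tendsto.comp h8
    refine tendsto_nhds_unique_of_eventuallyEq h7 h9 ?_
    filter_upwards [h8.eventually h2, self_mem_nhdsWithin] with t h10 h11
    exact h10 h11
  · exact h1 h6

theorem contDiffOn_conePt (hbd : ((𝓡∂ n).boundary X).Nonempty) :
    ContDiffOn ℝ ∞ (fun p : E k × ℝ × E m => B.conePt (c p.1) p.2.1 p.2.2)
      (O ×ˢ Ico (0 : ℝ) 1 ×ˢ univ) := by
  rintro ⟨y, t, V⟩ ⟨hy, ht, -⟩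
  rcases ht.1.eq_or_lt with h | h
  · obtain rfl : 0 = t := h
    obtain ⟨f, hf, hfe⟩ := B.exists_contDiffAt_conePt hO hc hcb hbd hy V
    have h1 : ContDiff ℝ ∞ fun p : E k × ℝ × E m => ((p.1, p.2.2), p.2.1) := by fun_prop
    have h2 : ContDiffAt ℝ ∞ (fun p : E k × ℝ × E m => f ((p.1, p.2.2), p.2.1)) (y, 0, V) :=
      ContDiffAt.comp (y, (0 : ℝ), V) (g := f) hf h1.contDiffAt
    have h3 : ContinuousAt (fun p : E k × ℝ × E m => ((p.1, p.2.2), p.2.1)) (y, (0 : ℝ), V) :=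
      h1.continuous.continuousAt
    refine h2.contDiffWithinAt.congr_of_eventuallyEq_of_mem ?_ ⟨hy, ht, mem_univ _⟩
    filter_upwards [nhdsWithin_le_nhds (h3.eventually hfe), self_mem_nhdsWithin] with p h4 h5
    exact h4 h5.2.1.1
  · exact (B.contDiffAt_conePt_of_pos hO hc (p := (y, t, V)) hy h ht.2).contDiffWithinAt

end Param

end Cutoff

end BoundaryEmbedding

namespace BoundaryEmbedding

variable {n m : ℕ} [NeZero n] {X : Type*} [TopologicalSpace X]
  [ChartedSpace (EuclideanHalfSpace n) X] {D : BoundaryEmbedding n m X}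

namespace Cutoff

variable [Nonempty X] [IsManifold (𝓡∂ n) ∞ X] (B : D.Cutoff)

section Param

variable {k : ℕ} {O : Set (E k)} {c : E k → X} (hO : IsOpen O)
  (hc : ContMDiffOn (𝓡 k) (𝓡∂ n) ∞ c O) (hcb : ∀ y ∈ O, c y ∈ (𝓡∂ n).boundary X)

include hO hc hcb

theorem contMDiffOn_coneMap (hbd : ((𝓡∂ n).boundary X).Nonempty) {ε : ℝ} (hε : ε * ε = 1) :
    letI := B.chartedSpaceNsing hbd hε
    ContMDiffOn 𝓘(ℝ, E k × ℝ × E m) (𝓡 (m + 1)) ∞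
      (fun p : E k × ℝ × E m => D.coneMap (c p.1) p.2.1 p.2.2) (O ×ˢ Ico (0 : ℝ) 1 ×ˢ univ) := by
  let _ := B.chartedSpaceNsing hbd hε
  have h1 : ContDiffOn ℝ ∞ (fun p : E k × ℝ × E m =>
      B.singCoord ε (D.coneMap (c p.1) p.2.1 p.2.2)) (O ×ˢ Ico (0 : ℝ) 1 ×ˢ univ) := by
    have h2 : ContDiffOn ℝ ∞ (fun p : E k × ℝ × E m => p.2.1) (O ×ˢ Ico (0 : ℝ) 1 ×ˢ univ) := by
      fun_prop
    refine ((singL m ε).contDiff.comp_contDiffOn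
      ((B.contDiffOn_conePt hO hc hcb hbd).prodMk h2)).congr fun p hp => ?_
    exact B.singCoord_coneMap ε ((D.rho_eq_zero_iff _).2 (hcb _ hp.1)) hp.2.1.1 hp.2.1.2 _
  have h2 := contMDiffOn_isOpenEmbedding_symm (I := 𝓡 (m + 1)) (n := ∞)
    (B.isOpenEmbedding_singCoord hbd hε)
  refine (h2.comp h1.contMDiffOn fun p _ => mem_range_self _).congr fun p _ => ?_
  exact ((B.isOpenEmbedding_singCoord hbd hε).toOpenPartialHomeomorph_left_inv _).symm

/-- The differential of the deformation to the normal cone in the model coordinates. -/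
theorem conePt_of_mfderivWithin_eq_zero (hbd : ((𝓡∂ n).boundary X).Nonempty) {ε : ℝ}
    (hε : ε * ε = 1) {p v : E k × ℝ × E m} (hp : p ∈ O ×ˢ Ico (0 : ℝ) 1 ×ˢ (univ : Set (E m)))
    (hv : letI := B.chartedSpaceNsing hbd hε
      (mfderivWithin 𝓘(ℝ, E k × ℝ × E m) (𝓡 (m + 1))
        (fun p : E k × ℝ × E m => D.coneMap (c p.1) p.2.1 p.2.2)
        (O ×ˢ Ico (0 : ℝ) 1 ×ˢ univ) p : E k × ℝ × E m →L[ℝ] E (m + 1)) v = 0) :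
    v.2.1 = 0 ∧ fderivWithin ℝ (fun p : E k × ℝ × E m => B.conePt (c p.1) p.2.1 p.2.2)
      (O ×ˢ Ico (0 : ℝ) 1 ×ˢ univ) p v = 0 := by
  let _ := B.chartedSpaceNsing hbd hε
  set S := O ×ˢ Ico (0 : ℝ) 1 ×ˢ (univ : Set (E m)) with hS
  have hu : UniqueDiffWithinAt ℝ S p :=
    (hO.uniqueDiffOn.prod ((uniqueDiffOn_Ico 0 1).prod uniqueDiffOn_univ)) p hp
  have hN := (B.contMDiffOn_coneMap hO hc hcb hbd hε p hp).mdifferentiableWithinAt (by simp)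
  have hZ : MDifferentiableAt (𝓡 (m + 1)) (𝓡 (m + 1)) (B.singCoord ε)
      (D.coneMap (c p.1) p.2.1 p.2.2) :=
    (contMDiff_isOpenEmbedding (I := 𝓡 (m + 1)) (n := ∞)
      (B.isOpenEmbedding_singCoord hbd hε)).mdifferentiableAt (by simp)
  let L₁ : E k × ℝ × E m →L[ℝ] E (m + 1) :=
    mfderivWithin 𝓘(ℝ, E k × ℝ × E m) (𝓡 (m + 1))
      (fun p : E k × ℝ × E m => D.coneMap (c p.1) p.2.1 p.2.2) S p
  let L₂ : E (m + 1) →L[ℝ] E (m + 1) := mfderiv (𝓡 (m + 1)) (𝓡 (m + 1)) (B.singCoord ε)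
      (D.coneMap (c p.1) p.2.1 p.2.2)
  have h1 : HasFDerivWithinAt (B.singCoord ε ∘
      fun p : E k × ℝ × E m => D.coneMap (c p.1) p.2.1 p.2.2) (L₂.comp L₁) S p :=
    hasMFDerivWithinAt_iff_hasFDerivWithinAt.1
      (hZ.hasMFDerivAt.comp_hasMFDerivWithinAt p hN.hasMFDerivWithinAt :
        HasMFDerivWithinAt 𝓘(ℝ, E k × ℝ × E m) 𝓘(ℝ, E (m + 1)) _ S p (L₂.comp L₁))
  have h2 := ((B.contDiffOn_conePt hO hc hcb hbd p hp).differentiableWithinAt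
    (by simp)).hasFDerivWithinAt
  have h3 := (singL m ε).hasFDerivAt.comp_hasFDerivWithinAt p
    (h2.prodMk ((hasFDerivAt_fst.comp p (hasFDerivAt_snd (𝕜 := ℝ))).hasFDerivWithinAt (s := S)))
  have h4 : HasFDerivWithinAt (B.singCoord ε ∘
      fun p : E k × ℝ × E m => D.coneMap (c p.1) p.2.1 p.2.2) _ S p :=
    h3.congr (fun q hq => B.singCoord_coneMap ε ((D.rho_eq_zero_iff _).2 (hcb _ hq.1))
      hq.2.1.1 hq.2.1.2 _)
      (B.singCoord_coneMap ε ((D.rho_eq_zero_iff _).2 (hcb _ hp.1)) hp.2.1.1 hp.2.1.2 _)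
  have h5 := hu.eq h1 h4
  have h6 := congrArg (fun L : E k × ℝ × E m →L[ℝ] E (m + 1) => L v) h5
  have h7 : singL m ε (fderivWithin ℝ (fun p : E k × ℝ × E m => B.conePt (c p.1) p.2.1 p.2.2)
      S p v, v.2.1) = 0 := by
    refine h6.symm.trans ?_
    exact (congrArg L₂ hv).trans (map_zero _)
  have h8 := singL_injective hε (h7.trans (map_zero _).symm)
  exact ⟨(Prod.mk.inj h8).2, (Prod.mk.inj h8).1⟩

theorem hasDerivAt_conePt_line (hbd : ((𝓡∂ n).boundary X).Nonempty) {y : E k} {t : ℝ} {V : E m}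
    (hy : y ∈ O) (ht : t ∈ Ico (0 : ℝ) 1) {η : E k} {w : E m}
    (h : fderivWithin ℝ (fun p : E k × ℝ × E m => B.conePt (c p.1) p.2.1 p.2.2)
      (O ×ˢ Ico (0 : ℝ) 1 ×ˢ univ) (y, t, V) (η, 0, w) = 0) :
    HasDerivAt (fun s : ℝ => B.conePt (c (y + s • η)) t (V + s • w)) 0 0 := by
  have h1 : ∀ᶠ s : ℝ in 𝓝 0, y + s • η ∈ O := by
    have h2 : Continuous fun s : ℝ => y + s • η := by fun_prop
    exact h2.continuousAt.eventually (hO.mem_nhds (by simpa using hy))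
  have h3 := hasDerivAt_line_of_hasFDerivWithinAt (ξ := (η, (0 : ℝ), w))
    ((B.contDiffOn_conePt hO hc hcb hbd (y, t, V) ⟨hy, ht, mem_univ _⟩).differentiableWithinAt
      (by simp)).hasFDerivWithinAt (by
        filter_upwards [h1] with s hs
        exact ⟨hs, by simpa using ht, mem_univ _⟩)
  rw [h] at h3
  simpa using h3

omit [Nonempty X] [IsManifold (𝓡∂ n) ∞ X] hcb in
theorem hasDerivAt_emb_line {y η : E k} (hy : y ∈ O) :
    HasDerivAt (fun s : ℝ => D.emb (c (y + s • η))) (fderiv ℝ (fun y => D.emb (c y)) y η) 0 :=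
  hasDerivAt_line_of_hasFDerivWithinAt (f := fun y => D.emb (c y)) (S := univ)
    ((contDiffAt_emb_comp (D := D) hO hc hy).differentiableAt
      (by simp)).hasFDerivAt.hasFDerivWithinAt
    (Eventually.of_forall fun _ => mem_univ _)

/-- For `t > 0` the kernel of the differential of the deformation to the normal cone is a graph
over the tangent space of `∂X`, as `emb x + t V` is a function of the image point. -/
theorem eq_of_fderivWithin_conePt_of_pos (hbd : ((𝓡∂ n).boundary X).Nonempty) {y : E k} {t : ℝ}
    {V : E m} (hy : y ∈ O) (h0 : 0 < t) (h1 : t < 1) {η : E k} {w : E m}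
    (h : fderivWithin ℝ (fun p : E k × ℝ × E m => B.conePt (c p.1) p.2.1 p.2.2)
      (O ×ˢ Ico (0 : ℝ) 1 ×ˢ univ) (y, t, V) (η, 0, w) = 0) :
    t • w = -fderiv ℝ (fun y => D.emb (c y)) y η := by
  have h2 := B.hasDerivAt_conePt_line hO hc hcb hbd hy ⟨h0.le, h1⟩ h
  have h3 : DifferentiableAt ℝ (fun q : E m => q + front (-((B.b (q, 0) + t)⁻¹ • B.F (q, 0))))
      (B.conePt (c (y + (0 : ℝ) • η)) t (V + (0 : ℝ) • w)) := by
    have h4 : ContDiff ℝ ∞ fun q : E m => B.b (q, 0) := B.contDiff_wgt_slice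
    have h5 : ContDiff ℝ ∞ fun q : E m => B.F (q, 0) := B.contDiff_wvec_slice
    have h6 : ContDiff ℝ ∞ fun q : E m => (B.b (q, 0) + t)⁻¹ := (h4.add contDiff_const).inv
      fun q => (add_pos_of_nonneg_of_pos (B.b_nonneg _) h0).ne'
    exact (contDiff_id.add (contDiff_front.comp (h6.smul h5).neg)).differentiable (by simp) _
  have h4 := hasDerivAt_comp_zero (γ := fun s : ℝ => B.conePt (c (y + s • η)) t (V + s • w)) h3 h2
  have h5 : (fun s : ℝ => D.emb (c (y + s • η)) + t • (V + s • w)) = fun s : ℝ =>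
      B.conePt (c (y + s • η)) t (V + s • w) +
        front (-((B.b (B.conePt (c (y + s • η)) t (V + s • w), 0) + t)⁻¹ •
          B.F (B.conePt (c (y + s • η)) t (V + s • w), 0))) := by
    funext s
    rw [B.conePt_of_pos h0 h1]
    have h6 : ((B.G t (D.emb (c (y + s • η)) + t • (V + s • w), 0)).1, (0 : ℝ)) =
        B.G t (D.emb (c (y + s • η)) + t • (V + s • w), 0) :=
      Prod.ext rfl (by simp only [G, shift, zero_mul])
    have h7 := congrArg Prod.fst (B.Θ_G h0 (D.emb (c (y + s • η)) + t • (V + s • w), 0))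
    simp only [Θ, shift] at h7
    rw [h6]
    exact h7.symm
  rw [← h5] at h4
  have h6 : HasDerivAt (fun s : ℝ => t • (V + s • w)) (t • w) 0 := by
    have h7 : HasDerivAt (fun s : ℝ => V + s • w) w 0 := by
      simpa using ((hasDerivAt_id (0 : ℝ)).smul_const w).const_add V
    exact h7.const_smul t
  have h7 := ((hasDerivAt_emb_line (η := η) hO hc hy).add h6).unique h4
  exact eq_neg_of_add_eq_zero_right h7

/-- At `t = 0` the kernel of the differential of the deformation to the normal cone is the tangent
space of `∂X`, as a subspace of the fibre. -/
theorem eq_of_fderivWithin_conePt_zero (hbd : ((𝓡∂ n).boundary X).Nonempty) {y : E k}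
    {V : E m} (hy : y ∈ O) (hci : Function.Injective (mfderiv (𝓡 k) (𝓡∂ n) c y)) {η : E k} {w : E m}
    (h : fderivWithin ℝ (fun p : E k × ℝ × E m => B.conePt (c p.1) p.2.1 p.2.2)
      (O ×ˢ Ico (0 : ℝ) 1 ×ˢ univ) (y, 0, V) (η, 0, w) = 0) :
    η = 0 ∧ ∃ ξ, D.dRho (c y) ξ = 0 ∧ D.dEmb (c y) ξ = w := by
  have h2 := B.hasDerivAt_conePt_line hO hc hcb hbd hy ⟨le_rfl, one_pos⟩ h
  have h1 : ∀ᶠ s : ℝ in 𝓝 0, D.rho (c (y + s • η)) = 0 := by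
    have h2 : Continuous fun s : ℝ => y + s • η := by fun_prop
    filter_upwards [h2.continuousAt.eventually (hO.mem_nhds (by simpa using hy))] with s hs
    exact (D.rho_eq_zero_iff _).2 (hcb _ hs)
  have h3 : HasDerivAt (fun s : ℝ => B.lift (c (y + s • η)) 0
      (D.nrm (c (y + s • η)) (join (V + s • w) 0))) 0 0 := by
    have h4 : HasDerivAt (fun s : ℝ => (B.conePt (c (y + s • η)) 0 (V + s • w), (0 : ℝ))) 0 0 :=
      h2.prodMk (hasDerivAt_const _ _)
    refine h4.congr_of_eventuallyEq ?_
    filter_upwards [h1] with s hs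
    rw [conePt_zero, lift, expo_of_rho_eq_zero hs]
  obtain ⟨h4, h5⟩ := B.hasDerivAt_zero_of_lift
    (fun s => D.isNrm_nrm (c (y + s • η)) (join (V + s • w) 0)) h3 fun _ => h1
  have hη : η = 0 := by
    have h6 := (hasDerivAt_emb_line (η := η) hO hc hy).unique h4
    have hcy : MDifferentiableAt (𝓡 k) (𝓡∂ n) c y :=
      (hc.contMDiffAt (hO.mem_nhds hy)).mdifferentiableAt (by simp)
    let L : E k →L[ℝ] E n := mfderiv (𝓡 k) (𝓡∂ n) c y
    let L' : E n →L[ℝ] E m := D.dEmb (c y)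
    have h7 : HasFDerivAt (fun y => D.emb (c y)) (L'.comp L) y :=
      hasMFDerivAt_iff_hasFDerivAt.1 ((D.mdiff_emb (c y)).hasMFDerivAt.comp y hcy.hasMFDerivAt :
        HasMFDerivAt 𝓘(ℝ, E k) 𝓘(ℝ, E m) (fun y => D.emb (c y)) y (L'.comp L))
    rw [h7.fderiv] at h6
    have h9 := D.injective_dEmb (c y) (h6.trans (map_zero _).symm)
    exact hci (h9.trans (map_zero _).symm)
  refine ⟨hη, ?_⟩
  subst hη
  have h6 : (fun s : ℝ => D.nrm (c (y + s • (0 : E k))) (join (V + s • w) 0)) =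
      fun s : ℝ => D.nrm (c y) (join V 0) + s • D.nrm (c y) (join w 0) := by
    funext s
    have h7 : join (V + s • w) 0 = join V 0 + s • join w 0 := by
      rw [← join_smul, ← join_add, mul_zero, add_zero]
    rw [smul_zero, add_zero, h7, nrm_add, nrm_smul]
  rw [h6] at h5
  have h7 : HasDerivAt (fun s : ℝ => D.nrm (c y) (join V 0) + s • D.nrm (c y) (join w 0))
      (D.nrm (c y) (join w 0)) 0 := by
    simpa using ((hasDerivAt_id (0 : ℝ)).smul_const (D.nrm (c y) (join w 0))).const_add
      (D.nrm (c y) (join V 0))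
  obtain ⟨ξ, hξ⟩ := D.mem_tangentImage.1 (D.mem_tangentImage_of_nrm_eq_zero (h7.unique h5))
  refine ⟨ξ, ?_, ?_⟩
  · simpa using congrArg height hξ
  · simpa using congrArg front hξ

end Param

omit [Nonempty X] [IsManifold (𝓡∂ n) ∞ X] in
/-- The tangent space of `∂X` has dimension at most `n - 1`, as `dρ ≠ 0` there. -/
theorem finrank_ker_dRho_le {x : X} (hx : x ∈ (𝓡∂ n).boundary X) :
    Module.finrank ℝ (LinearMap.ker (D.dRho x : E n →ₗ[ℝ] ℝ)) ≤ n - 1 := by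
  have h1 : D.dRho x ≠ 0 := D.mfderiv_rho_ne_zero x hx
  have h2 : LinearMap.range (D.dRho x : E n →ₗ[ℝ] ℝ) ≠ ⊥ := fun h => by
    refine h1 (ContinuousLinearMap.ext fun ξ => ?_)
    exact congrArg (fun L : E n →ₗ[ℝ] ℝ => L ξ) (LinearMap.range_eq_bot.1 h)
  have h3 := LinearMap.finrank_range_add_finrank_ker (D.dRho x : E n →ₗ[ℝ] ℝ)
  have h4 : 0 < Module.finrank ℝ (LinearMap.range (D.dRho x : E n →ₗ[ℝ] ℝ)) :=
    Nat.pos_of_ne_zero fun h => h2 (Submodule.finrank_eq_zero.1 h)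
  rw [finrank_euclideanSpace_fin] at h3
  omega

/-- The kernel of the differential has dimension at most `n - 1`, so the differential is onto. -/
theorem surjective_mfderivWithin_coneMap (hbd : ((𝓡∂ n).boundary X).Nonempty) {ε : ℝ}
    (hε : ε * ε = 1) {O : Set (E (n - 1))} {c : E (n - 1) → X} (hO : IsOpen O)
    (hc : ContMDiffOn (𝓡 (n - 1)) (𝓡∂ n) ∞ c O) (hcb : ∀ y ∈ O, c y ∈ (𝓡∂ n).boundary X)
    (hci : ∀ y ∈ O, Function.Injective (mfderiv (𝓡 (n - 1)) (𝓡∂ n) c y))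
    {p : E (n - 1) × ℝ × E m} (hp : p ∈ O ×ˢ Ico (0 : ℝ) 1 ×ˢ (univ : Set (E m))) :
    letI := B.chartedSpaceNsing hbd hε
    Function.Surjective (mfderivWithin 𝓘(ℝ, E (n - 1) × ℝ × E m) (𝓡 (m + 1))
        (fun p : E (n - 1) × ℝ × E m => D.coneMap (c p.1) p.2.1 p.2.2)
        (O ×ˢ Ico (0 : ℝ) 1 ×ˢ univ) p) := by
  let _ := B.chartedSpaceNsing hbd hε
  obtain ⟨y, t, V⟩ := p
  set L : E (n - 1) × ℝ × E m →L[ℝ] E (m + 1) :=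
    mfderivWithin 𝓘(ℝ, E (n - 1) × ℝ × E m) (𝓡 (m + 1))
        (fun p : E (n - 1) × ℝ × E m => D.coneMap (c p.1) p.2.1 p.2.2)
        (O ×ˢ Ico (0 : ℝ) 1 ×ˢ univ) (y, t, V) with hL
  have hker : ∀ v, L v = 0 → v.2.1 = 0 ∧
      fderivWithin ℝ (fun p : E (n - 1) × ℝ × E m => B.conePt (c p.1) p.2.1 p.2.2)
        (O ×ˢ Ico (0 : ℝ) 1 ×ˢ univ) (y, t, V) (v.1, 0, v.2.2) = 0 := fun v hv => by
    obtain ⟨h1, h2⟩ := B.conePt_of_mfderivWithin_eq_zero hO hc hcb hbd hε hp hv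
    refine ⟨h1, ?_⟩
    have h3 : v = (v.1, 0, v.2.2) := Prod.ext rfl (Prod.ext h1 rfl)
    rw [← h3]
    exact h2
  refine surjective_of_finrank_ker_le (L : E (n - 1) × ℝ × E m →ₗ[ℝ] E (m + 1)) (k := n - 1) ?_ ?_
  · rcases hp.2.1.1.eq_or_lt with h | h
    · obtain rfl : 0 = t := h
      have h1 : LinearMap.ker (L : E (n - 1) × ℝ × E m →ₗ[ℝ] E (m + 1)) ≤
          (LinearMap.ker (D.dRho (c y) : E n →ₗ[ℝ] ℝ)).map
            ((LinearMap.inr ℝ (E (n - 1)) (ℝ × E m)).comp ((LinearMap.inr ℝ ℝ (E m)).comp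
              (D.dEmb (c y) : E n →ₗ[ℝ] E m))) := fun v hv => by
        obtain ⟨h2, h3⟩ := hker v hv
        obtain ⟨h4, ξ, h5, h6⟩ := B.eq_of_fderivWithin_conePt_zero hO hc hcb hbd hp.1
          (hci y hp.1) h3
        exact ⟨ξ, h5, Prod.ext h4.symm (Prod.ext h2.symm h6)⟩
      exact (Submodule.finrank_mono h1).trans
        ((Submodule.finrank_map_le _ _).trans (finrank_ker_dRho_le (hcb y hp.1)))
    · have h1 : Function.Injective ((LinearMap.fst ℝ (E (n - 1)) (ℝ × E m)).comp
          (LinearMap.ker (L : E (n - 1) × ℝ × E m →ₗ[ℝ] E (m + 1))).subtype) := by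
        rw [injective_iff_map_eq_zero]
        rintro ⟨v, hv⟩ h2
        have h2 : v.1 = 0 := h2
        obtain ⟨h3, h4⟩ := hker v hv
        have h5 := B.eq_of_fderivWithin_conePt_of_pos hO hc hcb hbd hp.1 h hp.2.1.2 h4
        rw [h2, map_zero, neg_zero] at h5
        have h6 : v.2.2 = 0 := (smul_eq_zero.1 h5).resolve_left h.ne'
        exact Subtype.ext (Prod.ext h2 (Prod.ext h3 h6))
      exact (LinearMap.finrank_le_finrank_of_injective h1).trans
        (finrank_euclideanSpace_fin (𝕜 := ℝ) (n := n - 1)).le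
  · rw [Module.finrank_prod, Module.finrank_prod]
    simp [add_comm]

theorem isGlued (hbd : ((𝓡∂ n).boundary X).Nonempty) {ε : ℝ} (hε : ε * ε = 1) :
    @IsGlued n m _ X _ _ D (B.chartedSpaceNsing hbd hε) := by
  let _ := B.chartedSpaceNsing hbd hε
  exact
    { smooth_normal := B.contMDiff_normalMap hbd hε
      submersion_normal := B.surjective_mfderiv_normalMap hbd hε
      smooth_cone := fun O c hO hc hcb => B.contMDiffOn_coneMap hO hc hcb hbd hε
      submersion_cone := fun O c hO hc hcb hci p hp =>
        B.surjective_mfderivWithin_coneMap hbd hε hO hc hcb hci hp }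

end Cutoff

end BoundaryEmbedding

end APS

end

theorem proposition3p10 {n m : ℕ} [NeZero n] {X : Type*} [TopologicalSpace X]
    [ChartedSpace (EuclideanHalfSpace n) X] [IsManifold (𝓡∂ n) ∞ X]
    (D : APS.BoundaryEmbedding n m X) (hbd : ((𝓡∂ n).boundary X).Nonempty) :
    (∃ Φ : D.OrbitSpace ≃ₜ D.BF, ∀ a, Φ (D.toOrbit a) = D.qF a) ∧
    LocallyCompactSpace D.BF ∧
    ∃ (_ : ChartedSpace (APS.E (m + 1)) D.Nsing)
      (_ : ChartedSpace (EuclideanHalfSpace (m + 2)) D.BF),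
      D.IsGlued ∧ D.IsStandardOnCylinder ∧
      APS.IsOrientedCobordism (d := m + 1) (M₀ := D.Nsing) (M₁ := APS.E (m + 1)) (W := D.BF)
        APS.BoundaryEmbedding.BF.sing D.topEnd := by
  have : Nonempty X := hbd.to_type
  obtain ⟨B⟩ := D.nonempty_cutoff
  obtain ⟨ε, hε, hpos⟩ := B.exists_sign
  exact ⟨B.exists_homeomorph hbd, B.locallyCompactSpace_BF hbd, B.chartedSpaceNsing hbd hε,
    B.chartedSpaceBF hbd hε, B.isGlued hbd hε, B.isStandardOnCylinder hbd hε,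
    B.isOrientedCobordism hbd hε hpos⟩
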